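/- **Setting.** Let $(X,\nu)$ be a standard Borel space with a finite atomless measure, and let $\Pi$ be a Borel measure on $\mathbb R$ with $\Pi(\{0\})=0$ and $\int \frac{t^2}{1+t^2}\,d\Pi(t)<\infty$. Let $\eta=\eta_\Pi$ be a homogeneous process with independent values on $(X,\nu)$ (a Lévy process) with Lévy measure $\Pi$, drift $c\in\mathbb R$ and no Gaussian component, i.e. a linear map $a\mapsto\langle a,\eta\rangle$ from the space of (mod 0 classes of) bounded measurable real functions on $X$ to the random variables on some probability space such that $$\mathbb E e^{i\langle a,\eta\rangle}=\exp\int_X\Big(ic\,a(x)+\int_{\mathbb R}\Big(e^{ita(x)}-1-\frac{ita(x)}{1+t^2}\Big)d\Pi(t)\Big)d\nu(x).$$ Let $\alpha=\alpha^{L^2(\mathbb R,\Pi)}$ be the $L^2(\mathbb R,\Pi)$-valued white noise on $(X,\nu)$, i.e. the Gaussian white noise on $(X\times\mathbb R,\nu\times\Pi)$: a linear map $h\mapsto\langle h,\cdot\rangle$ from real $L^2(X\times\mathbb R,\nu\times\Pi)$ to the random variables on some probability space with $\mathbb E e^{i\langle h,\cdot\rangle}=e^{-\|h\|^2/2}$.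 For a process $Y$ write $L^2(Y)$ for the complex $L^2$ space over the σ-field generated by $Y$. If the restrictions of $Y$ to $B$ and to its complement $B'$ generate the σ-fields $\zeta(B)$, $\zeta(B')$, put $\xi(B)=\mathcal B(L^2(\zeta(B)))\otimes 1_{L^2(\zeta(B'))}$, an algebra of operators in $L^2(Y)=L^2(\zeta(B))\otimes L^2(\zeta(B'))$; the map $\xi$ is the Hilbert factorization of $L^2(Y)$. For $\eta$ the base is $X$; for $\alpha$ the base is $X\times\mathbb R$, or $X$ if one takes only the sets $A\times\mathbb R$, $A\subset X$. A special isomorphism of two factorizations $\xi_1,\xi_2$ over the same base is a surjective linear isometry $\Phi$ with $\Phi\,\xi_1(B)\,\Phi^{-1}=\xi_2(B)$ for all measurable $B$. **Theorem.** The process $\eta$ has a configuration of jumps, i.e. there is a Poisson process $\{(x_i,t_i)\}$ on $X\times\mathbb R$ with mean measure $\nu\times\Pi$, defined on the same probability space, such that for every bounded measurable $a$, in probability, $$\langle a,\eta\rangle=c\int_X a\,d\nu+\lim_{\varepsilon\to0}\Big(\sum_{|t_i|>\varepsilon}a(x_i)t_i-\iint_{|t|>\varepsilon}\frac{a(x)\,t}{1+t^2}\,d\nu(x)\,d\Pi(t)\Big).$$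 For every such configuration there is a surjective linear isometry $$\Phi:L^2(\alpha^{L^2(\mathbb R,\Pi)})\to L^2(\eta_\Pi)$$ with the following properties. 1. $\Phi$ preserves the unity function (the vacuum), is real (maps the subspace of real-valued functionals onto the subspace of real-valued functionals), and is a special isomorphism of the Hilbert factorizations over $X$. It is also a special isomorphism of the factorizations over $X\times\mathbb R$, where the factorization of $L^2(\eta_\Pi)$ over $X\times\mathbb R$ is given by the restrictions of the configuration of jumps to the sets $B\subset X\times\mathbb R$. 2. For every real $h\in L^1(X\times\mathbb R,\nu\times\Pi)\cap L^2(X\times\mathbb R,\nu\times\Pi)$, $$\Phi:\;e^{\langle h,\cdot\rangle-\|h\|^2/2}\;\mapsto\;\prod_i\big(1+h(x_i,t_i)\big)\cdot e^{-\iint h(x,t)\,d\nu(x)\,d\Pi(t)},$$ where both functionals are square integrable and the product converges unconditionally a.s. 3. $\Phi$ acts identically on the space of values $L^2(\mathbb R,\Pi)$ in the following sense. Identify $f\in L^2((X,\nu);L^2(\mathbb R,\Pi))=L^2(X\times\mathbb R,\nu\times\Pi)$ (complex-valued) with $\langle f,\cdot\rangle\in L^2(\alpha)$, and also with the compensated integral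 $\sum_if(x_i,t_i)-\iint f\,d\nu\,d\Pi\in L^2(\eta_\Pi)$ (extended from $L^1\cap L^2$ to $L^2$ by continuity). Then for every set $V\subset L^2(\mathbb R,\Pi)$, $\Phi$ maps the set of functions $f$ with values in $V$ for almost all $x$ onto the same set. 4. $\Phi$ is unique: every unity-preserving real special isomorphism $L^2(\alpha^{L^2(\mathbb R,\Pi)})\to L^2(\eta_\Pi)$ of the Hilbert factorizations over $X$ that acts identically on the space of values in the sense of 3 equals $\Phi$. -/

import Mathlib

open MeasureTheory ProbabilityTheory Filter Topology
open scoped ENNReal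

noncomputable section

namespace LevyGauss

/-! ### Generalized random processes -/

/-- A generalized random process indexed by `L^p(Z, μ; ℝ)`: a linear map into the space of
(classes mod 0 of) real random variables on `(Ω, P)`. Continuity is not part of the definition: it
is a consequence of the form of the characteristic functional for the processes below. -/
abbrev GenProcess {Z Ω : Type*} [MeasurableSpace Z] [MeasurableSpace Ω]
    (p : ℝ≥0∞) (μ : Measure Z) (P : Measure Ω) : Type _ :=
  Lp ℝ p μ →ₗ[ℝ] (Ω →ₘ[P] ℝ)

/-- The σ-field generated by the restriction of the process to `B`, i.e. by the variables `⟨a, ·⟩`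
with `a` vanishing a.e. outside `B`. -/
def GenProcess.sigma {Z Ω : Type*} [MeasurableSpace Z] [MeasurableSpace Ω] {p : ℝ≥0∞}
    {μ : Measure Z} {P : Measure Ω} (Y : GenProcess p μ P) (B : Set Z) : MeasurableSpace Ω :=
  ⨆ (a : Lp ℝ p μ) (_ : ∀ᵐ z ∂μ, z ∉ B → a z = 0),
    MeasurableSpace.comap (fun ω => Y a ω) inferInstance

/-- Gaussian white noise on `(Z, μ)`: the process on `L²(Z, μ)` with characteristic functional
`exp (-‖h‖² / 2)`. -/
def IsWhiteNoise {Z Ω : Type*} [MeasurableSpace Z] [MeasurableSpace Ω]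
    {μ : Measure Z} {P : Measure Ω} (W : GenProcess 2 μ P) : Prop :=
  ∀ h : Lp ℝ 2 μ,
    ∫ ω, Complex.exp (Complex.I * (W h ω : ℂ)) ∂P = Complex.exp (-((‖h‖ ^ 2 / 2 : ℝ) : ℂ))

/-- Lévy–Khintchin measures on the line. -/
structure IsLevyMeasure (Pi : Measure ℝ) : Prop where
  zero : Pi {0} = 0
  integrable : Integrable (fun t : ℝ => t ^ 2 / (1 + t ^ 2)) Pi

/-- The Lévy–Khintchin exponent with drift `c`, no Gaussian part and Lévy measure `Pi`. -/
def levyExponent (Pi : Measure ℝ) (c : ℝ) (y : ℝ) : ℂ :=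
  Complex.I * c * y +
    ∫ t : ℝ, (Complex.exp (Complex.I * t * y) - 1 - Complex.I * t * y / (1 + (t : ℂ) ^ 2)) ∂Pi

/-- Homogeneous process with independent values on `(X, ν)` (a Lévy process), without Gaussian
component, with drift `c` and Lévy measure `Pi`; its test functions are the bounded measurable
functions mod 0. The law of the process (in particular the independence of its values at functions
with disjoint supports) is determined by the characteristic functional. -/
def IsLevyProcess {X Ω : Type*} [MeasurableSpace X] [MeasurableSpace Ω]
    {ν : Measure X} {P : Measure Ω} (Pi : Measure ℝ) (c : ℝ) (η : GenProcess ∞ ν P) : Prop :=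
  ∀ a : Lp ℝ ∞ ν,
    ∫ ω, Complex.exp (Complex.I * (η a ω : ℂ)) ∂P =
      Complex.exp (∫ x, levyExponent Pi c (a x) ∂ν)

/-! ### Point configurations, Poisson processes, jumps -/

/-- An at most countable set of points with positive integral multiplicities. -/
structure Configuration (Z : Type*) where
  mult : Z → ℕ
  countable_support : (Function.support mult).Countable

/-- The number of points in `B`, with multiplicities. -/
def Configuration.count {Z : Type*} (κ : Configuration Z) (B : Set Z) : ℝ≥0∞ :=
  ∑' z : B, (κ.mult z : ℝ≥0∞)

/-- The σ-field generated by the restriction of a random configuration to `B`. -/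
def configSigma {Z Ω : Type*} [MeasurableSpace Z] (N : Ω → Configuration Z) (B : Set Z) :
    MeasurableSpace Ω :=
  ⨆ (C : Set Z) (_ : MeasurableSet C) (_ : C ⊆ B),
    MeasurableSpace.comap (fun ω => (N ω).count C) inferInstance

/-- `N` is a Poisson process with (σ-finite) mean measure `μ`. -/
structure IsPoissonProcess {Z Ω : Type*} [MeasurableSpace Z] [MeasurableSpace Ω]
    (μ : Measure Z) (P : Measure Ω) (N : Ω → Configuration Z) : Prop where
  measurable : ∀ B : Set Z, MeasurableSet B → Measurable fun ω => (N ω).count B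
  law : ∀ B : Set Z, MeasurableSet B → μ B ≠ ∞ → ∀ n : ℕ,
    P {ω | (N ω).count B = n} =
      ENNReal.ofReal (Real.exp (-(μ B).toReal) * (μ B).toReal ^ n / (n.factorial : ℝ))
  indep : ∀ (n : ℕ) (B : Fin n → Set Z), (∀ i, MeasurableSet (B i)) →
    Pairwise (fun i j => Disjoint (B i) (B j)) →
    iIndepFun (fun i ω => (N ω).count (B i)) P

/-- `N` is the configuration of jumps `(x_i, t_i)` of the process `η`: a Poisson process on
`X × ℝ` with mean measure `ν × Pi` such that, in probability,
`⟨a, η⟩ = c ∫ a dν + lim_{ε → 0} (∑_{|t_i| > ε} a(x_i) t_i - ∬_{|t| > ε} a(x) t / (1 + t²) dν dPi)`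
for each test function `a`. -/
structure IsJumpConfiguration {X Ω : Type*} [MeasurableSpace X] [MeasurableSpace Ω]
    {ν : Measure X} {P : Measure Ω} (Pi : Measure ℝ) (c : ℝ) (η : GenProcess ∞ ν P)
    (N : Ω → Configuration (X × ℝ)) : Prop where
  poisson : IsPoissonProcess (ν.prod Pi) P N
  jumps : ∀ a : Lp ℝ ∞ ν,
    TendstoInMeasure P
      (fun (n : ℕ) ω =>
        c * ∫ x, a x ∂ν +
          ((∑' z : X × ℝ, ((N ω).mult z : ℝ) *
              (if 1 / ((n : ℝ) + 1) < |z.2| then a z.1 * z.2 else 0)) -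
            ∫ z : X × ℝ, (if 1 / ((n : ℝ) + 1) < |z.2| then a z.1 * (z.2 / (1 + z.2 ^ 2)) else 0)
              ∂(ν.prod Pi)))
      atTop (fun ω => η a ω)

/-! ### Hilbert factorizations -/

/-- `L²(Ω, m, P)` (complex-valued) as a subspace of `L²(Ω, P)`; null sets are added to `m`. -/
abbrev L2 {Ω : Type*} (m : MeasurableSpace Ω) [MeasurableSpace Ω] (P : Measure Ω) : Type _ :=
  lpMeas ℂ ℂ m 2 P

/-- The algebra `𝓑(H₁) ⊗ 1_{H₂}` of operators on `L²(Ω, m, P)`, where `Hᵢ = L²(Ω, mᵢ, P)` for two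
independent σ-fields `m₁`, `m₂` generating `m` (mod 0), and `f ⊗ g` is the product `f g`. -/
def tensorFactor {Ω : Type*} (m m₁ m₂ : MeasurableSpace Ω) [MeasurableSpace Ω] (P : Measure Ω) :
    Set (L2 m P →L[ℂ] L2 m P) :=
  {T | ∃ S : L2 m₁ P →L[ℂ] L2 m₁ P, ∀ (f : L2 m₁ P) (g : L2 m₂ P) (u : L2 m P),
    (∀ᵐ ω ∂P, u.1 ω = f.1 ω * g.1 ω) → ∀ᵐ ω ∂P, (T u).1 ω = (S f).1 ω * g.1 ω}

/-- The Hilbert factorization in the space of square integrable functionals of a process. -/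
def processFactorization {Z Ω : Type*} [MeasurableSpace Z] [MeasurableSpace Ω] {p : ℝ≥0∞}
    {μ : Measure Z} {P : Measure Ω} (Y : GenProcess p μ P) (B : Set Z) :
    Set (L2 (Y.sigma Set.univ) P →L[ℂ] L2 (Y.sigma Set.univ) P) :=
  tensorFactor (Y.sigma Set.univ) (Y.sigma B) (Y.sigma Bᶜ) P

/-- The factorization over `X` of a process on `X × ℝ`, regarded as a vector-valued process on `X`:
the restriction to `A ⊆ X` is the restriction to `A × ℝ`. -/
def baseFactorization {X Ω : Type*} [MeasurableSpace X] [MeasurableSpace Ω] {p : ℝ≥0∞}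
    {μ : Measure (X × ℝ)} {P : Measure Ω} (Y : GenProcess p μ P) (A : Set X) :
    Set (L2 (Y.sigma Set.univ) P →L[ℂ] L2 (Y.sigma Set.univ) P) :=
  processFactorization Y (Prod.fst ⁻¹' A)

/-- The factorization over `X × ℝ` in the space `L²(η)` given by the jumps of `η`. -/
def jumpFactorization {X Ω : Type*} [MeasurableSpace X] [MeasurableSpace Ω]
    {ν : Measure X} {P : Measure Ω} (η : GenProcess ∞ ν P) (N : Ω → Configuration (X × ℝ))
    (B : Set (X × ℝ)) :
    Set (L2 (η.sigma Set.univ) P →L[ℂ] L2 (η.sigma Set.univ) P) :=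
  tensorFactor (η.sigma Set.univ) (configSigma N B) (configSigma N Bᶜ) P

/-- `Φ` is a special isomorphism of the factorizations `ξ₁`, `ξ₂` over the Borel space `Z`:
`Φ ξ₁(B) Φ⁻¹ = ξ₂(B)` for each measurable `B`. -/
def IsSpecialIsomorphism {Z H₁ H₂ : Type*} [MeasurableSpace Z]
    [NormedAddCommGroup H₁] [NormedSpace ℂ H₁] [NormedAddCommGroup H₂] [NormedSpace ℂ H₂]
    (ξ₁ : Set Z → Set (H₁ →L[ℂ] H₁)) (ξ₂ : Set Z → Set (H₂ →L[ℂ] H₂))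
    (Φ : H₁ ≃ₗᵢ[ℂ] H₂) : Prop :=
  ∀ B : Set Z, MeasurableSet B →
    (fun T : H₁ →L[ℂ] H₁ =>
      (Φ.toContinuousLinearEquiv : H₁ →L[ℂ] H₂) ∘L T ∘L
        (Φ.symm.toContinuousLinearEquiv : H₂ →L[ℂ] H₁)) '' ξ₁ B = ξ₂ B

section Isometries

variable {Ω₁ Ω₂ : Type*} {m₁ : MeasurableSpace Ω₁} {m₂ : MeasurableSpace Ω₂}
  [MeasurableSpace Ω₁] [MeasurableSpace Ω₂] {P₁ : Measure Ω₁} {P₂ : Measure Ω₂}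

/-- `Φ` sends the unity function (the vacuum) to the unity function. -/
def IsUnityPreserving (Φ : L2 m₁ P₁ ≃ₗᵢ[ℂ] L2 m₂ P₂) : Prop :=
  ∀ u : L2 m₁ P₁, (∀ᵐ ω ∂P₁, u.1 ω = 1) → ∀ᵐ ω ∂P₂, (Φ u).1 ω = 1

/-- `Φ` sends the subspace of real-valued functionals onto the subspace of real-valued
functionals. -/
def IsReal (Φ : L2 m₁ P₁ ≃ₗᵢ[ℂ] L2 m₂ P₂) : Prop :=
  ∀ u : L2 m₁ P₁, (∀ᵐ ω ∂P₁, (u.1 ω).im = 0) ↔ ∀ᵐ ω ∂P₂, ((Φ u).1 ω).im = 0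

end Isometries

/-! ### The first chaos and the space of values -/

/-- `F = ⟨f, W⟩` for a complex-valued `f ∈ L²`, extended from real `f` by complex linearity. -/
def IsGaussianIntegral {Z Ω : Type*} {m : MeasurableSpace Ω} [MeasurableSpace Z]
    [MeasurableSpace Ω] {μ : Measure Z} {P : Measure Ω} (W : GenProcess 2 μ P)
    (f : Lp ℂ 2 μ) (F : L2 m P) : Prop :=
  ∀ᵐ ω ∂P, F.1 ω =
    (W (Complex.reCLM.compLp f) ω : ℂ) + Complex.I * (W (Complex.imCLM.compLp f) ω : ℂ)

/-- `F = ∑_i f(z_i) - ∫ f dμ`, the compensated integral of `f ∈ L²` over the random configuration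
`N = {z_i}`: defined by the formula for `f ∈ L¹ ∩ L²`, and by continuity in `L²` in general. -/
def IsCompensatedIntegral {Z Ω : Type*} {m : MeasurableSpace Ω} [MeasurableSpace Z]
    [MeasurableSpace Ω] (μ : Measure Z) {P : Measure Ω} (N : Ω → Configuration Z)
    (f : Lp ℂ 2 μ) (F : L2 m P) : Prop :=
  (f, F) ∈ closure {q : Lp ℂ 2 μ × L2 m P | Integrable q.1 μ ∧
    ∀ᵐ ω ∂P, q.2.1 ω = (∑' z : Z, ((N ω).mult z : ℂ) * q.1 z) - ∫ z, q.1 z ∂μ}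

/-- The elements of `L²(X × ℝ, ν × Pi) = L²((X, ν); L²(ℝ, Pi))` whose values lie in `V`. -/
def functionsWithValuesIn {X : Type*} [MeasurableSpace X] (ν : Measure X) (Pi : Measure ℝ)
    (V : Set (Lp ℂ 2 Pi)) : Set (Lp ℂ 2 (ν.prod Pi)) :=
  {f | ∀ᵐ x ∂ν, ∃ v ∈ V, ∀ᵐ t ∂Pi, f (x, t) = v t}

/-- `Φ` acts identically on the space of values `L²(ℝ, Pi)`: after the identification of the first
chaoses of the white noise `W` and of the process with jumps `N` with `L²((X, ν); L²(ℝ, Pi))`, for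
each set `V ⊆ L²(ℝ, Pi)`, the image under `Φ` of the set of functions with values in `V` is the
same set of functions. -/
def ActsIdenticallyOnValues {X Ω₁ Ω₂ : Type*}
    {m₁ : MeasurableSpace Ω₁} {m₂ : MeasurableSpace Ω₂} [MeasurableSpace X] [MeasurableSpace Ω₁]
    [MeasurableSpace Ω₂] {ν : Measure X} {Pi : Measure ℝ} {P₁ : Measure Ω₁} {P₂ : Measure Ω₂}
    (W : GenProcess 2 (ν.prod Pi) P₁) (N : Ω₂ → Configuration (X × ℝ))
    (Φ : L2 m₁ P₁ ≃ₗᵢ[ℂ] L2 m₂ P₂) : Prop :=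
  ∀ V : Set (Lp ℂ 2 Pi),
    Φ '' {F | ∃ f ∈ functionsWithValuesIn ν Pi V, IsGaussianIntegral W f F} =
      {G | ∃ f ∈ functionsWithValuesIn ν Pi V, IsCompensatedIntegral (ν.prod Pi) N f G}

/-- The action of `Φ` on multiplicative functionals: for each real `h ∈ L¹ ∩ L²`,
`exp (⟨h, ·⟩ - ‖h‖² / 2) ↦ ∏_i (1 + h(x_i, t_i)) exp (-∬ h)`, both sides being functionals in the
respective `L²` spaces and the product being convergent a.s. -/
def HasExponentialFormula {Z Ω₁ Ω₂ : Type*}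
    {m₁ : MeasurableSpace Ω₁} {m₂ : MeasurableSpace Ω₂} [MeasurableSpace Z] [MeasurableSpace Ω₁]
    [MeasurableSpace Ω₂] {μ : Measure Z} {P₁ : Measure Ω₁} {P₂ : Measure Ω₂}
    (W : GenProcess 2 μ P₁) (N : Ω₂ → Configuration Z)
    (Φ : L2 m₁ P₁ ≃ₗᵢ[ℂ] L2 m₂ P₂) : Prop :=
  ∀ (h : Z → ℝ) (h2 : MemLp h 2 μ), Integrable h μ →
    (∀ᵐ ω ∂P₂, Multipliable fun z : Z => (1 + h z) ^ (N ω).mult z) ∧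
    ∃ u : L2 m₁ P₁,
      (∀ᵐ ω ∂P₁, u.1 ω = (Real.exp (W (h2.toLp h) ω - ‖h2.toLp h‖ ^ 2 / 2) : ℂ)) ∧
      ∀ᵐ ω ∂P₂, (Φ u).1 ω =
        (((∏' z : Z, (1 + h z) ^ (N ω).mult z) * Real.exp (-∫ z, h z ∂μ) : ℝ) : ℂ)

end LevyGauss

end

open MeasureTheory ProbabilityTheory Filter Topology
open scoped ENNReal

noncomputable section

namespace LevyGauss

/-! Both `L²` spaces are realizations of the Fock space over `H = L²(ν × Pi)`, with the same vacuum
and the same decomposition over the base. In each of them there are exponential vectors `E h`, `h ∈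
H` complex, with `⟪E h, E g⟫ = exp ⟪h, g⟫`, `E 0 = 1`, `E (h + g) = E h · E g` when `h` and `g` have
disjoint supports, and `E` commuting with complex conjugation; this is `IsExpSystem`. For white
noise, `E h = exp (⟨h, W⟩ - ∫ h² / 2)`. For the configuration of jumps, `E h = ∏ (1 + h(z_i)) exp
(-∫ h)` on `L¹ ∩ L²`, extended to `H` by the continuity that the kernel `exp ⟪h, g⟫` forces. Two
total families with the same Gram matrix are unitarily equivalent, so `E₁ h ↦ E₂ h` defines `Φ`, and
the exponential formula is its definition.

The other properties of `Φ` follow once the closed span `expSpace E B` of the exponential vectors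
supported in `B` is known to be the `L²` space of the σ-field of the process over `B`
(`Represents`). The kernel then makes σ-fields over disjoint sets independent, `Φ` multiplies
functionals over `B` by functionals over the complement, and conjugation by `Φ` maps factors onto
factors. The derivative of `E` at `0` is the first chaos, so `Φ` is the identity on `H` there,
whatever the set `V` of values.

The hard case of `Represents` is the σ-field of the Lévy process itself: `⟨a, η⟩` adds all jumps up,
and the configuration has to be recovered from such sums (`IsJumpConfiguration.represents_sigma`).
By the Lévy–Khintchin formula `exp (i⟨a, η⟩)` is a constant multiple of `E (exp (i a(x) t) - 1)`. As
`X` has no atoms, sums of `E (1_C h) - 1` over the cells `C` of finer and finer partitions converge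
to the first chaos of `h`, and products of first-order terms over the cells converge back to `E h`.
The functions `1_D(x) (exp (i s t) - 1)` are total, so the sums put the whole first chaos over `A`
into the σ-field of `η` over `A`, and the products put all exponential vectors there.

The products also give uniqueness. A unity-preserving special isomorphism is multiplicative over
complementary sets, as the operators `|f⟩⟨1| ⊗ 1` lie in the factors (`special_map_mul`). With `V =
{v}` it fixes the constant function `v` in the first chaos; orthogonality over complementary sets
upgrades this to `1_A v`, hence to the first chaos (`map_firstChaos_of_constVec`), and the products
carry it to all exponential vectors.

For the existence of jumps, a Poisson process is built on a canonical space together with a Lévy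
process `η'` having these jumps. By `represents_sigma` the configuration is mod 0 a measurable
function of `η'`. Since `η` and `η'` have the same law, the same function applied to `η` is a
configuration of its jumps. -/

open scoped InnerProductSpace


/-! ### Hilbert space preliminaries: Gram matrices and the exponential kernel -/

section Hilbert

variable {ι K₁ K₂ : Type*} [NormedAddCommGroup K₁] [InnerProductSpace ℂ K₁] [CompleteSpace K₁]
  [NormedAddCommGroup K₂] [InnerProductSpace ℂ K₂] [CompleteSpace K₂]

/-- Two total families with the same Gram matrix are unitarily equivalent. -/
theorem exists_linearIsometryEquiv_of_inner_eq (u : ι → K₁) (v : ι → K₂)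
    (hu : (Submodule.span ℂ (Set.range u)).topologicalClosure = ⊤)
    (hv : (Submodule.span ℂ (Set.range v)).topologicalClosure = ⊤)
    (h : ∀ i j, ⟪u i, u j⟫_ℂ = ⟪v i, v j⟫_ℂ) :
    ∃ Φ : K₁ ≃ₗᵢ[ℂ] K₂, ∀ i, Φ (u i) = v i := by
  have hd₁ : DenseRange (Finsupp.linearCombination ℂ u) := by
    rw [DenseRange, ← LinearMap.coe_range, Finsupp.range_linearCombination]
    exact Submodule.dense_iff_topologicalClosure_eq_top.2 hu
  have hd₂ : DenseRange (Finsupp.linearCombination ℂ v) := by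
    rw [DenseRange, ← LinearMap.coe_range, Finsupp.range_linearCombination]
    exact Submodule.dense_iff_topologicalClosure_eq_top.2 hv
  have hn : ∀ x : ι →₀ ℂ, ‖Finsupp.linearCombination ℂ v x‖ = ‖Finsupp.linearCombination ℂ u x‖ := by
    intro x
    have : ⟪Finsupp.linearCombination ℂ v x, Finsupp.linearCombination ℂ v x⟫_ℂ =
        ⟪Finsupp.linearCombination ℂ u x, Finsupp.linearCombination ℂ u x⟫_ℂ := by
      simp only [Finsupp.linearCombination_apply, Finsupp.sum, sum_inner, inner_sum,
        inner_smul_left, inner_smul_right, h]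
    rw [inner_self_eq_norm_sq_to_K, inner_self_eq_norm_sq_to_K] at this
    have h2 : ‖Finsupp.linearCombination ℂ v x‖ ^ 2 = ‖Finsupp.linearCombination ℂ u x‖ ^ 2 := by
      exact_mod_cast this
    exact (pow_left_inj₀ (norm_nonneg _) (norm_nonneg _) two_ne_zero).1 h2
  refine ⟨(LinearEquiv.refl ℂ (ι →₀ ℂ)).extendOfIsometry _ _ hd₁ hd₂ hn, fun i => ?_⟩
  have := LinearEquiv.extendOfIsometry_eq (LinearEquiv.refl ℂ (ι →₀ ℂ)) _ _ hd₁ hd₂ hn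
    (Finsupp.single i 1)
  simpa using this

theorem norm_sub_sq_eq_re_inner (x y : K₁) :
    ‖x - y‖ ^ 2 = (⟪x, x⟫_ℂ - ⟪x, y⟫_ℂ - ⟪y, x⟫_ℂ + ⟪y, y⟫_ℂ).re := by
  rw [← inner_self_eq_norm_sq (𝕜 := ℂ), inner_sub_left, inner_sub_right, inner_sub_right]
  simp only [RCLike.re_to_complex]
  congr 1
  ring

/-- A map with `⟪E h, E g⟫ = exp ⟪h, g⟫` on a dense subset extends to the whole space. -/
theorem exists_extension_of_inner_eq_exp {D : Type*} (i : D → K₁) (hi : DenseRange i)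
    (e : D → K₂) (he : ∀ h g, ⟪e h, e g⟫_ℂ = Complex.exp ⟪i h, i g⟫_ℂ) :
    ∃ E : K₁ → K₂, Continuous E ∧ (∀ d, E (i d) = e d) ∧
      ∀ h g, ⟪E h, E g⟫_ℂ = Complex.exp ⟪h, g⟫_ℂ := by
  -- `G` is the squared distance of the images, expressed through the kernel. It is continuous and
  -- vanishes on the diagonal, which suffices to extend `e` by limits although `exp` is not
  -- uniformly continuous.
  let G : K₁ × K₁ → ℝ := fun p => (Complex.exp ⟪p.1, p.1⟫_ℂ - Complex.exp ⟪p.1, p.2⟫_ℂ -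
    Complex.exp ⟪p.2, p.1⟫_ℂ + Complex.exp ⟪p.2, p.2⟫_ℂ).re
  have hG : Continuous G := by fun_prop
  have hdist : ∀ a b, dist (e a) (e b) = Real.sqrt (G (i a, i b)) := by
    intro a b
    rw [dist_eq_norm, ← Real.sqrt_sq (norm_nonneg _), norm_sub_sq_eq_re_inner]
    simp only [he, G]
  letI : TopologicalSpace D := TopologicalSpace.induced i inferInstance
  have di : IsDenseInducing i := ⟨⟨rfl⟩, hi⟩
  have hlim : ∀ b, ∃ c, Tendsto e (comap i (𝓝 b)) (𝓝 c) := by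
    intro b
    haveI : (comap i (𝓝 b)).NeBot := di.comap_nhds_neBot b
    have : Cauchy (map e (comap i (𝓝 b))) := by
      rw [Metric.cauchy_iff]
      refine ⟨inferInstance, fun ε hε => ?_⟩
      have h1 : Tendsto (fun p : D × D => Real.sqrt (G (i p.1, i p.2)))
          (comap i (𝓝 b) ×ˢ comap i (𝓝 b)) (𝓝 (Real.sqrt (G (b, b)))) := by
        refine (Real.continuous_sqrt.comp hG).continuousAt.tendsto.comp ?_
        exact (tendsto_comap.comp tendsto_fst).prodMk_nhds (tendsto_comap.comp tendsto_snd)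
      have h0 : G (b, b) = 0 := by simp [G]
      rw [h0, Real.sqrt_zero] at h1
      have h2 := h1.eventually (gt_mem_nhds hε)
      obtain ⟨s, hs, hs'⟩ := (eventually_prod_self_iff (r := fun x y =>
        Real.sqrt (G (i x, i y)) < ε)).1 h2
      refine ⟨e '' s, image_mem_map hs, ?_⟩
      rintro _ ⟨x, hx, rfl⟩ _ ⟨y, hy, rfl⟩
      rw [hdist]
      exact hs' x hx y hy
    exact cauchy_map_iff_exists_tendsto.1 this
  have hEc := di.continuous_extend hlim
  have hEi : ∀ d, di.extend e (i d) = e d := by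
    intro d
    obtain ⟨c, hc⟩ := hlim (i d)
    have hd : e d = c := by
      have h3 : Tendsto (fun x => dist (e d) (e x)) (comap i (𝓝 (i d))) (𝓝 0) := by
        have : Tendsto (fun x => Real.sqrt (G (i d, i x))) (comap i (𝓝 (i d)))
            (𝓝 (Real.sqrt (G (i d, i d)))) :=
          (Real.continuous_sqrt.comp hG).continuousAt.tendsto.comp
            (tendsto_const_nhds.prodMk_nhds tendsto_comap)
        rw [show G (i d, i d) = 0 by simp [G], Real.sqrt_zero] at this
        simpa only [hdist] using this
      haveI : (comap i (𝓝 (i d))).NeBot := di.comap_nhds_neBot (i d)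
      have h4 := tendsto_nhds_unique h3 (tendsto_const_nhds.dist hc)
      exact (dist_eq_zero.1 h4.symm)
    exact di.extend_eq_of_tendsto (hd ▸ hc)
  refine ⟨di.extend e, hEc, hEi, fun h g => ?_⟩
  refine hi.induction_on₂ (p := fun h g => ⟪di.extend e h, di.extend e g⟫_ℂ =
    Complex.exp ⟪h, g⟫_ℂ) ?_ ?_ h g
  · exact isClosed_eq (by fun_prop) (by fun_prop)
  · intro a b
    rw [hEi, hEi, he]

end Hilbert

/-- The derivative of `exp (c t)` at `0`, along `t = 1 / x`. It computes the inner products of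
difference quotients of exponential vectors. -/
theorem tendsto_mul_exp_div_sub_one (c : ℂ) :
    Tendsto (fun x : ℝ => (x : ℂ) * (Complex.exp (c / x) - 1)) atTop (𝓝 c) := by
  have h1 : HasDerivAt (fun t : ℝ => Complex.exp (c * t)) c 0 := by
    have : HasDerivAt (fun t : ℝ => c * (t : ℂ)) c 0 := by
      simpa using (Complex.ofRealCLM.hasDerivAt (x := (0:ℝ))).const_mul c
    simpa using this.cexp
  have h2 := h1.tendsto_slope_zero_right
  have h3 := h2.comp tendsto_inv_atTop_nhdsGT_zero
  refine h3.congr fun x => ?_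
  simp [div_eq_mul_inv]


/-! ### Exponential systems -/

section ExpSystem

variable {Z Ω : Type*} [MeasurableSpace Z] [MeasurableSpace Ω] {μ : Measure Z} {P : Measure Ω}

/-- `h` vanishes almost everywhere outside `B`. -/
def SupportedIn (h : Lp ℂ 2 μ) (B : Set Z) : Prop := ∀ᵐ z ∂μ, z ∉ B → h z = 0

/-- A system of exponential vectors of the Fock space over `L²(μ)`, realized in `L²(P)` in such a
way that exponential vectors of functions with disjoint supports are multiplied pointwise. -/
structure IsExpSystem (E : Lp ℂ 2 μ → Lp ℂ 2 P) : Prop where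
  inner_eq : ∀ h g, ⟪E h, E g⟫_ℂ = Complex.exp ⟪h, g⟫_ℂ
  zero : E 0 =ᵐ[P] fun _ => 1
  mul : ∀ h g, (∀ᵐ z ∂μ, h z = 0 ∨ g z = 0) → E (h + g) =ᵐ[P] fun ω => E h ω * E g ω
  star_eq : ∀ h, E (star h) = star (E h)

/-- The closed subspace generated by the exponential vectors of functions supported in `B`. -/
def expSpace (E : Lp ℂ 2 μ → Lp ℂ 2 P) (B : Set Z) : Submodule ℂ (Lp ℂ 2 P) :=
  (Submodule.span ℂ (E '' {h | SupportedIn h B})).topologicalClosure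

/-- The restriction of `h` to `B`, extended by zero. -/
def cut (B : Set Z) (hB : MeasurableSet B) (h : Lp ℂ 2 μ) : Lp ℂ 2 μ :=
  ((Lp.memLp h).indicator hB).toLp _

theorem coeFn_cut (B : Set Z) (hB : MeasurableSet B) (h : Lp ℂ 2 μ) :
    cut B hB h =ᵐ[μ] B.indicator h := MemLp.coeFn_toLp _

theorem supportedIn_cut (B : Set Z) (hB : MeasurableSet B) (h : Lp ℂ 2 μ) :
    SupportedIn (cut B hB h) B := by
  filter_upwards [coeFn_cut B hB h] with z hz hzB
  simp [hz, hzB]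

theorem SupportedIn.mono {h : Lp ℂ 2 μ} {B C : Set Z} (hh : SupportedIn h B) (hBC : B ⊆ C) :
    SupportedIn h C := by
  filter_upwards [hh] with z hz hzC
  exact hz fun hB => hzC (hBC hB)

theorem supportedIn_univ (h : Lp ℂ 2 μ) : SupportedIn h Set.univ := by
  filter_upwards with z hz
  exact absurd (Set.mem_univ z) hz

theorem supportedIn_zero (B : Set Z) : SupportedIn (0 : Lp ℂ 2 μ) B := by
  filter_upwards [Lp.coeFn_zero ℂ 2 μ] with z hz _
  exact hz

theorem SupportedIn.smul {h : Lp ℂ 2 μ} {B : Set Z} (hh : SupportedIn h B) (c : ℂ) :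
    SupportedIn (c • h) B := by
  filter_upwards [hh, Lp.coeFn_smul c h] with z hz h1 hzB
  simp [h1, hz hzB]

theorem SupportedIn.disjoint {h g : Lp ℂ 2 μ} {B C : Set Z} (hh : SupportedIn h B)
    (hg : SupportedIn g C) (hBC : Disjoint B C) : ∀ᵐ z ∂μ, h z = 0 ∨ g z = 0 := by
  filter_upwards [hh, hg] with z h1 h2
  by_cases hz : z ∈ B
  · exact Or.inr (h2 fun hC => Set.disjoint_left.1 hBC hz hC)
  · exact Or.inl (h1 hz)

theorem cut_eq_self {h : Lp ℂ 2 μ} {B : Set Z} (hB : MeasurableSet B) (hh : SupportedIn h B) :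
    cut B hB h = h := by
  refine Lp.ext ?_
  filter_upwards [coeFn_cut B hB h, hh] with z h1 h2
  rw [h1]
  by_cases hz : z ∈ B
  · simp [hz]
  · simp [hz, h2 hz]

theorem cut_add_cut_compl (B : Set Z) (hB : MeasurableSet B) (h : Lp ℂ 2 μ) :
    cut B hB h + cut Bᶜ hB.compl h = h := by
  refine Lp.ext ?_
  filter_upwards [coeFn_cut B hB h, coeFn_cut Bᶜ hB.compl h,
    Lp.coeFn_add (cut B hB h) (cut Bᶜ hB.compl h)] with z h1 h2 h3
  rw [h3, Pi.add_apply, h1, h2]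
  by_cases hz : z ∈ B <;> simp [hz]

theorem inner_eq_zero_of_disjoint {h g : Lp ℂ 2 μ} (hd : ∀ᵐ z ∂μ, h z = 0 ∨ g z = 0) :
    ⟪h, g⟫_ℂ = 0 := by
  rw [L2.inner_def]
  refine integral_eq_zero_of_ae ?_
  filter_upwards [hd] with z hz
  rcases hz with hz | hz <;> simp [hz]

variable {E : Lp ℂ 2 μ → Lp ℂ 2 P}

theorem mem_expSpace (E : Lp ℂ 2 μ → Lp ℂ 2 P) {h : Lp ℂ 2 μ} {B : Set Z} (hh : SupportedIn h B) :
    E h ∈ expSpace E B :=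
  Submodule.le_topologicalClosure _ (Submodule.subset_span ⟨h, hh, rfl⟩)

theorem isClosed_expSpace (E : Lp ℂ 2 μ → Lp ℂ 2 P) (B : Set Z) :
    IsClosed (expSpace E B : Set (Lp ℂ 2 P)) :=
  Submodule.isClosed_topologicalClosure _

theorem expSpace_le {B : Set Z} {K : Submodule ℂ (Lp ℂ 2 P)} (hK : IsClosed (K : Set (Lp ℂ 2 P)))
    (h : ∀ h, SupportedIn h B → E h ∈ K) : expSpace E B ≤ K := by
  refine Submodule.topologicalClosure_minimal _ (Submodule.span_le.2 ?_) hK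
  rintro _ ⟨g, hg, rfl⟩
  exact h g hg

theorem expSpace_mono (E : Lp ℂ 2 μ → Lp ℂ 2 P) {B C : Set Z} (hBC : B ⊆ C) :
    expSpace E B ≤ expSpace E C :=
  expSpace_le (isClosed_expSpace E C) fun _ hh => mem_expSpace E (hh.mono hBC)

/-- Continuous linear maps that agree on exponential vectors agree on `expSpace`. -/
theorem eqOn_expSpace {F : Type*} [NormedAddCommGroup F] [NormedSpace ℂ F] {B : Set Z}
    {S T : Lp ℂ 2 P →L[ℂ] F} (h : ∀ h, SupportedIn h B → S (E h) = T (E h)) {x : Lp ℂ 2 P}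
    (hx : x ∈ expSpace E B) : S x = T x := by
  have : expSpace E B ≤ LinearMap.eqLocus S.toLinearMap T.toLinearMap := by
    refine expSpace_le ?_ fun g hg => h g hg
    exact isClosed_eq S.continuous T.continuous
  exact this hx

/-- By totality of the exponential vectors `x - y` is orthogonal to itself. This is the standard way
below to identify a vector. -/
theorem eq_of_inner_exp_eq {B : Set Z} {x y : Lp ℂ 2 P} (hx : x ∈ expSpace E B)
    (hy : y ∈ expSpace E B) (h : ∀ h, SupportedIn h B → ⟪E h, x⟫_ℂ = ⟪E h, y⟫_ℂ) : x = y := by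
  have h1 : ⟪x - y, x - y⟫_ℂ = 0 := by
    have h2 : ∀ z ∈ expSpace E B, innerSL ℂ (x - y) z = (0 : Lp ℂ 2 P →L[ℂ] ℂ) z := by
      intro z hz
      refine eqOn_expSpace (E := E) (fun g hg => ?_) hz
      rw [innerSL_apply_apply, ← inner_conj_symm, inner_sub_right, h g hg]
      simp
    exact h2 _ (Submodule.sub_mem _ hx hy)
  exact sub_eq_zero.1 (inner_self_eq_zero.1 h1)

namespace IsExpSystem

variable (hE : IsExpSystem E)
include hE

theorem inner_zero_exp (h : Lp ℂ 2 μ) : ⟪E 0, E h⟫_ℂ = 1 := by simp [hE.inner_eq]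

/-- On exponential vectors the exponent is `0` and all three inner products equal `1`; the general
case follows by linearity and continuity in one variable at a time. Applied to indicators, this is
independence. -/
theorem inner_eq_mul_of_disjoint {B C : Set Z} (hBC : Disjoint B C) {f g : Lp ℂ 2 P}
    (hf : f ∈ expSpace E B) (hg : g ∈ expSpace E C) : ⟪f, g⟫_ℂ = ⟪f, E 0⟫_ℂ * ⟪E 0, g⟫_ℂ := by
  have h1 : ∀ h, SupportedIn h B → ⟪E h, g⟫_ℂ = ⟪E 0, g⟫_ℂ := by
    intro h hh
    refine eqOn_expSpace (E := E) (S := innerSL ℂ (E h)) (T := innerSL ℂ (E 0)) (fun k hk => ?_) hg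
    simp only [innerSL_apply_apply]
    rw [hE.inner_zero_exp, hE.inner_eq, inner_eq_zero_of_disjoint (hh.disjoint hk hBC),
      Complex.exp_zero]
  have h2 := eqOn_expSpace (E := E) (S := innerSL ℂ g) (T := (⟪g, E 0⟫_ℂ) • innerSL ℂ (E 0))
    (fun k hk => ?_) hf
  · simp only [innerSL_apply_apply, smul_apply, smul_eq_mul] at h2
    rw [← inner_conj_symm f g, h2, map_mul, inner_conj_symm, inner_conj_symm, mul_comm]
  · simp only [innerSL_apply_apply, smul_apply, smul_eq_mul]
    rw [hE.inner_zero_exp, mul_one, ← inner_conj_symm, h1 k hk, inner_conj_symm]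

/-! #### The first chaos -/

/-- The limit is the derivative of `s ↦ E (s f)` at `0`. By the kernel, two difference quotients
have inner product `nm (exp (⟪f, f⟫ / nm) - 1)`, up to shifts by one, which tends to `⟪f, f⟫`; so
they form a Cauchy sequence with a limit of norm `‖f‖`. Linearity holds because the inner products
with the `E h` determine the limit. -/
theorem exists_firstChaos : ∃ I : Lp ℂ 2 μ →ₗᵢ[ℂ] Lp ℂ 2 P,
    (∀ f, Tendsto (fun n : ℕ => ((n : ℂ) + 1) • (E (((n : ℂ) + 1)⁻¹ • f) - E 0)) atTop
      (𝓝 (I f))) ∧ (∀ h f, ⟪E h, I f⟫_ℂ = ⟪h, f⟫_ℂ) := by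
  have hcast : Tendsto (fun n : ℕ => (n : ℝ) + 1) atTop atTop :=
    tendsto_atTop_add_const_right _ _ tendsto_natCast_atTop_atTop
  set u : Lp ℂ 2 μ → ℕ → Lp ℂ 2 P :=
    fun f n => ((n : ℂ) + 1) • (E (((n : ℂ) + 1)⁻¹ • f) - E 0) with hu
  have hne : ∀ n : ℕ, ((n : ℂ) + 1) ≠ 0 := fun n => Nat.cast_add_one_ne_zero n
  have hconj : ∀ n : ℕ, (starRingEnd ℂ) ((n : ℂ) + 1) = (n : ℂ) + 1 := fun n => by simp
  have huu : ∀ f g n m, ⟪u f n, u g m⟫_ℂ = (((n : ℝ) + 1) * ((m : ℝ) + 1) : ℝ) *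
      (Complex.exp (⟪f, g⟫_ℂ / ((((n : ℝ) + 1) * ((m : ℝ) + 1) : ℝ) : ℂ)) - 1) := by
    intro f g n m
    simp only [hu, inner_smul_left, inner_smul_right, inner_sub_left, inner_sub_right,
      hE.inner_eq, inner_zero_left, inner_zero_right, mul_zero, Complex.exp_zero, hconj, map_inv₀]
    push_cast
    have : ((m : ℂ) + 1)⁻¹ * (((n : ℂ) + 1)⁻¹ * ⟪f, g⟫_ℂ) =
        ⟪f, g⟫_ℂ / (((n : ℂ) + 1) * ((m : ℂ) + 1)) := by
      rw [div_eq_mul_inv, mul_inv]; ring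
    rw [this]
    ring
  have hEu : ∀ h f n, ⟪E h, u f n⟫_ℂ = ((n : ℝ) + 1 : ℝ) *
      (Complex.exp (⟪h, f⟫_ℂ / (((n : ℝ) + 1 : ℝ) : ℂ)) - 1) := by
    intro h f n
    simp only [hu, inner_smul_right, inner_sub_right, hE.inner_eq, inner_zero_right,
      Complex.exp_zero]
    push_cast
    rw [div_eq_inv_mul]
  have hprod : Tendsto (fun p : ℕ × ℕ => ((p.1 : ℝ) + 1) * ((p.2 : ℝ) + 1)) atTop atTop := by
    rw [← prod_atTop_atTop_eq]
    exact (hcast.comp tendsto_fst).atTop_mul_atTop₀ (hcast.comp tendsto_snd)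
  have hcau : ∀ f, CauchySeq (u f) := by
    intro f
    rw [cauchySeq_iff_tendsto_dist_atTop_0]
    -- With `q` ranging over the four arrangements of a pair of indices, every term of the expanded
    -- squared distance has the same limit `⟪f, f⟫`, and the terms cancel.
    have hφ : ∀ q : ℕ × ℕ → ℕ × ℕ, Tendsto q atTop atTop → Tendsto (fun p =>
        ⟪u f (q p).1, u f (q p).2⟫_ℂ) atTop (𝓝 ⟪f, f⟫_ℂ) := by
      intro q hq
      simp only [huu]
      exact (tendsto_mul_exp_div_sub_one _).comp (hprod.comp hq)
    have h1 : Tendsto (fun p : ℕ × ℕ => (p.1, p.1)) atTop atTop := by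
      rw [← prod_atTop_atTop_eq]; exact tendsto_fst.prodMk tendsto_fst
    have h2 : Tendsto (fun p : ℕ × ℕ => (p.2, p.2)) atTop atTop := by
      rw [← prod_atTop_atTop_eq]; exact tendsto_snd.prodMk tendsto_snd
    have h3 : Tendsto (fun p : ℕ × ℕ => (p.2, p.1)) atTop atTop := by
      rw [← prod_atTop_atTop_eq]; exact tendsto_snd.prodMk tendsto_fst
    have h4 := (((hφ _ h1).sub (hφ _ tendsto_id)).sub (hφ _ h3)).add (hφ _ h2)
    have h5 := (Real.continuous_sqrt.tendsto _).comp
      ((Complex.continuous_re.tendsto _).comp h4)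
    simp only [id, sub_self, zero_sub, neg_add_cancel, Complex.zero_re, Real.sqrt_zero] at h5
    refine h5.congr fun p => ?_
    rw [dist_eq_norm, ← Real.sqrt_sq (norm_nonneg (u f p.1 - u f p.2)), norm_sub_sq_eq_re_inner]
    rfl
  choose J hJ using fun f => cauchySeq_tendsto_of_complete (hcau f)
  have hEJ : ∀ h f, ⟪E h, J f⟫_ℂ = ⟪h, f⟫_ℂ := by
    intro h f
    have h1 : Tendsto (fun n => ⟪E h, u f n⟫_ℂ) atTop (𝓝 ⟪E h, J f⟫_ℂ) :=
      tendsto_const_nhds.inner (hJ f)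
    refine tendsto_nhds_unique h1 ?_
    simp only [hEu]
    exact (tendsto_mul_exp_div_sub_one _).comp hcast
  have hJmem : ∀ f, J f ∈ expSpace E Set.univ := by
    intro f
    refine (isClosed_expSpace E _).mem_of_tendsto (hJ f) (Eventually.of_forall fun n => ?_)
    exact Submodule.smul_mem _ _ (Submodule.sub_mem _ (mem_expSpace E (supportedIn_univ _))
      (mem_expSpace E (supportedIn_univ _)))
  have hJJ : ∀ f, ‖J f‖ = ‖f‖ := by
    intro f
    have h1 : Tendsto (fun n => ⟪u f n, u f n⟫_ℂ) atTop (𝓝 ⟪J f, J f⟫_ℂ) := (hJ f).inner (hJ f)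
    have h2 : Tendsto (fun n => ⟪u f n, u f n⟫_ℂ) atTop (𝓝 ⟪f, f⟫_ℂ) := by
      simp only [huu]
      exact (tendsto_mul_exp_div_sub_one _).comp (hcast.atTop_mul_atTop₀ hcast)
    have h3 := tendsto_nhds_unique h1 h2
    rw [inner_self_eq_norm_sq_to_K, inner_self_eq_norm_sq_to_K] at h3
    have h4 : ‖J f‖ ^ 2 = ‖f‖ ^ 2 := by exact_mod_cast h3
    exact (pow_left_inj₀ (norm_nonneg _) (norm_nonneg _) two_ne_zero).1 h4
  refine ⟨⟨⟨⟨J, fun f g => ?_⟩, fun c f => ?_⟩, hJJ⟩, hJ, hEJ⟩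
  · refine eq_of_inner_exp_eq (hJmem _) (Submodule.add_mem _ (hJmem _) (hJmem _)) fun h _ => ?_
    rw [inner_add_right, hEJ, hEJ, hEJ, inner_add_right]
  · refine eq_of_inner_exp_eq (hJmem _) (Submodule.smul_mem _ _ (hJmem _)) fun h _ => ?_
    simp only [RingHom.id_apply]
    rw [inner_smul_right, hEJ, hEJ, inner_smul_right]

/-- The first chaos: the isometric embedding of `L²(μ)` given by the derivative of the
exponential vectors at the origin. -/
def firstChaos : Lp ℂ 2 μ →ₗᵢ[ℂ] Lp ℂ 2 P := hE.exists_firstChaos.choose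

theorem tendsto_firstChaos (f : Lp ℂ 2 μ) :
    Tendsto (fun n : ℕ => ((n : ℂ) + 1) • (E (((n : ℂ) + 1)⁻¹ • f) - E 0)) atTop
      (𝓝 (hE.firstChaos f)) := hE.exists_firstChaos.choose_spec.1 f

theorem inner_exp_firstChaos (h f : Lp ℂ 2 μ) : ⟪E h, hE.firstChaos f⟫_ℂ = ⟪h, f⟫_ℂ :=
  hE.exists_firstChaos.choose_spec.2 h f

theorem firstChaos_mem {f : Lp ℂ 2 μ} {B : Set Z} (hf : SupportedIn f B) :
    hE.firstChaos f ∈ expSpace E B := by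
  refine (isClosed_expSpace E _).mem_of_tendsto (hE.tendsto_firstChaos f)
    (Eventually.of_forall fun n => ?_)
  exact Submodule.smul_mem _ _ (Submodule.sub_mem _ (mem_expSpace E (hf.smul _))
      (mem_expSpace E (supportedIn_zero _)))

theorem inner_firstChaos_exp (h f : Lp ℂ 2 μ) : ⟪hE.firstChaos f, E h⟫_ℂ = ⟪f, h⟫_ℂ := by
  rw [← inner_conj_symm, hE.inner_exp_firstChaos, inner_conj_symm]

theorem inner_zero_firstChaos (f : Lp ℂ 2 μ) : ⟪E 0, hE.firstChaos f⟫_ℂ = 0 := by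
  rw [hE.inner_exp_firstChaos, inner_zero_left]

theorem eq_firstChaos {f : Lp ℂ 2 μ} {x : Lp ℂ 2 P} (hx : x ∈ expSpace E Set.univ)
    (h : ∀ h, ⟪E h, x⟫_ℂ = ⟪h, f⟫_ℂ) : x = hE.firstChaos f :=
  eq_of_inner_exp_eq hx (hE.firstChaos_mem (supportedIn_univ f)) fun g _ => by
    rw [h, hE.inner_exp_firstChaos]

/-- If the difference quotients of the exponential vectors converge almost everywhere, the limit is
the first chaos. -/
theorem firstChaos_ae_eq {f : Lp ℂ 2 μ} {F : Ω → ℂ}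
    (hF : ∀ᵐ ω ∂P, Tendsto (fun n : ℕ => ((n : ℂ) + 1) * (E (((n : ℂ) + 1)⁻¹ • f) ω - 1)) atTop
      (𝓝 (F ω))) : hE.firstChaos f =ᵐ[P] F := by
  have h1 := tendstoInMeasure_of_tendsto_Lp (hE.tendsto_firstChaos f)
  obtain ⟨ns, hns, h2⟩ := h1.exists_seq_tendsto_ae
  have h3 : ∀ᵐ ω ∂P, ∀ n : ℕ, (((n : ℂ) + 1) • (E (((n : ℂ) + 1)⁻¹ • f) - E 0) : Lp ℂ 2 P) ω =
      ((n : ℂ) + 1) * (E (((n : ℂ) + 1)⁻¹ • f) ω - 1) := by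
    rw [ae_all_iff]
    intro n
    filter_upwards [Lp.coeFn_smul ((n : ℂ) + 1) (E (((n : ℂ) + 1)⁻¹ • f) - E 0),
      Lp.coeFn_sub (E (((n : ℂ) + 1)⁻¹ • f)) (E 0), hE.zero] with ω h1 h2 h3
    rw [h1, Pi.smul_apply, h2, Pi.sub_apply, h3, smul_eq_mul]
  filter_upwards [hF, h2, h3] with ω h4 h5 h6
  refine tendsto_nhds_unique h5 ?_
  simp only [h6]
  exact h4.comp hns.tendsto_atTop

end IsExpSystem

end ExpSystem


/-! ### Factorizations given by exponential systems -/

theorem stronglyMeasurable_limUnder {Ω : Type*} [m : MeasurableSpace Ω] {f : ℕ → Ω → ℂ}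
    (hf : ∀ n, StronglyMeasurable (f n)) :
    StronglyMeasurable fun ω => limUnder atTop fun n => f n ω :=
  StronglyMeasurable.limUnder hf

section Represents

variable {Ω : Type*} {m m₁ m₂ m₃ : MeasurableSpace Ω} [mΩ : MeasurableSpace Ω] {P : Measure Ω}

/-- Here `m` is not the ambient σ-field of `P`, so the limit is taken of honestly `m`-measurable
versions. -/
theorem aestronglyMeasurable_of_tendsto_ae' {f : ℕ → Ω → ℂ} {g : Ω → ℂ}
    (hf : ∀ n, AEStronglyMeasurable[m] (f n) P)
    (h : ∀ᵐ ω ∂P, Tendsto (fun n => f n ω) atTop (𝓝 (g ω))) : AEStronglyMeasurable[m] g P := by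
  choose f' hf' hff' using hf
  refine ⟨fun ω => limUnder atTop fun n => f' n ω, stronglyMeasurable_limUnder (m := m) hf', ?_⟩
  filter_upwards [h, ae_all_iff.2 hff'] with ω h1 h2
  simp only [h2] at h1
  exact h1.limUnder_eq.symm

theorem isClosed_lpMeas (hm : m ≤ mΩ) : IsClosed (lpMeas ℂ ℂ m 2 P : Set (Lp ℂ 2 P)) :=
  isClosed_aestronglyMeasurable hm

theorem indepFun_of_indep {f g : Ω → ℂ} (h : Indep m₁ m₂ P) (hf : AEStronglyMeasurable[m₁] f P)
    (hg : AEStronglyMeasurable[m₂] g P) : IndepFun f g P := by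
  obtain ⟨f', hf', hff'⟩ := hf
  obtain ⟨g', hg', hgg'⟩ := hg
  have h1 : IndepFun f' g' P :=
    indep_of_indep_of_le_left (indep_of_indep_of_le_right h hg'.measurable.comap_le)
      hf'.measurable.comap_le
  exact h1.congr hff'.symm hgg'.symm

/-- The integrand is a product of the `m₁`-measurable function `f' · conj f` and the `m₂`-measurable
`g' · conj g`, whose expectations multiply. -/
theorem inner_mul_of_indep (h : Indep m₁ m₂ P) (h₁ : m₁ ≤ mΩ) (h₂ : m₂ ≤ mΩ)
    {f f' g g' u u' : Lp ℂ 2 P} (hf : f ∈ lpMeas ℂ ℂ m₁ 2 P) (hf' : f' ∈ lpMeas ℂ ℂ m₁ 2 P)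
    (hg : g ∈ lpMeas ℂ ℂ m₂ 2 P) (hg' : g' ∈ lpMeas ℂ ℂ m₂ 2 P)
    (hu : u =ᵐ[P] fun ω => f ω * g ω) (hu' : u' =ᵐ[P] fun ω => f' ω * g' ω) :
    ⟪u, u'⟫_ℂ = ⟪f, f'⟫_ℂ * ⟪g, g'⟫_ℂ := by
  rw [mem_lpMeas_iff_aestronglyMeasurable] at hf hf' hg hg'
  simp only [L2.inner_def, RCLike.inner_apply]
  have hF : AEStronglyMeasurable[m₁] (fun ω => f' ω * (starRingEnd ℂ) (f ω)) P :=
    hf'.mul (Complex.continuous_conj.comp_aestronglyMeasurable hf)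
  have hG : AEStronglyMeasurable[m₂] (fun ω => g' ω * (starRingEnd ℂ) (g ω)) P :=
    hg'.mul (Complex.continuous_conj.comp_aestronglyMeasurable hg)
  rw [← (indepFun_of_indep h hF hG).integral_fun_mul_eq_mul_integral (hF.mono h₁) (hG.mono h₂)]
  refine integral_congr_ae ?_
  filter_upwards [hu, hu'] with ω h1 h2
  rw [h1, h2, map_mul]
  ring

theorem exists_mul_of_indep [IsProbabilityMeasure P] (h : Indep m₁ m₂ P) (h₁ : m₁ ≤ mΩ)
    (h₂ : m₂ ≤ mΩ) {f g : Lp ℂ 2 P} (hf : f ∈ lpMeas ℂ ℂ m₁ 2 P) (hg : g ∈ lpMeas ℂ ℂ m₂ 2 P) :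
    ∃ u : Lp ℂ 2 P, u =ᵐ[P] fun ω => f ω * g ω := by
  rw [mem_lpMeas_iff_aestronglyMeasurable] at hf hg
  have h3 : MemLp (fun ω => f ω * g ω) 2 P := by
    refine (memLp_two_iff_integrable_sq_norm ((hf.mono h₁).mul (hg.mono h₂))).2 ?_
    have h4 : IndepFun (fun ω => ‖f ω‖ ^ 2) (fun ω => ‖g ω‖ ^ 2) P :=
      (indepFun_of_indep h hf hg).comp (φ := fun z : ℂ => ‖z‖ ^ 2) (ψ := fun z : ℂ => ‖z‖ ^ 2)
        (by fun_prop) (by fun_prop)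
    have h5 := h4.integrable_mul ((Lp.memLp f).integrable_norm_pow two_ne_zero)
      ((Lp.memLp g).integrable_norm_pow two_ne_zero)
    refine h5.congr (ae_of_all _ fun ω => ?_)
    simp [mul_pow]
  exact ⟨h3.toLp _, h3.coeFn_toLp⟩

variable {Z : Type*} [MeasurableSpace Z] {μ : Measure Z} {E : Lp ℂ 2 μ → Lp ℂ 2 P}

/-- The functions measurable (mod 0) with respect to the σ-field `m` form the subspace generated
by the exponential vectors of functions supported in `B`. -/
structure Represents {Z Ω : Type*} (m : MeasurableSpace Ω) [MeasurableSpace Z]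
    [mΩ : MeasurableSpace Ω] {μ : Measure Z} {P : Measure Ω} (E : Lp ℂ 2 μ → Lp ℂ 2 P)
    (B : Set Z) : Prop where
  le : m ≤ mΩ
  eq : lpMeas ℂ ℂ m 2 P = expSpace E B

theorem Represents.mem_iff {B : Set Z} (h : Represents m E B) {f : Lp ℂ 2 P} :
    f ∈ lpMeas ℂ ℂ m 2 P ↔ f ∈ expSpace E B := by rw [h.eq]

theorem exp_zero_eq (hE : IsExpSystem E) [IsProbabilityMeasure P] :
    E 0 = indicatorConstLp 2 (MeasurableSet.univ) (measure_ne_top P _) (1 : ℂ) := by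
  refine Lp.ext (hE.zero.trans ?_)
  refine EventuallyEq.trans ?_ indicatorConstLp_coeFn.symm
  simp

/-- The factorization of inner products over disjoint sets, applied to the indicators of two events,
with `E 0 = 1`. -/
theorem IsExpSystem.indep [IsProbabilityMeasure P] (hE : IsExpSystem E) {B C : Set Z}
    (h₁ : Represents m₁ E B) (h₂ : Represents m₂ E C) (hBC : Disjoint B C) : Indep m₁ m₂ P := by
  rw [Indep_iff]
  intro s t hs ht
  have hs' := h₁.mem_iff.1 (mem_lpMeas_indicatorConstLp (𝕜 := ℂ) (p := 2) (c := (1 : ℂ))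
    h₁.le hs (measure_ne_top P s))
  have ht' := h₂.mem_iff.1 (mem_lpMeas_indicatorConstLp (𝕜 := ℂ) (p := 2) (c := (1 : ℂ))
    h₂.le ht (measure_ne_top P t))
  have h3 := hE.inner_eq_mul_of_disjoint hBC hs' ht'
  rw [exp_zero_eq hE] at h3
  simp only [L2.inner_indicatorConstLp_one_indicatorConstLp_one, Set.inter_univ,
    Set.univ_inter] at h3
  have h4 : P.real (s ∩ t) = P.real s * P.real t := by
    have h5 : ((P.real (s ∩ t) : ℝ) : ℂ) = ((P.real s * P.real t : ℝ) : ℂ) := by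
      push_cast
      exact h3
    exact_mod_cast h5
  simp only [measureReal_def, ← ENNReal.toReal_mul] at h4
  exact (ENNReal.toReal_eq_toReal_iff' (measure_ne_top _ _)
    (ENNReal.mul_ne_top (measure_ne_top _ _) (measure_ne_top _ _))).1 h4

theorem IsExpSystem.inner_mul [IsProbabilityMeasure P] (hE : IsExpSystem E) {B C : Set Z}
    (h₁ : Represents m₁ E B) (h₂ : Represents m₂ E C) (hBC : Disjoint B C)
    {f f' g g' u u' : Lp ℂ 2 P} (hf : f ∈ expSpace E B) (hf' : f' ∈ expSpace E B)
    (hg : g ∈ expSpace E C) (hg' : g' ∈ expSpace E C)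
    (hu : u =ᵐ[P] fun ω => f ω * g ω) (hu' : u' =ᵐ[P] fun ω => f' ω * g' ω) :
    ⟪u, u'⟫_ℂ = ⟪f, f'⟫_ℂ * ⟪g, g'⟫_ℂ :=
  inner_mul_of_indep (hE.indep h₁ h₂ hBC) h₁.le h₂.le (h₁.mem_iff.2 hf) (h₁.mem_iff.2 hf')
    (h₂.mem_iff.2 hg) (h₂.mem_iff.2 hg') hu hu'

theorem Represents.mul_mem {D : Set Z} (h₃ : Represents m₃ E D) {f g u : Lp ℂ 2 P}
    (hf : f ∈ expSpace E D) (hg : g ∈ expSpace E D) (hu : u =ᵐ[P] fun ω => f ω * g ω) :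
    u ∈ expSpace E D := by
  rw [← h₃.mem_iff, mem_lpMeas_iff_aestronglyMeasurable] at *
  exact (hf.mul hg).congr hu.symm

theorem IsExpSystem.exists_mul [IsProbabilityMeasure P] (hE : IsExpSystem E) {B C D : Set Z}
    (h₁ : Represents m₁ E B) (h₂ : Represents m₂ E C) (hBC : Disjoint B C)
    (h₃ : Represents m₃ E D) (hB : B ⊆ D) (hC : C ⊆ D)
    {f g : Lp ℂ 2 P} (hf : f ∈ expSpace E B) (hg : g ∈ expSpace E C) :
    ∃ u ∈ expSpace E D, u =ᵐ[P] fun ω => f ω * g ω := by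
  obtain ⟨u, hu⟩ := exists_mul_of_indep (hE.indep h₁ h₂ hBC) h₁.le h₂.le (h₁.mem_iff.2 hf)
    (h₂.mem_iff.2 hg)
  exact ⟨u, h₃.mul_mem (expSpace_mono E hB hf) (expSpace_mono E hC hg) hu, hu⟩

theorem IsExpSystem.exp_ae_eq_cut_mul (hE : IsExpSystem E) {B : Set Z} (hB : MeasurableSet B)
    (h : Lp ℂ 2 μ) : E h =ᵐ[P] fun ω => E (cut B hB h) ω * E (cut Bᶜ hB.compl h) ω := by
  have := hE.mul (cut B hB h) (cut Bᶜ hB.compl h) ((supportedIn_cut B hB h).disjoint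
    (supportedIn_cut Bᶜ hB.compl h) disjoint_compl_right)
  rwa [cut_add_cut_compl] at this

theorem Represents.completeSpace {B : Set Z} (h : Represents m E B) :
    CompleteSpace (lpMeas ℂ ℂ m 2 P) :=
  (isClosed_lpMeas h.le).completeSpace_coe

end Represents

/-! ### Unitaries matching two exponential systems -/

section Intertwining

variable {Z Ω₁ Ω₂ : Type*} {m₁ a₁ b₁ : MeasurableSpace Ω₁} {m₂ a₂ b₂ : MeasurableSpace Ω₂}
  [MeasurableSpace Z] [MeasurableSpace Ω₁] [MeasurableSpace Ω₂]
  {μ : Measure Z} {P₁ : Measure Ω₁} {P₂ : Measure Ω₂}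
  {E₁ : Lp ℂ 2 μ → Lp ℂ 2 P₁} {E₂ : Lp ℂ 2 μ → Lp ℂ 2 P₂}

/-- `Φ` sends the exponential vectors of one system to those of the other one. -/
def Intertwines (E₁ : Lp ℂ 2 μ → Lp ℂ 2 P₁) (E₂ : Lp ℂ 2 μ → Lp ℂ 2 P₂)
    (Φ : L2 m₁ P₁ ≃ₗᵢ[ℂ] L2 m₂ P₂) : Prop :=
  ∀ (h : Lp ℂ 2 μ) (u : L2 m₁ P₁), u.1 = E₁ h → (Φ u).1 = E₂ h

theorem span_range_eq_top {E : Lp ℂ 2 μ → Lp ℂ 2 P₁} (r : Represents m₁ E Set.univ)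
    (e : Lp ℂ 2 μ → L2 m₁ P₁) (he : ∀ h, (e h).1 = E h) :
    (Submodule.span ℂ (Set.range e)).topologicalClosure = ⊤ := by
  rw [eq_top_iff]
  rintro x -
  have hcl : IsClosed (((Submodule.span ℂ (Set.range e)).topologicalClosure.map
      (lpMeas ℂ ℂ m₁ 2 P₁).subtype : Submodule ℂ (Lp ℂ 2 P₁)) : Set (Lp ℂ 2 P₁)) := by
    rw [Submodule.map_coe]
    exact ((isClosed_lpMeas r.le).isClosedEmbedding_subtypeVal).isClosedMap _
      (Submodule.isClosed_topologicalClosure _)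
  have h1 : expSpace E Set.univ ≤ (Submodule.span ℂ (Set.range e)).topologicalClosure.map
      (lpMeas ℂ ℂ m₁ 2 P₁).subtype := by
    refine expSpace_le hcl fun h _ => ⟨e h, ?_, he h⟩
    exact Submodule.le_topologicalClosure _ (Submodule.subset_span ⟨h, rfl⟩)
  obtain ⟨y, hy, hyx⟩ := h1 (r.mem_iff.1 x.2)
  exact (Subtype.ext hyx : y = x) ▸ hy

theorem exists_intertwines (hE₁ : IsExpSystem E₁) (hE₂ : IsExpSystem E₂)
    (r₁ : Represents m₁ E₁ Set.univ) (r₂ : Represents m₂ E₂ Set.univ) :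
    ∃ Φ : L2 m₁ P₁ ≃ₗᵢ[ℂ] L2 m₂ P₂, Intertwines E₁ E₂ Φ := by
  have := r₁.completeSpace
  have := r₂.completeSpace
  let e₁ : Lp ℂ 2 μ → L2 m₁ P₁ := fun h => ⟨E₁ h, r₁.mem_iff.2 (mem_expSpace E₁ (supportedIn_univ h))⟩
  let e₂ : Lp ℂ 2 μ → L2 m₂ P₂ := fun h => ⟨E₂ h, r₂.mem_iff.2 (mem_expSpace E₂ (supportedIn_univ h))⟩
  obtain ⟨Φ, hΦ⟩ := exists_linearIsometryEquiv_of_inner_eq e₁ e₂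
    (span_range_eq_top r₁ e₁ fun _ => rfl) (span_range_eq_top r₂ e₂ fun _ => rfl) (fun h g => by
      rw [Submodule.coe_inner, Submodule.coe_inner, hE₁.inner_eq, hE₂.inner_eq])
  refine ⟨Φ, fun h u hu => ?_⟩
  have : u = e₁ h := Subtype.ext hu
  rw [this, hΦ]

/-- The composition of `Φ` with the orthogonal projection to its domain. -/
def extendByZero (hm : m₁ ≤ ‹MeasurableSpace Ω₁›) (Φ : L2 m₁ P₁ ≃ₗᵢ[ℂ] L2 m₂ P₂) :
    Lp ℂ 2 P₁ →L[ℂ] Lp ℂ 2 P₂ :=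
  haveI : CompleteSpace (lpMeas ℂ ℂ m₁ 2 P₁) := (isClosed_lpMeas hm).completeSpace_coe
  (lpMeas ℂ ℂ m₂ 2 P₂).subtypeL ∘L (Φ.toContinuousLinearEquiv : L2 m₁ P₁ →L[ℂ] L2 m₂ P₂) ∘L
    (lpMeas ℂ ℂ m₁ 2 P₁).orthogonalProjectionOnto

theorem extendByZero_apply (hm : m₁ ≤ ‹MeasurableSpace Ω₁›) (Φ : L2 m₁ P₁ ≃ₗᵢ[ℂ] L2 m₂ P₂)
    (u : L2 m₁ P₁) : extendByZero hm Φ u.1 = (Φ u).1 := by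
  simp [extendByZero]

theorem inner_map_coe (Φ : L2 m₁ P₁ ≃ₗᵢ[ℂ] L2 m₂ P₂) (u v : L2 m₁ P₁) :
    ⟪(Φ u).1, (Φ v).1⟫_ℂ = ⟪u.1, v.1⟫_ℂ := by
  rw [← Submodule.coe_inner, Φ.inner_map_map, Submodule.coe_inner]

namespace Intertwines

variable {Φ : L2 m₁ P₁ ≃ₗᵢ[ℂ] L2 m₂ P₂}

theorem symm (hΦ : Intertwines E₁ E₂ Φ) (r₁ : Represents m₁ E₁ Set.univ) :
    Intertwines E₂ E₁ Φ.symm := by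
  intro h u hu
  have h1 := hΦ h ⟨E₁ h, r₁.mem_iff.2 (mem_expSpace E₁ (supportedIn_univ h))⟩ rfl
  rw [← hu] at h1
  rw [← Subtype.ext h1, Φ.symm_apply_apply]

theorem map_mem (hΦ : Intertwines E₁ E₂ Φ) (r₁ : Represents m₁ E₁ Set.univ) {B : Set Z}
    {u : L2 m₁ P₁} (hu : u.1 ∈ expSpace E₁ B) : (Φ u).1 ∈ expSpace E₂ B := by
  have h1 : expSpace E₁ B ≤ (expSpace E₂ B).comap (extendByZero r₁.le Φ).toLinearMap := by
    refine expSpace_le ((isClosed_expSpace E₂ B).preimage (extendByZero r₁.le Φ).continuous)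
      fun h hh => ?_
    have h2 := extendByZero_apply r₁.le Φ
      ⟨E₁ h, r₁.mem_iff.2 (mem_expSpace E₁ (supportedIn_univ h))⟩
    rw [hΦ h _ rfl] at h2
    change extendByZero r₁.le Φ (E₁ h) ∈ expSpace E₂ B
    rw [h2]
    exact mem_expSpace E₂ hh
  have h3 := h1 hu
  change extendByZero r₁.le Φ u.1 ∈ expSpace E₂ B at h3
  rwa [extendByZero_apply] at h3

theorem inner_exp (hΦ : Intertwines E₁ E₂ Φ) (r₁ : Represents m₁ E₁ Set.univ) (h : Lp ℂ 2 μ)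
    (u : L2 m₁ P₁) : ⟪E₂ h, (Φ u).1⟫_ℂ = ⟪E₁ h, u.1⟫_ℂ := by
  rw [← hΦ h ⟨E₁ h, r₁.mem_iff.2 (mem_expSpace E₁ (supportedIn_univ h))⟩ rfl, inner_map_coe]

theorem map_firstChaos (hΦ : Intertwines E₁ E₂ Φ) (hE₁ : IsExpSystem E₁) (hE₂ : IsExpSystem E₂)
    (r₁ : Represents m₁ E₁ Set.univ) {f : Lp ℂ 2 μ} {u : L2 m₁ P₁}
    (hu : u.1 = hE₁.firstChaos f) : (Φ u).1 = hE₂.firstChaos f := by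
  refine hE₂.eq_firstChaos (hΦ.map_mem r₁ (r₁.mem_iff.1 u.2)) fun h => ?_
  rw [hΦ.inner_exp r₁, hu, hE₁.inner_exp_firstChaos]

/-- Testing against `E₂ h`, the product of its parts over `B` and `Bᶜ`: by independence the inner
product with a product factors in both spaces, and `Φ` preserves each factor. -/
theorem map_mul [IsProbabilityMeasure P₁] [IsProbabilityMeasure P₂] (hΦ : Intertwines E₁ E₂ Φ)
    (hE₁ : IsExpSystem E₁) (hE₂ : IsExpSystem E₂)
    (r₁ : Represents m₁ E₁ Set.univ) (r₂ : Represents m₂ E₂ Set.univ) {B : Set Z}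
    (hB : MeasurableSet B) (ra₁ : Represents a₁ E₁ B) (rb₁ : Represents b₁ E₁ Bᶜ)
    (ra₂ : Represents a₂ E₂ B) (rb₂ : Represents b₂ E₂ Bᶜ) {f g u : L2 m₁ P₁}
    (hf : f.1 ∈ expSpace E₁ B) (hg : g.1 ∈ expSpace E₁ Bᶜ)
    (hu : u.1 =ᵐ[P₁] fun ω => f.1 ω * g.1 ω) :
    (Φ u).1 =ᵐ[P₂] fun ω => (Φ f).1 ω * (Φ g).1 ω := by
  have hd : Disjoint B Bᶜ := disjoint_compl_right
  obtain ⟨w, hw, hw'⟩ := hE₂.exists_mul ra₂ rb₂ hd r₂ (Set.subset_univ _)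
    (Set.subset_univ _) (hΦ.map_mem r₁ hf) (hΦ.map_mem r₁ hg)
  have h1 : (Φ u).1 = w := by
    refine eq_of_inner_exp_eq (E := E₂) (r₂.mem_iff.1 (Φ u).2) hw fun h _ => ?_
    rw [hΦ.inner_exp r₁,
      hE₁.inner_mul ra₁ rb₁ hd (mem_expSpace E₁ (supportedIn_cut B hB h)) hf
        (mem_expSpace E₁ (supportedIn_cut Bᶜ hB.compl h)) hg (hE₁.exp_ae_eq_cut_mul hB h) hu,
      hE₂.inner_mul ra₂ rb₂ hd (mem_expSpace E₂ (supportedIn_cut B hB h)) (hΦ.map_mem r₁ hf)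
        (mem_expSpace E₂ (supportedIn_cut Bᶜ hB.compl h)) (hΦ.map_mem r₁ hg)
        (hE₂.exp_ae_eq_cut_mul hB h) hw',
      hΦ.inner_exp r₁, hΦ.inner_exp r₁]
  rw [h1]
  exact hw'

theorem isUnityPreserving (hΦ : Intertwines E₁ E₂ Φ) (hE₁ : IsExpSystem E₁)
    (hE₂ : IsExpSystem E₂) : IsUnityPreserving Φ := by
  intro u hu
  rw [hΦ 0 u (Lp.ext ((show u.1 =ᵐ[P₁] fun _ => 1 from hu).trans hE₁.zero.symm))]
  exact hE₂.zero

/-- The restriction of `Φ` to the factor of `B`. -/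
theorem exists_restrict (hΦ : Intertwines E₁ E₂ Φ) (r₁ : Represents m₁ E₁ Set.univ) {B : Set Z}
    (ra₁ : Represents a₁ E₁ B) (ra₂ : Represents a₂ E₂ B) :
    ∃ R : L2 a₁ P₁ →L[ℂ] L2 a₂ P₂, ∀ (f : L2 a₁ P₁) (u : L2 m₁ P₁), u.1 = f.1 →
      (Φ u).1 = (R f).1 := by
  have hle : ∀ f : L2 a₁ P₁, f.1 ∈ lpMeas ℂ ℂ m₁ 2 P₁ := fun f =>
    r₁.mem_iff.2 (expSpace_mono E₁ (Set.subset_univ B) (ra₁.mem_iff.1 f.2))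
  refine ⟨(extendByZero r₁.le Φ ∘L (lpMeas ℂ ℂ a₁ 2 P₁).subtypeL).codRestrict
    (lpMeas ℂ ℂ a₂ 2 P₂) fun f => ?_, fun f u hu => ?_⟩
  · change extendByZero r₁.le Φ f.1 ∈ _
    rw [extendByZero_apply r₁.le Φ ⟨f.1, hle f⟩, ra₂.mem_iff]
    exact hΦ.map_mem r₁ (ra₁.mem_iff.1 f.2)
  · change (Φ u).1 = extendByZero r₁.le Φ f.1
    rw [← hu, extendByZero_apply]

/-- If `T = S ⊗ 1`, then `Φ T Φ⁻¹ = (R S R') ⊗ 1`, where `R` and `R'` are the restrictions of `Φ`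
and `Φ⁻¹` to the factors of `B`. This is multiplicativity of `Φ⁻¹` and `Φ`, used once each. -/
theorem conj_mem_tensorFactor [IsProbabilityMeasure P₁] [IsProbabilityMeasure P₂]
    (hΦ : Intertwines E₁ E₂ Φ)
    (hE₁ : IsExpSystem E₁) (hE₂ : IsExpSystem E₂)
    (r₁ : Represents m₁ E₁ Set.univ) (r₂ : Represents m₂ E₂ Set.univ) {B : Set Z}
    (hB : MeasurableSet B) (ra₁ : Represents a₁ E₁ B) (rb₁ : Represents b₁ E₁ Bᶜ)
    (ra₂ : Represents a₂ E₂ B) (rb₂ : Represents b₂ E₂ Bᶜ) {T : L2 m₁ P₁ →L[ℂ] L2 m₁ P₁}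
    (hT : T ∈ tensorFactor m₁ a₁ b₁ P₁) :
    (Φ.toContinuousLinearEquiv : L2 m₁ P₁ →L[ℂ] L2 m₂ P₂) ∘L T ∘L
      (Φ.symm.toContinuousLinearEquiv : L2 m₂ P₂ →L[ℂ] L2 m₁ P₁) ∈ tensorFactor m₂ a₂ b₂ P₂ := by
  obtain ⟨S, hS⟩ := hT
  have hΨ := hΦ.symm r₁
  obtain ⟨R, hR⟩ := hΦ.exists_restrict r₁ ra₁ ra₂
  obtain ⟨R', hR'⟩ := hΨ.exists_restrict r₂ ra₂ ra₁
  obtain ⟨Q', hQ'⟩ := hΨ.exists_restrict r₂ rb₂ rb₁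
  have hsub₁ : ∀ f : L2 a₁ P₁, f.1 ∈ lpMeas ℂ ℂ m₁ 2 P₁ := fun f =>
    r₁.mem_iff.2 (expSpace_mono E₁ (Set.subset_univ B) (ra₁.mem_iff.1 f.2))
  have hsub₂ : ∀ f : L2 a₂ P₂, f.1 ∈ lpMeas ℂ ℂ m₂ 2 P₂ := fun f =>
    r₂.mem_iff.2 (expSpace_mono E₂ (Set.subset_univ B) (ra₂.mem_iff.1 f.2))
  have hsubc₂ : ∀ f : L2 b₂ P₂, f.1 ∈ lpMeas ℂ ℂ m₂ 2 P₂ := fun f =>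
    r₂.mem_iff.2 (expSpace_mono E₂ (Set.subset_univ Bᶜ) (rb₂.mem_iff.1 f.2))
  refine ⟨R ∘L S ∘L R', fun f g u hu => ?_⟩
  let f' : L2 m₂ P₂ := ⟨f.1, hsub₂ f⟩
  let g' : L2 m₂ P₂ := ⟨g.1, hsubc₂ g⟩
  have h1 : (Φ.symm u).1 =ᵐ[P₁] fun ω => (Φ.symm f').1 ω * (Φ.symm g').1 ω :=
    hΨ.map_mul hE₂ hE₁ r₂ r₁ hB ra₂ rb₂ ra₁ rb₁ (ra₂.mem_iff.1 f.2) (rb₂.mem_iff.1 g.2) hu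
  have h2 := hS (R' f) (Q' g) (Φ.symm u) (by rw [← hR' f f' rfl, ← hQ' g g' rfl]; exact h1)
  rw [← hQ' g g' rfl] at h2
  have h3 := hΦ.map_mul hE₁ hE₂ r₁ r₂ hB ra₁ rb₁ ra₂ rb₂
    (f := ⟨(S (R' f)).1, hsub₁ _⟩) (g := Φ.symm g') (u := T (Φ.symm u))
    (ra₁.mem_iff.1 (S (R' f)).2) (hΨ.map_mem r₂ (rb₂.mem_iff.1 g.2)) h2
  rw [hR (S (R' f)) ⟨(S (R' f)).1, hsub₁ _⟩ rfl, Φ.apply_symm_apply] at h3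
  exact h3

theorem image_tensorFactor [IsProbabilityMeasure P₁] [IsProbabilityMeasure P₂]
    (hΦ : Intertwines E₁ E₂ Φ)
    (hE₁ : IsExpSystem E₁) (hE₂ : IsExpSystem E₂)
    (r₁ : Represents m₁ E₁ Set.univ) (r₂ : Represents m₂ E₂ Set.univ) {B : Set Z}
    (hB : MeasurableSet B) (ra₁ : Represents a₁ E₁ B) (rb₁ : Represents b₁ E₁ Bᶜ)
    (ra₂ : Represents a₂ E₂ B) (rb₂ : Represents b₂ E₂ Bᶜ) :
    (fun T : L2 m₁ P₁ →L[ℂ] L2 m₁ P₁ =>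
      (Φ.toContinuousLinearEquiv : L2 m₁ P₁ →L[ℂ] L2 m₂ P₂) ∘L T ∘L
        (Φ.symm.toContinuousLinearEquiv : L2 m₂ P₂ →L[ℂ] L2 m₁ P₁)) '' tensorFactor m₁ a₁ b₁ P₁ =
      tensorFactor m₂ a₂ b₂ P₂ := by
  refine Set.Subset.antisymm ?_ fun T hT => ?_
  · rintro _ ⟨T, hT, rfl⟩
    exact hΦ.conj_mem_tensorFactor hE₁ hE₂ r₁ r₂ hB ra₁ rb₁ ra₂ rb₂ hT
  · refine ⟨_, (hΦ.symm r₁).conj_mem_tensorFactor hE₂ hE₁ r₂ r₁ hB ra₂ rb₂ ra₁ rb₁ hT, ?_⟩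
    ext u
    simp

theorem star_lpMeas {u : Lp ℂ 2 P₁} (hu : u ∈ lpMeas ℂ ℂ m₁ 2 P₁) :
    star u ∈ lpMeas ℂ ℂ m₁ 2 P₁ := by
  rw [mem_lpMeas_iff_aestronglyMeasurable] at *
  exact (Complex.continuous_conj.comp_aestronglyMeasurable hu).congr (Lp.coeFn_star u).symm

theorem star_eq_self_iff {u : Lp ℂ 2 P₁} : star u = u ↔ ∀ᵐ ω ∂P₁, (u ω).im = 0 := by
  constructor
  · intro h
    have h1 := Lp.coeFn_star u
    rw [h] at h1
    filter_upwards [h1] with ω h2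
    exact Complex.conj_eq_iff_im.1 h2.symm
  · intro h
    refine Lp.ext ?_
    filter_upwards [Lp.coeFn_star u, h] with ω h1 h2
    rw [h1]
    exact Complex.conj_eq_iff_im.2 h2

theorem inner_star_star (u v : Lp ℂ 2 P₁) : ⟪star u, star v⟫_ℂ = (starRingEnd ℂ) ⟪u, v⟫_ℂ := by
  rw [L2.inner_def, L2.inner_def, ← integral_conj]
  refine integral_congr_ae ?_
  filter_upwards [Lp.coeFn_star u, Lp.coeFn_star v] with ω h1 h2
  rw [h1, h2]
  simp

/-- Conjugation preserves both exponential systems, so the inner products of both sides with every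
`E₂ h` agree. -/
theorem map_star (hΦ : Intertwines E₁ E₂ Φ) (hE₁ : IsExpSystem E₁) (hE₂ : IsExpSystem E₂)
    (r₁ : Represents m₁ E₁ Set.univ) (r₂ : Represents m₂ E₂ Set.univ) (u : L2 m₁ P₁) :
    (Φ ⟨star u.1, star_lpMeas u.2⟩).1 = star (Φ u).1 := by
  refine eq_of_inner_exp_eq (E := E₂) (r₂.mem_iff.1 (Φ _).2)
    (r₂.mem_iff.1 (star_lpMeas (Φ u).2)) fun h _ => ?_
  rw [hΦ.inner_exp r₁, ← star_star h, hE₁.star_eq, hE₂.star_eq, inner_star_star, inner_star_star,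
    hΦ.inner_exp r₁]

theorem isReal (hΦ : Intertwines E₁ E₂ Φ) (hE₁ : IsExpSystem E₁) (hE₂ : IsExpSystem E₂)
    (r₁ : Represents m₁ E₁ Set.univ) (r₂ : Represents m₂ E₂ Set.univ) : IsReal Φ := by
  intro u
  rw [← star_eq_self_iff, ← star_eq_self_iff, ← hΦ.map_star hE₁ hE₂ r₁ r₂]
  rw [SetLike.coe_eq_coe, Φ.injective.eq_iff]
  exact ⟨fun h => Subtype.ext h, fun h => congrArg Subtype.val h⟩

end Intertwines

end Intertwining


/-! ### Rank-one operators and the multiplicativity of special isomorphisms -/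

section Special

variable {Z Ω : Type*} {m a b : MeasurableSpace Ω}
  [MeasurableSpace Z] [mΩ : MeasurableSpace Ω] {μ : Measure Z} {P : Measure Ω}
  {E : Lp ℂ 2 μ → Lp ℂ 2 P}

/-- The operator `|f⟩⟨1| ⊗ 1` belongs to the factor of `B` if `f` is measurable over `B`. -/
theorem exists_rankOne_mem_tensorFactor [IsProbabilityMeasure P] (hE : IsExpSystem E)
    (r : Represents m E Set.univ) {B : Set Z} (ra : Represents a E B) (rb : Represents b E Bᶜ)
    {f : Lp ℂ 2 P} (hf : f ∈ expSpace E B) :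
    ∃ T ∈ tensorFactor m a b P, ∀ g : L2 m P, g.1 ∈ expSpace E Bᶜ →
      (T g).1 =ᵐ[P] fun ω => f ω * g.1 ω := by
  have hd : Disjoint B Bᶜ := disjoint_compl_right
  have := rb.completeSpace
  choose M hMm hM using fun g : L2 b P => hE.exists_mul ra rb hd r (Set.subset_univ B)
    (Set.subset_univ Bᶜ) hf (rb.mem_iff.1 g.2)
  let L : L2 b P →ₗ[ℂ] L2 m P :=
    { toFun := fun g => ⟨M g, r.mem_iff.2 (hMm g)⟩
      map_add' := fun g g' => by
        refine Subtype.ext (Lp.ext ?_)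
        filter_upwards [hM g, hM g', hM (g + g'), Lp.coeFn_add (M g) (M g'),
          Lp.coeFn_add g.1 g'.1] with ω h1 h2 h3 h4 h5
        simp only [Submodule.coe_add] at *
        rw [h3, h4, Pi.add_apply, h1, h2, h5, Pi.add_apply]
        ring
      map_smul' := fun c g => by
        refine Subtype.ext (Lp.ext ?_)
        filter_upwards [hM g, hM (c • g), Lp.coeFn_smul c (M g), Lp.coeFn_smul c g.1]
          with ω h1 h2 h3 h4
        simp only [Submodule.coe_smul, RingHom.id_apply] at *
        rw [h2, h3, Pi.smul_apply, h1, h4, Pi.smul_apply]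
        simp only [smul_eq_mul]
        ring }
  have hL : ∀ g, ‖L g‖ ≤ ‖f‖ * ‖g‖ := by
    intro g
    have h1 := hE.inner_mul ra rb hd hf hf (rb.mem_iff.1 g.2) (rb.mem_iff.1 g.2) (hM g) (hM g)
    simp only [inner_self_eq_norm_sq_to_K] at h1
    have h2 : ‖M g‖ ^ 2 = (‖f‖ * ‖g.1‖) ^ 2 := by
      rw [mul_pow]
      exact_mod_cast h1
    exact ((pow_left_inj₀ (norm_nonneg _) (by positivity) two_ne_zero).1 h2).le
  -- The operator `|f⟩⟨1|` on the factor of `B`. The operator `|f⟩⟨1| ⊗ 1` on the whole space is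
  -- realized as the projection `Q` onto the functionals over `Bᶜ`, followed by multiplication by
  -- `f`.
  let S : L2 a P →L[ℂ] L2 a P :=
    (innerSL ℂ (E 0) ∘L (lpMeas ℂ ℂ a 2 P).subtypeL).smulRight ⟨f, ra.mem_iff.2 hf⟩
  let Q : L2 m P →L[ℂ] L2 b P :=
    (lpMeas ℂ ℂ b 2 P).orthogonalProjectionOnto ∘L (lpMeas ℂ ℂ m 2 P).subtypeL
  have hT : ∀ g : L2 b P, ∀ u : L2 m P, Q u = g →
      ((L.mkContinuous ‖f‖ hL ∘L Q) u).1 =ᵐ[P] fun ω => f ω * g.1 ω := by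
    intro g u hu
    have : (L.mkContinuous ‖f‖ hL ∘L Q) u = L g := by
      rw [ContinuousLinearMap.comp_apply, hu]
      rfl
    rw [this]
    exact hM g
  refine ⟨L.mkContinuous ‖f‖ hL ∘L Q, ⟨S, fun f' g u hu => ?_⟩, fun g hg => ?_⟩
  -- By independence the conditional expectation of `f' g` given the σ-field `b` of `Bᶜ` is the mean
  -- of `f'` times `g`. The test vector `w` is written as `1 · w` to apply the product formula.
  · have h1 : Q u = ⟪E 0, f'.1⟫_ℂ • g := by
      refine Subtype.ext ?_
      change (lpMeas ℂ ℂ b 2 P).starProjection u.1 = _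
      refine Submodule.eq_starProjection_of_mem_of_inner_eq_zero
        (Submodule.smul_mem _ _ g.2) fun w hw => ?_
      have h0 : w =ᵐ[P] fun ω => E 0 ω * w ω := by
        filter_upwards [hE.zero] with ω h
        rw [h, one_mul]
      rw [inner_sub_left, hE.inner_mul ra rb hd (ra.mem_iff.1 f'.2)
        (mem_expSpace E (supportedIn_zero B)) (rb.mem_iff.1 g.2) (rb.mem_iff.1 hw) hu h0,
        Submodule.coe_smul, inner_smul_left, inner_conj_symm, sub_self]
    filter_upwards [hT _ u h1, Lp.coeFn_smul ⟪E 0, f'.1⟫_ℂ g.1,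
      Lp.coeFn_smul ⟪E 0, f'.1⟫_ℂ f] with ω h2 h3 h4
    rw [h2]
    change f ω * (⟪E 0, f'.1⟫_ℂ • g.1 : Lp ℂ 2 P) ω = (⟪E 0, f'.1⟫_ℂ • f : Lp ℂ 2 P) ω * g.1 ω
    rw [h3, h4, Pi.smul_apply, Pi.smul_apply, smul_eq_mul, smul_eq_mul]
    ring
  · refine hT ⟨g.1, rb.mem_iff.2 hg⟩ g ?_
    exact (lpMeas ℂ ℂ b 2 P).orthogonalProjectionOnto_mem_subspace_eq_self ⟨g.1, rb.mem_iff.2 hg⟩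

end Special

section SpecialMap

variable {Z Ω₁ Ω₂ : Type*} {m₁ a₁ b₁ : MeasurableSpace Ω₁} {m₂ a₂ b₂ : MeasurableSpace Ω₂}
  [MeasurableSpace Z] [MeasurableSpace Ω₁] [MeasurableSpace Ω₂]
  {μ : Measure Z} {P₁ : Measure Ω₁} {P₂ : Measure Ω₂}
  {E₁ : Lp ℂ 2 μ → Lp ℂ 2 P₁} {E₂ : Lp ℂ 2 μ → Lp ℂ 2 P₂}

/-- Conjugation by `Ψ` maps one set of operators into another one. -/
def ConjMapsTo (Ψ : L2 m₁ P₁ ≃ₗᵢ[ℂ] L2 m₂ P₂) (ξ₁ : Set (L2 m₁ P₁ →L[ℂ] L2 m₁ P₁))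
    (ξ₂ : Set (L2 m₂ P₂ →L[ℂ] L2 m₂ P₂)) : Prop :=
  ∀ T ∈ ξ₁, (Ψ.toContinuousLinearEquiv : L2 m₁ P₁ →L[ℂ] L2 m₂ P₂) ∘L T ∘L
    (Ψ.symm.toContinuousLinearEquiv : L2 m₂ P₂ →L[ℂ] L2 m₁ P₁) ∈ ξ₂

/-- A unity-preserving special isomorphism respects subspaces over `B` and products. -/
theorem special_map_mul [IsProbabilityMeasure P₁] (hE₁ : IsExpSystem E₁) (hE₂ : IsExpSystem E₂)
    (r₁ : Represents m₁ E₁ Set.univ) (r₂ : Represents m₂ E₂ Set.univ) {B : Set Z}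
    (ra₁ : Represents a₁ E₁ B) (rb₁ : Represents b₁ E₁ Bᶜ)
    (ra₂ : Represents a₂ E₂ B) (rb₂ : Represents b₂ E₂ Bᶜ) {Ψ : L2 m₁ P₁ ≃ₗᵢ[ℂ] L2 m₂ P₂}
    (hu : IsUnityPreserving Ψ)
    (hΨ : ConjMapsTo Ψ (tensorFactor m₁ a₁ b₁ P₁) (tensorFactor m₂ a₂ b₂ P₂))
    {f : L2 m₁ P₁} (hf : f.1 ∈ expSpace E₁ B) :
    (Ψ f).1 ∈ expSpace E₂ B ∧ ∀ g u : L2 m₁ P₁, g.1 ∈ expSpace E₁ Bᶜ →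
      (Ψ g).1 ∈ expSpace E₂ Bᶜ → (u.1 =ᵐ[P₁] fun ω => f.1 ω * g.1 ω) →
      (Ψ u).1 =ᵐ[P₂] fun ω => (Ψ f).1 ω * (Ψ g).1 ω := by
  -- `T = |f⟩⟨1| ⊗ 1` sends `1` to `f` and `g` to `f g`. Its conjugate has the form `S ⊗ 1`, sending
  -- `1` to `S 1` and `Ψ g` to `S 1 · Ψ g`. Hence `Ψ f = S 1` lies over `B`, and `Ψ (f g) = Ψ f · Ψ
  -- g`.
  obtain ⟨T, hT, hTg⟩ := exists_rankOne_mem_tensorFactor hE₁ r₁ ra₁ rb₁ hf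
  obtain ⟨S, hS⟩ := hΨ T hT
  let e₁ : L2 m₁ P₁ := ⟨E₁ 0, r₁.mem_iff.2 (mem_expSpace E₁ (supportedIn_zero _))⟩
  let eB : L2 a₂ P₂ := ⟨E₂ 0, ra₂.mem_iff.2 (mem_expSpace E₂ (supportedIn_zero _))⟩
  let eC : L2 b₂ P₂ := ⟨E₂ 0, rb₂.mem_iff.2 (mem_expSpace E₂ (supportedIn_zero _))⟩
  have hΨe : (Ψ e₁).1 =ᵐ[P₂] fun _ => 1 := hu e₁ hE₁.zero
  have hTe : T e₁ = f := by
    refine Subtype.ext (Lp.ext ?_)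
    filter_upwards [hTg e₁ (mem_expSpace E₁ (supportedIn_zero _)), hE₁.zero] with ω h1 h2
    rw [h1]
    change f.1 ω * E₁ 0 ω = f.1 ω
    rw [h2, mul_one]
  have hSe : (Ψ f).1 =ᵐ[P₂] (S eB).1 := by
    have h1 := hS eB eC (Ψ e₁) (by
      filter_upwards [hΨe, hE₂.zero] with ω h1 h2
      change _ = E₂ 0 ω * E₂ 0 ω
      rw [h1, h2, one_mul])
    filter_upwards [h1, hE₂.zero] with ω h2 h3
    simp only [ContinuousLinearMap.comp_apply, ContinuousLinearEquiv.coe_coe,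
      LinearIsometryEquiv.coe_toContinuousLinearEquiv, LinearIsometryEquiv.symm_apply_apply,
      hTe] at h2
    rw [h2]
    change (S eB).1 ω * E₂ 0 ω = _
    rw [h3, mul_one]
  refine ⟨?_, fun g u hg hΨg hug => ?_⟩
  · rw [Lp.ext hSe]
    exact ra₂.mem_iff.1 (S eB).2
  · have h1 := hS eB ⟨(Ψ g).1, rb₂.mem_iff.2 hΨg⟩ (Ψ g) (by
      filter_upwards [hE₂.zero] with ω h2
      change _ = E₂ 0 ω * _
      rw [h2, one_mul])
    have h3 : T g = u := Subtype.ext (Lp.ext ((hTg g hg).trans hug.symm))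
    filter_upwards [h1, hSe] with ω h2 h4
    simp only [ContinuousLinearMap.comp_apply, ContinuousLinearEquiv.coe_coe,
      LinearIsometryEquiv.coe_toContinuousLinearEquiv, LinearIsometryEquiv.symm_apply_apply,
      h3] at h2
    rw [h2, h4]

end SpecialMap

/-! ### Partitions of an atomless space -/

section Partition

variable {X : Type*} [MeasurableSpace X] [MeasurableSpace.CountablyGenerated X]

/-- The map whose fibres are the cells of the `n`-th partition. -/
def cellIndex (X : Type*) [MeasurableSpace X] [MeasurableSpace.CountablyGenerated X] (n : ℕ)
    (x : X) : Fin n → Bool := fun k => MeasurableSpace.mapNatBool X x k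

theorem measurable_cellIndex (n : ℕ) : Measurable (cellIndex X n) :=
  measurable_pi_lambda _ fun k => (measurable_pi_apply (k : ℕ)).comp
    (MeasurableSpace.measurable_mapNatBool X)

/-- The sum is the integral over `x` of the mass of the cell containing `x`. These cells decrease to
`{x}`, as the generating sets separate points, and `{x}` has mass `0`; dominated convergence
finishes. -/
theorem tendsto_sum_sq_cells [MeasurableSpace.SeparatesPoints X] (ρ : Measure X)
    [IsFiniteMeasure ρ] (hρ : ∀ x, ρ {x} = 0) :
    Tendsto (fun n => ∑ b : Fin n → Bool, ρ.real (cellIndex X n ⁻¹' {b}) ^ 2) atTop (𝓝 0) := by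
  have hm : ∀ (n : ℕ) (b : Fin n → Bool), MeasurableSet (cellIndex X n ⁻¹' {b}) :=
    fun n b => measurable_cellIndex n (measurableSet_singleton b)
  have h1 : ∀ n, ∑ b : Fin n → Bool, ρ.real (cellIndex X n ⁻¹' {b}) ^ 2 =
      ∫ x, ρ.real (cellIndex X n ⁻¹' {cellIndex X n x}) ∂ρ := by
    intro n
    have h2 : ∀ x, ρ.real (cellIndex X n ⁻¹' {cellIndex X n x}) =
        ∑ b : Fin n → Bool, (cellIndex X n ⁻¹' {b}).indicator
          (fun _ => ρ.real (cellIndex X n ⁻¹' {b})) x := by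
      intro x
      rw [Finset.sum_eq_single (cellIndex X n x)]
      · simp
      · intro b _ hb
        rw [Set.indicator_of_notMem]
        simpa using fun h => hb h.symm
      · simp
    simp only [h2]
    rw [integral_finsetSum]
    · refine Finset.sum_congr rfl fun b _ => ?_
      rw [integral_indicator_const _ (hm n b), smul_eq_mul, sq]
    · intro b _
      exact (integrable_const _).indicator (hm n b)
  simp only [h1]
  have h3 : (0 : ℝ) = ∫ _ : X, (0 : ℝ) ∂ρ := by simp
  rw [h3]
  refine tendsto_integral_of_dominated_convergence (fun _ => ρ.real Set.univ) (fun n => ?_)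
    (integrable_const _) (fun n => ae_of_all _ fun x => ?_) (ae_of_all _ fun x => ?_)
  · exact ((measurable_of_finite fun b : Fin n → Bool => ρ.real (cellIndex X n ⁻¹' {b})).comp
      (measurable_cellIndex n)).aestronglyMeasurable
  · rw [Real.norm_of_nonneg measureReal_nonneg]
    exact measureReal_mono (Set.subset_univ _)
  · have h4 : Tendsto (fun n => ρ (cellIndex X n ⁻¹' {cellIndex X n x})) atTop
        (𝓝 (ρ (⋂ n, cellIndex X n ⁻¹' {cellIndex X n x}))) := by
      refine tendsto_measure_iInter_atTop (fun n => (hm n _).nullMeasurableSet) ?_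
        ⟨0, measure_ne_top _ _⟩
      intro n k hnk y hy
      simp only [Set.mem_preimage, Set.mem_singleton_iff] at hy ⊢
      ext i
      exact congrFun hy ⟨i, i.2.trans_le hnk⟩
    have h5 : ⋂ n, cellIndex X n ⁻¹' {cellIndex X n x} = {x} := by
      ext y
      simp only [Set.mem_iInter, Set.mem_preimage, Set.mem_singleton_iff]
      refine ⟨fun h => ?_, fun h n => by rw [h]⟩
      refine MeasurableSpace.injective_mapNatBool X (funext fun k => ?_)
      -- The `k`-th coordinate is first visible in the partition of level `k + 1`.
      exact congrFun (h (k + 1)) ⟨k, Nat.lt_succ_self k⟩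
    rw [h5, hρ] at h4
    exact (ENNReal.tendsto_toReal ENNReal.zero_ne_top).comp h4

end Partition


/-! ### Sums and products over fine partitions -/

theorem exp_sub_one_sub_le {r : ℝ} (hr : 0 ≤ r) : Real.exp r - 1 - r ≤ r ^ 2 * Real.exp r := by
  have h1 : Real.exp r * (1 - r) ≤ 1 := by
    have h2 := Real.add_one_le_exp (-r)
    have h3 : Real.exp r * Real.exp (-r) = 1 := by rw [← Real.exp_add]; simp
    nlinarith [Real.exp_pos r]
  have h4 := Real.add_one_le_exp r
  nlinarith [Real.exp_pos r, mul_nonneg hr hr]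

/-- Multiplied over the cells, it bounds `∏ (1 + r)` below by `exp (∑ r - ∑ r²)`, where `∑ r²` tends
to `0` over fine partitions. -/
theorem exp_sub_sq_le_one_add {r : ℝ} (hr : 0 ≤ r) : Real.exp (r - r ^ 2) ≤ 1 + r := by
  have h1 := Real.le_log_one_add_of_nonneg hr
  have h2 : r - r ^ 2 ≤ 2 * r / (r + 2) := by
    rw [le_div_iff₀ (by positivity)]
    nlinarith [mul_nonneg hr hr, mul_nonneg (mul_nonneg hr hr) hr]
  calc Real.exp (r - r ^ 2) ≤ Real.exp (Real.log (1 + r)) := Real.exp_le_exp.2 (h2.trans h1)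
    _ = 1 + r := Real.exp_log (by positivity)

theorem inner_self_eq_ofReal {K : Type*} [NormedAddCommGroup K] [InnerProductSpace ℂ K] (x : K) :
    ⟪x, x⟫_ℂ = ((‖x‖ ^ 2 : ℝ) : ℂ) := by
  rw [inner_self_eq_norm_sq_to_K]
  norm_cast

section Cells

variable {X Y Ω : Type*} [MeasurableSpace X] [MeasurableSpace.CountablyGenerated X]
  [MeasurableSpace Y] [MeasurableSpace Ω]
  {μ : Measure (X × Y)} {P : Measure Ω}

/-- The union of the sets over the cells with index in `s`. -/
def cells (X Y : Type*) [MeasurableSpace X] [MeasurableSpace.CountablyGenerated X] (n : ℕ)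
    (s : Set (Fin n → Bool)) : Set (X × Y) := (fun z : X × Y => cellIndex X n z.1) ⁻¹' s

theorem measurableSet_cells (n : ℕ) (s : Set (Fin n → Bool)) :
    MeasurableSet (cells X Y n s) :=
  (measurable_cellIndex n).comp measurable_fst s.toFinite.measurableSet

/-- The restriction of `h` to the cells with index in `s`. -/
def cellCut (n : ℕ) (s : Set (Fin n → Bool)) (h : Lp ℂ 2 μ) : Lp ℂ 2 μ :=
  cut (cells X Y n s) (measurableSet_cells n s) h

theorem supportedIn_cellCut (n : ℕ) (s : Set (Fin n → Bool)) (h : Lp ℂ 2 μ) :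
    SupportedIn (cellCut n s h) (cells X Y n s) := supportedIn_cut _ _ h

theorem disjoint_cells (n : ℕ) {s t : Set (Fin n → Bool)} (h : Disjoint s t) :
    Disjoint (cells X Y n s) (cells X Y n t) := Disjoint.preimage _ h

theorem inner_cellCut_of_disjoint (n : ℕ) {s t : Set (Fin n → Bool)} (hst : Disjoint s t)
    (h : Lp ℂ 2 μ) : ⟪cellCut n s h, cellCut n t h⟫_ℂ = 0 :=
  inner_eq_zero_of_disjoint ((supportedIn_cellCut n s h).disjoint (supportedIn_cellCut n t h)
    (disjoint_cells n hst))

theorem cellCut_insert (n : ℕ) {s : Set (Fin n → Bool)} {b : Fin n → Bool} (hb : b ∉ s)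
    (h : Lp ℂ 2 μ) : cellCut n (insert b s) h = cellCut n {b} h + cellCut n s h := by
  refine Lp.ext ?_
  filter_upwards [coeFn_cut _ (measurableSet_cells n (insert b s)) h,
    coeFn_cut _ (measurableSet_cells n {b}) h, coeFn_cut _ (measurableSet_cells n s) h,
    Lp.coeFn_add (cellCut n {b} h) (cellCut n s h)] with z h1 h2 h3 h4
  rw [h4, Pi.add_apply]
  refine h1.trans ?_
  refine Eq.trans ?_ (congrArg₂ (· + ·) h2.symm h3.symm)
  by_cases hz : cellIndex X n z.1 = b
  · simp [Set.indicator, cells, hz, hb]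
  · have h5 : z ∈ cells X Y n (insert b s) ↔ z ∈ cells X Y n s := by simp [cells, hz]
    have h6 : z ∉ cells X Y n {b} := by simp [cells, hz]
    by_cases h7 : z ∈ cells X Y n s
    · simp [h5.2 h7, h6, h7]
    · simp [mt h5.1 h7, h6, h7]

theorem cellCut_univ (n : ℕ) (h : Lp ℂ 2 μ) : cellCut n Set.univ h = h :=
  cut_eq_self _ (supportedIn_univ h)

theorem cellCut_empty (n : ℕ) (h : Lp ℂ 2 μ) : cellCut n ∅ h = 0 := by
  refine Lp.ext ?_
  filter_upwards [coeFn_cut _ (measurableSet_cells n ∅) h, Lp.coeFn_zero ℂ 2 μ] with z h1 h2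
  rw [h2]
  exact h1.trans (by simp [cells])

theorem cellCut_finset (n : ℕ) (s : Finset (Fin n → Bool)) (h : Lp ℂ 2 μ) :
    cellCut n (s : Set (Fin n → Bool)) h = ∑ b ∈ s, cellCut n {b} h := by
  classical
  induction s using Finset.induction_on with
  | empty => simp [cellCut_empty]
  | insert b s hb ih =>
    rw [Finset.coe_insert, cellCut_insert n (by simpa using hb), ih, Finset.sum_insert hb]

theorem sum_cellCut (n : ℕ) (h : Lp ℂ 2 μ) : ∑ b, cellCut n {b} h = h := by
  rw [← cellCut_finset, Finset.coe_univ, cellCut_univ]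

theorem inner_cellCut_self (n : ℕ) (s : Set (Fin n → Bool)) (h : Lp ℂ 2 μ) :
    ⟪cellCut n s h, cellCut n s h⟫_ℂ = ((‖cellCut n s h‖ ^ 2 : ℝ) : ℂ) :=
  inner_self_eq_ofReal _

theorem inner_cellCut_singleton (n : ℕ) (b b' : Fin n → Bool) (h : Lp ℂ 2 μ) :
    ⟪cellCut n {b} h, cellCut n {b'} h⟫_ℂ =
      if b = b' then ((‖cellCut n {b} h‖ ^ 2 : ℝ) : ℂ) else 0 := by
  split_ifs with hbb
  · rw [← hbb, inner_cellCut_self]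
  · exact inner_cellCut_of_disjoint n (by simpa using hbb) h

theorem sum_norm_sq_cellCut (n : ℕ) (h : Lp ℂ 2 μ) :
    ∑ b, ‖cellCut n {b} h‖ ^ 2 = ‖h‖ ^ 2 := by
  have h1 : ⟪h, h⟫_ℂ = ∑ b, ((‖cellCut n {b} h‖ ^ 2 : ℝ) : ℂ) := by
    conv_lhs => rw [← sum_cellCut n h]
    simp only [sum_inner, inner_sum, inner_cellCut_singleton]
    simp
  rw [inner_self_eq_ofReal] at h1
  exact_mod_cast h1.symm

theorem norm_sq_cellCut_le (n : ℕ) (b : Fin n → Bool) (h : Lp ℂ 2 μ) :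
    ‖cellCut n {b} h‖ ^ 2 ≤ ‖h‖ ^ 2 := by
  rw [← sum_norm_sq_cellCut n h]
  exact Finset.single_le_sum (f := fun b => ‖cellCut n {b} h‖ ^ 2) (fun _ _ => by positivity)
    (Finset.mem_univ b)

/-- The number `‖1_C h‖²` is the mass of `C` under the projection to `X` of the measure `|h|² μ`.
This projection is finite and has no atoms, since the fibres over points are null. -/
theorem tendsto_sum_norm_pow_four_cellCut [MeasurableSpace.SeparatesPoints X]
    (hμ : ∀ x : X, μ (Prod.fst ⁻¹' {x}) = 0) (h : Lp ℂ 2 μ) :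
    Tendsto (fun n => ∑ b, (‖cellCut n {b} h‖ ^ 2) ^ 2) atTop (𝓝 0) := by
  have := MeasurableSpace.measurableSingletonClass_of_countablySeparated (α := X)
  let ρ : Measure X := (μ.withDensity fun z => ‖h z‖ₑ ^ 2).map Prod.fst
  have hfin : ∫⁻ z, ‖h z‖ₑ ^ 2 ∂μ ≠ ∞ := by
    have := (Lp.memLp h).eLpNorm_lt_top
    rw [eLpNorm_lt_top_iff_lintegral_rpow_enorm_lt_top two_ne_zero ENNReal.ofNat_ne_top] at this
    simpa using this.ne
  have : IsFiniteMeasure (μ.withDensity fun z => ‖h z‖ₑ ^ 2) := isFiniteMeasure_withDensity hfin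
  have hc : ∀ n b, ρ.real (cellIndex X n ⁻¹' {b}) = ‖cellCut n {b} h‖ ^ 2 := by
    intro n b
    have h1 : ρ (cellIndex X n ⁻¹' {b}) = ∫⁻ z in cells X Y n {b}, ‖h z‖ₑ ^ 2 ∂μ := by
      rw [Measure.map_apply measurable_fst (measurable_cellIndex n (measurableSet_singleton b)),
        withDensity_apply _ (measurable_fst
          (measurable_cellIndex n (measurableSet_singleton b)))]
      rfl
    have h2 : ((‖cellCut n {b} h‖ₑ) ^ 2) = ∫⁻ z in cells X Y n {b}, ‖h z‖ₑ ^ 2 ∂μ := by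
      rw [cellCut, Lp.enorm_def, eLpNorm_congr_ae (coeFn_cut _ (measurableSet_cells n {b}) h),
        eLpNorm_indicator_eq_eLpNorm_restrict (measurableSet_cells n {b}),
        eLpNorm_eq_lintegral_rpow_enorm_toReal two_ne_zero ENNReal.ofNat_ne_top,
        ← ENNReal.rpow_natCast, ← ENNReal.rpow_mul]
      simp [cells]
    rw [measureReal_def, h1, ← h2, ENNReal.toReal_pow, toReal_enorm]
  have h3 := tendsto_sum_sq_cells ρ (fun x => by
    have hx : MeasurableSet ({x} : Set X) := measurableSet_singleton x
    rw [Measure.map_apply measurable_fst hx]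
    exact withDensity_absolutelyContinuous _ _ (hμ x))
  simpa only [hc] using h3

variable {E : Lp ℂ 2 μ → Lp ℂ 2 P} (hE : IsExpSystem E)
include hE

/-- Removing the vacuum and the first chaos from the exponential vectors removes the two lowest
terms of the exponential series, so the kernel left over is of second order. -/
theorem IsExpSystem.inner_remainder (h g : Lp ℂ 2 μ) :
    ⟪E h - E 0 - hE.firstChaos h, E g - E 0 - hE.firstChaos g⟫_ℂ =
      Complex.exp ⟪h, g⟫_ℂ - 1 - ⟪h, g⟫_ℂ := by
  simp only [inner_sub_left, inner_sub_right, hE.inner_eq, hE.inner_exp_firstChaos,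
    hE.inner_firstChaos_exp, LinearIsometry.inner_map_map, inner_zero_left, inner_zero_right,
    Complex.exp_zero]
  ring

/-- The first chaos as a limit of sums of exponential vectors over fine partitions. -/
theorem IsExpSystem.tendsto_sum_exp_cellCut [MeasurableSpace.SeparatesPoints X]
    (hμ : ∀ x : X, μ (Prod.fst ⁻¹' {x}) = 0) (h : Lp ℂ 2 μ) :
    Tendsto (fun n => ∑ b, (E (cellCut n {b} h) - E 0)) atTop (𝓝 (hE.firstChaos h)) := by
  rw [tendsto_iff_norm_sub_tendsto_zero]
  have h1 : ∀ n, ‖∑ b, (E (cellCut n {b} h) - E 0) - hE.firstChaos h‖ ^ 2 =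
      ∑ b, (Real.exp (‖cellCut n {b} h‖ ^ 2) - 1 - ‖cellCut n {b} h‖ ^ 2) := by
    intro n
    -- The first chaos is additive over the cells, so the error is the sum of the cell remainders.
    -- These are mutually orthogonal, since the remainder kernel vanishes at `0`; the squared errors
    -- add up.
    have h2 : ∑ b, (E (cellCut n {b} h) - E 0) - hE.firstChaos h =
        ∑ b, (E (cellCut n {b} h) - E 0 - hE.firstChaos (cellCut n {b} h)) := by
      conv_lhs => rw [← sum_cellCut n h, map_sum, sum_cellCut n h]
      rw [← Finset.sum_sub_distrib]
    have h3 : ⟪∑ b, (E (cellCut n {b} h) - E 0) - hE.firstChaos h,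
        ∑ b, (E (cellCut n {b} h) - E 0) - hE.firstChaos h⟫_ℂ =
        ((∑ b, (Real.exp (‖cellCut n {b} h‖ ^ 2) - 1 - ‖cellCut n {b} h‖ ^ 2) : ℝ) : ℂ) := by
      rw [h2]
      simp only [sum_inner, inner_sum, hE.inner_remainder, inner_cellCut_singleton]
      push_cast
      refine Finset.sum_congr rfl fun b _ => ?_
      rw [Finset.sum_eq_single b]
      · simp
      · intro b' _ hb'
        simp [hb']
      · simp
    rw [inner_self_eq_ofReal] at h3
    exact Complex.ofReal_injective h3
  have h4 : Tendsto (fun n => ‖∑ b, (E (cellCut n {b} h) - E 0) - hE.firstChaos h‖ ^ 2) atTop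
      (𝓝 0) := by
    have h5 := (tendsto_sum_norm_pow_four_cellCut hμ h).mul_const (Real.exp (‖h‖ ^ 2))
    rw [zero_mul] at h5
    refine squeeze_zero (fun _ => by positivity) (fun n => ?_) h5
    rw [h1, Finset.sum_mul]
    refine Finset.sum_le_sum fun b _ => (exp_sub_one_sub_le (by positivity)).trans ?_
    exact mul_le_mul_of_nonneg_left (Real.exp_le_exp.2 (norm_sq_cellCut_le n b h)) (by positivity)
  have h6 := (Real.continuous_sqrt.tendsto 0).comp h4
  simpa [Function.comp_def, Real.sqrt_sq (norm_nonneg _)] using h6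

omit [MeasurableSpace.CountablyGenerated X] in
theorem IsExpSystem.one_add_firstChaos_mem {B : Set (X × Y)} {h : Lp ℂ 2 μ}
    (hh : SupportedIn h B) : E 0 + hE.firstChaos h ∈ expSpace E B :=
  Submodule.add_mem _ (mem_expSpace E (supportedIn_zero B)) (hE.firstChaos_mem hh)

variable {M : Set X → MeasurableSpace Ω}

/-- The product is the part of the exponential vector of degree at most one in each cell.
Independence over the cells multiplies inner products, so pairing it with the exponential vector and
with itself gives the same number. Membership in `expSpace` is carried through the induction because
independence of the next factor needs it. -/
theorem IsExpSystem.exists_prod_one_add_firstChaos [IsProbabilityMeasure P]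
    (hM : ∀ A, MeasurableSet A → Represents (M A) E (Prod.fst ⁻¹' A)) (h : Lp ℂ 2 μ) (n : ℕ)
    (s : Finset (Fin n → Bool)) :
    ∃ F ∈ expSpace E (cells X Y n (s : Set (Fin n → Bool))),
      (F =ᵐ[P] fun ω => ∏ b ∈ s, (E 0 + hE.firstChaos (cellCut n {b} h)) ω) ∧
      ⟪E (cellCut n s h), F⟫_ℂ = ∏ b ∈ s, (1 + ((‖cellCut n {b} h‖ ^ 2 : ℝ) : ℂ)) ∧
      ⟪F, F⟫_ℂ = ∏ b ∈ s, (1 + ((‖cellCut n {b} h‖ ^ 2 : ℝ) : ℂ)) := by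
  classical
  have hR : ∀ s : Set (Fin n → Bool), Represents (M (cellIndex X n ⁻¹' s)) E (cells X Y n s) :=
    fun s => hM _ (measurable_cellIndex n s.toFinite.measurableSet)
  induction s using Finset.induction_on with
  | empty =>
    refine ⟨E 0, mem_expSpace E (supportedIn_zero _), ?_, ?_, ?_⟩
    · simpa using hE.zero
    · simp [hE.inner_eq]
    · rw [hE.inner_eq]
      simp
  | insert b s hb ih =>
    obtain ⟨F, hF, hF1, hF2, hF3⟩ := ih
    have hd : Disjoint ({b} : Set (Fin n → Bool)) (s : Set (Fin n → Bool)) := by simpa using hb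
    have hG := hE.one_add_firstChaos_mem (supportedIn_cellCut n {b} h)
    have hsub : ∀ t : Set (Fin n → Bool), t ⊆ insert b (s : Set (Fin n → Bool)) →
        cells X Y n t ⊆ cells X Y n (insert b (s : Set (Fin n → Bool))) :=
      fun t ht => Set.preimage_mono ht
    obtain ⟨F', hF', hF'1⟩ := hE.exists_mul (hR {b}) (hR s) (disjoint_cells n hd)
      (hR (insert b s)) (hsub _ (by simp)) (hsub _ (by simp)) hG hF
    have hGG : ⟪E 0 + hE.firstChaos (cellCut n {b} h), E 0 + hE.firstChaos (cellCut n {b} h)⟫_ℂ =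
        1 + ((‖cellCut n {b} h‖ ^ 2 : ℝ) : ℂ) := by
      rw [← inner_cellCut_self]
      simp only [inner_add_left, inner_add_right, hE.inner_eq, hE.inner_exp_firstChaos,
        hE.inner_firstChaos_exp, LinearIsometry.inner_map_map, inner_zero_left, inner_zero_right,
        Complex.exp_zero]
      ring
    have hEG : ⟪E (cellCut n {b} h), E 0 + hE.firstChaos (cellCut n {b} h)⟫_ℂ =
        1 + ((‖cellCut n {b} h‖ ^ 2 : ℝ) : ℂ) := by
      rw [← inner_cellCut_self]
      simp only [inner_add_right, hE.inner_eq, hE.inner_exp_firstChaos, inner_zero_right,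
        Complex.exp_zero]
    rw [Finset.coe_insert]
    refine ⟨F', hF', ?_, ?_, ?_⟩
    · filter_upwards [hF1, hF'1] with ω h1 h2
      rw [Finset.prod_insert hb, h2, h1]
    · rw [Finset.prod_insert hb, ← hF2, ← hEG]
      refine hE.inner_mul (hR {b}) (hR s) (disjoint_cells n hd)
        (mem_expSpace E (supportedIn_cellCut n {b} h)) hG
        (mem_expSpace E (supportedIn_cellCut n s h)) hF ?_ hF'1
      rw [cellCut_insert n (by simpa using hb)]
      exact hE.mul _ _ ((supportedIn_cellCut n {b} h).disjoint (supportedIn_cellCut n s h)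
        (disjoint_cells n hd))
    · rw [Finset.prod_insert hb, ← hF3, ← hGG]
      exact hE.inner_mul (hR {b}) (hR s) (disjoint_cells n hd) hG hG hF hF hF'1 hF'1

/-- An exponential vector as a limit of products of elements of the first chaos. -/
theorem IsExpSystem.exists_tendsto_prod [IsProbabilityMeasure P]
    [MeasurableSpace.SeparatesPoints X] (hμ : ∀ x : X, μ (Prod.fst ⁻¹' {x}) = 0)
    (hM : ∀ A, MeasurableSet A → Represents (M A) E (Prod.fst ⁻¹' A)) (h : Lp ℂ 2 μ) :
    ∃ F : ℕ → Lp ℂ 2 P, Tendsto F atTop (𝓝 (E h)) ∧ ∀ n, F n ∈ expSpace E Set.univ ∧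
      F n =ᵐ[P] fun ω => ∏ b, (E 0 + hE.firstChaos (cellCut n {b} h)) ω := by
  choose F hF hF1 hF2 hF3 using fun n =>
    hE.exists_prod_one_add_firstChaos hM h n Finset.univ
  refine ⟨F, ?_, fun n => ⟨expSpace_mono E (Set.subset_univ _) (hF n), hF1 n⟩⟩
  rw [tendsto_iff_norm_sub_tendsto_zero]
  -- Pythagoras: the inner product of `E h` with `F n` equals the square of the norm of `F n`.
  have h1 : ∀ n, ‖F n - E h‖ ^ 2 =
      Real.exp (‖h‖ ^ 2) - ∏ b, (1 + ‖cellCut n {b} h‖ ^ 2) := by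
    intro n
    have h2 := hF2 n
    have h3 := hF3 n
    rw [Finset.coe_univ, cellCut_univ] at h2
    have h5 : (∏ b, (1 + ((‖cellCut n {b} h‖ ^ 2 : ℝ) : ℂ))) =
        ((∏ b, (1 + ‖cellCut n {b} h‖ ^ 2) : ℝ) : ℂ) := by push_cast; rfl
    rw [h5] at h2 h3
    have h4 : ⟪F n, E h⟫_ℂ = ((∏ b, (1 + ‖cellCut n {b} h‖ ^ 2) : ℝ) : ℂ) := by
      rw [← inner_conj_symm, h2, Complex.conj_ofReal]
    have h6 : ⟪E h, E h⟫_ℂ = ((Real.exp (‖h‖ ^ 2) : ℝ) : ℂ) := by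
      rw [hE.inner_eq, inner_self_eq_norm_sq_to_K]
      push_cast
      rfl
    rw [norm_sub_sq_eq_re_inner, h2, h3, h4, h6]
    simp only [Complex.add_re, Complex.sub_re, Complex.ofReal_re]
    ring
  have h4 : Tendsto (fun n => ‖F n - E h‖ ^ 2) atTop (𝓝 0) := by
    have h5 := (tendsto_sum_norm_pow_four_cellCut hμ h).const_mul (Real.exp (‖h‖ ^ 2))
    rw [mul_zero] at h5
    refine squeeze_zero (fun _ => by positivity) (fun n => ?_) h5
    rw [h1]
    -- With `exp (-s) ≥ 1 - s`, the squared distance is at most `exp (‖h‖²)` times the sum of the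
    -- fourth powers of the norms of the cuts.
    have h6 : Real.exp (‖h‖ ^ 2 - ∑ b, (‖cellCut n {b} h‖ ^ 2) ^ 2) ≤
        ∏ b, (1 + ‖cellCut n {b} h‖ ^ 2) := by
      rw [← sum_norm_sq_cellCut n h, ← Finset.sum_sub_distrib, Real.exp_sum]
      exact Finset.prod_le_prod (fun _ _ => (Real.exp_pos _).le)
        fun b _ => exp_sub_sq_le_one_add (by positivity)
    have h7 := Real.add_one_le_exp (-∑ b, (‖cellCut n {b} h‖ ^ 2) ^ 2)
    rw [sub_eq_add_neg, Real.exp_add] at h6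
    nlinarith [Real.exp_pos (‖h‖ ^ 2)]
  have h6 := (Real.continuous_sqrt.tendsto 0).comp h4
  simpa [Function.comp_def, Real.sqrt_sq (norm_nonneg _)] using h6

end Cells

/-! ### Isomorphisms determined by their action on the first chaos -/

section Uniqueness

variable {X Y Ω₁ Ω₂ : Type*} {m₁ : MeasurableSpace Ω₁} {m₂ : MeasurableSpace Ω₂}
  {M₁ : Set X → MeasurableSpace Ω₁} {M₂ : Set X → MeasurableSpace Ω₂}
  [MeasurableSpace X] [MeasurableSpace.CountablyGenerated X] [MeasurableSpace.SeparatesPoints X]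
  [MeasurableSpace Y] [MeasurableSpace Ω₁] [MeasurableSpace Ω₂]
  {μ : Measure (X × Y)} {P₁ : Measure Ω₁} {P₂ : Measure Ω₂}
  {E₁ : Lp ℂ 2 μ → Lp ℂ 2 P₁} {E₂ : Lp ℂ 2 μ → Lp ℂ 2 P₂}

/-- A unity-preserving special isomorphism which is given by the identity in the first chaos
intertwines the exponential vectors. -/
theorem intertwines_of_firstChaos [IsProbabilityMeasure P₁] [IsProbabilityMeasure P₂]
    (hμ : ∀ x : X, μ (Prod.fst ⁻¹' {x}) = 0) (hE₁ : IsExpSystem E₁) (hE₂ : IsExpSystem E₂)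
    (r₁ : Represents m₁ E₁ Set.univ) (r₂ : Represents m₂ E₂ Set.univ)
    (hM₁ : ∀ A, MeasurableSet A → Represents (M₁ A) E₁ (Prod.fst ⁻¹' A))
    (hM₂ : ∀ A, MeasurableSet A → Represents (M₂ A) E₂ (Prod.fst ⁻¹' A))
    {Ψ : L2 m₁ P₁ ≃ₗᵢ[ℂ] L2 m₂ P₂} (hu : IsUnityPreserving Ψ)
    (hΨ : ∀ A, MeasurableSet A → ConjMapsTo Ψ (tensorFactor m₁ (M₁ A) (M₁ Aᶜ) P₁)
      (tensorFactor m₂ (M₂ A) (M₂ Aᶜ) P₂))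
    (hI : ∀ (f : Lp ℂ 2 μ) (u : L2 m₁ P₁), u.1 = hE₁.firstChaos f →
      (Ψ u).1 = hE₂.firstChaos f) : Intertwines E₁ E₂ Ψ := by
  classical
  have hmul : ∀ (n : ℕ) (s : Set (Fin n → Bool)) {f : L2 m₁ P₁},
      f.1 ∈ expSpace E₁ (cells X Y n s) →
      (Ψ f).1 ∈ expSpace E₂ (cells X Y n s) ∧ ∀ g u : L2 m₁ P₁,
        g.1 ∈ expSpace E₁ (cells X Y n s)ᶜ → (Ψ g).1 ∈ expSpace E₂ (cells X Y n s)ᶜ →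
        (u.1 =ᵐ[P₁] fun ω => f.1 ω * g.1 ω) →
        (Ψ u).1 =ᵐ[P₂] fun ω => (Ψ f).1 ω * (Ψ g).1 ω := by
    intro n s f hf
    have hs : MeasurableSet (cellIndex X n ⁻¹' s) :=
      measurable_cellIndex n s.toFinite.measurableSet
    exact special_map_mul hE₁ hE₂ r₁ r₂ (hM₁ _ hs) (hM₁ _ hs.compl) (hM₂ _ hs) (hM₂ _ hs.compl)
      hu (hΨ _ hs) hf
  have hone : ∀ u : L2 m₁ P₁, u.1 = E₁ 0 → (Ψ u).1 = E₂ 0 := by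
    intro u h0
    have h1 := hu u (by rw [h0]; exact hE₁.zero)
    have h2 : (Ψ u).1 =ᵐ[P₂] fun _ => 1 := h1
    exact Lp.ext (h2.trans hE₂.zero.symm)
  have hadd : ∀ (f : Lp ℂ 2 μ) (u : L2 m₁ P₁), u.1 = E₁ 0 + hE₁.firstChaos f →
      (Ψ u).1 = E₂ 0 + hE₂.firstChaos f := by
    intro f u hf
    let v : L2 m₁ P₁ := ⟨E₁ 0, r₁.mem_iff.2 (mem_expSpace E₁ (supportedIn_zero _))⟩
    have h1 : u = v + (u - v) := by abel
    rw [h1, map_add, Submodule.coe_add, hone v rfl, hI f (u - v) ?_]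
    rw [Submodule.coe_sub, hf]
    exact add_sub_cancel_left _ _
  -- The cells are split off one at a time. The product over the remaining cells lies over the
  -- complement of the cell `b`, and so does its image, as multiplicativity requires.
  have hprod : ∀ (h : Lp ℂ 2 μ) (n : ℕ) (s : Finset (Fin n → Bool)) (F : L2 m₁ P₁),
      (F.1 =ᵐ[P₁] fun ω => ∏ b ∈ s, (E₁ 0 + hE₁.firstChaos (cellCut n {b} h)) ω) →
      (Ψ F).1 =ᵐ[P₂] fun ω => ∏ b ∈ s, (E₂ 0 + hE₂.firstChaos (cellCut n {b} h)) ω := by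
    intro h n s
    induction s using Finset.induction_on with
    | empty =>
      intro F hF
      simp only [Finset.prod_empty] at hF ⊢
      exact hu F hF
    | insert b s hb ih =>
      intro F hF
      obtain ⟨G, hG, hG1, -, -⟩ := hE₁.exists_prod_one_add_firstChaos hM₁ h n s
      have hGm : G ∈ lpMeas ℂ ℂ m₁ 2 P₁ :=
        r₁.mem_iff.2 (expSpace_mono E₁ (Set.subset_univ _) hG)
      have hsub : cells X Y n (s : Set (Fin n → Bool)) ⊆ (cells X Y n {b})ᶜ := by
        refine Disjoint.subset_compl_right (disjoint_cells n ?_)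
        simpa using hb
      have hf := hE₁.one_add_firstChaos_mem (supportedIn_cellCut n {b} h)
      let f : L2 m₁ P₁ := ⟨_, r₁.mem_iff.2 (expSpace_mono E₁ (Set.subset_univ _) hf)⟩
      have h1 := (hmul n {b} (f := f) hf).2 ⟨G, hGm⟩ F (expSpace_mono E₁ hsub hG)
        (expSpace_mono E₂ hsub (hmul n s (f := ⟨G, hGm⟩) hG).1) (by
          filter_upwards [hF, hG1] with ω h2 h3
          rw [h2, Finset.prod_insert hb, h3])
      filter_upwards [h1, ih ⟨G, hGm⟩ hG1] with ω h2 h3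
      rw [h2, h3, Finset.prod_insert hb, hadd (cellCut n {b} h) f rfl]
  intro h u hu'
  obtain ⟨F, hF, hF1⟩ := hE₁.exists_tendsto_prod hμ hM₁ h
  obtain ⟨G, hG, hG1⟩ := hE₂.exists_tendsto_prod hμ hM₂ h
  have h1 : ∀ n, extendByZero r₁.le Ψ (F n) = G n := by
    intro n
    rw [extendByZero_apply r₁.le Ψ ⟨F n, r₁.mem_iff.2 (hF1 n).1⟩]
    refine Lp.ext ((hprod h n Finset.univ ⟨F n, _⟩ (hF1 n).2).trans (hG1 n).2.symm)
  -- The products converge to `E₁ h` in one space and to `E₂ h` in the other, and `Ψ` maps one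
  -- sequence to the other.
  have h2 := ((extendByZero r₁.le Ψ).continuous.tendsto (E₁ h)).comp hF
  rw [← hu', extendByZero_apply] at h2
  refine tendsto_nhds_unique h2 ?_
  simpa only [Function.comp_def, h1] using hG

end Uniqueness


/-! ### Uniqueness of characteristic functionals -/

section CharFunctional

variable {ι Ω Ω' : Type*}

/-- The joint law of a family of random variables is determined by its characteristic
functional. -/
theorem map_eq_of_charFunctional_eq [MeasurableSpace Ω] [MeasurableSpace Ω'] {Q : Measure Ω}
    {Q' : Measure Ω'} [IsFiniteMeasure Q] [IsFiniteMeasure Q'] {Y : ι → Ω → ℝ} {Y' : ι → Ω' → ℝ}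
    (hY : ∀ i, Measurable (Y i)) (hY' : ∀ i, Measurable (Y' i))
    (h : ∀ (s : Finset ι) (c : ι → ℝ),
      ∫ ω, Complex.exp (Complex.I * ((∑ i ∈ s, c i * Y i ω : ℝ) : ℂ)) ∂Q =
      ∫ ω, Complex.exp (Complex.I * ((∑ i ∈ s, c i * Y' i ω : ℝ) : ℂ)) ∂Q') :
    Q.map (fun ω i => Y i ω) = Q'.map (fun ω i => Y' i ω) := by
  classical
  have hm : Measurable fun ω i => Y i ω := measurable_pi_lambda _ hY
  have hm' : Measurable fun ω i => Y' i ω := measurable_pi_lambda _ hY'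
  -- A measure on a product, over an arbitrary index set, is determined by its finite-dimensional
  -- marginals, and these by their characteristic functions.
  refine IsProjectiveLimit.unique (P := fun I => (Q.map (fun ω i => Y i ω)).map I.restrict)
    (fun I => rfl) fun I => ?_
  beta_reduce
  rw [Measure.map_map (by fun_prop) hm, Measure.map_map (by fun_prop) hm']
  refine (Measure.ext_of_charFunDual ?_).symm
  ext L
  rw [charFunDual_apply, charFunDual_apply, integral_map, integral_map]
  -- Any linear functional of finitely many coordinates is a combination of them, so the hypothesis
  -- covers all characters of the marginal.
  · have hL : ∀ v : I → ℝ, L v = ∑ i ∈ I, (if hi : i ∈ I then L (Pi.single ⟨i, hi⟩ 1) else 0) *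
        (if hi : i ∈ I then v ⟨i, hi⟩ else 0) := by
      intro v
      have h1 : v = ∑ i : I, v i • (Pi.single i (1 : ℝ) : I → ℝ) := by
        ext j
        simp [Finset.sum_apply, Pi.single_apply]
      conv_lhs => rw [h1]
      rw [map_sum, ← Finset.sum_attach I, Finset.univ_eq_attach]
      refine Finset.sum_congr rfl fun i _ => ?_
      rw [map_smul, smul_eq_mul, mul_comm]
      simp
    have h2 := h I fun i => if hi : i ∈ I then L (Pi.single ⟨i, hi⟩ 1) else 0
    have h3 : ∀ y : ι → ℝ, L (I.restrict y) =
        ∑ i ∈ I, (if hi : i ∈ I then L (Pi.single ⟨i, hi⟩ 1) else 0) * y i := by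
      intro y
      rw [hL]
      refine Finset.sum_congr rfl fun i hi => ?_
      simp [hi]
    simp only [Function.comp_def, h3, mul_comm _ Complex.I]
    exact h2
  · exact ((Finset.measurable_restrict I).comp hm').aemeasurable
  · exact (by fun_prop : Continuous fun v : I → ℝ => Complex.exp (L v * Complex.I)).aestronglyMeasurable
  · exact ((Finset.measurable_restrict I).comp hm).aemeasurable
  · exact (by fun_prop : Continuous fun v : I → ℝ => Complex.exp (L v * Complex.I)).aestronglyMeasurable

theorem norm_exp_I_mul (x : ℝ) : ‖Complex.exp (Complex.I * (x : ℂ))‖ = 1 := by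
  rw [mul_comm, Complex.norm_exp_ofReal_mul_I]

theorem measurable_exp_sum [MeasurableSpace Ω] {Y : ι → Ω → ℝ} (hY : ∀ i, Measurable (Y i))
    (s : Finset ι) (c : ι → ℝ) :
    Measurable fun ω => Complex.exp (Complex.I * ((∑ i ∈ s, c i * Y i ω : ℝ) : ℂ)) := by
  have := hY
  fun_prop

/-- The densities `|g| + g` and `|g|` define finite positive measures. By hypothesis `Y` has the
same characteristic functional under both, so they coincide on the σ-field of `Y`, and their
difference has density `g`. The measure `P` itself may be infinite. -/
theorem setIntegral_eq_zero_of_charFunctional_real [MeasurableSpace Ω] {P : Measure Ω}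
    {Y : ι → Ω → ℝ} (hY : ∀ i, Measurable (Y i)) {g : Ω → ℝ} (hg : Integrable g P)
    (h : ∀ (s : Finset ι) (c : ι → ℝ),
      ∫ ω, Complex.exp (Complex.I * ((∑ i ∈ s, c i * Y i ω : ℝ) : ℂ)) * (g ω : ℂ) ∂P = 0)
    {S : Set Ω} (hS : MeasurableSet[⨆ i, MeasurableSpace.comap (Y i) inferInstance] S) :
    ∫ ω in S, g ω ∂P = 0 := by
  have hm : Measurable fun ω i => Y i ω := measurable_pi_lambda _ hY
  have h0 : ∀ ω, 0 ≤ ‖g ω‖ + g ω := fun ω => by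
    have := neg_abs_le (g ω)
    rw [Real.norm_eq_abs]
    linarith
  have hi : Integrable (fun ω => ‖g ω‖ + g ω) P := hg.norm.add hg
  let Q₁ := P.withDensity fun ω => ENNReal.ofReal (‖g ω‖ + g ω)
  let Q₂ := P.withDensity fun ω => ENNReal.ofReal ‖g ω‖
  have : IsFiniteMeasure Q₁ := isFiniteMeasure_withDensity_ofReal hi.2
  have : IsFiniteMeasure Q₂ := isFiniteMeasure_withDensity_ofReal hg.norm.2
  have hmap : Q₁.map (fun ω i => Y i ω) = Q₂.map (fun ω i => Y i ω) := by
    refine map_eq_of_charFunctional_eq hY hY fun s c => ?_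
    have e1 := measurable_exp_sum hY s c
    have hb : ∀ {k : Ω → ℝ}, Integrable k P → Integrable (fun ω =>
        Complex.exp (Complex.I * ((∑ i ∈ s, c i * Y i ω : ℝ) : ℂ)) * (k ω : ℂ)) P := fun hk =>
      hk.ofReal.bdd_mul (c := 1) e1.aestronglyMeasurable
        (ae_of_all _ fun ω => (norm_exp_I_mul _).le)
    have hd : ∀ {k : Ω → ℝ}, Integrable k P → (∀ ω, 0 ≤ k ω) →
        ∫ ω, Complex.exp (Complex.I * ((∑ i ∈ s, c i * Y i ω : ℝ) : ℂ))
          ∂(P.withDensity fun ω => ENNReal.ofReal (k ω)) =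
        ∫ ω, Complex.exp (Complex.I * ((∑ i ∈ s, c i * Y i ω : ℝ) : ℂ)) * (k ω : ℂ) ∂P := by
      intro k hk hk0
      rw [integral_withDensity_eq_integral_toReal_smul₀ hk.1.aemeasurable.ennreal_ofReal
        (ae_of_all _ fun _ => ENNReal.ofReal_lt_top)]
      refine integral_congr_ae (ae_of_all _ fun ω => ?_)
      simp only [ENNReal.toReal_ofReal (hk0 ω), Complex.real_smul]
      ring
    rw [hd hi h0, hd hg.norm fun ω => norm_nonneg _]
    have h2 : ∀ ω, Complex.exp (Complex.I * ((∑ i ∈ s, c i * Y i ω : ℝ) : ℂ)) *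
        ((‖g ω‖ + g ω : ℝ) : ℂ) =
        Complex.exp (Complex.I * ((∑ i ∈ s, c i * Y i ω : ℝ) : ℂ)) * ((‖g ω‖ : ℝ) : ℂ) +
        Complex.exp (Complex.I * ((∑ i ∈ s, c i * Y i ω : ℝ) : ℂ)) * (g ω : ℂ) := by
      intro ω
      push_cast
      ring
    simp only [h2]
    rw [integral_add (hb hg.norm) (hb hg), h s c, add_zero]
  have hcomap : (⨆ i, MeasurableSpace.comap (Y i) inferInstance : MeasurableSpace Ω) =
      MeasurableSpace.comap (fun ω i => Y i ω) MeasurableSpace.pi := by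
    rw [MeasurableSpace.pi, MeasurableSpace.comap_iSup]
    simp only [MeasurableSpace.comap_comp, Function.comp_def]
  rw [hcomap] at hS
  obtain ⟨S', hS', rfl⟩ := hS
  have hS2 := hm hS'
  have h3 : Q₁ ((fun ω i => Y i ω) ⁻¹' S') = Q₂ ((fun ω i => Y i ω) ⁻¹' S') := by
    rw [← Measure.map_apply hm hS', hmap, Measure.map_apply hm hS']
  rw [withDensity_apply _ hS2, withDensity_apply _ hS2,
    ← ofReal_integral_eq_lintegral_ofReal hi.integrableOn (ae_of_all _ h0),
    ← ofReal_integral_eq_lintegral_ofReal hg.norm.integrableOn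
      (ae_of_all _ fun ω => norm_nonneg _),
    ENNReal.ofReal_eq_ofReal_iff (integral_nonneg h0) (integral_nonneg fun ω => norm_nonneg _),
    integral_add hg.norm.integrableOn hg.integrableOn] at h3
  linarith

/-- Conjugating the hypothesis and replacing `c` by `-c` gives the same for the conjugate of `g`,
which reduces the claim to real and imaginary parts. -/
theorem setIntegral_eq_zero_of_charFunctional [MeasurableSpace Ω] {P : Measure Ω}
    {Y : ι → Ω → ℝ} (hY : ∀ i, Measurable (Y i)) {g : Ω → ℂ} (hg : Integrable g P)
    (h : ∀ (s : Finset ι) (c : ι → ℝ),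
      ∫ ω, Complex.exp (Complex.I * ((∑ i ∈ s, c i * Y i ω : ℝ) : ℂ)) * g ω ∂P = 0)
    {S : Set Ω} (hS : MeasurableSet[⨆ i, MeasurableSpace.comap (Y i) inferInstance] S) :
    ∫ ω in S, g ω ∂P = 0 := by
  have hconj : ∀ (s : Finset ι) (c : ι → ℝ),
      ∫ ω, Complex.exp (Complex.I * ((∑ i ∈ s, c i * Y i ω : ℝ) : ℂ)) *
        (starRingEnd ℂ) (g ω) ∂P = 0 := by
    intro s c
    have h1 := congrArg (starRingEnd ℂ) (h s fun i => -c i)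
    rw [← integral_conj, map_zero] at h1
    rw [← h1]
    refine integral_congr_ae (ae_of_all _ fun ω => ?_)
    simp only [map_mul, map_neg, ← Complex.exp_conj, Complex.conj_I, Complex.conj_ofReal, neg_mul,
      Finset.sum_neg_distrib, Complex.ofReal_neg, mul_neg, neg_neg]
  have hgc : Integrable (fun ω => (starRingEnd ℂ) (g ω)) P :=
    (Complex.conjCLE.toContinuousLinearMap.integrable_comp hg)
  have hb : ∀ (s : Finset ι) (c : ι → ℝ) {k : Ω → ℂ}, Integrable k P → Integrable (fun ω =>
        Complex.exp (Complex.I * ((∑ i ∈ s, c i * Y i ω : ℝ) : ℂ)) * k ω) P := fun s c _ hk =>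
      hk.bdd_mul (c := 1) (measurable_exp_sum hY s c).aestronglyMeasurable
        (ae_of_all _ fun ω => (norm_exp_I_mul _).le)
  have hre := setIntegral_eq_zero_of_charFunctional_real hY hg.re (fun s c => by
    have h2 : ∀ ω, Complex.exp (Complex.I * ((∑ i ∈ s, c i * Y i ω : ℝ) : ℂ)) *
        ((RCLike.re (g ω) : ℝ) : ℂ) = (1 / 2 : ℂ) *
        (Complex.exp (Complex.I * ((∑ i ∈ s, c i * Y i ω : ℝ) : ℂ)) * g ω +
         Complex.exp (Complex.I * ((∑ i ∈ s, c i * Y i ω : ℝ) : ℂ)) *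
          (starRingEnd ℂ) (g ω)) := by
      intro ω
      rw [← mul_add, Complex.add_conj]
      simp only [RCLike.re_to_complex]
      push_cast
      ring
    simp only [h2]
    rw [integral_const_mul, integral_add (hb s c hg) (hb s c hgc), h s c, hconj s c]
    simp) hS
  have him := setIntegral_eq_zero_of_charFunctional_real hY hg.im (fun s c => by
    have h2 : ∀ ω, Complex.exp (Complex.I * ((∑ i ∈ s, c i * Y i ω : ℝ) : ℂ)) *
        ((RCLike.im (g ω) : ℝ) : ℂ) = (-Complex.I / 2 : ℂ) *
        (Complex.exp (Complex.I * ((∑ i ∈ s, c i * Y i ω : ℝ) : ℂ)) * g ω -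
         Complex.exp (Complex.I * ((∑ i ∈ s, c i * Y i ω : ℝ) : ℂ)) *
          (starRingEnd ℂ) (g ω)) := by
      intro ω
      rw [← mul_sub, Complex.sub_conj]
      simp only [RCLike.im_to_complex]
      push_cast
      linear_combination (Complex.exp (Complex.I * (∑ i ∈ s, (c i : ℂ) * (Y i ω : ℂ))) *
        ((g ω).im : ℂ)) * Complex.I_sq
    simp only [h2]
    rw [integral_const_mul, integral_sub (hb s c hg) (hb s c hgc), h s c, hconj s c]
    simp) hS
  have h3 := integral_re_add_im (𝕜 := ℂ) (μ := P.restrict S) hg.integrableOn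
  rw [← h3, hre, him]
  simp

end CharFunctional

/-! ### Functions measurable with respect to a generated σ-field -/

section SigmaFields

variable {ι Ω β : Type*} {m' : MeasurableSpace Ω}

/-- The exponentials `exp (i ∑ c_k Y_k)` are total in the space of square integrable functions
measurable with respect to the σ-field generated by the `Y_k`. -/
theorem eq_zero_of_inner_exp_eq_zero [mΩ : MeasurableSpace Ω] {P : Measure Ω}
    [IsProbabilityMeasure P] {Y : ι → Ω → ℝ} (hY : ∀ i, Measurable (Y i)) {f : Lp ℂ 2 P}
    (hf : AEStronglyMeasurable[⨆ i, MeasurableSpace.comap (Y i) inferInstance] f P)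
    (h : ∀ (s : Finset ι) (c : ι → ℝ),
      ∫ ω, Complex.exp (Complex.I * ((∑ i ∈ s, c i * Y i ω : ℝ) : ℂ)) * f ω ∂P = 0) : f = 0 := by
  have hle : (⨆ i, MeasurableSpace.comap (Y i) inferInstance) ≤ mΩ :=
    iSup_le fun i => (hY i).comap_le
  have hfi : Integrable f P := (Lp.memLp f).integrable one_le_two
  have h1 := Lp.ae_eq_zero_of_forall_setIntegral_eq_zero' (𝕜 := ℂ) hle f two_ne_zero
    ENNReal.ofNat_ne_top (fun s _ _ => hfi.integrableOn)
    (fun s hs _ => setIntegral_eq_zero_of_charFunctional hY hfi h hs) hf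
  exact Lp.ext (h1.trans (Lp.coeFn_zero ℂ 2 P).symm)

/-- If the generators of a σ-field are measurable mod 0 with respect to `m'`, so are all functions
measurable with respect to it. -/
theorem aestronglyMeasurable_of_generators [mβ : MeasurableSpace β] [mΩ : MeasurableSpace Ω]
    {P : Measure Ω} {Y : ι → Ω → β}
    (hY : ∀ i, ∃ Y' : Ω → β, Measurable[m'] Y' ∧ Y i =ᵐ[P] Y') {f : Ω → ℂ}
    (hf : AEStronglyMeasurable[⨆ i, MeasurableSpace.comap (Y i) mβ] f P) :
    AEStronglyMeasurable[m'] f P := by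
  -- The sets equal mod 0 to a set of `m'` form a σ-field; it contains the generators and hence
  -- everything they generate.
  have hle : (⨆ i, MeasurableSpace.comap (Y i) mβ) ≤ eventuallyMeasurableSpace m' (ae P) := by
    refine iSup_le fun i => ?_
    rintro _ ⟨t, ht, rfl⟩
    obtain ⟨Y', hY', hYY'⟩ := hY i
    exact ⟨Y' ⁻¹' t, hY' ht, hYY'.preimage t⟩
  obtain ⟨g, hg, hfg⟩ := hf
  refine AEStronglyMeasurable.congr ?_ hfg.symm
  refine aestronglyMeasurable_of_tendsto_ae' (f := fun n => hg.approx n) (fun n => ?_)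
    (ae_of_all _ fun ω => hg.tendsto_approx ω)
  generalize hg.approx n = φ
  induction φ using SimpleFunc.induction with
  | const c hs =>
    rename_i s
    obtain ⟨t, ht, hst⟩ := hle s hs
    refine ⟨t.indicator fun _ => c, (@stronglyMeasurable_const _ _ m' _ c).indicator ht, ?_⟩
    have h1 := indicator_ae_eq_of_ae_eq_set (f := fun _ : Ω => c) hst
    refine EventuallyEq.trans (ae_of_all _ fun ω => ?_) h1
    simp [SimpleFunc.piecewise, Set.indicator, Set.piecewise]
  | add _ h1 h2 => exact h1.add h2

end SigmaFields


/-! ### Real and imaginary parts in `L²` -/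

section RealPart

variable {Z : Type*} [MeasurableSpace Z] {μ : Measure Z}

/-- The real part of an element of complex `L²`. -/
abbrev reL (h : Lp ℂ 2 μ) : Lp ℝ 2 μ := Complex.reCLM.compLp h

/-- The imaginary part of an element of complex `L²`. -/
abbrev imL (h : Lp ℂ 2 μ) : Lp ℝ 2 μ := Complex.imCLM.compLp h

/-- A real `L²` function as a complex one. -/
abbrev ofRealL (a : Lp ℝ 2 μ) : Lp ℂ 2 μ := Complex.ofRealCLM.compLp a

theorem coeFn_reL (h : Lp ℂ 2 μ) : ∀ᵐ z ∂μ, reL h z = (h z).re :=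
  ContinuousLinearMap.coeFn_compLp _ _

theorem coeFn_imL (h : Lp ℂ 2 μ) : ∀ᵐ z ∂μ, imL h z = (h z).im :=
  ContinuousLinearMap.coeFn_compLp _ _

theorem coeFn_ofRealL (a : Lp ℝ 2 μ) : ∀ᵐ z ∂μ, ofRealL a z = (a z : ℂ) :=
  ContinuousLinearMap.coeFn_compLp _ _

theorem reL_add (h g : Lp ℂ 2 μ) : reL (h + g) = reL h + reL g :=
  map_add (Complex.reCLM.compLpₗ 2 μ) h g

theorem imL_add (h g : Lp ℂ 2 μ) : imL (h + g) = imL h + imL g :=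
  map_add (Complex.imCLM.compLpₗ 2 μ) h g

theorem reL_smul (r : ℝ) (h : Lp ℂ 2 μ) : reL ((r : ℂ) • h) = r • reL h := by
  refine Lp.ext ?_
  filter_upwards [coeFn_reL ((r : ℂ) • h), coeFn_reL h, Lp.coeFn_smul (r : ℂ) h,
    Lp.coeFn_smul r (reL h)] with z h1 h2 h3 h4
  rw [h1, h4, h3, Pi.smul_apply, Pi.smul_apply, h2]
  simp

theorem imL_smul (r : ℝ) (h : Lp ℂ 2 μ) : imL ((r : ℂ) • h) = r • imL h := by
  refine Lp.ext ?_
  filter_upwards [coeFn_imL ((r : ℂ) • h), coeFn_imL h, Lp.coeFn_smul (r : ℂ) h,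
    Lp.coeFn_smul r (imL h)] with z h1 h2 h3 h4
  rw [h1, h4, h3, Pi.smul_apply, Pi.smul_apply, h2]
  simp

theorem reL_star (h : Lp ℂ 2 μ) : reL (star h) = reL h := by
  refine Lp.ext ?_
  filter_upwards [coeFn_reL (star h), coeFn_reL h, Lp.coeFn_star h] with z h1 h2 h3
  rw [h1, h2, h3]
  simp

theorem imL_star (h : Lp ℂ 2 μ) : imL (star h) = -imL h := by
  refine Lp.ext ?_
  filter_upwards [coeFn_imL (star h), coeFn_imL h, Lp.coeFn_star h, Lp.coeFn_neg (imL h)]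
    with z h1 h2 h3 h4
  rw [h1, h4, Pi.neg_apply, h2, h3]
  simp

theorem reL_ofRealL (a : Lp ℝ 2 μ) : reL (ofRealL a) = a := by
  refine Lp.ext ?_
  filter_upwards [coeFn_reL (ofRealL a), coeFn_ofRealL a] with z h1 h2
  rw [h1, h2, Complex.ofReal_re]

theorem imL_ofRealL (a : Lp ℝ 2 μ) : imL (ofRealL a) = 0 := by
  refine Lp.ext ?_
  filter_upwards [coeFn_imL (ofRealL a), coeFn_ofRealL a, Lp.coeFn_zero ℝ 2 μ] with z h1 h2 h3
  rw [h1, h2, Complex.ofReal_im, h3, Pi.zero_apply]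

theorem reL_I_smul_ofRealL (a : Lp ℝ 2 μ) : reL (Complex.I • ofRealL a) = 0 := by
  refine Lp.ext ?_
  filter_upwards [coeFn_reL (Complex.I • ofRealL a), coeFn_ofRealL a, Lp.coeFn_zero ℝ 2 μ,
    Lp.coeFn_smul Complex.I (ofRealL a)] with z h1 h2 h3 h4
  rw [h1, h4, Pi.smul_apply, h2, h3]
  simp

theorem imL_I_smul_ofRealL (a : Lp ℝ 2 μ) : imL (Complex.I • ofRealL a) = a := by
  refine Lp.ext ?_
  filter_upwards [coeFn_imL (Complex.I • ofRealL a), coeFn_ofRealL a,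
    Lp.coeFn_smul Complex.I (ofRealL a)] with z h1 h2 h4
  rw [h1, h4, Pi.smul_apply, h2]
  simp

theorem ofRealL_add_I_smul (h : Lp ℂ 2 μ) : ofRealL (reL h) + Complex.I • ofRealL (imL h) = h := by
  refine Lp.ext ?_
  filter_upwards [coeFn_reL h, coeFn_imL h, coeFn_ofRealL (reL h), coeFn_ofRealL (imL h),
    Lp.coeFn_smul Complex.I (ofRealL (imL h)),
    Lp.coeFn_add (ofRealL (reL h)) (Complex.I • ofRealL (imL h))] with z h1 h2 h3 h4 h5 h6
  rw [h6, Pi.add_apply, h5, Pi.smul_apply, h4, h3, h1, h2, smul_eq_mul, mul_comm,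
    Complex.re_add_im]

theorem inner_ofRealL (a b : Lp ℝ 2 μ) : ⟪ofRealL a, ofRealL b⟫_ℂ = (⟪a, b⟫_ℝ : ℂ) := by
  rw [L2.inner_def, L2.inner_def, ← integral_complex_ofReal]
  refine integral_congr_ae ?_
  filter_upwards [coeFn_ofRealL a, coeFn_ofRealL b] with z h1 h2
  rw [h1, h2]
  simp

theorem inner_eq_reL_imL (h g : Lp ℂ 2 μ) : ⟪h, g⟫_ℂ =
    (⟪reL h, reL g⟫_ℝ + ⟪imL h, imL g⟫_ℝ : ℝ) +
      Complex.I * (⟪reL h, imL g⟫_ℝ - ⟪imL h, reL g⟫_ℝ : ℝ) := by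
  conv_lhs => rw [← ofRealL_add_I_smul h, ← ofRealL_add_I_smul g]
  simp only [inner_add_left, inner_add_right, inner_smul_left, inner_smul_right, inner_ofRealL,
    Complex.conj_I]
  push_cast
  linear_combination (-(⟪imL h, imL g⟫_ℝ : ℂ)) * Complex.I_sq

theorem real_inner_eq_zero_of_disjoint {a b : Lp ℝ 2 μ} (hd : ∀ᵐ z ∂μ, a z = 0 ∨ b z = 0) :
    ⟪a, b⟫_ℝ = 0 := by
  rw [L2.inner_def]
  refine integral_eq_zero_of_ae ?_
  filter_upwards [hd] with z hz
  rcases hz with hz | hz <;> simp [hz]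

end RealPart

/-! ### White noise -/

section WhiteNoise

variable {Z Ω : Type*} [MeasurableSpace Z] [MeasurableSpace Ω] {μ : Measure Z} {P : Measure Ω}
  {W : GenProcess 2 μ P}

theorem GenProcess.measurable {p : ℝ≥0∞} (Y : GenProcess p μ P) (a : Lp ℝ p μ) :
    Measurable fun ω => Y a ω := (Y a).measurable

theorem GenProcess.coeFn_add {p : ℝ≥0∞} (Y : GenProcess p μ P) (a b : Lp ℝ p μ) :
    ∀ᵐ ω ∂P, Y (a + b) ω = Y a ω + Y b ω := by
  rw [map_add]
  exact AEEqFun.coeFn_add _ _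

theorem GenProcess.coeFn_smul {p : ℝ≥0∞} (Y : GenProcess p μ P) (r : ℝ) (a : Lp ℝ p μ) :
    ∀ᵐ ω ∂P, Y (r • a) ω = r * Y a ω := by
  rw [map_smul]
  exact AEEqFun.coeFn_smul _ _

theorem GenProcess.coeFn_zero {p : ℝ≥0∞} (Y : GenProcess p μ P) :
    ∀ᵐ ω ∂P, Y 0 ω = 0 := by
  rw [map_zero]
  exact AEEqFun.coeFn_zero

theorem GenProcess.coeFn_sum {p : ℝ≥0∞} (Y : GenProcess p μ P) {ι : Type*} (s : Finset ι)
    (c : ι → ℝ) (a : ι → Lp ℝ p μ) :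
    ∀ᵐ ω ∂P, Y (∑ i ∈ s, c i • a i) ω = ∑ i ∈ s, c i * Y (a i) ω := by
  classical
  induction s using Finset.induction_on with
  | empty => simpa using Y.coeFn_zero
  | insert i s hi ih =>
    rw [Finset.sum_insert hi]
    filter_upwards [ih, Y.coeFn_add (c i • a i) (∑ i ∈ s, c i • a i), Y.coeFn_smul (c i) (a i)]
      with ω h1 h2 h3
    rw [h2, h3, h1, Finset.sum_insert hi]

theorem GenProcess.sigma_le {p : ℝ≥0∞} (Y : GenProcess p μ P) (B : Set Z) :
    Y.sigma B ≤ ‹MeasurableSpace Ω› :=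
  iSup_le fun a => iSup_le fun _ => (Y.measurable a).comap_le

theorem GenProcess.measurable_sigma {p : ℝ≥0∞} (Y : GenProcess p μ P) {B : Set Z} {a : Lp ℝ p μ}
    (ha : ∀ᵐ z ∂μ, z ∉ B → a z = 0) : Measurable[Y.sigma B] fun ω => Y a ω :=
  (comap_measurable _).mono
    (le_iSup₂_of_le (f := fun (a : Lp ℝ p μ) (_ : ∀ᵐ z ∂μ, z ∉ B → a z = 0) =>
      MeasurableSpace.comap (fun ω => Y a ω) inferInstance) a ha le_rfl) le_rfl

theorem GenProcess.sigma_eq_iSup {p : ℝ≥0∞} (Y : GenProcess p μ P) (B : Set Z) :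
    Y.sigma B = ⨆ a : {a : Lp ℝ p μ // ∀ᵐ z ∂μ, z ∉ B → a z = 0},
      MeasurableSpace.comap (fun ω => Y a.1 ω) inferInstance := by
  rw [GenProcess.sigma, iSup_subtype']

variable [IsProbabilityMeasure P]

theorem IsWhiteNoise.integral_exp_two (hW : IsWhiteNoise W) (a b : Lp ℝ 2 μ) (s t : ℝ) :
    ∫ ω, Complex.exp (Complex.I * ((s * W a ω + t * W b ω : ℝ) : ℂ)) ∂P =
      Complex.exp (-((‖s • a + t • b‖ ^ 2 / 2 : ℝ) : ℂ)) := by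
  rw [← hW]
  refine integral_congr_ae ?_
  filter_upwards [W.coeFn_add (s • a) (t • b), W.coeFn_smul s a, W.coeFn_smul t b] with ω h1 h2 h3
  rw [h1, h2, h3]

theorem IsWhiteNoise.map_eq (hW : IsWhiteNoise W) (a : Lp ℝ 2 μ) :
    P.map (fun ω => W a ω) = gaussianReal 0 (‖a‖₊ ^ 2) := by
  have := Measure.isProbabilityMeasure_map (μ := P) (W.measurable a).aemeasurable
  refine Measure.ext_of_charFun ?_
  ext t
  rw [charFun_gaussianReal, charFun_apply_real, integral_map (W.measurable a).aemeasurable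
    (by fun_prop)]
  have h := hW.integral_exp_two a 0 t 0
  simp only [zero_mul, add_zero, smul_zero, norm_smul] at h
  convert h using 2
  · ext ω
    push_cast
    ring_nf
  · simp only [Real.norm_eq_abs, mul_pow, sq_abs]
    push_cast
    simp
    ring

/-- For orthogonal `a` and `b` the quadratic form in the exponent has no cross term, so the joint
characteristic function factors. -/
theorem IsWhiteNoise.indepFun (hW : IsWhiteNoise W) {a b : Lp ℝ 2 μ} (hab : ⟪a, b⟫_ℝ = 0) :
    IndepFun (fun ω => W a ω) (fun ω => W b ω) P := by
  rw [indepFun_iff_charFun_prod (W.measurable a).aemeasurable (W.measurable b).aemeasurable]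
  intro t
  have hma := W.measurable a
  have hmb := W.measurable b
  rw [hW.map_eq, hW.map_eq, charFun_gaussianReal, charFun_gaussianReal, charFun_apply,
    integral_map (by fun_prop) (by fun_prop), ← Complex.exp_add]
  have h := hW.integral_exp_two a b t.ofLp.1 t.ofLp.2
  convert h using 2
  · ext ω
    simp only [WithLp.prod_inner_apply]
    simp
    ring_nf
  · rw [norm_add_sq_real, inner_smul_left, inner_smul_right, hab, norm_smul, norm_smul]
    simp only [Real.norm_eq_abs, mul_pow, sq_abs]
    push_cast
    simp
    ring

theorem IsWhiteNoise.integrable_exp (hW : IsWhiteNoise W) (a : Lp ℝ 2 μ) (z : ℂ) :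
    Integrable (fun ω => Complex.exp (z * (W a ω : ℂ))) P := by
  refine integrable_cexp_mul_of_re_mem_integrableExpSet (W.measurable a).aemeasurable ?_
  have h := integrable_exp_mul_gaussianReal (μ := 0) (v := ‖a‖₊ ^ 2) z.re
  rw [← hW.map_eq a, integrable_map_measure (by fun_prop) (W.measurable a).aemeasurable] at h
  exact h

theorem IsWhiteNoise.integral_exp (hW : IsWhiteNoise W) (a : Lp ℝ 2 μ) (z : ℂ) :
    ∫ ω, Complex.exp (z * (W a ω : ℂ)) ∂P = Complex.exp ((‖a‖ : ℂ) ^ 2 * z ^ 2 / 2) := by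
  have h := complexMGF_gaussianReal (hW.map_eq a) z
  simpa [complexMGF] using h

/-- The Laplace–Fourier transform of white noise. -/
theorem IsWhiteNoise.integral_exp_add (hW : IsWhiteNoise W) (a b : Lp ℝ 2 μ) :
    ∫ ω, Complex.exp ((W a ω : ℂ) + Complex.I * (W b ω : ℂ)) ∂P =
      Complex.exp (((‖a‖ ^ 2 - ‖b‖ ^ 2 : ℝ) : ℂ) / 2 + Complex.I * (⟪a, b⟫_ℝ : ℂ)) := by
  -- Split off the component of `b` along `a`. The rest `b'` is orthogonal to `a`, hence gives an
  -- independent variable, and two one-dimensional Gaussian integrals remain. If `a = 0`, division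
  -- by zero gives `l = 0`, which serves as well.
  set l : ℝ := ⟪a, b⟫_ℝ / ‖a‖ ^ 2 with hl
  set b' := b - l • a with hb'
  have hla : l * ‖a‖ ^ 2 = ⟪a, b⟫_ℝ := by
    by_cases ha : a = 0
    · simp [ha]
    · have : ‖a‖ ^ 2 ≠ 0 := by simpa using ha
      rw [hl, div_mul_cancel₀ _ this]
  have hab : ⟪a, b'⟫_ℝ = 0 := by
    rw [hb', inner_sub_right, inner_smul_right, real_inner_self_eq_norm_sq, hla, sub_self]
  have hb : b = l • a + b' := by rw [hb']; abel
  have h1 : ∫ ω, Complex.exp ((W a ω : ℂ) + Complex.I * (W b ω : ℂ)) ∂P =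
      ∫ ω, Complex.exp ((1 + Complex.I * l) * (W a ω : ℂ)) *
        Complex.exp (Complex.I * (W b' ω : ℂ)) ∂P := by
    refine integral_congr_ae ?_
    filter_upwards [W.coeFn_add (l • a) b', W.coeFn_smul l a] with ω h1 h2
    rw [hb, h1, h2, ← Complex.exp_add]
    congr 1
    push_cast
    ring
  rw [h1, (hW.indepFun hab).integral_fun_comp_mul_comp
    (f := fun x : ℝ => Complex.exp ((1 + Complex.I * l) * (x : ℂ)))
    (g := fun x : ℝ => Complex.exp (Complex.I * (x : ℂ))) (W.measurable a).aemeasurable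
    (W.measurable b').aemeasurable (by fun_prop) (by fun_prop), hW.integral_exp, hW.integral_exp,
    ← Complex.exp_add]
  congr 1
  have hbn : ‖b‖ ^ 2 = l ^ 2 * ‖a‖ ^ 2 + ‖b'‖ ^ 2 := by
    rw [hb, norm_add_sq_real, inner_smul_left, hab, norm_smul, mul_pow]
    simp
  have h2 : (‖b‖ : ℂ) ^ 2 = l ^ 2 * ‖a‖ ^ 2 + ‖b'‖ ^ 2 := by exact_mod_cast hbn
  have h3 : (l : ℂ) * (‖a‖ : ℂ) ^ 2 = (⟪a, b⟫_ℝ : ℂ) := by exact_mod_cast hla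
  push_cast
  rw [h2, ← h3]
  linear_combination ((‖a‖ : ℂ) ^ 2 * (l : ℂ) ^ 2 / 2 + (‖b'‖ : ℂ) ^ 2 / 2) * Complex.I_sq

end WhiteNoise


/-! ### Exponential vectors of white noise -/

section GaussExp

variable {Z Ω : Type*} [MeasurableSpace Z] [MeasurableSpace Ω] {μ : Measure Z} {P : Measure Ω}
  {W : GenProcess 2 μ P}

/-- The complex bilinear form `∫ h² dμ`. -/
def bilinSq (h : Lp ℂ 2 μ) : ℂ :=
  ((‖reL h‖ ^ 2 - ‖imL h‖ ^ 2 : ℝ) : ℂ) + 2 * Complex.I * (⟪reL h, imL h⟫_ℝ : ℂ)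

/-- The complex-linear extension of the white noise. -/
def cplx (W : GenProcess 2 μ P) (h : Lp ℂ 2 μ) (ω : Ω) : ℂ :=
  (W (reL h) ω : ℂ) + Complex.I * (W (imL h) ω : ℂ)

theorem measurable_cplx (W : GenProcess 2 μ P) (h : Lp ℂ 2 μ) : Measurable (cplx W h) := by
  have h1 := W.measurable (reL h)
  have h2 := W.measurable (imL h)
  unfold cplx
  fun_prop

theorem measurable_sigma_cplx (W : GenProcess 2 μ P) {h : Lp ℂ 2 μ} {B : Set Z}
    (hh : SupportedIn h B) : Measurable[W.sigma B] (cplx W h) := by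
  have h1 : Measurable[W.sigma B] fun ω => W (reL h) ω := W.measurable_sigma (by
    filter_upwards [hh, coeFn_reL h] with z h1 h2 hz
    rw [h2, h1 hz, Complex.zero_re])
  have h2 : Measurable[W.sigma B] fun ω => W (imL h) ω := W.measurable_sigma (by
    filter_upwards [hh, coeFn_imL h] with z h1 h2 hz
    rw [h2, h1 hz, Complex.zero_im])
  exact (Complex.measurable_ofReal.comp h1).add
    ((Complex.measurable_ofReal.comp h2).const_mul Complex.I)

theorem cplx_add (W : GenProcess 2 μ P) (h g : Lp ℂ 2 μ) :
    ∀ᵐ ω ∂P, cplx W (h + g) ω = cplx W h ω + cplx W g ω := by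
  unfold cplx
  rw [reL_add, imL_add]
  filter_upwards [W.coeFn_add (reL h) (reL g), W.coeFn_add (imL h) (imL g)] with ω h1 h2
  rw [h1, h2]
  push_cast
  ring

theorem cplx_smul_ofReal (W : GenProcess 2 μ P) (r : ℝ) (h : Lp ℂ 2 μ) :
    ∀ᵐ ω ∂P, cplx W ((r : ℂ) • h) ω = r * cplx W h ω := by
  unfold cplx
  rw [reL_smul, imL_smul]
  filter_upwards [W.coeFn_smul r (reL h), W.coeFn_smul r (imL h)] with ω h1 h2
  rw [h1, h2]
  push_cast
  ring

theorem cplx_star (W : GenProcess 2 μ P) (h : Lp ℂ 2 μ) :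
    ∀ᵐ ω ∂P, cplx W (star h) ω = (starRingEnd ℂ) (cplx W h ω) := by
  unfold cplx
  rw [reL_star, imL_star, ← neg_one_smul ℝ]
  filter_upwards [W.coeFn_smul (-1) (imL h)] with ω h1
  rw [h1]
  simp

theorem bilinSq_smul_ofReal (r : ℝ) (h : Lp ℂ 2 μ) :
    bilinSq ((r : ℂ) • h) = (r : ℂ) ^ 2 * bilinSq h := by
  unfold bilinSq
  rw [reL_smul, imL_smul, norm_smul, norm_smul, inner_smul_left, inner_smul_right, mul_pow, mul_pow]
  simp only [Real.norm_eq_abs, sq_abs]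
  push_cast
  simp
  ring

theorem bilinSq_star (h : Lp ℂ 2 μ) : bilinSq (star h) = (starRingEnd ℂ) (bilinSq h) := by
  unfold bilinSq
  rw [reL_star, imL_star, norm_neg, inner_neg_right]
  simp only [map_add, map_mul, Complex.conj_ofReal, Complex.conj_I, map_ofNat]
  push_cast
  ring

theorem bilinSq_add {h g : Lp ℂ 2 μ} (hd : ∀ᵐ z ∂μ, h z = 0 ∨ g z = 0) :
    bilinSq (h + g) = bilinSq h + bilinSq g := by
  have h1 : ⟪reL h, reL g⟫_ℝ = 0 := real_inner_eq_zero_of_disjoint (by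
    filter_upwards [hd, coeFn_reL h, coeFn_reL g] with z h1 h2 h3
    rw [h2, h3]
    rcases h1 with h1 | h1 <;> simp [h1])
  have h2 : ⟪reL h, imL g⟫_ℝ = 0 := real_inner_eq_zero_of_disjoint (by
    filter_upwards [hd, coeFn_reL h, coeFn_imL g] with z h1 h2 h3
    rw [h2, h3]
    rcases h1 with h1 | h1 <;> simp [h1])
  have h3 : ⟪reL g, imL h⟫_ℝ = 0 := real_inner_eq_zero_of_disjoint (by
    filter_upwards [hd, coeFn_imL h, coeFn_reL g] with z h1 h2 h3
    rw [h2, h3]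
    rcases h1 with h1 | h1 <;> simp [h1])
  have h4 : ⟪imL h, imL g⟫_ℝ = 0 := real_inner_eq_zero_of_disjoint (by
    filter_upwards [hd, coeFn_imL h, coeFn_imL g] with z h1 h2 h3
    rw [h2, h3]
    rcases h1 with h1 | h1 <;> simp [h1])
  unfold bilinSq
  rw [reL_add, imL_add, norm_add_sq_real, norm_add_sq_real, inner_add_left, inner_add_right,
    inner_add_right, h1, h2, h3, h4]
  push_cast
  ring

/-- The exponential functional of white noise, as a function. -/
def gaussExpFun (W : GenProcess 2 μ P) (h : Lp ℂ 2 μ) (ω : Ω) : ℂ :=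
  Complex.exp (cplx W h ω - bilinSq h / 2)

variable [IsProbabilityMeasure P]

theorem IsWhiteNoise.memLp_gaussExpFun (hW : IsWhiteNoise W) (h : Lp ℂ 2 μ) :
    MemLp (gaussExpFun W h) 2 P := by
  have hm : Measurable (gaussExpFun W h) :=
    Complex.measurable_exp.comp ((measurable_cplx W h).sub_const _)
  rw [memLp_two_iff_integrable_sq_norm hm.aestronglyMeasurable]
  have h1 := ((hW.integrable_exp (reL h) 2).norm).const_mul (‖Complex.exp (-bilinSq h / 2)‖ ^ 2)
  refine h1.congr (ae_of_all _ fun ω => ?_)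
  simp only [gaussExpFun, cplx, Complex.norm_exp]
  rw [← Real.exp_nat_mul, ← Real.exp_nat_mul, ← Real.exp_add]
  congr 1
  simp
  ring

/-- The exponential vectors of white noise. -/
def gaussExp (hW : IsWhiteNoise W) (h : Lp ℂ 2 μ) : Lp ℂ 2 P :=
  (hW.memLp_gaussExpFun h).toLp _

theorem coeFn_gaussExp (hW : IsWhiteNoise W) (h : Lp ℂ 2 μ) :
    gaussExp hW h =ᵐ[P] gaussExpFun W h := MemLp.coeFn_toLp _

/-- The integrand is a constant times the exponential of the noise at real argument `Re h + Re g`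
and imaginary argument `Im g - Im h`. In its Laplace–Fourier transform the normalizations cancel the
pure squares and the cross terms form `⟪h, g⟫`. -/
theorem inner_gaussExp (hW : IsWhiteNoise W) (h g : Lp ℂ 2 μ) :
    ⟪gaussExp hW h, gaussExp hW g⟫_ℂ = Complex.exp ⟪h, g⟫_ℂ := by
  have h1 : ⟪gaussExp hW h, gaussExp hW g⟫_ℂ =
      ∫ ω, Complex.exp (-(starRingEnd ℂ) (bilinSq h) / 2 - bilinSq g / 2) *
        Complex.exp ((W (reL h + reL g) ω : ℂ) +
          Complex.I * (W (imL g + (-1 : ℝ) • imL h) ω : ℂ)) ∂P := by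
    rw [L2.inner_def]
    refine integral_congr_ae ?_
    filter_upwards [coeFn_gaussExp hW h, coeFn_gaussExp hW g, W.coeFn_add (reL h) (reL g),
      W.coeFn_add (imL g) ((-1 : ℝ) • imL h), W.coeFn_smul (-1) (imL h)] with ω h1 h2 h3 h4 h5
    rw [h1, h2, h3, h4, h5, RCLike.inner_apply, gaussExpFun, gaussExpFun, ← Complex.exp_conj,
      ← Complex.exp_add, ← Complex.exp_add]
    congr 1
    simp only [cplx, map_sub, map_add, map_mul, Complex.conj_ofReal, Complex.conj_I, map_div₀,
      map_ofNat]
    push_cast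
    ring
  rw [h1, integral_const_mul, hW.integral_exp_add, ← Complex.exp_add, inner_eq_reL_imL]
  congr 1
  unfold bilinSq
  rw [neg_one_smul, ← sub_eq_add_neg, norm_add_sq_real, norm_sub_sq_real, inner_add_left,
    inner_sub_right, inner_sub_right, real_inner_comm (imL h) (imL g),
    real_inner_comm (reL g) (imL h)]
  simp only [map_add, map_mul, Complex.conj_ofReal, Complex.conj_I, map_ofNat]
  push_cast
  ring

theorem isExpSystem_gaussExp (hW : IsWhiteNoise W) : IsExpSystem (gaussExp hW) where
  inner_eq := inner_gaussExp hW
  zero := by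
    have h0 : ∀ᵐ ω ∂P, cplx W 0 ω = 0 := by
      have := cplx_smul_ofReal W 0 (0 : Lp ℂ 2 μ)
      simpa using this
    have h1 : bilinSq (0 : Lp ℂ 2 μ) = 0 := by
      have := bilinSq_smul_ofReal 0 (0 : Lp ℂ 2 μ)
      simpa using this
    filter_upwards [coeFn_gaussExp hW (0 : Lp ℂ 2 μ), h0] with ω h2 h3
    rw [h2, gaussExpFun, h3, h1]
    simp
  mul h g hd := by
    filter_upwards [coeFn_gaussExp hW h, coeFn_gaussExp hW g, coeFn_gaussExp hW (h + g),
      cplx_add W h g] with ω h1 h2 h3 h4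
    rw [h1, h2, h3, gaussExpFun, gaussExpFun, gaussExpFun, h4, bilinSq_add hd, ← Complex.exp_add]
    congr 1
    ring
  star_eq h := by
    refine Lp.ext ?_
    filter_upwards [coeFn_gaussExp hW h, coeFn_gaussExp hW (star h), cplx_star W h,
      Lp.coeFn_star (gaussExp hW h)] with ω h1 h2 h3 h4
    rw [h2, h4, Pi.star_apply, h1, gaussExpFun, gaussExpFun, h3, bilinSq_star]
    rw [Complex.star_def, ← Complex.exp_conj]
    simp only [map_sub, map_div₀, map_ofNat]

/-- For each `ω` this is the derivative at `s = 0` of `exp (s ⟨f, W⟩ - s² ∫ f² / 2)`. Only real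
scalars `1 / (n + 1)` occur, so real linearity of `W` is enough. -/
theorem firstChaos_gaussExp (hW : IsWhiteNoise W) (f : Lp ℂ 2 μ) :
    (isExpSystem_gaussExp hW).firstChaos f =ᵐ[P] cplx W f := by
  refine (isExpSystem_gaussExp hW).firstChaos_ae_eq ?_
  have h1 : ∀ᵐ ω ∂P, ∀ n : ℕ, gaussExp hW (((n : ℂ) + 1)⁻¹ • f) ω =
      Complex.exp (((n : ℂ) + 1)⁻¹ * cplx W f ω - (((n : ℂ) + 1)⁻¹) ^ 2 * bilinSq f / 2) := by
    rw [ae_all_iff]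
    intro n
    have h0 : ((n : ℂ) + 1)⁻¹ = ((((n : ℝ) + 1)⁻¹ : ℝ) : ℂ) := by push_cast; rfl
    filter_upwards [coeFn_gaussExp hW (((n : ℂ) + 1)⁻¹ • f),
      cplx_smul_ofReal W (((n : ℝ) + 1)⁻¹) f] with ω h1 h2
    rw [h1, gaussExpFun, h0, h2, bilinSq_smul_ofReal]
  filter_upwards [h1] with ω h1
  simp only [h1]
  have hd : HasDerivAt (fun s : ℂ => Complex.exp (s * cplx W f ω - s ^ 2 * bilinSq f / 2))
      (cplx W f ω) 0 := by
    have : HasDerivAt (fun s : ℂ => Complex.exp (s * cplx W f ω - s ^ 2 * bilinSq f / 2))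
        (Complex.exp (0 * cplx W f ω - 0 ^ 2 * bilinSq f / 2) *
          (1 * cplx W f ω - (((2 : ℕ) : ℂ) * 0 ^ (2 - 1) * 1) * bilinSq f / 2)) 0 := by
      refine HasDerivAt.cexp ?_
      exact ((hasDerivAt_id (0 : ℂ)).mul_const _).sub
        ((((hasDerivAt_id (0 : ℂ)).pow 2).mul_const _).div_const _)
    simpa using this
  have hs := hd.tendsto_slope_zero
  have ht : Tendsto (fun n : ℕ => ((n : ℂ) + 1)⁻¹) atTop (𝓝[≠] 0) := by
    rw [tendsto_nhdsWithin_iff]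
    refine ⟨?_, Eventually.of_forall fun n => inv_ne_zero (Nat.cast_add_one_ne_zero n)⟩
    have := tendsto_one_div_add_atTop_nhds_zero_nat (𝕜 := ℂ)
    simpa using this
  refine (hs.comp ht).congr fun n => ?_
  simp

/-- For real `b` supported in `B`, the exponential vector of `i b` is a nonzero constant times `exp
(i ⟨b, W⟩)`. Such exponentials are total in `L²` of the σ-field, so no functional over `B` is
orthogonal to all exponential vectors. -/
theorem represents_gaussExp (hW : IsWhiteNoise W) (B : Set Z) :
    Represents (W.sigma B) (gaussExp hW) B where
  le := W.sigma_le B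
  eq := by
    refine le_antisymm (fun f hf => ?_) (expSpace_le (isClosed_lpMeas (W.sigma_le B)) fun h hh => ?_)
    · have : CompleteSpace (expSpace (gaussExp hW) B) :=
        (isClosed_expSpace (gaussExp hW) B).completeSpace_coe
      set p : Lp ℂ 2 P := (expSpace (gaussExp hW) B).starProjection f with hp
      have hpm : p ∈ expSpace (gaussExp hW) B := Submodule.starProjection_apply_mem _ _
      have hle : expSpace (gaussExp hW) B ≤ lpMeas ℂ ℂ (W.sigma B) 2 P := by
        refine expSpace_le (isClosed_lpMeas (W.sigma_le B)) fun h hh => ?_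
        rw [mem_lpMeas_iff_aestronglyMeasurable]
        refine AEStronglyMeasurable.congr ?_ (coeFn_gaussExp hW h).symm
        exact ((Complex.measurable_exp.comp
          ((measurable_sigma_cplx W hh).sub_const _)).stronglyMeasurable).aestronglyMeasurable
      have hz : f - p = 0 := by
        refine eq_zero_of_inner_exp_eq_zero
          (Y := fun (a : {a : Lp ℝ 2 μ // ∀ᵐ z ∂μ, z ∉ B → a z = 0}) ω => W a.1 ω)
          (fun a => W.measurable a.1) ?_ fun s c => ?_
        · rw [← W.sigma_eq_iSup]
          refine (mem_lpMeas_iff_aestronglyMeasurable (𝕜 := ℂ)).1 ?_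
          exact Submodule.sub_mem (lpMeas ℂ ℂ (W.sigma B) 2 P) hf (hle hpm)
        -- The sign compensates for the conjugation of the left entry of the inner product.
        · set b : Lp ℝ 2 μ := ∑ i ∈ s, (-c i) • i.1 with hb
          have hbB : ∀ᵐ z ∂μ, z ∉ B → b z = 0 := by
            rw [hb]
            have : (∑ i ∈ s, (-c i) • i.1) ∈ {a : Lp ℝ 2 μ | ∀ᵐ z ∂μ, z ∉ B → a z = 0} := by
              refine Finset.sum_induction _ (fun a => a ∈ {a : Lp ℝ 2 μ | ∀ᵐ z ∂μ, z ∉ B → a z = 0})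
                ?_ ?_ ?_
              · intro a b ha hb
                filter_upwards [ha, hb, Lp.coeFn_add a b] with z h1 h2 h3 hz
                rw [h3, Pi.add_apply, h1 hz, h2 hz, add_zero]
              · filter_upwards [Lp.coeFn_zero ℝ 2 μ] with z h1 _
                exact h1
              · intro i _
                filter_upwards [i.2, Lp.coeFn_smul (-c i) i.1] with z h1 h2 hz
                rw [h2, Pi.smul_apply, h1 hz, smul_zero]
            exact this
          have hsup : SupportedIn (Complex.I • ofRealL b) B := by
            refine SupportedIn.smul ?_ _
            filter_upwards [hbB, coeFn_ofRealL b] with z h1 h2 hz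
            rw [h2, h1 hz, Complex.ofReal_zero]
          have h0 : ⟪gaussExp hW (Complex.I • ofRealL b), f - p⟫_ℂ = 0 := by
            have := Submodule.sub_starProjection_mem_orthogonal (K := expSpace (gaussExp hW) B) f
            exact (Submodule.mem_orthogonal _ _).1 this _ (mem_expSpace _ hsup)
          rw [L2.inner_def] at h0
          have h1 : ∫ ω, ⟪gaussExp hW (Complex.I • ofRealL b) ω, (f - p : Lp ℂ 2 P) ω⟫_ℂ ∂P =
              ∫ ω, (starRingEnd ℂ) (Complex.exp (-bilinSq (Complex.I • ofRealL b) / 2)) *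
                (Complex.exp (Complex.I * ((∑ i ∈ s, c i * W i.1 ω : ℝ) : ℂ)) *
                  (f - p : Lp ℂ 2 P) ω) ∂P := by
            refine integral_congr_ae ?_
            filter_upwards [coeFn_gaussExp hW (Complex.I • ofRealL b), W.coeFn_zero,
              W.coeFn_sum s (fun i => -c i) fun i => i.1] with ω h1 h2 h3
            rw [h1, RCLike.inner_apply, gaussExpFun, cplx, reL_I_smul_ofRealL, imL_I_smul_ofRealL,
              h2, hb, h3, ← mul_assoc, ← Complex.exp_conj, ← Complex.exp_conj, ← Complex.exp_add,
              mul_comm]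
            congr 2
            simp only [map_sub, map_add, map_mul, Complex.conj_ofReal, Complex.conj_I, map_div₀,
              map_neg, Finset.sum_neg_distrib, neg_mul]
            push_cast
            simp
            ring
          rw [h1, integral_const_mul] at h0
          refine (mul_eq_zero.1 h0).resolve_left ?_
          rw [← Complex.exp_conj]
          exact Complex.exp_ne_zero _
      rw [sub_eq_zero.1 hz]
      exact hpm
    · rw [mem_lpMeas_iff_aestronglyMeasurable]
      refine AEStronglyMeasurable.congr ?_ (coeFn_gaussExp hW h).symm
      exact ((Complex.measurable_exp.comp
        ((measurable_sigma_cplx W hh).sub_const _)).stronglyMeasurable).aestronglyMeasurable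

/-- The exponential vector of a real function. -/
theorem gaussExp_ofRealL (hW : IsWhiteNoise W) (a : Lp ℝ 2 μ) :
    ∀ᵐ ω ∂P, gaussExp hW (ofRealL a) ω = (Real.exp (W a ω - ‖a‖ ^ 2 / 2) : ℂ) := by
  filter_upwards [coeFn_gaussExp hW (ofRealL a), W.coeFn_zero] with ω h1 h2
  rw [h1, gaussExpFun, cplx, bilinSq, reL_ofRealL, imL_ofRealL, h2]
  simp

end GaussExp


/-! ### Multiplicative functionals of a configuration -/

namespace Configuration

section Measure

variable {Z : Type*} [MeasurableSpace Z] (κ : Configuration Z)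

/-- The configuration as an integer-valued measure. -/
def toMeasure : Measure Z := Measure.sum fun z => (κ.mult z : ℝ≥0∞) • Measure.dirac z

theorem lintegral_toMeasure {f : Z → ℝ≥0∞} (hf : Measurable f) :
    ∫⁻ z, f z ∂κ.toMeasure = ∑' z, (κ.mult z : ℝ≥0∞) * f z := by
  rw [toMeasure, lintegral_sum_measure]
  refine tsum_congr fun z => ?_
  rw [lintegral_smul_measure, lintegral_dirac' _ hf, smul_eq_mul]

theorem toMeasure_apply {B : Set Z} (hB : MeasurableSet B) : κ.toMeasure B = κ.count B := by
  rw [← lintegral_indicator_one hB, lintegral_toMeasure κ (measurable_one.indicator hB), count,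
    tsum_subtype B fun z => (κ.mult z : ℝ≥0∞)]
  refine tsum_congr fun z => ?_
  by_cases hz : z ∈ B <;> simp [hz]

end Measure

variable {Z : Type*} (κ : Configuration Z)

/-- The integer number of points in `B`; it is `0` if there are infinitely many. -/
def num (B : Set Z) : ℕ := ⌊(κ.count B).toReal⌋₊

theorem finite_support_of_count_ne_top {B : Set Z} (h : κ.count B ≠ ∞) :
    {z | z ∈ B ∧ κ.mult z ≠ 0}.Finite := by
  rw [count, tsum_subtype B fun z => (κ.mult z : ℝ≥0∞)] at h
  refine (ENNReal.finite_const_le_of_tsum_ne_top h one_ne_zero).subset fun z hz => ?_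
  simp only [Set.mem_ofPred_eq, Set.indicator_of_mem hz.1]
  exact_mod_cast Nat.one_le_iff_ne_zero.2 hz.2

theorem count_eq_sum {B : Set Z} {T : Finset Z} (hT : ∀ z, z ∈ T ↔ z ∈ B ∧ κ.mult z ≠ 0) :
    κ.count B = (∑ z ∈ T, κ.mult z : ℕ) := by
  rw [count, tsum_subtype B fun z => (κ.mult z : ℝ≥0∞), tsum_eq_sum (s := T)]
  · push_cast
    refine Finset.sum_congr rfl fun z hz => ?_
    rw [Set.indicator_of_mem ((hT z).1 hz).1]
  · intro z hz
    by_cases hB : z ∈ B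
    · have : κ.mult z = 0 := by
        by_contra h0
        exact hz ((hT z).2 ⟨hB, h0⟩)
      simp [this]
    · simp [hB]

theorem coe_num {B : Set Z} (h : κ.count B ≠ ∞) : (κ.num B : ℝ≥0∞) = κ.count B := by
  have hT : ∀ z, z ∈ (κ.finite_support_of_count_ne_top h).toFinset ↔ z ∈ B ∧ κ.mult z ≠ 0 := by
    simp
  rw [num, κ.count_eq_sum hT, ENNReal.toReal_natCast, Nat.floor_natCast]

theorem num_eq_of_count_eq {B : Set Z} {n : ℕ} (h : κ.count B = n) : κ.num B = n := by
  rw [num, h, ENNReal.toReal_natCast, Nat.floor_natCast]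

/-- The multiplicative functional `∏ (1 + h(z_i))`. -/
def expProd (h : Z → ℂ) : ℂ := ∏' z, (1 + h z) ^ κ.mult z

/-- `∑ |h(z_i)| < ∞`. -/
def SummableOn (h : Z → ℂ) : Prop := Summable fun z => (κ.mult z : ℝ) * ‖h z‖

variable {κ}

/-- Combines `(1 + x)^n ≤ exp (n x)` with `1 - u ≤ exp (-u)` at `u = n x`. Summed over the points,
it controls the infinite products by `∑ n x`. -/
theorem one_add_pow_sub_one_le {x : ℝ} (hx : 0 ≤ x) (n : ℕ) :
    (1 + x) ^ n - 1 ≤ n * x * Real.exp (n * x) := by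
  have h1 : (1 + x) ^ n ≤ Real.exp (n * x) := by
    rw [Real.exp_nat_mul]
    exact pow_le_pow_left₀ (by linarith) (by linarith [Real.add_one_le_exp x]) n
  have h2 : 1 - n * x ≤ Real.exp (-(n * x)) := by linarith [Real.add_one_le_exp (-(n * x))]
  have h3 := mul_le_mul_of_nonneg_right h2 (Real.exp_pos (n * x)).le
  rw [← Real.exp_add, neg_add_cancel, Real.exp_zero] at h3
  linarith

theorem norm_one_add_pow_sub_one_le (a : ℂ) {b : ℝ} (hab : ‖a‖ ≤ b) (n : ℕ) :
    ‖(1 + a) ^ n - 1‖ ≤ (1 + b) ^ n - 1 := by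
  have hb : 0 ≤ b := (norm_nonneg a).trans hab
  induction n with
  | zero => simp
  | succ n ih =>
    have h1 : (1 + a) ^ (n + 1) - 1 = ((1 + a) ^ n - 1) * (1 + a) + a := by ring
    have h2 : ‖1 + a‖ ≤ 1 + b := (norm_add_le _ _).trans (by simpa using hab)
    rw [h1]
    calc _ ≤ ‖(1 + a) ^ n - 1‖ * ‖1 + a‖ + ‖a‖ := by
          refine (norm_add_le _ _).trans ?_
          rw [norm_mul]
      _ ≤ ((1 + b) ^ n - 1) * (1 + b) + b :=
          add_le_add (mul_le_mul ih h2 (norm_nonneg _) ((norm_nonneg _).trans ih)) hab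
      _ = _ := by ring

theorem summable_pow_sub_one {b : Z → ℝ} (hb : ∀ z, 0 ≤ b z)
    (hs : Summable fun z => (κ.mult z : ℝ) * b z) :
    Summable fun z => (1 + b z) ^ κ.mult z - 1 := by
  refine Summable.of_nonneg_of_le (fun z => ?_) (fun z => ?_)
    (hs.mul_right (Real.exp (∑' z, (κ.mult z : ℝ) * b z)))
  · linarith [one_le_pow₀ (n := κ.mult z) (by linarith [hb z] : (1 : ℝ) ≤ 1 + b z)]
  · refine (one_add_pow_sub_one_le (hb z) _).trans ?_
    have h0 : ∀ z, 0 ≤ (κ.mult z : ℝ) * b z := fun z => mul_nonneg (Nat.cast_nonneg _) (hb z)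
    exact mul_le_mul_of_nonneg_left (Real.exp_le_exp.2 (hs.le_tsum z fun j _ => h0 j)) (h0 z)

theorem SummableOn.multipliable {h : Z → ℂ} (hs : κ.SummableOn h) :
    Multipliable fun z => (1 + h z) ^ κ.mult z := by
  have h1 : Summable fun z => ‖(1 + h z) ^ κ.mult z - 1‖ :=
    Summable.of_nonneg_of_le (fun z => norm_nonneg _)
      (fun z => norm_one_add_pow_sub_one_le (h z) le_rfl _)
      (summable_pow_sub_one (fun z => norm_nonneg _) hs)
  have h2 := multipliable_one_add_of_summable h1
  simpa using h2

theorem SummableOn.of_le {h g : Z → ℂ} (hg : κ.SummableOn g)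
    (hle : ∀ z, κ.mult z ≠ 0 → ‖h z‖ ≤ ‖g z‖) : κ.SummableOn h := by
  refine Summable.of_nonneg_of_le (fun z => by positivity) (fun z => ?_) hg
  by_cases hz : κ.mult z = 0
  · simp [hz]
  · exact mul_le_mul_of_nonneg_left (hle z hz) (Nat.cast_nonneg _)

theorem SummableOn.congr {h g : Z → ℂ} (hg : κ.SummableOn g)
    (he : ∀ z, κ.mult z ≠ 0 → h z = g z) : κ.SummableOn h :=
  hg.of_le fun z hz => (by rw [he z hz])

theorem SummableOn.add {h g : Z → ℂ} (hh : κ.SummableOn h) (hg : κ.SummableOn g) :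
    κ.SummableOn fun z => h z + g z := by
  refine Summable.of_nonneg_of_le (fun z => by positivity) (fun z => ?_) (Summable.add hh hg)
  rw [← mul_add]
  exact mul_le_mul_of_nonneg_left (norm_add_le _ _) (Nat.cast_nonneg _)

theorem SummableOn.const_mul {h : Z → ℂ} (hh : κ.SummableOn h) (s : ℂ) :
    κ.SummableOn fun z => s * h z := by
  have := Summable.mul_left ‖s‖ hh
  refine this.congr fun z => ?_
  rw [norm_mul]
  ring

/-- At a point of the configuration the multiplicity is at least one, so `‖g‖` there is bounded by
the whole sum for `g`. -/
theorem SummableOn.mul {h g : Z → ℂ} (hh : κ.SummableOn h) (hg : κ.SummableOn g) :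
    κ.SummableOn fun z => h z * g z := by
  refine Summable.of_nonneg_of_le (fun z => by positivity) (fun z => ?_)
    (Summable.mul_right (∑' z, (κ.mult z : ℝ) * ‖g z‖) hh)
  by_cases hz : κ.mult z = 0
  · simp [hz]
  rw [norm_mul, ← mul_assoc]
  refine mul_le_mul_of_nonneg_left ?_ (by positivity)
  refine le_trans ?_ (Summable.le_tsum hg z fun j _ => by positivity)
  have : (1 : ℝ) ≤ κ.mult z := by exact_mod_cast Nat.one_le_iff_ne_zero.2 hz
  nlinarith [norm_nonneg (g z)]

theorem expProd_congr {h g : Z → ℂ} (he : ∀ z, κ.mult z ≠ 0 → h z = g z) :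
    κ.expProd h = κ.expProd g := by
  refine tprod_congr fun z => ?_
  by_cases hz : κ.mult z = 0
  · simp [hz]
  · rw [he z hz]

theorem expProd_zero : κ.expProd (fun _ => 0) = 1 := by simp [expProd]

theorem expProd_mul {h g : Z → ℂ} (hh : κ.SummableOn h) (hg : κ.SummableOn g) :
    κ.expProd h * κ.expProd g = κ.expProd fun z => h z + g z + h z * g z := by
  rw [expProd, expProd, ← hh.multipliable.tprod_mul hg.multipliable]
  refine tprod_congr fun z => ?_
  rw [← mul_pow]
  congr 1
  ring

theorem expProd_add {h g : Z → ℂ} (hh : κ.SummableOn h) (hg : κ.SummableOn g)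
    (hd : ∀ z, κ.mult z ≠ 0 → h z = 0 ∨ g z = 0) :
    κ.expProd (fun z => h z + g z) = κ.expProd h * κ.expProd g := by
  rw [expProd_mul hh hg]
  refine expProd_congr fun z hz => ?_
  rcases hd z hz with h0 | h0 <;> simp [h0]

theorem conj_expProd {h : Z → ℂ} (hh : κ.SummableOn h) :
    (starRingEnd ℂ) (κ.expProd h) = κ.expProd fun z => (starRingEnd ℂ) (h z) := by
  have := hh.multipliable.map_tprod (starRingEnd ℂ) Complex.continuous_conj
  rw [expProd, this]
  refine tprod_congr fun z => ?_
  simp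

theorem expProd_ofReal {h : Z → ℝ} (hh : κ.SummableOn fun z => (h z : ℂ)) :
    κ.expProd (fun z => (h z : ℂ)) = ((∏' z, (1 + h z) ^ κ.mult z : ℝ) : ℂ) ∧
      Multipliable fun z => (1 + h z) ^ κ.mult z := by
  have hm : Multipliable fun z => (1 + h z) ^ κ.mult z := by
    have h1 : Summable fun z => ‖(1 + h z) ^ κ.mult z - 1‖ := by
      refine Summable.of_nonneg_of_le (fun z => norm_nonneg _) (fun z => ?_)
        (summable_pow_sub_one (fun z => norm_nonneg _) hh)
      have := norm_one_add_pow_sub_one_le (h z : ℂ) le_rfl (κ.mult z)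
      rw [← Complex.norm_real]
      push_cast
      exact this
    have h2 := multipliable_one_add_of_summable h1
    simpa using h2
  refine ⟨?_, hm⟩
  have := hm.map_tprod Complex.ofRealHom Complex.continuous_ofReal
  rw [Complex.ofRealHom_eq_coe] at this
  rw [this, expProd]
  refine tprod_congr fun z => ?_
  simp

theorem norm_expProd_le {h : Z → ℂ} {b : Z → ℝ} (hb : κ.SummableOn fun z => (b z : ℂ))
    (hle : ∀ z, ‖h z‖ ≤ b z) : ‖κ.expProd h‖ ≤ ‖κ.expProd fun z => (b z : ℂ)‖ := by
  have hb0 : ∀ z, 0 ≤ b z := fun z => (norm_nonneg _).trans (hle z)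
  have hh : κ.SummableOn h := hb.of_le fun z _ => by
    rw [Complex.norm_real, Real.norm_of_nonneg (hb0 z)]
    exact hle z
  refine le_of_tendsto_of_tendsto' hh.multipliable.hasProd.norm hb.multipliable.hasProd.norm
    fun s => ?_
  refine Finset.prod_le_prod (fun z _ => norm_nonneg _) fun z _ => ?_
  rw [norm_pow, norm_pow]
  refine pow_le_pow_left₀ (norm_nonneg _) ?_ _
  have : ‖(1 : ℂ) + b z‖ = 1 + b z := by
    rw [← Complex.ofReal_one, ← Complex.ofReal_add, Complex.norm_real,
      Real.norm_of_nonneg (by linarith [hb0 z])]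
  rw [this]
  exact (norm_add_le _ _).trans (by simpa using hle z)

theorem tendsto_expProd {h : ℕ → Z → ℂ} {g : Z → ℂ} {b : Z → ℝ}
    (hb : κ.SummableOn fun z => (b z : ℂ)) (hle : ∀ n z, ‖h n z‖ ≤ b z)
    (hlim : ∀ z, Tendsto (fun n => h n z) atTop (𝓝 (g z))) :
    Tendsto (fun n => κ.expProd (h n)) atTop (𝓝 (κ.expProd g)) := by
  have hb0 : ∀ z, 0 ≤ b z := fun z => (norm_nonneg _).trans (hle 0 z)
  have h1 := tendsto_tprod_one_add_of_dominated_convergence (𝓕 := atTop)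
    (f := fun n z => (1 + h n z) ^ κ.mult z - 1) (g := fun z => (1 + g z) ^ κ.mult z - 1)
    (bound := fun z => (1 + b z) ^ κ.mult z - 1)
    (summable_pow_sub_one hb0 (Summable.congr hb fun z => by
      rw [Complex.norm_real, Real.norm_of_nonneg (hb0 z)]))
    (fun z => (((hlim z).const_add 1).pow _).sub_const 1)
    (Eventually.of_forall fun n z => norm_one_add_pow_sub_one_le _ (hle n z) _)
  simpa [expProd] using h1

/-! Second-order estimates -/

/-- The estimates satisfied by a product `p` of factors `1 + a` in terms of the sum `s` of the
terms `a` and the sum `t` of their absolute values. -/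
structure ProdBound (p s : ℂ) (t : ℝ) : Prop where
  second : ‖p - 1 - s‖ ≤ Real.exp t - 1 - t
  sum : ‖s‖ ≤ t
  prod : ‖p‖ ≤ Real.exp t

theorem ProdBound.one_add (a : ℂ) : ProdBound (1 + a) a ‖a‖ where
  second := by
    have := Real.add_one_le_exp ‖a‖
    simp only [add_sub_cancel_left, sub_self, norm_zero]
    linarith
  sum := le_rfl
  prod := (norm_add_le _ _).trans (by simpa [add_comm] using Real.add_one_le_exp ‖a‖)

theorem ProdBound.one : ProdBound 1 0 0 := by simpa using ProdBound.one_add 0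

/-- The error satisfies `pq - 1 - (s + u) = (p - 1 - s) q + (q - 1 - u)(1 + s) + s u`, and the same
identity with `exp t`, `exp v`, `t`, `v` in place of `p`, `q`, `s`, `u` adds up the bounds exactly.
-/
theorem ProdBound.mul {p q s u : ℂ} {t v : ℝ} (h : ProdBound p s t) (k : ProdBound q u v) :
    ProdBound (p * q) (s + u) (t + v) where
  second := by
    have h1 : p * q - 1 - (s + u) = (p - 1 - s) * q + (q - 1 - u) * (1 + s) + s * u := by ring
    have ht : 0 ≤ t := (norm_nonneg _).trans h.sum
    have hv : 0 ≤ v := (norm_nonneg _).trans k.sum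
    have h2 : ‖1 + s‖ ≤ 1 + t := (norm_add_le _ _).trans (by simpa using h.sum)
    rw [h1, Real.exp_add]
    calc _ ≤ ‖p - 1 - s‖ * ‖q‖ + ‖q - 1 - u‖ * ‖1 + s‖ + ‖s‖ * ‖u‖ := by
          refine (norm_add₃_le).trans ?_
          simp only [norm_mul, le_refl]
      _ ≤ (Real.exp t - 1 - t) * Real.exp v + (Real.exp v - 1 - v) * (1 + t) + t * v := by
          gcongr
          · exact (norm_nonneg _).trans h.second
          · exact h.second
          · exact k.prod
          · exact (norm_nonneg _).trans k.second
          · exact k.second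
          · exact h.sum
          · exact k.sum
      _ = _ := by ring
  sum := (norm_add_le _ _).trans (add_le_add h.sum k.sum)
  prod := by
    rw [norm_mul, Real.exp_add]
    exact mul_le_mul h.prod k.prod (norm_nonneg _) (Real.exp_pos _).le

theorem ProdBound.pow (a : ℂ) (n : ℕ) : ProdBound ((1 + a) ^ n) (n * a) (n * ‖a‖) := by
  induction n with
  | zero => simpa using ProdBound.one
  | succ n ih =>
    convert ih.mul (ProdBound.one_add a) using 1 <;> push_cast <;> ring

theorem SummableOn.prodBound {h : Z → ℂ} (hh : κ.SummableOn h) :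
    ProdBound (κ.expProd h) (∑' z, (κ.mult z : ℂ) * h z) (∑' z, (κ.mult z : ℝ) * ‖h z‖) := by
  have hfin : ∀ s : Finset Z, ProdBound (∏ z ∈ s, (1 + h z) ^ κ.mult z)
      (∑ z ∈ s, (κ.mult z : ℂ) * h z) (∑ z ∈ s, (κ.mult z : ℝ) * ‖h z‖) := by
    classical
    intro s
    induction s using Finset.induction_on with
    | empty => simpa using ProdBound.one
    | insert z s hz ih =>
      rw [Finset.prod_insert hz, Finset.sum_insert hz, Finset.sum_insert hz]
      exact (ProdBound.pow _ _).mul ih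
  have h1 : Tendsto (fun s : Finset Z => ∏ z ∈ s, (1 + h z) ^ κ.mult z) atTop
    (𝓝 (κ.expProd h)) := hh.multipliable.hasProd
  have h2 : Tendsto (fun s : Finset Z => ∑ z ∈ s, (κ.mult z : ℂ) * h z) atTop
      (𝓝 (∑' z, (κ.mult z : ℂ) * h z)) := by
    refine Summable.hasSum (Summable.of_norm ?_)
    refine Summable.congr hh fun z => ?_
    simp
  have h3 : Tendsto (fun s : Finset Z => ∑ z ∈ s, (κ.mult z : ℝ) * ‖h z‖) atTop
      (𝓝 (∑' z, (κ.mult z : ℝ) * ‖h z‖)) := Summable.hasSum hh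
  have h4 := (Real.continuous_exp.tendsto _).comp h3
  exact ⟨le_of_tendsto_of_tendsto' ((h1.sub_const 1).sub h2).norm ((h4.sub_const 1).sub h3)
      fun s => (hfin s).second,
    le_of_tendsto_of_tendsto' h2.norm h3 fun s => (hfin s).sum,
    le_of_tendsto_of_tendsto' h1.norm h4 fun s => (hfin s).prod⟩

/-- The second-order estimate bounds the remainder by `exp r - 1 - r` with `r` proportional to
`‖s‖`, which is `O(‖s‖²)`. -/
theorem SummableOn.hasDerivAt_expProd {h : Z → ℂ} (hh : κ.SummableOn h) :
    HasDerivAt (fun s : ℂ => κ.expProd fun z => s * h z) (∑' z, (κ.mult z : ℂ) * h z) 0 := by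
  set t := ∑' z, (κ.mult z : ℝ) * ‖h z‖ with ht
  have ht0 : 0 ≤ t := tsum_nonneg fun z => by positivity
  rw [hasDerivAt_iff_isLittleO]
  have hO : (fun s : ℂ => (κ.expProd fun z => s * h z) - (κ.expProd fun z => 0 * h z) -
      (s - 0) • ∑' z, (κ.mult z : ℂ) * h z) =O[𝓝 0] fun s : ℂ => ‖s‖ ^ 2 := by
    refine Asymptotics.IsBigO.of_bound (t ^ 2) ?_
    have hev : ∀ᶠ s : ℂ in 𝓝 0, ‖s‖ * t ≤ 1 := by
      have : Tendsto (fun s : ℂ => ‖s‖ * t) (𝓝 0) (𝓝 (‖(0 : ℂ)‖ * t)) :=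
        (continuous_norm.mul continuous_const).tendsto _
      rw [norm_zero, zero_mul] at this
      exact this.eventually_le_const one_pos
    filter_upwards [hev] with s hs
    have h1 := (hh.const_mul s).prodBound.second
    have h2 : ∑' z, (κ.mult z : ℝ) * ‖s * h z‖ = ‖s‖ * t := by
      rw [ht, ← tsum_mul_left]
      refine tsum_congr fun z => ?_
      rw [norm_mul]
      ring
    have h3 : ∑' z, (κ.mult z : ℂ) * (s * h z) = s * ∑' z, (κ.mult z : ℂ) * h z := by
      rw [← tsum_mul_left]
      refine tsum_congr fun z => ?_
      ring
    have h4 : (κ.expProd fun z => 0 * h z) = 1 := by simp [expProd]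
    rw [h2, h3] at h1
    rw [h4, sub_zero, smul_eq_mul]
    refine h1.trans ?_
    have h5 := Real.abs_exp_sub_one_sub_id_le (x := ‖s‖ * t)
      (by rw [abs_of_nonneg (by positivity)]; exact hs)
    refine (le_abs_self _).trans (h5.trans ?_)
    rw [Real.norm_of_nonneg (by positivity)]
    nlinarith
  refine hO.trans_isLittleO ?_
  have : (fun s : ℂ => ‖s‖ ^ 2) =o[𝓝 0] fun s : ℂ => ‖s‖ ^ 1 :=
    Asymptotics.isLittleO_norm_pow_norm_pow (by norm_num)
  simp only [pow_one] at this
  simpa using this.of_norm_right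

/-- Differentiates the normalized product at the origin; with `c = ∫ h` the limit is the compensated
sum, so this computes the first chaos configuration by configuration. -/
theorem SummableOn.tendsto_slope {h : Z → ℂ} (hh : κ.SummableOn h) (c : ℂ) :
    Tendsto (fun n : ℕ => ((n : ℂ) + 1) *
      ((κ.expProd fun z => ((n : ℂ) + 1)⁻¹ * h z) * Complex.exp (-(((n : ℂ) + 1)⁻¹ * c)) - 1)) atTop
      (𝓝 ((∑' z, (κ.mult z : ℂ) * h z) - c)) := by
  have h0 : HasDerivAt (fun s : ℂ => Complex.exp (-(s * c))) (-c) 0 := by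
    have := (((hasDerivAt_id (0 : ℂ)).mul_const c).neg).cexp
    simpa using this
  have hd := hh.hasDerivAt_expProd.mul h0
  have h4 : (κ.expProd fun z => 0 * h z) = 1 := by simp [expProd]
  have hs := hd.tendsto_slope_zero
  simp only [h4, Pi.mul_apply, zero_add, zero_mul, neg_zero, Complex.exp_zero, mul_one, one_mul,
    smul_eq_mul, expProd_zero] at hs
  have ht : Tendsto (fun n : ℕ => ((n : ℂ) + 1)⁻¹) atTop (𝓝[≠] 0) := by
    rw [tendsto_nhdsWithin_iff]
    refine ⟨?_, Eventually.of_forall fun n => inv_ne_zero (Nat.cast_add_one_ne_zero n)⟩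
    have := tendsto_one_div_add_atTop_nhds_zero_nat (𝕜 := ℂ)
    simpa using this
  have h5 := hs.comp ht
  rw [← sub_eq_add_neg] at h5
  refine h5.congr fun n => ?_
  simp

/-! Step functions -/

theorem summableOn_indicator {B : Set Z} (hB : κ.count B ≠ ∞) (c : ℂ) :
    κ.SummableOn (B.indicator fun _ => c) := by
  refine summable_of_hasFiniteSupport ((κ.finite_support_of_count_ne_top hB).subset fun z hz => ?_)
  refine ⟨?_, ?_⟩
  · by_contra h0
    simp [h0] at hz
  · intro h0
    simp [h0] at hz

theorem expProd_indicator {B : Set Z} (hB : κ.count B ≠ ∞) (c : ℂ) :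
    κ.expProd (B.indicator fun _ => c) = (1 + c) ^ κ.num B := by
  have hT : ∀ z, z ∈ (κ.finite_support_of_count_ne_top hB).toFinset ↔ z ∈ B ∧ κ.mult z ≠ 0 := by
    simp
  rw [expProd, κ.num_eq_of_count_eq (κ.count_eq_sum hT), ← Finset.prod_pow_eq_pow_sum,
    tprod_eq_prod (s := (κ.finite_support_of_count_ne_top hB).toFinset)]
  · refine Finset.prod_congr rfl fun z hz => ?_
    rw [Set.indicator_of_mem ((hT z).1 hz).1]
  · intro z hz
    by_cases hzB : z ∈ B
    · have : κ.mult z = 0 := by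
        by_contra h0
        exact hz ((hT z).2 ⟨hzB, h0⟩)
      simp [this]
    · simp [hzB]

theorem expProd_sum_indicator {ι : Type*} (s : Finset ι) (B : ι → Set Z) (c : ι → ℂ)
    (hB : ∀ i ∈ s, κ.count (B i) ≠ ∞) (hd : (s : Set ι).PairwiseDisjoint B) :
    κ.SummableOn (fun z => ∑ i ∈ s, (B i).indicator (fun _ => c i) z) ∧
    κ.expProd (fun z => ∑ i ∈ s, (B i).indicator (fun _ => c i) z) =
      ∏ i ∈ s, (1 + c i) ^ κ.num (B i) := by
  classical
  induction s using Finset.induction_on with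
  | empty => simp [expProd_zero, SummableOn]
  | insert i s hi ih =>
    obtain ⟨h1, h2⟩ := ih (fun j hj => hB j (Finset.mem_insert_of_mem hj))
      (hd.subset (by simp))
    simp only [Finset.sum_insert hi, Finset.prod_insert hi]
    have h3 := summableOn_indicator (hB i (Finset.mem_insert_self _ _)) (c i)
    refine ⟨h3.add h1, ?_⟩
    rw [expProd_add h3 h1, h2, expProd_indicator (hB i (Finset.mem_insert_self _ _))]
    intro z _
    by_cases hz : z ∈ B i
    · right
      refine Finset.sum_eq_zero fun j hj => ?_
      have hij : i ≠ j := fun h => hi (h ▸ hj)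
      have := hd (by simp) (by simp [hj]) hij
      rw [Set.indicator_of_notMem (Set.disjoint_left.1 this hz)]
    · left
      simp [hz]

end Configuration


/-! ### Moments of Poisson processes -/

section Poisson

variable {Z Ω : Type*} [MeasurableSpace Z] [MeasurableSpace Ω] {μ : Measure Z} {P : Measure Ω}
  {N : Ω → Configuration Z}

theorem lintegral_cast_poissonMeasure (r : NNReal) :
    ∫⁻ n : ℕ, (n : ℝ≥0∞) ∂poissonMeasure r = r := by
  rw [poissonMeasure, lintegral_sum_measure]
  simp only [lintegral_smul_measure, lintegral_dirac, smul_eq_mul]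
  rw [tsum_eq_zero_add' ENNReal.summable]
  have h1 : ∀ n : ℕ, ENNReal.ofReal (Real.exp (-r) * (r : ℝ) ^ (n + 1) / ((n + 1).factorial : ℝ)) *
      ((n + 1 : ℕ) : ℝ≥0∞) =
      r * ENNReal.ofReal (Real.exp (-r) * (r : ℝ) ^ n / (n.factorial : ℝ)) := by
    intro n
    rw [← ENNReal.ofReal_natCast, ← ENNReal.ofReal_mul (by positivity),
      ← ENNReal.ofReal_coe_nnreal, ← ENNReal.ofReal_mul (NNReal.coe_nonneg r)]
    congr 1
    rw [Nat.factorial_succ]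
    have : (n.factorial : ℝ) ≠ 0 := by positivity
    push_cast
    field_simp
    ring
  simp only [h1]
  rw [ENNReal.tsum_mul_left]
  have h2 : ∑' n : ℕ, ENNReal.ofReal (Real.exp (-r) * (r : ℝ) ^ n / (n.factorial : ℝ)) = 1 := by
    rw [← ENNReal.ofReal_tsum_of_nonneg (fun n => by positivity)
      (hasSum_one_poissonMeasure r).summable, (hasSum_one_poissonMeasure r).tsum_eq,
      ENNReal.ofReal_one]
  rw [h2]
  simp

theorem integral_pow_poissonMeasure (r : NNReal) (c : ℂ) :
    ∫ n : ℕ, (1 + c) ^ n ∂poissonMeasure r = Complex.exp (c * r) := by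
  rw [integral_poissonMeasure]
  have h1 : ∀ n : ℕ, (Real.exp (-r) * (r : ℝ) ^ n / (n.factorial : ℝ)) • (1 + c) ^ n =
      Complex.exp (-r) * ((r * (1 + c)) ^ n / (n.factorial : ℂ)) := by
    intro n
    rw [Complex.real_smul]
    push_cast
    rw [mul_pow]
    ring
  simp only [h1]
  rw [tsum_mul_left, (NormedSpace.expSeries_div_hasSum_exp ((r : ℂ) * (1 + c))).tsum_eq,
    ← Complex.exp_eq_exp_ℂ, ← Complex.exp_add]
  congr 1
  ring

theorem measurable_num {m : MeasurableSpace Ω} {B : Set Z}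
    (h : Measurable[m] fun ω => (N ω).count B) : Measurable[m] fun ω => (N ω).num B :=
  (Nat.measurable_floor.comp ENNReal.measurable_toReal).comp h

theorem Configuration.measurable_toMeasure
    (hN : ∀ B, MeasurableSet B → Measurable fun ω => (N ω).count B) :
    Measurable fun ω => (N ω).toMeasure := by
  refine Measure.measurable_of_measurable_coe _ fun B hB => ?_
  simp only [Configuration.toMeasure_apply _ hB]
  exact hN B hB

theorem Configuration.measurable_tsum
    (hN : ∀ B, MeasurableSet B → Measurable fun ω => (N ω).count B)
    {f : Z → ℝ≥0∞} (hf : Measurable f) :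
    Measurable fun ω => ∑' z, ((N ω).mult z : ℝ≥0∞) * f z := by
  have := (Measure.measurable_lintegral hf).comp (measurable_toMeasure hN)
  convert this using 1
  ext ω
  exact (Configuration.lintegral_toMeasure _ hf).symm

/-- Serves measurability in `ω`: the sum runs over an arbitrary set `Z` and no enumeration of the
points is chosen, but sums with values in `ℝ≥0∞` are integrals against the random measure. The value
`0` is the convention for a divergent real sum. -/
theorem Configuration.tsum_real_eq (κ : Configuration Z) (u : Z → ℝ) :
    ∑' z, (κ.mult z : ℝ) * u z =
      if ∑' z, (κ.mult z : ℝ≥0∞) * ENNReal.ofReal (u z) ≠ ∞ ∧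
          ∑' z, (κ.mult z : ℝ≥0∞) * ENNReal.ofReal (-u z) ≠ ∞ then
        (∑' z, (κ.mult z : ℝ≥0∞) * ENNReal.ofReal (u z)).toReal -
          (∑' z, (κ.mult z : ℝ≥0∞) * ENNReal.ofReal (-u z)).toReal
      else 0 := by
  have hle : ∀ v : Z → ℝ, (Summable fun z => (κ.mult z : ℝ) * v z) →
      ∑' z, (κ.mult z : ℝ≥0∞) * ENNReal.ofReal (v z) ≠ ∞ := by
    intro v hv
    refine ne_top_of_le_ne_top hv.abs.tsum_ofReal_ne_top (ENNReal.tsum_le_tsum fun z => ?_)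
    rw [← ENNReal.ofReal_natCast, ← ENNReal.ofReal_mul (Nat.cast_nonneg _)]
    exact ENNReal.ofReal_le_ofReal (le_abs_self _)
  split_ifs with h
  · have h1 := ENNReal.summable_toReal h.1
    have h2 := ENNReal.summable_toReal h.2
    have hfin : ∀ (r : ℝ) (z : Z), (κ.mult z : ℝ≥0∞) * ENNReal.ofReal r ≠ ∞ := fun r z =>
      ENNReal.mul_ne_top (ENNReal.natCast_ne_top _) ENNReal.ofReal_ne_top
    rw [ENNReal.tsum_toReal_eq fun z => hfin _ z, ENNReal.tsum_toReal_eq fun z => hfin _ z,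
      ← h1.tsum_sub h2]
    refine tsum_congr fun z => ?_
    rw [ENNReal.toReal_mul, ENNReal.toReal_mul, ENNReal.toReal_natCast, ENNReal.toReal_ofReal',
      ENNReal.toReal_ofReal', ← mul_sub, max_zero_sub_max_neg_zero_eq_self]
  · refine tsum_eq_zero_of_not_summable fun hs => h ⟨hle _ hs, hle _ ?_⟩
    simpa using hs.neg

theorem Configuration.measurable_tsum_real
    (hN : ∀ B, MeasurableSet B → Measurable fun ω => (N ω).count B) {u : Z → ℝ}
    (hu : Measurable u) : Measurable fun ω => ∑' z, ((N ω).mult z : ℝ) * u z := by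
  have h1 := measurable_tsum hN hu.ennreal_ofReal
  have h2 := measurable_tsum hN hu.neg.ennreal_ofReal
  simp only [tsum_real_eq]
  refine Measurable.ite ?_ (h1.ennreal_toReal.sub h2.ennreal_toReal) measurable_const
  exact (h1 (measurableSet_singleton ∞)).compl.inter (h2 (measurableSet_singleton ∞)).compl

namespace IsPoissonProcess

variable (hN : IsPoissonProcess μ P N)
include hN

theorem measurable_num {B : Set Z} (hB : MeasurableSet B) : Measurable fun ω => (N ω).num B :=
  LevyGauss.measurable_num (hN.measurable B hB)

variable [IsProbabilityMeasure P]

/-- The Poisson probabilities add up to `1`, leaving no mass for other values of the count. -/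
theorem ae_count_eq_num {B : Set Z} (hB : MeasurableSet B) (hμ : μ B ≠ ∞) :
    ∀ᵐ ω ∂P, (N ω).count B = (N ω).num B := by
  set S : ℕ → Set Ω := fun n => {ω | (N ω).count B = n} with hS
  have hm : ∀ n, MeasurableSet (S n) := fun n => hN.measurable B hB (measurableSet_singleton _)
  have hd : Pairwise (Function.onFun Disjoint S) := by
    intro i j hij
    refine Set.disjoint_left.2 fun ω h1 h2 => hij ?_
    have h1' : (N ω).count B = i := h1
    rw [show (N ω).count B = j from h2] at h1'
    exact_mod_cast h1'.symm
  have h1 : P (⋃ n, S n) = 1 := by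
    rw [measure_iUnion hd hm]
    simp only [hS, hN.law B hB hμ]
    have := hasSum_one_poissonMeasure (μ B).toNNReal
    rw [← ENNReal.ofReal_one, ← this.tsum_eq, ENNReal.ofReal_tsum_of_nonneg
      (fun n => by positivity) this.summable]
    rfl
  have h2 : ∀ᵐ ω ∂P, ω ∈ ⋃ n, S n :=
    (mem_ae_iff_prob_eq_one (MeasurableSet.iUnion hm)).2 h1
  filter_upwards [h2] with ω hω
  obtain ⟨n, hn⟩ := Set.mem_iUnion.1 hω
  have hn' : (N ω).count B = n := hn
  rw [(N ω).num_eq_of_count_eq hn', hn']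

theorem ae_count_ne_top {B : Set Z} (hB : MeasurableSet B) (hμ : μ B ≠ ∞) :
    ∀ᵐ ω ∂P, (N ω).count B ≠ ∞ := by
  filter_upwards [hN.ae_count_eq_num hB hμ] with ω h
  rw [h]
  exact ENNReal.natCast_ne_top _

theorem map_num {B : Set Z} (hB : MeasurableSet B) (hμ : μ B ≠ ∞) :
    P.map (fun ω => (N ω).num B) = poissonMeasure (μ B).toNNReal := by
  refine Measure.ext_of_singleton fun n => ?_
  rw [Measure.map_apply (hN.measurable_num hB) (measurableSet_singleton _),
    poissonMeasure_singleton]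
  refine Eq.trans ?_ (hN.law B hB hμ n)
  refine measure_congr ?_
  filter_upwards [hN.ae_count_eq_num hB hμ] with ω h
  refine propext ?_
  change (N ω).num B = n ↔ (N ω).count B = n
  rw [h]
  exact_mod_cast Iff.rfl

theorem integral_pow_num {B : Set Z} (hB : MeasurableSet B) (hμ : μ B ≠ ∞) (c : ℂ) :
    ∫ ω, (1 + c) ^ (N ω).num B ∂P = Complex.exp (c * μ.real B) := by
  have h := integral_map (μ := P) (hN.measurable_num hB).aemeasurable
    (f := fun n : ℕ => (1 + c) ^ n) (by fun_prop)
  rw [← h, hN.map_num hB hμ, integral_pow_poissonMeasure]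
  rfl

theorem lintegral_count_of_ne_top {B : Set Z} (hB : MeasurableSet B) (hμ : μ B ≠ ∞) :
    ∫⁻ ω, (N ω).count B ∂P = μ B := by
  rw [lintegral_congr_ae (hN.ae_count_eq_num hB hμ),
    ← lintegral_map (f := fun n : ℕ => (n : ℝ≥0∞)) (by fun_prop) (hN.measurable_num hB),
    hN.map_num hB hμ, lintegral_cast_poissonMeasure, ENNReal.coe_toNNReal hμ]

theorem measurable_toMeasure : Measurable fun ω => (N ω).toMeasure :=
  Configuration.measurable_toMeasure hN.measurable

variable [SigmaFinite μ]

/-- The mean measure of a Poisson process is `μ`. -/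
theorem bind_eq : P.bind (fun ω => (N ω).toMeasure) = μ := by
  have hfin : ∀ B, MeasurableSet B → μ B ≠ ∞ → P.bind (fun ω => (N ω).toMeasure) B = μ B := by
    intro B hB hμ
    rw [Measure.bind_apply hB hN.measurable_toMeasure.aemeasurable]
    simp only [Configuration.toMeasure_apply _ hB]
    exact hN.lintegral_count_of_ne_top hB hμ
  refine Measure.ext fun B hB => ?_
  set S := disjointed (spanningSets μ) with hS
  have hSm : ∀ n, MeasurableSet (S n) := fun n =>
    MeasurableSet.disjointed (measurableSet_spanningSets μ) n
  have hU : B = ⋃ n, B ∩ S n := by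
    rw [← Set.inter_iUnion, hS, iUnion_disjointed, iUnion_spanningSets, Set.inter_univ]
  have hd : Pairwise (Function.onFun Disjoint fun n => B ∩ S n) := fun i j hij =>
    ((disjoint_disjointed (spanningSets μ)) hij).mono Set.inter_subset_right Set.inter_subset_right
  rw [hU, measure_iUnion hd fun n => hB.inter (hSm n), measure_iUnion hd fun n => hB.inter (hSm n)]
  refine tsum_congr fun n => hfin _ (hB.inter (hSm n)) ?_
  refine ne_top_of_le_ne_top (measure_spanningSets_lt_top μ n).ne (measure_mono ?_)
  exact Set.inter_subset_right.trans (disjointed_subset _ _)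

/-- Campbell's formula. -/
theorem lintegral_tsum {f : Z → ℝ≥0∞} (hf : Measurable f) :
    ∫⁻ ω, ∑' z, ((N ω).mult z : ℝ≥0∞) * f z ∂P = ∫⁻ z, f z ∂μ := by
  conv_rhs => rw [← hN.bind_eq]
  rw [Measure.lintegral_bind hN.measurable_toMeasure.aemeasurable hf.aemeasurable]
  refine lintegral_congr fun ω => ?_
  rw [Configuration.lintegral_toMeasure _ hf]

theorem measurable_tsum {f : Z → ℝ≥0∞} (hf : Measurable f) :
    Measurable fun ω => ∑' z, ((N ω).mult z : ℝ≥0∞) * f z :=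
  Configuration.measurable_tsum hN.measurable hf

/-- Almost surely, no points of the process lie in a given null set. -/
theorem ae_forall {p : Z → Prop} (hp : ∀ᵐ z ∂μ, p z) :
    ∀ᵐ ω ∂P, ∀ z, (N ω).mult z ≠ 0 → p z := by
  obtain ⟨T, hT, hTm, hT0⟩ := exists_measurable_superset_of_null (ae_iff.1 hp)
  have h1 : ∫⁻ ω, (N ω).count T ∂P = 0 := by
    rw [hN.lintegral_count_of_ne_top hTm (by simp [hT0]), hT0]
  rw [lintegral_eq_zero_iff (hN.measurable T hTm)] at h1
  filter_upwards [h1] with ω hω z hz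
  by_contra hpz
  have hzT : z ∈ T := hT hpz
  have h2 : (N ω).count T = 0 := hω
  rw [Configuration.count, ENNReal.tsum_eq_zero] at h2
  exact hz (by exact_mod_cast h2 ⟨z, hzT⟩)

theorem ae_summableOn {h : Z → ℂ} (hh : Integrable h μ) : ∀ᵐ ω ∂P, (N ω).SummableOn h := by
  obtain ⟨g, hg, hgh⟩ := hh.1
  have hgi : Integrable g μ := hh.congr hgh
  have h1 : ∫⁻ ω, ∑' z, ((N ω).mult z : ℝ≥0∞) * ‖g z‖ₑ ∂P ≠ ∞ := by
    rw [hN.lintegral_tsum hg.enorm]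
    exact hgi.2.ne
  have h2 := ae_lt_top (hN.measurable_tsum hg.enorm) h1
  filter_upwards [h2, hN.ae_forall hgh] with ω hω he
  refine Configuration.SummableOn.congr ?_ he
  have h3 := ENNReal.summable_toReal hω.ne
  refine h3.congr fun z => ?_
  rw [ENNReal.toReal_mul, ENNReal.toReal_natCast, toReal_enorm]

theorem ae_expProd_congr {h g : Z → ℂ} (hhg : h =ᵐ[μ] g) :
    ∀ᵐ ω ∂P, (N ω).expProd h = (N ω).expProd g := by
  filter_upwards [hN.ae_forall hhg] with ω hω
  exact Configuration.expProd_congr hω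

end IsPoissonProcess

end Poisson


/-! ### Expectation of multiplicative functionals of a Poisson process -/

section PoissonExp

variable {Z Ω : Type*} [MeasurableSpace Z] [MeasurableSpace Ω] {μ : Measure Z} {P : Measure Ω}
  {N : Ω → Configuration Z}

theorem configSigma_mono (N : Ω → Configuration Z) {B C : Set Z} (h : B ⊆ C) :
    configSigma N B ≤ configSigma N C :=
  iSup_mono fun D => iSup_mono fun hD => iSup_le fun hDB =>
    le_iSup_of_le (hDB.trans h) le_rfl

theorem measurable_configSigma_count (N : Ω → Configuration Z) {B C : Set Z}
    (hC : MeasurableSet C) (h : C ⊆ B) :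
    Measurable[configSigma N B] fun ω => (N ω).count C :=
  (comap_measurable _).mono (le_iSup_of_le C (le_iSup_of_le hC (le_iSup_of_le h le_rfl))) le_rfl

theorem simpleFunc_eq_sum (S : SimpleFunc Z ℂ) (z : Z) :
    S z = ∑ c ∈ S.range with c ≠ 0, (S ⁻¹' {c}).indicator (fun _ => c) z := by
  classical
  have h1 : ∀ c ∈ S.range.filter (· ≠ 0), (S ⁻¹' {c}).indicator (fun _ => c) z =
      if S z = c then c else 0 := fun c _ => by
    simp [Set.indicator_apply]
  rw [Finset.sum_congr rfl h1, Finset.sum_ite_eq]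
  by_cases h0 : S z = 0
  · simp [h0]
  · simp [h0]

namespace IsPoissonProcess

variable (hN : IsPoissonProcess μ P N)
include hN

theorem configSigma_le (B : Set Z) : configSigma N B ≤ ‹MeasurableSpace Ω› :=
  iSup_le fun C => iSup_le fun hC => iSup_le fun _ => (hN.measurable C hC).comap_le

variable [IsProbabilityMeasure P]

theorem integral_prod_pow_num {ι : Type*} [Fintype ι] (B : ι → Set Z) (c : ι → ℂ)
    (hB : ∀ i, MeasurableSet (B i)) (hμ : ∀ i, μ (B i) ≠ ∞)
    (hd : Pairwise fun i j => Disjoint (B i) (B j)) :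
    ∫ ω, ∏ i, (1 + c i) ^ (N ω).num (B i) ∂P = Complex.exp (∑ i, c i * μ.real (B i)) := by
  have e := Fintype.equivFin ι
  have h1 := hN.indep (Fintype.card ι) (fun k => B (e.symm k)) (fun k => hB _)
    fun i j hij => hd fun h => hij (e.symm.injective h)
  have h2 : iIndepFun (fun i ω => (N ω).count (B i)) P := by
    have := h1.precomp e.injective
    simpa using this
  have h3 := h2.integral_fun_prod_comp (f := fun i (x : ℝ≥0∞) => (1 + c i) ^ ⌊x.toReal⌋₊)
    (fun i => (hN.measurable _ (hB i)).aemeasurable)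
    (fun i => ((measurable_from_nat (f := fun n : ℕ => (1 + c i) ^ n)).comp
      (Nat.measurable_floor.comp ENNReal.measurable_toReal)).aestronglyMeasurable)
  rw [Complex.exp_sum]
  refine h3.trans (Finset.prod_congr rfl fun i _ => ?_)
  exact hN.integral_pow_num (hB i) (hμ i) (c i)

/-- Multiplicative functionals of step functions. -/
theorem exists_simpleFunc {S : SimpleFunc Z ℂ} (hS : Integrable S μ) :
    ∃ F : Ω → ℂ, Measurable[configSigma N (Function.support S)] F ∧
      (∀ᵐ ω ∂P, (N ω).expProd S = F ω) ∧ Integrable F P ∧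
      ∫ ω, F ω ∂P = Complex.exp (∫ z, S z ∂μ) := by
  classical
  set s := S.range.filter (· ≠ 0) with hs
  have hμ : ∀ c ∈ s, μ (S ⁻¹' {c}) ≠ ∞ := fun c hc =>
    (S.measure_preimage_lt_top_of_integrable hS (Finset.mem_filter.1 hc).2).ne
  have hd : Pairwise fun c c' : ℂ => Disjoint (S ⁻¹' {c}) (S ⁻¹' {c'}) := fun c c' hcc =>
    Disjoint.preimage _ (Set.disjoint_singleton.2 hcc)
  set F : Ω → ℂ := fun ω => ∏ c ∈ s, (1 + c) ^ (N ω).num (S ⁻¹' {c}) with hF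
  have hint : ∫ ω, F ω ∂P = Complex.exp (∫ z, S z ∂μ) := by
    have h1 := hN.integral_prod_pow_num (fun c : s => S ⁻¹' {(c : ℂ)}) (fun c => (c : ℂ))
      (fun c => S.measurableSet_preimage _) (fun c => hμ c c.2)
      fun c c' hcc => hd fun h => hcc (Subtype.ext h)
    have h2 : ∀ ω, F ω = ∏ c : s, (1 + (c : ℂ)) ^ (N ω).num (S ⁻¹' {(c : ℂ)}) := fun ω => by
      rw [hF]
      exact (Finset.prod_coe_sort s fun c => (1 + c) ^ (N ω).num (S ⁻¹' {c})).symm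
    simp only [h2]
    rw [h1, ← SimpleFunc.integral_eq_integral S hS, SimpleFunc.integral_eq_sum_filter,
      Finset.sum_coe_sort s fun c => c * (μ.real (S ⁻¹' {c}) : ℂ)]
    congr 1
    refine Finset.sum_congr rfl fun c _ => ?_
    rw [Complex.real_smul, mul_comm]
  refine ⟨F, ?_, ?_, ?_, hint⟩
  · refine Finset.measurable_fun_prod _ fun c hc => ?_
    refine (measurable_from_nat (f := fun n : ℕ => (1 + c) ^ n)).comp (LevyGauss.measurable_num ?_)
    refine measurable_configSigma_count N (S.measurableSet_preimage _) fun z hz => ?_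
    rw [Set.mem_preimage, Set.mem_singleton_iff] at hz
    rw [Function.mem_support, hz]
    exact (Finset.mem_filter.1 hc).2
  · have h1 : ∀ᵐ ω ∂P, ∀ c ∈ s, (N ω).count (S ⁻¹' {c}) ≠ ∞ := by
      rw [Finset.eventually_all]
      exact fun c hc => hN.ae_count_ne_top (S.measurableSet_preimage _) (hμ c hc)
    filter_upwards [h1] with ω hω
    have h2 := (Configuration.expProd_sum_indicator (κ := N ω) s (fun c => S ⁻¹' {c}) (fun c => c)
      hω fun c _ c' _ hcc => hd hcc).2
    refine Eq.trans ?_ h2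
    exact Configuration.expProd_congr fun z _ => simpleFunc_eq_sum S z
  -- The integral of a non-integrable function is `0` by convention, whereas this one has just been
  -- computed to be an exponential.
  · by_contra h0
    rw [integral_undef h0] at hint
    exact Complex.exp_ne_zero _ hint.symm

variable [SigmaFinite μ]

/-- Fatou's lemma: for step functions `S ≤ 2 b` the products are nonnegative with expectation `exp
(∫ S) ≤ exp (2 ∫ b)`. The result supplies the dominating functions for complex products. -/
theorem integrable_expProd_ofReal {b : Z → ℝ} (hb : Measurable b) (hb0 : ∀ z, 0 ≤ b z)
    (hbi : Integrable b μ) : Integrable (fun ω => (N ω).expProd fun z => (b z : ℂ)) P := by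
  set S : ℕ → SimpleFunc Z ℝ := fun n =>
    SimpleFunc.approxOn b hb (Set.Ici 0) 0 Set.self_mem_Ici n with hS
  have hS0 : ∀ n z, 0 ≤ S n z := fun n z => SimpleFunc.approxOn_mem hb _ n z
  have hSb : ∀ n z, S n z ≤ 2 * b z := fun n z => by
    have := SimpleFunc.norm_approxOn_zero_le hb (s := Set.Ici 0) Set.self_mem_Ici z n
    rw [Real.norm_of_nonneg (hb0 z)] at this
    rw [two_mul]
    exact (le_abs_self _).trans this
  set T : ℕ → SimpleFunc Z ℂ := fun n => (S n).map ((↑) : ℝ → ℂ) with hT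
  have hTS : ∀ n z, T n z = (S n z : ℂ) := fun n z => rfl
  have hSi : ∀ n, Integrable (S n) μ := fun n =>
    (hbi.const_mul 2).mono' (S n).aestronglyMeasurable (ae_of_all _ fun z => by
      rw [Real.norm_of_nonneg (hS0 n z)]
      exact hSb n z)
  have hTi : ∀ n, Integrable (T n) μ := fun n => (hSi n).ofReal
  choose F hFm hF hFi hFint using fun n => hN.exists_simpleFunc (hTi n)
  have h2b : Integrable (fun z => ((2 * b z : ℝ) : ℂ)) μ := (hbi.const_mul 2).ofReal
  have hsum := hN.ae_summableOn h2b
  have hlim : ∀ᵐ ω ∂P, Tendsto (fun n => F n ω) atTop (𝓝 ((N ω).expProd fun z => (b z : ℂ))) := by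
    filter_upwards [hsum, ae_all_iff.2 hF] with ω h1 h2
    have := Configuration.tendsto_expProd (h := fun n => T n) (g := fun z => (b z : ℂ)) h1
      (fun n z => by
        rw [hTS, Complex.norm_real, Real.norm_of_nonneg (hS0 n z)]
        exact hSb n z)
      (fun z => (Complex.continuous_ofReal.tendsto _).comp
        (SimpleFunc.tendsto_approxOn hb Set.self_mem_Ici (subset_closure (hb0 z))))
    simpa only [h2] using this
  have hbound : ∀ n, eLpNorm (F n) 1 P ≤ ENNReal.ofReal (Real.exp (∫ z, 2 * b z ∂μ)) := by
    intro n
    rw [eLpNorm_one_eq_lintegral_enorm, ← ofReal_integral_norm_eq_lintegral_enorm (hFi n)]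
    refine ENNReal.ofReal_le_ofReal ?_
    have hnn : ∀ᵐ ω ∂P, ((‖F n ω‖ : ℝ) : ℂ) = F n ω := by
      filter_upwards [hF n, hN.ae_summableOn (hTi n)] with ω h1 h2
      rw [← h1]
      have h3 := (Configuration.expProd_ofReal (κ := N ω) (h := S n) h2).1
      have h4 : 0 ≤ ∏' z, (1 + S n z) ^ (N ω).mult z := by
        refine ge_of_tendsto' (Configuration.expProd_ofReal (κ := N ω) (h := S n) h2).2.hasProd
          fun s => ?_
        refine Finset.prod_nonneg fun z _ => pow_nonneg ?_ _
        linarith [hS0 n z]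
      change ((‖(N ω).expProd fun z => (S n z : ℂ)‖ : ℝ) : ℂ) =
        (N ω).expProd fun z => (S n z : ℂ)
      rw [h3, Complex.norm_real, Real.norm_of_nonneg h4]
    have h5 : ((∫ ω, ‖F n ω‖ ∂P : ℝ) : ℂ) = (Real.exp (∫ z, S n z ∂μ) : ℂ) := by
      rw [← integral_complex_ofReal, integral_congr_ae hnn, hFint n, Complex.ofReal_exp,
        ← integral_complex_ofReal]
      rfl
    rw [Complex.ofReal_inj.1 h5]
    exact Real.exp_le_exp.2 (integral_mono (hSi n) (hbi.const_mul 2) fun z => hSb n z)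
  have hm : AEStronglyMeasurable (fun ω => (N ω).expProd fun z => (b z : ℂ)) P :=
    aestronglyMeasurable_of_tendsto_ae atTop (fun n => (hFi n).1) hlim
  rw [← memLp_one_iff_integrable]
  refine ⟨hm, ?_⟩
  refine lt_of_le_of_lt (Lp.eLpNorm_lim_le_liminf_eLpNorm (fun n => (hFi n).1) _ hlim) ?_
  refine lt_of_le_of_lt (liminf_le_of_frequently_le' (Frequently.of_forall hbound)) ?_
  exact ENNReal.ofReal_lt_top

/-- The expectation of a multiplicative functional, for a measurable integrable function. -/
theorem expProd_of_measurable {h : Z → ℂ} (hm : Measurable h) (hh : Integrable h μ) :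
    AEStronglyMeasurable[configSigma N (Function.support h)] (fun ω => (N ω).expProd h) P ∧
    Integrable (fun ω => (N ω).expProd h) P ∧
    ∫ ω, (N ω).expProd h ∂P = Complex.exp (∫ z, h z ∂μ) := by
  set S : ℕ → SimpleFunc Z ℂ := fun n =>
    SimpleFunc.approxOn h hm Set.univ 0 (Set.mem_univ _) n with hS
  have hSb : ∀ n z, ‖S n z‖ ≤ 2 * ‖h z‖ := fun n z => by
    rw [two_mul]
    exact SimpleFunc.norm_approxOn_zero_le hm (Set.mem_univ _) z n
  have hSlim : ∀ z, Tendsto (fun n => S n z) atTop (𝓝 (h z)) := fun z =>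
    SimpleFunc.tendsto_approxOn hm (Set.mem_univ _) (by simp)
  have h2i : Integrable (fun z => 2 * ‖h z‖) μ := hh.norm.const_mul 2
  have hSi : ∀ n, Integrable (S n) μ := fun n =>
    h2i.mono' (S n).aestronglyMeasurable (ae_of_all _ fun z => hSb n z)
  choose F hFm hF hFi hFint using fun n => hN.exists_simpleFunc (hSi n)
  have h2b : Integrable (fun z => ((2 * ‖h z‖ : ℝ) : ℂ)) μ := h2i.ofReal
  have hlim : ∀ᵐ ω ∂P, Tendsto (fun n => F n ω) atTop (𝓝 ((N ω).expProd h)) := by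
    filter_upwards [hN.ae_summableOn h2b, ae_all_iff.2 hF] with ω h1 h2
    have := Configuration.tendsto_expProd (h := fun n => S n) (g := h) h1 hSb hSlim
    simpa only [h2] using this
  -- The approximating step functions satisfy `‖S‖ ≤ 2 ‖h‖`, so the product for `2 ‖h‖` dominates
  -- all of theirs.
  have hDi := (hN.integrable_expProd_ofReal (b := fun z => 2 * ‖h z‖) (by fun_prop)
    (fun z => by positivity) h2i).norm
  have hdom : ∀ n, ∀ᵐ ω ∂P, ‖F n ω‖ ≤ ‖(N ω).expProd fun z => ((2 * ‖h z‖ : ℝ) : ℂ)‖ := by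
    intro n
    filter_upwards [hF n, hN.ae_summableOn h2b] with ω h1 h2
    rw [← h1]
    exact Configuration.norm_expProd_le h2 (hSb n)
  have hsup : ∀ n, Function.support (S n) ⊆ Function.support h := fun n z hz => by
    rw [Function.mem_support] at hz ⊢
    intro h0
    have := hSb n z
    rw [h0, norm_zero, mul_zero] at this
    exact hz (norm_le_zero_iff.1 this)
  have hml : AEStronglyMeasurable[configSigma N (Function.support h)]
      (fun ω => (N ω).expProd h) P := by
    refine aestronglyMeasurable_of_tendsto_ae' (f := F) (fun n => ?_) hlim
    have h1 : Measurable[configSigma N (Function.support h)] (F n) :=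
      (hFm n).mono (configSigma_mono N (hsup n)) le_rfl
    exact h1.stronglyMeasurable.aestronglyMeasurable
  have hm' : AEStronglyMeasurable (fun ω => (N ω).expProd h) P :=
    hml.mono (hN.configSigma_le _)
  refine ⟨hml, ?_, ?_⟩
  · refine hDi.mono' hm' ?_
    filter_upwards [hlim, ae_all_iff.2 hdom] with ω h1 h2
    exact le_of_tendsto' h1.norm h2
  · have h1 := tendsto_integral_of_dominated_convergence _ (fun n => (hFi n).1) hDi hdom hlim
    have h2 := tendsto_integral_of_dominated_convergence (μ := μ) _ (fun n => (hSi n).1) h2i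
      (fun n => ae_of_all _ (hSb n)) (ae_of_all _ hSlim)
    simp only [hFint] at h1
    exact tendsto_nhds_unique h1 ((Complex.continuous_exp.tendsto _).comp h2)

theorem integrable_expProd {h : Z → ℂ} (hh : Integrable h μ) :
    Integrable (fun ω => (N ω).expProd h) P := by
  have hi : Integrable (hh.1.aemeasurable.mk h) μ := hh.congr hh.1.aemeasurable.ae_eq_mk
  refine (hN.expProd_of_measurable hh.1.aemeasurable.measurable_mk hi).2.1.congr ?_
  exact hN.ae_expProd_congr hh.1.aemeasurable.ae_eq_mk.symm

theorem integral_expProd {h : Z → ℂ} (hh : Integrable h μ) :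
    ∫ ω, (N ω).expProd h ∂P = Complex.exp (∫ z, h z ∂μ) := by
  have hi : Integrable (hh.1.aemeasurable.mk h) μ := hh.congr hh.1.aemeasurable.ae_eq_mk
  rw [integral_congr_ae hh.1.aemeasurable.ae_eq_mk,
    ← (hN.expProd_of_measurable hh.1.aemeasurable.measurable_mk hi).2.2]
  exact integral_congr_ae (hN.ae_expProd_congr hh.1.aemeasurable.ae_eq_mk)

theorem aestronglyMeasurable_expProd {h : Z → ℂ} (hh : Integrable h μ) {B : Set Z}
    (hB : MeasurableSet B) (hs : ∀ᵐ z ∂μ, z ∉ B → h z = 0) :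
    AEStronglyMeasurable[configSigma N B] (fun ω => (N ω).expProd h) P := by
  set g := B.indicator (hh.1.aemeasurable.mk h) with hg
  have hgm : Measurable g := hh.1.aemeasurable.measurable_mk.indicator hB
  have hgh : g =ᵐ[μ] h := by
    filter_upwards [hh.1.aemeasurable.ae_eq_mk, hs] with z h1 h2
    by_cases hz : z ∈ B
    · rw [hg, Set.indicator_of_mem hz, h1]
    · rw [hg, Set.indicator_of_notMem hz, h2 hz]
  have h1 := (hN.expProd_of_measurable hgm (hh.congr hgh.symm)).1
  refine (h1.mono (configSigma_mono N fun z hz => ?_)).congr (hN.ae_expProd_congr hgh)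
  by_contra h0
  exact hz (by rw [hg, Set.indicator_of_notMem h0])

end IsPoissonProcess

end PoissonExp


/-! ### Convergence in `L²` -/

section Convergence

variable {Z : Type*} [MeasurableSpace Z] {μ : Measure Z}

theorem norm_sq_eq_integral (f : Lp ℂ 2 μ) : ‖f‖ ^ 2 = ∫ z, ‖f z‖ ^ 2 ∂μ := by
  have h := inner_self_eq_ofReal f
  rw [L2.inner_def] at h
  simp only [inner_self_eq_ofReal] at h
  rw [integral_complex_ofReal] at h
  exact (Complex.ofReal_inj.1 h).symm

theorem tendsto_of_dominated {f : ℕ → Lp ℂ 2 μ} {g : Lp ℂ 2 μ} {b : Z → ℝ}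
    (hb : Integrable (fun z => b z ^ 2) μ) (hle : ∀ n, ∀ᵐ z ∂μ, ‖f n z‖ ≤ b z)
    (hlim : ∀ᵐ z ∂μ, Tendsto (fun n => f n z) atTop (𝓝 (g z))) : Tendsto f atTop (𝓝 g) := by
  rw [tendsto_iff_norm_sub_tendsto_zero]
  have h1 : Tendsto (fun n => ∫ z, ‖(f n - g) z‖ ^ 2 ∂μ) atTop (𝓝 (∫ _ : Z, (0 : ℝ) ∂μ)) := by
    refine tendsto_integral_of_dominated_convergence (fun z => 4 * b z ^ 2) (fun n => ?_)
      (hb.const_mul 4) (fun n => ?_) ?_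
    · exact ((Lp.aestronglyMeasurable (f n - g)).norm).pow 2
    · filter_upwards [ae_all_iff.2 hle, hlim, Lp.coeFn_sub (f n) g] with z h1 h2 h3
      have h4 : ‖g z‖ ≤ b z := le_of_tendsto' h2.norm h1
      rw [h3, Pi.sub_apply, Real.norm_of_nonneg (by positivity)]
      have h5 : ‖f n z - g z‖ ≤ 2 * b z := (norm_sub_le _ _).trans (by linarith [h1 n])
      calc _ ≤ (2 * b z) ^ 2 := pow_le_pow_left₀ (norm_nonneg _) h5 2
        _ = _ := by ring
    · filter_upwards [hlim, ae_all_iff.2 fun n => Lp.coeFn_sub (f n) g] with z h2 h3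
      simp only [h3, Pi.sub_apply]
      have := ((h2.sub_const (g z)).norm).pow 2
      simpa using this
  simp only [← norm_sq_eq_integral, integral_zero] at h1
  have h2 := (Real.continuous_sqrt.tendsto _).comp h1
  simpa [Function.comp_def, Real.sqrt_sq (norm_nonneg _)] using h2

/-- Multiplication is not continuous on `L²`, so the relation is passed to the limit almost
everywhere, along one subsequence good for all three sequences. -/
theorem ae_eq_mul_of_tendsto {u v w : ℕ → Lp ℂ 2 μ} {u' v' w' : Lp ℂ 2 μ}
    (hu : Tendsto u atTop (𝓝 u')) (hv : Tendsto v atTop (𝓝 v')) (hw : Tendsto w atTop (𝓝 w'))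
    (h : ∀ n, w n =ᵐ[μ] fun z => u n z * v n z) : w' =ᵐ[μ] fun z => u' z * v' z := by
  obtain ⟨a, ha, h1⟩ := (tendstoInMeasure_of_tendsto_Lp hu).exists_seq_tendsto_ae
  obtain ⟨b, hb, h2⟩ := (tendstoInMeasure_of_tendsto_Lp
    (hv.comp ha.tendsto_atTop)).exists_seq_tendsto_ae
  obtain ⟨c, hc, h3⟩ := (tendstoInMeasure_of_tendsto_Lp
    (hw.comp (ha.tendsto_atTop.comp hb.tendsto_atTop))).exists_seq_tendsto_ae
  filter_upwards [h1, h2, h3, ae_all_iff.2 h] with z k1 k2 k3 k4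
  have l1 := k1.comp (hb.tendsto_atTop.comp hc.tendsto_atTop)
  have l2 := k2.comp hc.tendsto_atTop
  refine tendsto_nhds_unique k3 ((l1.mul l2).congr fun n => ?_)
  simp only [Function.comp_apply]
  exact (k4 _).symm

theorem continuous_star_Lp : Continuous (star : Lp ℂ 2 μ → Lp ℂ 2 μ) := by
  refine Isometry.continuous (Isometry.of_dist_eq fun f g => ?_)
  rw [dist_eq_norm, dist_eq_norm]
  refine (sq_eq_sq₀ (norm_nonneg _) (norm_nonneg _)).1 ?_
  rw [norm_sub_sq_eq_re_inner, norm_sub_sq_eq_re_inner]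
  simp only [Intertwines.inner_star_star, Complex.add_re, Complex.sub_re, Complex.conj_re]

theorem integrable_norm_sq (h : Lp ℂ 2 μ) : Integrable (fun z => ‖h z‖ ^ 2) μ :=
  (memLp_two_iff_integrable_sq_norm (Lp.aestronglyMeasurable h)).1 (Lp.memLp h)

theorem integrable_conj_mul (h g : Lp ℂ 2 μ) :
    Integrable (fun z => (starRingEnd ℂ) (h z) * g z) μ := by
  have := L2.integrable_inner (𝕜 := ℂ) h g
  refine this.congr (ae_of_all _ fun z => ?_)
  simp only [RCLike.inner_apply]
  ring

theorem inner_eq_integral_conj_mul (h g : Lp ℂ 2 μ) :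
    ⟪h, g⟫_ℂ = ∫ z, (starRingEnd ℂ) (h z) * g z ∂μ := by
  rw [L2.inner_def]
  refine integral_congr_ae (ae_of_all _ fun z => ?_)
  simp only [RCLike.inner_apply]
  ring

variable [SigmaFinite μ]

/-- Cutoffs of `h` to sets of finite measure. -/
def finiteCut (n : ℕ) (h : Lp ℂ 2 μ) : Lp ℂ 2 μ :=
  cut (spanningSets μ n) (measurableSet_spanningSets μ n) h

theorem coeFn_finiteCut (n : ℕ) (h : Lp ℂ 2 μ) :
    finiteCut n h =ᵐ[μ] (spanningSets μ n).indicator h := coeFn_cut _ _ _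

theorem integrable_finiteCut (n : ℕ) (h : Lp ℂ 2 μ) : Integrable (finiteCut n h) μ := by
  have : IsFiniteMeasure (μ.restrict (spanningSets μ n)) :=
    ⟨by rw [Measure.restrict_apply_univ]; exact measure_spanningSets_lt_top μ n⟩
  refine Integrable.congr ?_ (coeFn_finiteCut n h).symm
  rw [integrable_indicator_iff (measurableSet_spanningSets μ n)]
  exact ((Lp.memLp h).restrict _).integrable one_le_two

theorem tendsto_finiteCut (h : Lp ℂ 2 μ) : Tendsto (fun n => finiteCut n h) atTop (𝓝 h) := by
  refine tendsto_of_dominated (b := fun z => ‖h z‖) (integrable_norm_sq h) (fun n => ?_) ?_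
  · filter_upwards [coeFn_finiteCut n h] with z hz
    rw [hz]
    exact norm_indicator_le_norm_self _ _
  · filter_upwards [ae_all_iff.2 fun n => coeFn_finiteCut n h] with z hz
    simp only [hz]
    have h1 : ∀ᶠ n in atTop, z ∈ spanningSets μ n := by
      have h2 : z ∈ ⋃ n, spanningSets μ n := by rw [iUnion_spanningSets]; trivial
      obtain ⟨k, hk⟩ := Set.mem_iUnion.1 h2
      filter_upwards [eventually_ge_atTop k] with n hn
      exact monotone_spanningSets μ hn hk
    refine tendsto_const_nhds.congr' ?_
    filter_upwards [h1] with n hn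
    rw [Set.indicator_of_mem hn]

theorem denseRange_integrable :
    DenseRange (Subtype.val : {h : Lp ℂ 2 μ // Integrable h μ} → Lp ℂ 2 μ) := fun h =>
  mem_closure_of_tendsto (tendsto_finiteCut h)
    (Eventually.of_forall fun n => ⟨⟨finiteCut n h, integrable_finiteCut n h⟩, rfl⟩)

end Convergence

/-! ### Exponential vectors of a Poisson process -/

section PoissonSystem

variable {Z Ω : Type*} [MeasurableSpace Z] [MeasurableSpace Ω] {μ : Measure Z} {P : Measure Ω}
  {N : Ω → Configuration Z} [IsProbabilityMeasure P] [SigmaFinite μ]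

/-- The normalized multiplicative functional. -/
def poissonExpFun (μ : Measure Z) (N : Ω → Configuration Z) (h : Z → ℂ) (ω : Ω) : ℂ :=
  (N ω).expProd h * Complex.exp (-∫ z, h z ∂μ)

theorem integrable_conj {h : Z → ℂ} (hh : Integrable h μ) :
    Integrable (fun z => (starRingEnd ℂ) (h z)) μ :=
  Complex.conjCLE.toContinuousLinearMap.integrable_comp hh

namespace IsPoissonProcess

variable (hN : IsPoissonProcess μ P N)
include hN

/-- Pointwise `(1 + conj h)(1 + g) = 1 + (conj h + g + conj h · g)`. In the expectation the
normalizing constants cancel the linear terms, and `exp (∫ conj h · g)` remains. -/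
theorem conj_mul_poissonExpFun {h g : Lp ℂ 2 μ} (hh : Integrable h μ) (hg : Integrable g μ) :
    ∀ᵐ ω ∂P, (starRingEnd ℂ) (poissonExpFun μ N h ω) * poissonExpFun μ N g ω =
      ((N ω).expProd fun z => (starRingEnd ℂ) (h z) + g z + (starRingEnd ℂ) (h z) * g z) *
        Complex.exp (-(∫ z, (starRingEnd ℂ) (h z) ∂μ) - ∫ z, g z ∂μ) := by
  filter_upwards [hN.ae_summableOn hh, hN.ae_summableOn (integrable_conj hh),
    hN.ae_summableOn hg] with ω h1 h2 h3
  rw [poissonExpFun, poissonExpFun, map_mul, ← Complex.exp_conj, Configuration.conj_expProd h1,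
    ← Configuration.expProd_mul h2 h3, sub_eq_add_neg, Complex.exp_add, map_neg, ← integral_conj]
  ring

theorem integrable_conj_mul_poissonExpFun {h g : Lp ℂ 2 μ} (hh : Integrable h μ)
    (hg : Integrable g μ) :
    Integrable (fun ω => (starRingEnd ℂ) (poissonExpFun μ N h ω) * poissonExpFun μ N g ω) P := by
  refine Integrable.congr ?_ (EventuallyEq.symm (hN.conj_mul_poissonExpFun hh hg))
  exact (hN.integrable_expProd (((integrable_conj hh).add hg).add
    (integrable_conj_mul h g))).mul_const _

theorem integral_conj_mul_poissonExpFun {h g : Lp ℂ 2 μ} (hh : Integrable h μ)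
    (hg : Integrable g μ) :
    ∫ ω, (starRingEnd ℂ) (poissonExpFun μ N h ω) * poissonExpFun μ N g ω ∂P =
      Complex.exp ⟪h, g⟫_ℂ := by
  rw [integral_congr_ae (hN.conj_mul_poissonExpFun hh hg), integral_mul_const,
    hN.integral_expProd (h := fun z => (starRingEnd ℂ) (h z) + g z + (starRingEnd ℂ) (h z) * g z)
      (((integrable_conj hh).add hg).add (integrable_conj_mul h g)),
    integral_add (f := fun z => (starRingEnd ℂ) (h z) + g z) ((integrable_conj hh).add hg)
      (integrable_conj_mul h g), integral_add (integrable_conj hh) hg, ← Complex.exp_add, inner_eq_integral_conj_mul]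
  congr 1
  ring

theorem memLp_poissonExpFun {h : Lp ℂ 2 μ} (hh : Integrable h μ) :
    MemLp (poissonExpFun μ N h) 2 P := by
  have hm : AEStronglyMeasurable (poissonExpFun μ N h) P :=
    ((hN.integrable_expProd hh).mul_const _).1
  rw [memLp_two_iff_integrable_sq_norm hm]
  refine (hN.integrable_conj_mul_poissonExpFun hh hh).norm.congr (ae_of_all _ fun ω => ?_)
  simp only [norm_mul, RCLike.norm_conj, sq]

/-- The product formula requires integrable `h`; these are dense in `L²`, and the kernel allows
extension by continuity. -/
theorem exists_poissonExp : ∃ E : Lp ℂ 2 μ → Lp ℂ 2 P, Continuous E ∧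
    (∀ h : Lp ℂ 2 μ, Integrable h μ → E h =ᵐ[P] poissonExpFun μ N h) ∧
    ∀ h g, ⟪E h, E g⟫_ℂ = Complex.exp ⟪h, g⟫_ℂ := by
  obtain ⟨E, h1, h2, h3⟩ := exists_extension_of_inner_eq_exp
    (Subtype.val : {h : Lp ℂ 2 μ // Integrable h μ} → Lp ℂ 2 μ) denseRange_integrable
    (fun h => (hN.memLp_poissonExpFun h.2).toLp _) (fun h g => by
      rw [← hN.integral_conj_mul_poissonExpFun h.2 g.2, inner_eq_integral_conj_mul]
      refine integral_congr_ae ?_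
      filter_upwards [(hN.memLp_poissonExpFun h.2).coeFn_toLp,
        (hN.memLp_poissonExpFun g.2).coeFn_toLp] with ω h1 h2
      rw [h1, h2])
  refine ⟨E, h1, fun h hh => ?_, h3⟩
  rw [h2 ⟨h, hh⟩]
  exact MemLp.coeFn_toLp _

end IsPoissonProcess

/-- The exponential vectors of a Poisson process. -/
def poissonExp (hN : IsPoissonProcess μ P N) : Lp ℂ 2 μ → Lp ℂ 2 P := hN.exists_poissonExp.choose

theorem coeFn_poissonExp (hN : IsPoissonProcess μ P N) {h : Lp ℂ 2 μ} (hh : Integrable h μ) :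
    poissonExp hN h =ᵐ[P] poissonExpFun μ N h := hN.exists_poissonExp.choose_spec.2.1 h hh

theorem continuous_poissonExp (hN : IsPoissonProcess μ P N) : Continuous (poissonExp hN) :=
  hN.exists_poissonExp.choose_spec.1

theorem poissonExpFun_congr (hN : IsPoissonProcess μ P N) {h g : Z → ℂ} (hhg : h =ᵐ[μ] g) :
    poissonExpFun μ N h =ᵐ[P] poissonExpFun μ N g := by
  filter_upwards [hN.ae_expProd_congr hhg] with ω hω
  rw [poissonExpFun, poissonExpFun, hω, integral_congr_ae hhg]

theorem isExpSystem_poissonExp (hN : IsPoissonProcess μ P N) : IsExpSystem (poissonExp hN) where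
  inner_eq := hN.exists_poissonExp.choose_spec.2.2
  zero := by
    have h0 : Integrable (0 : Lp ℂ 2 μ) μ :=
      (integrable_zero Z ℂ μ).congr (Lp.coeFn_zero ℂ 2 μ).symm
    refine (coeFn_poissonExp hN h0).trans ((poissonExpFun_congr hN (Lp.coeFn_zero ℂ 2 μ)).trans
      (ae_of_all _ fun ω => ?_))
    have : (N ω).expProd (0 : Z → ℂ) = 1 := Configuration.expProd_zero
    rw [poissonExpFun, this]
    simp
  mul h g hd := by
    have hc := continuous_poissonExp hN
    -- Multiplicativity is checked on cutoffs to sets of finite measure, where the product formula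
    -- applies and disjointness of supports is preserved, and then passed to the limit.
    have ha : ∀ n, finiteCut n h + finiteCut n g = finiteCut n (h + g) := by
      intro n
      refine Lp.ext ?_
      filter_upwards [coeFn_finiteCut n h, coeFn_finiteCut n g, coeFn_finiteCut n (h + g),
        Lp.coeFn_add h g, Lp.coeFn_add (finiteCut n h) (finiteCut n g)] with z h1 h2 h3 h4 h5
      rw [h5, Pi.add_apply, h1, h2, h3]
      by_cases hz : z ∈ spanningSets μ n
      · simp only [Set.indicator_of_mem hz, h4, Pi.add_apply]
      · simp only [Set.indicator_of_notMem hz, add_zero]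
    refine ae_eq_mul_of_tendsto ((hc.tendsto _).comp (tendsto_finiteCut h))
      ((hc.tendsto _).comp (tendsto_finiteCut g))
      ((hc.tendsto _).comp (tendsto_finiteCut (h + g))) fun n => ?_
    simp only [Function.comp_apply]
    have hdn : ∀ᵐ z ∂μ, finiteCut n h z = 0 ∨ finiteCut n g z = 0 := by
      filter_upwards [hd, coeFn_finiteCut n h, coeFn_finiteCut n g] with z h1 h2 h3
      rw [h2, h3]
      by_cases hz : z ∈ spanningSets μ n
      · simpa [hz] using h1
      · simp [hz]
    have ih := integrable_finiteCut n h
    have ig := integrable_finiteCut n g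
    have h5 := Lp.coeFn_add (finiteCut n h) (finiteCut n g)
    rw [ha] at h5
    filter_upwards [coeFn_poissonExp hN ih, coeFn_poissonExp hN ig,
      coeFn_poissonExp hN (integrable_finiteCut n (h + g)), hN.ae_forall hdn,
      hN.ae_summableOn ih, hN.ae_summableOn ig, poissonExpFun_congr hN h5]
      with ω k1 k2 k3 k4 k5 k6 k7
    rw [k1, k2, k3, k7, poissonExpFun, poissonExpFun, poissonExpFun]
    have h6 : (∫ z, (⇑(finiteCut n h) + ⇑(finiteCut n g)) z ∂μ) =
        (∫ z, finiteCut n h z ∂μ) + ∫ z, finiteCut n g z ∂μ := integral_add ih ig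
    have h7 : (N ω).expProd (⇑(finiteCut n h) + ⇑(finiteCut n g)) =
        (N ω).expProd (finiteCut n h) * (N ω).expProd (finiteCut n g) :=
      Configuration.expProd_add k5 k6 k4
    rw [h6, h7, neg_add, Complex.exp_add]
    ring
  star_eq h := by
    have hc := continuous_poissonExp hN
    have h1 : Tendsto (fun n => star (poissonExp hN (finiteCut n h))) atTop
        (𝓝 (star (poissonExp hN h))) :=
      (continuous_star_Lp.tendsto _).comp ((hc.tendsto _).comp (tendsto_finiteCut h))
    have h2 : Tendsto (fun n => poissonExp hN (star (finiteCut n h))) atTop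
        (𝓝 (poissonExp hN (star h))) :=
      (hc.tendsto _).comp ((continuous_star_Lp.tendsto _).comp (tendsto_finiteCut h))
    refine tendsto_nhds_unique h2 (h1.congr fun n => ?_)
    have ih := integrable_finiteCut n h
    have hs : ⇑(star (finiteCut n h)) =ᵐ[μ] fun z => (starRingEnd ℂ) (finiteCut n h z) :=
      Lp.coeFn_star _
    have is : Integrable (star (finiteCut n h) : Lp ℂ 2 μ) μ := (integrable_conj ih).congr hs.symm
    refine Lp.ext ?_
    filter_upwards [Lp.coeFn_star (poissonExp hN (finiteCut n h)), coeFn_poissonExp hN ih,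
      coeFn_poissonExp hN is, poissonExpFun_congr hN hs, hN.ae_summableOn ih] with ω k1 k2 k3 k4 k5
    rw [k1, Pi.star_apply, k2, k3, k4, poissonExpFun, poissonExpFun, Complex.star_def, map_mul,
      Configuration.conj_expProd k5, ← Complex.exp_conj, map_neg, ← integral_conj]

theorem firstChaos_poissonExp (hN : IsPoissonProcess μ P N) {f : Lp ℂ 2 μ} (hf : Integrable f μ) :
    (isExpSystem_poissonExp hN).firstChaos f =ᵐ[P]
      fun ω => (∑' z, ((N ω).mult z : ℂ) * f z) - ∫ z, f z ∂μ := by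
  refine (isExpSystem_poissonExp hN).firstChaos_ae_eq ?_
  have h1 : ∀ᵐ ω ∂P, ∀ n : ℕ, poissonExp hN (((n : ℂ) + 1)⁻¹ • f) ω =
      ((N ω).expProd fun z => ((n : ℂ) + 1)⁻¹ * f z) *
        Complex.exp (-(((n : ℂ) + 1)⁻¹ * ∫ z, f z ∂μ)) := by
    rw [ae_all_iff]
    intro n
    have hs : ⇑(((n : ℂ) + 1)⁻¹ • f) =ᵐ[μ] fun z => ((n : ℂ) + 1)⁻¹ * f z := Lp.coeFn_smul _ _
    have hi : Integrable (((n : ℂ) + 1)⁻¹ • f : Lp ℂ 2 μ) μ := (hf.const_mul _).congr hs.symm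
    filter_upwards [coeFn_poissonExp hN hi, poissonExpFun_congr hN hs] with ω k1 k2
    rw [k1, k2, poissonExpFun, integral_const_mul]
  filter_upwards [h1, hN.ae_summableOn hf] with ω k1 k2
  simp only [k1]
  exact k2.tendsto_slope _

/-- The set in the definition is the graph of the first chaos over integrable functions. As these
are dense and the first chaos is continuous, its closure is the full graph. -/
theorem isCompensatedIntegral_iff {Z Ω : Type*} {m : MeasurableSpace Ω} [MeasurableSpace Z]
    [MeasurableSpace Ω] {μ : Measure Z} {P : Measure Ω} {N : Ω → Configuration Z}
    [IsProbabilityMeasure P] [SigmaFinite μ]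
    (hN : IsPoissonProcess μ P N)
    (hm : ∀ f, (isExpSystem_poissonExp hN).firstChaos f ∈ lpMeas ℂ ℂ m 2 P)
    (f : Lp ℂ 2 μ) (G : L2 m P) :
    IsCompensatedIntegral μ N f G ↔ G.1 = (isExpSystem_poissonExp hN).firstChaos f := by
  set I := (isExpSystem_poissonExp hN).firstChaos with hI
  have hset : {q : Lp ℂ 2 μ × L2 m P | Integrable q.1 μ ∧
      ∀ᵐ ω ∂P, q.2.1 ω = (∑' z : Z, ((N ω).mult z : ℂ) * q.1 z) - ∫ z, q.1 z ∂μ} =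
      {q | Integrable q.1 μ ∧ q.2.1 = I q.1} := by
    ext q
    refine and_congr_right fun hq => ⟨fun h => Lp.ext ?_, fun h => ?_⟩
    · filter_upwards [h, firstChaos_poissonExp hN hq] with ω h1 h2
      rw [h1, h2]
    · filter_upwards [firstChaos_poissonExp hN hq] with ω h2
      rw [h, h2]
  rw [IsCompensatedIntegral, hset]
  constructor
  · intro h
    have hcl : IsClosed {q : Lp ℂ 2 μ × L2 m P | q.2.1 = I q.1} :=
      isClosed_eq (continuous_subtype_val.comp continuous_snd) (I.continuous.comp continuous_fst)
    exact hcl.closure_subset_iff.2 (fun q hq => hq.2) h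
  · intro h
    have h1 : Tendsto (fun n => (finiteCut n f, (⟨I (finiteCut n f), hm _⟩ : L2 m P))) atTop
        (𝓝 (f, G)) := by
      refine (tendsto_finiteCut f).prodMk_nhds (tendsto_subtype_rng.2 ?_)
      rw [h]
      exact (I.continuous.tendsto _).comp (tendsto_finiteCut f)
    exact mem_closure_of_tendsto h1 (Eventually.of_forall fun n => ⟨integrable_finiteCut n f, rfl⟩)

end PoissonSystem


/-! ### The σ-fields of a Poisson process -/

section PoissonSigma

/-- The difference of an `m`-measurable `f` and its projection to `expSpace` is again `m`-measurable
and is orthogonal to the exponential vectors. -/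
theorem Represents.of_orthogonal {Z Ω : Type*} {m : MeasurableSpace Ω} [MeasurableSpace Z]
    [mΩ : MeasurableSpace Ω] {μ : Measure Z} {P : Measure Ω} {E : Lp ℂ 2 μ → Lp ℂ 2 P}
    {B : Set Z} (hm : m ≤ mΩ) (hE : ∀ h, SupportedIn h B → E h ∈ lpMeas ℂ ℂ m 2 P)
    (h0 : ∀ f ∈ lpMeas ℂ ℂ m 2 P, (∀ h, SupportedIn h B → ⟪E h, f⟫_ℂ = 0) → f = 0) :
    Represents m E B where
  le := hm
  eq := by
    have hle : expSpace E B ≤ lpMeas ℂ ℂ m 2 P := expSpace_le (isClosed_lpMeas hm) hE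
    refine le_antisymm (fun f hf => ?_) hle
    have : CompleteSpace (expSpace E B) := (isClosed_expSpace E B).completeSpace_coe
    have hpm : (expSpace E B).starProjection f ∈ expSpace E B :=
      Submodule.starProjection_apply_mem _ _
    have hz := h0 (f - (expSpace E B).starProjection f) (Submodule.sub_mem _ hf (hle hpm))
      fun h hh => by
        have := Submodule.sub_starProjection_mem_orthogonal (K := expSpace E B) f
        exact (Submodule.mem_orthogonal _ _).1 this _ (mem_expSpace _ hh)
    rw [sub_eq_zero.1 hz]
    exact hpm

/-- The sets may overlap; the induction uses the product rule for `1 + h` and `1 + g` without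
disjointness. -/
theorem Configuration.expProd_exp_sum {Z ι : Type*} {κ : Configuration Z} (s : Finset ι)
    (C : ι → Set Z) (c : ι → ℝ) (hC : ∀ i ∈ s, κ.count (C i) ≠ ∞) :
    κ.SummableOn (fun z =>
      Complex.exp (Complex.I * ((∑ i ∈ s, c i * (C i).indicator (fun _ => 1) z : ℝ) : ℂ)) - 1) ∧
    κ.expProd (fun z =>
      Complex.exp (Complex.I * ((∑ i ∈ s, c i * (C i).indicator (fun _ => 1) z : ℝ) : ℂ)) - 1) =
      Complex.exp (Complex.I * ((∑ i ∈ s, c i * κ.num (C i) : ℝ) : ℂ)) := by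
  classical
  induction s using Finset.induction_on with
  | empty => simp [expProd_zero, SummableOn]
  | insert i s hi ih =>
    obtain ⟨h1, h2⟩ := ih fun j hj => hC j (Finset.mem_insert_of_mem hj)
    have hi' := hC i (Finset.mem_insert_self _ _)
    have h3 := summableOn_indicator hi' (Complex.exp (Complex.I * c i) - 1)
    have h4 := expProd_indicator hi' (Complex.exp (Complex.I * c i) - 1)
    have h5 : ∀ z, Complex.exp (Complex.I *
        ((∑ j ∈ insert i s, c j * (C j).indicator (fun _ => 1) z : ℝ) : ℂ)) - 1 =
        (C i).indicator (fun _ => Complex.exp (Complex.I * c i) - 1) z +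
        (Complex.exp (Complex.I * ((∑ j ∈ s, c j * (C j).indicator (fun _ => 1) z : ℝ) : ℂ)) - 1) +
        (C i).indicator (fun _ => Complex.exp (Complex.I * c i) - 1) z *
        (Complex.exp
          (Complex.I * ((∑ j ∈ s, c j * (C j).indicator (fun _ => 1) z : ℝ) : ℂ)) - 1) := by
      intro z
      rw [Finset.sum_insert hi]
      by_cases hz : z ∈ C i
      · simp only [Set.indicator_of_mem hz, mul_one, Complex.ofReal_add, mul_add, Complex.exp_add]
        ring
      · simp only [Set.indicator_of_notMem hz, mul_zero, zero_add]
        ring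
    simp only [h5]
    refine ⟨(h3.add h1).add (h3.mul h1), ?_⟩
    rw [← expProd_mul h3 h1, h2, h4, Finset.sum_insert hi, Complex.ofReal_add, mul_add,
      Complex.exp_add, add_sub_cancel, ← Complex.exp_nat_mul]
    congr 2
    push_cast
    ring

theorem memLp_of_bounded {Z : Type*} [MeasurableSpace Z] {μ : Measure Z} {h : Z → ℂ}
    (hm : Measurable h) {K : ℝ} (hK : ∀ z, ‖h z‖ ≤ K) {T : Set Z} (hT : MeasurableSet T)
    (hμ : μ T ≠ ∞) (h0 : ∀ z, z ∉ T → h z = 0) (p : ℝ≥0∞) : MemLp h p μ := by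
  have h1 : T.indicator h = h := Set.indicator_eq_self.2 fun z hz => by
    by_contra hzT
    exact hz (h0 z hzT)
  rw [← h1, memLp_indicator_iff_restrict hT]
  have : IsFiniteMeasure (μ.restrict T) :=
    ⟨by rw [Measure.restrict_apply_univ]; exact hμ.lt_top⟩
  exact MemLp.of_bound hm.aestronglyMeasurable K (ae_of_all _ hK)

variable {Z Ω : Type*} [MeasurableSpace Z] [MeasurableSpace Ω] {μ : Measure Z} {P : Measure Ω}
  {N : Ω → Configuration Z} [IsProbabilityMeasure P] [SigmaFinite μ]

theorem Configuration.count_eq_tsum_spanningSets (μ : Measure Z) [SigmaFinite μ]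
    (κ : Configuration Z) {C : Set Z} (hC : MeasurableSet C) :
    κ.count C = ∑' n, κ.count (C ∩ disjointed (spanningSets μ) n) := by
  have hSm : ∀ n, MeasurableSet (disjointed (spanningSets μ) n) := fun n =>
    MeasurableSet.disjointed (measurableSet_spanningSets μ) n
  have hU : C = ⋃ n, C ∩ disjointed (spanningSets μ) n := by
    rw [← Set.inter_iUnion, iUnion_disjointed, iUnion_spanningSets, Set.inter_univ]
  have hd : Pairwise (Function.onFun Disjoint fun n => C ∩ disjointed (spanningSets μ) n) :=
    fun i j hij => ((disjoint_disjointed (spanningSets μ)) hij).mono Set.inter_subset_right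
      Set.inter_subset_right
  conv_lhs => rw [← κ.toMeasure_apply hC, hU, measure_iUnion hd fun n => hC.inter (hSm n)]
  exact tsum_congr fun n => κ.toMeasure_apply (hC.inter (hSm n))

theorem measure_inter_disjointed_ne_top (C : Set Z) (n : ℕ) :
    μ (C ∩ disjointed (spanningSets μ) n) ≠ ∞ :=
  ne_top_of_le_ne_top (measure_spanningSets_lt_top μ n).ne
    (measure_mono (Set.inter_subset_right.trans (disjointed_subset _ _)))

theorem configSigma_eq_iSup (N : Ω → Configuration Z) (B : Set Z) :
    configSigma N B = ⨆ C : {C : Set Z // MeasurableSet C ∧ C ⊆ B},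
      MeasurableSpace.comap (fun ω => (N ω).count C.1) inferInstance := by
  rw [configSigma, iSup_subtype]
  refine iSup_congr fun C => ?_
  rw [iSup_and]

/-- Exponentials of `i` times combinations of counts are constant multiples of the exponential
vectors of `exp (i u) - 1`, with `u` a step function supported in `B`; such exponentials are total.
-/
theorem represents_configSigma (hN : IsPoissonProcess μ P N) {B : Set Z} (hB : MeasurableSet B) :
    Represents (configSigma N B) (poissonExp hN) B := by
  refine Represents.of_orthogonal (hN.configSigma_le B) (fun h hh => ?_) fun f hf hf0 => ?_
  · refine (isClosed_lpMeas (hN.configSigma_le B)).mem_of_tendsto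
      (((continuous_poissonExp hN).tendsto _).comp (tendsto_finiteCut h))
      (Eventually.of_forall fun n => ?_)
    simp only [Function.comp_apply, SetLike.mem_coe]
    rw [mem_lpMeas_iff_aestronglyMeasurable]
    refine AEStronglyMeasurable.congr ?_ (coeFn_poissonExp hN (integrable_finiteCut n h)).symm
    refine AEStronglyMeasurable.mul_const (hN.aestronglyMeasurable_expProd
      (integrable_finiteCut n h) hB ?_) _
    filter_upwards [hh, coeFn_finiteCut n h] with z h1 h2 hz
    rw [h2, Set.indicator_apply_eq_zero]
    exact fun _ => h1 hz
  -- Only sets of finite measure, with almost surely finite counts, serve as generators. The count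
  -- in a general set is recovered as the sum over countably many such pieces.
  · let ι := {C : Set Z // MeasurableSet C ∧ C ⊆ B ∧ μ C ≠ ∞}
    let Y : ι → Ω → ℝ := fun C ω => ((N ω).num C.1 : ℝ)
    have hY : ∀ i, Measurable (Y i) := fun C =>
      measurable_from_nat.comp (hN.measurable_num C.2.1)
    refine eq_zero_of_inner_exp_eq_zero hY ?_ fun s c => ?_
    · rw [mem_lpMeas_iff_aestronglyMeasurable, configSigma_eq_iSup] at hf
      refine aestronglyMeasurable_of_generators (fun C => ?_) hf
      have hSm : ∀ n, MeasurableSet (disjointed (spanningSets μ) n) := fun n =>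
        MeasurableSet.disjointed (measurableSet_spanningSets μ) n
      let D : ℕ → ι := fun n => ⟨C.1 ∩ disjointed (spanningSets μ) n, C.2.1.inter (hSm n),
        Set.inter_subset_left.trans C.2.2, measure_inter_disjointed_ne_top _ n⟩
      refine ⟨fun ω => ∑' n, ENNReal.ofReal (Y (D n) ω), ?_, ?_⟩
      · refine Measurable.ennreal_tsum fun n => ENNReal.measurable_ofReal.comp ?_
        exact (comap_measurable (Y (D n))).mono
          (le_iSup (fun i => MeasurableSpace.comap (Y i) inferInstance) (D n)) le_rfl
      · filter_upwards [ae_all_iff.2 fun n => hN.ae_count_eq_num (D n).2.1 (D n).2.2.2] with ω hω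
        rw [(N ω).count_eq_tsum_spanningSets μ C.2.1]
        refine tsum_congr fun n => ?_
        rw [ENNReal.ofReal_natCast]
        exact hω n
    · set u : Z → ℂ := fun z => Complex.exp (Complex.I *
        ((∑ i ∈ s, -c i * i.1.indicator (fun _ => 1) z : ℝ) : ℂ)) - 1 with hu
      have hum : Measurable u := by
        have : ∀ i : ι, Measurable (i.1.indicator fun _ => (1 : ℝ)) := fun i =>
          measurable_const.indicator i.2.1
        have h2 : Measurable fun z => ∑ i ∈ s, -c i * i.1.indicator (fun _ => (1 : ℝ)) z :=
          Finset.measurable_fun_sum _ fun i _ => (this i).const_mul _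
        exact (Complex.measurable_exp.comp
          ((Complex.measurable_ofReal.comp h2).const_mul Complex.I)).sub_const 1
      have hub : ∀ z, ‖u z‖ ≤ 2 := fun z => by
        refine (norm_sub_le _ _).trans ?_
        rw [norm_exp_I_mul, norm_one]
        norm_num
      have hT : MeasurableSet (⋃ i ∈ s, i.1) := Finset.measurableSet_biUnion _ fun i _ => i.2.1
      have hTμ : μ (⋃ i ∈ s, i.1) ≠ ∞ :=
        (measure_biUnion_lt_top s.finite_toSet fun i _ => i.2.2.2.lt_top).ne
      have hu0 : ∀ z, z ∉ (⋃ i ∈ s, i.1) → u z = 0 := fun z hz => by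
        have : ∑ i ∈ s, -c i * i.1.indicator (fun _ => (1 : ℝ)) z = 0 := by
          refine Finset.sum_eq_zero fun i hi => ?_
          rw [Set.indicator_of_notMem fun h => hz (Set.mem_biUnion hi h), mul_zero]
        rw [hu]
        simp only [this]
        simp
      have h2 := memLp_of_bounded hum hub hT hTμ hu0 2
      have h1 : Integrable u μ := memLp_one_iff_integrable.1 (memLp_of_bounded hum hub hT hTμ hu0 1)
      have hsup : SupportedIn (h2.toLp u) B := by
        filter_upwards [h2.coeFn_toLp] with z hz hzB
        rw [hz]
        refine hu0 z fun h => ?_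
        obtain ⟨i, _, hi⟩ := Set.mem_iUnion₂.1 h
        exact hzB (i.2.2.1 hi)
      have h3 := hf0 _ hsup
      rw [inner_eq_integral_conj_mul] at h3
      have hi : Integrable (h2.toLp u) μ := h1.congr h2.coeFn_toLp.symm
      have h4 : ∫ ω, (starRingEnd ℂ) (poissonExp hN (h2.toLp u) ω) * f ω ∂P =
          ∫ ω, (starRingEnd ℂ) (Complex.exp (-∫ z, u z ∂μ)) *
            (Complex.exp (Complex.I * ((∑ i ∈ s, c i * Y i ω : ℝ) : ℂ)) * f ω) ∂P := by
        refine integral_congr_ae ?_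
        have hfin : ∀ᵐ ω ∂P, ∀ i ∈ s, (N ω).count i.1 ≠ ∞ := by
          rw [Finset.eventually_all]
          exact fun i _ => hN.ae_count_ne_top i.2.1 i.2.2.2
        filter_upwards [coeFn_poissonExp hN hi, poissonExpFun_congr hN h2.coeFn_toLp, hfin]
          with ω k1 k2 k3
        have k4 := (Configuration.expProd_exp_sum (κ := N ω) s (fun i => i.1) (fun i => -c i) k3).2
        have k5 : (starRingEnd ℂ) ((N ω).expProd u) =
            Complex.exp (Complex.I * ((∑ i ∈ s, c i * Y i ω : ℝ) : ℂ)) := by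
          rw [hu, k4, ← Complex.exp_conj]
          simp only [map_mul, map_neg, Complex.conj_I, Complex.conj_ofReal, neg_mul,
            Finset.sum_neg_distrib, Complex.ofReal_neg, mul_neg, neg_neg, Y]
        rw [k1, k2, poissonExpFun, map_mul, k5]
        ring
      rw [h4, integral_const_mul] at h3
      refine (mul_eq_zero.1 h3).resolve_left ?_
      rw [← Complex.exp_conj]
      exact Complex.exp_ne_zero _

end PoissonSigma


/-! ### Lévy measures -/

section LevyMeasure

/-- The numbers of absolute value greater than `1 / (n + 1)`. -/
def bigJumps (n : ℕ) : Set ℝ := {t | 1 / ((n : ℝ) + 1) < |t|}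

theorem measurableSet_bigJumps (n : ℕ) : MeasurableSet (bigJumps n) :=
  measurableSet_lt measurable_const measurable_norm

theorem eventually_mem_bigJumps {t : ℝ} (ht : t ≠ 0) : ∀ᶠ n in atTop, t ∈ bigJumps n :=
  tendsto_one_div_add_atTop_nhds_zero_nat.eventually_lt_const (abs_pos.2 ht)

variable {Pi : Measure ℝ}

/-- Chebyshev's inequality for `t² / (1 + t²)`, which is increasing in `|t|`. -/
theorem IsLevyMeasure.measure_bigJumps (hPi : IsLevyMeasure Pi) (n : ℕ) :
    Pi (bigJumps n) < ∞ := by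
  set e : ℝ := 1 / ((n : ℝ) + 1) with he
  have he0 : 0 < e := by positivity
  refine lt_of_le_of_lt (measure_mono fun t ht => ?_)
    (hPi.integrable.measure_ge_lt_top (ε := e ^ 2 / (1 + e ^ 2)) (by positivity))
  have h1 : e ^ 2 ≤ t ^ 2 := by
    rw [← sq_abs t]
    exact pow_le_pow_left₀ he0.le (le_of_lt ht) 2
  change e ^ 2 / (1 + e ^ 2) ≤ t ^ 2 / (1 + t ^ 2)
  rw [div_le_div_iff₀ (by positivity) (by positivity)]
  nlinarith

theorem IsLevyMeasure.sigmaFinite (hPi : IsLevyMeasure Pi) : SigmaFinite Pi := by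
  refine ⟨⟨{ set := fun n => {0} ∪ bigJumps n
             set_mem := fun _ => trivial
             finite := fun n => ?_
             spanning := ?_ }⟩⟩
  · refine (measure_union_le _ _).trans_lt ?_
    rw [hPi.zero, zero_add]
    exact hPi.measure_bigJumps n
  · refine Set.eq_univ_of_forall fun t => Set.mem_iUnion.2 ?_
    by_cases ht : t = 0
    · exact ⟨0, Or.inl ht⟩
    · obtain ⟨n, hn⟩ := (eventually_mem_bigJumps ht).exists
      exact ⟨n, Or.inr hn⟩

theorem IsLevyMeasure.ae_ne_zero (hPi : IsLevyMeasure Pi) : ∀ᵐ t ∂Pi, t ≠ 0 := by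
  rw [ae_iff]
  simpa using hPi.zero

/-- Combines the two bounds `K² t²` and `4`; it puts `exp (i a(x) t) - 1` into `L²` for bounded `a`.
-/
theorem norm_exp_sub_one_sq_le {y t K : ℝ} (hy : |y| ≤ K) :
    ‖Complex.exp (Complex.I * ((y * t : ℝ) : ℂ)) - 1‖ ^ 2 ≤
      (K ^ 2 + 4) * (t ^ 2 / (1 + t ^ 2)) := by
  have h1 : ‖Complex.exp (Complex.I * ((y * t : ℝ) : ℂ)) - 1‖ ^ 2 ≤ K ^ 2 * t ^ 2 := by
    have := Real.norm_exp_I_mul_ofReal_sub_one_le (x := y * t)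
    calc _ ≤ ‖y * t‖ ^ 2 := pow_le_pow_left₀ (norm_nonneg _) this 2
      _ = |y| ^ 2 * t ^ 2 := by rw [Real.norm_eq_abs, abs_mul, mul_pow, sq_abs t]
      _ ≤ _ := by gcongr
  have h2 : ‖Complex.exp (Complex.I * ((y * t : ℝ) : ℂ)) - 1‖ ^ 2 ≤ 4 := by
    have : ‖Complex.exp (Complex.I * ((y * t : ℝ) : ℂ)) - 1‖ ≤ 2 := by
      refine (norm_sub_le _ _).trans ?_
      rw [norm_exp_I_mul, norm_one]
      norm_num
    calc _ ≤ (2 : ℝ) ^ 2 := pow_le_pow_left₀ (norm_nonneg _) this 2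
      _ = 4 := by norm_num
  rw [mul_div_assoc', le_div_iff₀ (by positivity)]
  nlinarith [sq_nonneg t]

end LevyMeasure

/-! ### Exponential functionals of a Lévy process -/

section LevyVec

theorem Configuration.expProd_exp {Z : Type*} {κ : Configuration Z} {B : Set Z}
    (hB : κ.count B ≠ ∞) {u : Z → ℝ} (hu : ∀ z, z ∉ B → u z = 0) :
    κ.expProd (fun z => Complex.exp (Complex.I * (u z : ℂ)) - 1) =
      Complex.exp (Complex.I * ((∑' z, (κ.mult z : ℝ) * u z : ℝ) : ℂ)) := by
  have hT : ∀ z, z ∉ (κ.finite_support_of_count_ne_top hB).toFinset → κ.mult z = 0 ∨ u z = 0 := by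
    intro z hz
    by_cases hzB : z ∈ B
    · left
      by_contra h0
      exact hz (by simpa using ⟨hzB, h0⟩)
    · exact Or.inr (hu z hzB)
  rw [expProd, tprod_eq_prod (s := (κ.finite_support_of_count_ne_top hB).toFinset),
    tsum_eq_sum (s := (κ.finite_support_of_count_ne_top hB).toFinset), Complex.ofReal_sum,
    Finset.mul_sum, Complex.exp_sum]
  · refine Finset.prod_congr rfl fun z _ => ?_
    rw [add_sub_cancel, ← Complex.exp_nat_mul]
    congr 1
    push_cast
    ring
  · intro z hz
    rcases hT z hz with h | h <;> simp [h]
  · intro z hz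
    rcases hT z hz with h | h <;> simp [h]

variable {X : Type*} [MeasurableSpace X] {ν : Measure X} {Pi : Measure ℝ}

/-- The function `exp(i a(x) t) - 1`. -/
def levyVec (a : X → ℝ) (z : X × ℝ) : ℂ := Complex.exp (Complex.I * ((a z.1 * z.2 : ℝ) : ℂ)) - 1

theorem measurable_levyVec {a : X → ℝ} (ha : Measurable a) : Measurable (levyVec a) := by
  unfold levyVec
  fun_prop

theorem ae_abs_le_norm (a : Lp ℝ ∞ ν) : ∀ᵐ x ∂ν, |a x| ≤ ‖a‖ := by
  have h := ae_le_eLpNormEssSup (f := a) (μ := ν)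
  filter_upwards [h] with x hx
  rw [Lp.norm_def, eLpNorm_exponent_top, ← Real.norm_eq_abs, ← toReal_enorm]
  refine ENNReal.toReal_mono ?_ hx
  have := Lp.eLpNorm_ne_top a
  rwa [eLpNorm_exponent_top] at this

theorem ae_fst {p : X → Prop} (h : ∀ᵐ x ∂ν, p x) : ∀ᵐ z ∂ν.prod Pi, p z.1 :=
  Measure.quasiMeasurePreserving_fst.ae h

theorem ae_snd [SFinite Pi] {p : ℝ → Prop} (h : ∀ᵐ t ∂Pi, p t) : ∀ᵐ z ∂ν.prod Pi, p z.2 :=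
  Measure.quasiMeasurePreserving_snd.ae h

variable [IsFiniteMeasure ν]

theorem integrable_sq_levy (ν : Measure X) [IsFiniteMeasure ν] (hPi : IsLevyMeasure Pi) (K : ℝ) :
    Integrable (fun z : X × ℝ => K * (z.2 ^ 2 / (1 + z.2 ^ 2))) (ν.prod Pi) := by
  have := hPi.sigmaFinite
  exact (hPi.integrable.comp_snd ν).const_mul K

theorem memLp_levyVec (hPi : IsLevyMeasure Pi) (a : Lp ℝ ∞ ν) :
    MemLp (levyVec a) 2 (ν.prod Pi) := by
  have hm := (measurable_levyVec (Lp.stronglyMeasurable a).measurable).aestronglyMeasurable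
    (μ := ν.prod Pi)
  rw [memLp_two_iff_integrable_sq_norm hm]
  refine (integrable_sq_levy ν hPi (‖a‖ ^ 2 + 4)).mono' (hm.norm.pow 2) ?_
  filter_upwards [ae_fst (ae_abs_le_norm a)] with z hz
  rw [Real.norm_of_nonneg (by positivity)]
  exact norm_exp_sub_one_sq_le hz

/-- The function `exp(i a(x) t) - 1` as an element of `L²`. -/
def levyVecL (hPi : IsLevyMeasure Pi) (a : Lp ℝ ∞ ν) : Lp ℂ 2 (ν.prod Pi) :=
  (memLp_levyVec hPi a).toLp _

theorem coeFn_levyVecL (hPi : IsLevyMeasure Pi) (a : Lp ℝ ∞ ν) :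
    levyVecL hPi a =ᵐ[ν.prod Pi] levyVec a := MemLp.coeFn_toLp _

/-- The restriction of a bounded function to `D`. -/
def indL (D : Set X) (hD : MeasurableSet D) (a : Lp ℝ ∞ ν) : Lp ℝ ∞ ν :=
  ((Lp.memLp a).indicator hD).toLp _

theorem cut_levyVecL (hPi : IsLevyMeasure Pi) {D : Set X} (hD : MeasurableSet D) (a : Lp ℝ ∞ ν) :
    cut (Prod.fst ⁻¹' D) (measurable_fst hD) (levyVecL hPi a) = levyVecL hPi (indL D hD a) := by
  have h1 : indL D hD a =ᵐ[ν] D.indicator a := MemLp.coeFn_toLp _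
  refine Lp.ext ?_
  filter_upwards [coeFn_cut (Prod.fst ⁻¹' D) (measurable_fst hD) (levyVecL hPi a),
    coeFn_levyVecL hPi a, coeFn_levyVecL hPi (indL D hD a), ae_fst h1] with z k1 k2 k3 k4
  rw [k1, k3, levyVec, k4]
  by_cases hz : z.1 ∈ D
  · rw [Set.indicator_of_mem (by exact hz), k2, Set.indicator_of_mem hz, levyVec]
  · rw [Set.indicator_of_notMem (by exact hz), Set.indicator_of_notMem hz]
    simp

theorem tendsto_cut_bigJumps (hPi : IsLevyMeasure Pi) (h : Lp ℂ 2 (ν.prod Pi)) :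
    Tendsto (fun n => cut (Prod.snd ⁻¹' bigJumps n) (measurable_snd (measurableSet_bigJumps n)) h)
      atTop (𝓝 h) := by
  have := hPi.sigmaFinite
  refine tendsto_of_dominated (b := fun z => ‖h z‖) (integrable_norm_sq h) (fun n => ?_) ?_
  · filter_upwards [coeFn_cut _ (measurable_snd (measurableSet_bigJumps n)) h] with z hz
    rw [hz]
    exact norm_indicator_le_norm_self _ _
  · filter_upwards [ae_all_iff.2 fun n => coeFn_cut _ (measurable_snd (measurableSet_bigJumps n)) h,
      ae_snd hPi.ae_ne_zero] with z hz h0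
    simp only [hz]
    refine tendsto_const_nhds.congr' ?_
    filter_upwards [eventually_mem_bigJumps h0] with n hn
    rw [Set.indicator_of_mem (by exact hn)]

theorem measure_snd_bigJumps_ne_top (ν : Measure X) [IsFiniteMeasure ν] (hPi : IsLevyMeasure Pi)
    (n : ℕ) : ν.prod Pi (Prod.snd ⁻¹' bigJumps n) ≠ ∞ := by
  have := hPi.sigmaFinite
  have h1 : (Prod.snd ⁻¹' bigJumps n : Set (X × ℝ)) = Set.univ ×ˢ bigJumps n := by ext; simp
  rw [h1, Measure.prod_prod]
  exact ENNReal.mul_ne_top (measure_ne_top _ _) (hPi.measure_bigJumps n).ne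

theorem integrable_cut_bigJumps (hPi : IsLevyMeasure Pi) (n : ℕ) (h : Lp ℂ 2 (ν.prod Pi)) :
    Integrable (cut (Prod.snd ⁻¹' bigJumps n) (measurable_snd (measurableSet_bigJumps n)) h)
      (ν.prod Pi) := by
  refine Integrable.congr ?_ (coeFn_cut _ (measurable_snd (measurableSet_bigJumps n)) h).symm
  rw [integrable_indicator_iff (measurable_snd (measurableSet_bigJumps n))]
  have : IsFiniteMeasure ((ν.prod Pi).restrict (Prod.snd ⁻¹' bigJumps n)) :=
    ⟨by rw [Measure.restrict_apply_univ]; exact (measure_snd_bigJumps_ne_top ν hPi n).lt_top⟩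
  exact ((Lp.memLp h).restrict _).integrable one_le_two

variable {Ω : Type*} [MeasurableSpace Ω] {P : Measure Ω} [IsProbabilityMeasure P]
  {η : GenProcess ∞ ν P} {N : Ω → Configuration (X × ℝ)} {c : ℝ}

/-- The integrand of the Lévy–Khintchin formula. -/
def levyIntegrand (y t : ℝ) : ℂ :=
  Complex.exp (Complex.I * t * y) - 1 - Complex.I * t * y / (1 + (t : ℂ) ^ 2)

/-- For `|t| ≤ 1` the exponential is expanded to second order, with `w - w / (1 + t²) = w t² / (1 +
t²)` left over, `w = i y t`. For `|t| > 1` every term is bounded and `t² / (1 + t²) ≥ 1/2`. -/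
theorem norm_levyIntegrand_le {y t K : ℝ} (hy : |y| ≤ K) :
    ‖levyIntegrand y t‖ ≤ (6 * K ^ 2 + K + 4) * (t ^ 2 / (1 + t ^ 2)) := by
  have hK : 0 ≤ K := (abs_nonneg y).trans hy
  have ht : 0 < 1 + t ^ 2 := by positivity
  have hq : ‖(1 + (t : ℂ) ^ 2)‖ = 1 + t ^ 2 := by
    rw [show (1 + (t : ℂ) ^ 2) = ((1 + t ^ 2 : ℝ) : ℂ) by push_cast; rfl, Complex.norm_real,
      Real.norm_of_nonneg ht.le]
  have hne : (1 + (t : ℂ) ^ 2) ≠ 0 := by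
    rw [← norm_ne_zero_iff, hq]
    exact ht.ne'
  have harg : Complex.I * t * y = Complex.I * ((y * t : ℝ) : ℂ) := by
    push_cast
    ring
  have hnorm : ‖Complex.I * ((y * t : ℝ) : ℂ)‖ = |y| * |t| := by
    rw [norm_mul, Complex.norm_I, one_mul, Complex.norm_real, Real.norm_eq_abs, abs_mul]
  have hexp : ‖Complex.exp (Complex.I * ((y * t : ℝ) : ℂ))‖ = 1 := norm_exp_I_mul _
  set w : ℂ := Complex.I * ((y * t : ℝ) : ℂ) with hw
  rw [levyIntegrand, harg]
  set s : ℝ := t ^ 2 / (1 + t ^ 2) with hs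
  have hs0 : 0 ≤ s := by positivity
  rcases le_or_gt |t| 1 with h1 | h1
  · have ht2 : t ^ 2 ≤ 1 := by
      rw [← sq_abs]
      nlinarith [abs_nonneg t]
    have hst : t ^ 2 ≤ 2 * s := by
      rw [hs, mul_div_assoc', le_div_iff₀ ht]
      nlinarith [sq_nonneg t]
    have h2 : Complex.exp w - 1 - w / (1 + (t : ℂ) ^ 2) =
        (Complex.exp w - 1 - w) + w * ((t : ℂ) ^ 2 / (1 + (t : ℂ) ^ 2)) := by
      field_simp
      ring
    -- For large `w` the bound follows from `|exp w| = 1`, as `w` is imaginary: `2 + ‖w‖ ≤ 3 ‖w‖²`.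
    have h3 : ‖Complex.exp w - 1 - w‖ ≤ 3 * ‖w‖ ^ 2 := by
      rcases le_or_gt ‖w‖ 1 with h4 | h4
      · exact (Complex.norm_exp_sub_one_sub_id_le h4).trans (by nlinarith [sq_nonneg ‖w‖])
      · refine (norm_sub_le _ _).trans ((add_le_add_left (norm_sub_le _ _) _).trans ?_)
        rw [hexp, norm_one]
        nlinarith
    have h5 : ‖w‖ ^ 2 ≤ K ^ 2 * t ^ 2 := by
      rw [hnorm, mul_pow, sq_abs t]
      gcongr
    have h6 : ‖w * ((t : ℂ) ^ 2 / (1 + (t : ℂ) ^ 2))‖ ≤ K * s := by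
      rw [norm_mul, norm_div, hq, norm_pow, Complex.norm_real, Real.norm_eq_abs, sq_abs, ← hs, hnorm]
      have : |y| * |t| ≤ K * 1 := by gcongr
      nlinarith
    rw [h2]
    refine (norm_add_le _ _).trans ?_
    nlinarith [mul_le_mul_of_nonneg_left hst (sq_nonneg K)]
  · have ht2 : 1 ≤ t ^ 2 := by
      rw [← sq_abs]
      nlinarith
    have hst : 1 ≤ 2 * s := by
      rw [hs, mul_div_assoc', le_div_iff₀ ht]
      linarith
    have h6 : ‖w / (1 + (t : ℂ) ^ 2)‖ ≤ K * s := by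
      rw [norm_div, hq, hnorm, hs, mul_div_assoc']
      gcongr
      rw [← sq_abs]
      nlinarith
    refine (norm_sub_le _ _).trans ((add_le_add_left (norm_sub_le _ _) _).trans ?_)
    rw [hexp, norm_one]
    nlinarith [mul_nonneg (sq_nonneg K) hs0]

theorem integrable_levyIntegrand (hPi : IsLevyMeasure Pi) (a : Lp ℝ ∞ ν) :
    Integrable (fun z : X × ℝ => levyIntegrand (a z.1) z.2) (ν.prod Pi) := by
  have := hPi.sigmaFinite
  have ha : Measurable a := (Lp.stronglyMeasurable a).measurable
  refine (integrable_sq_levy ν hPi (6 * ‖a‖ ^ 2 + ‖a‖ + 4)).mono' ?_ ?_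
  · refine Measurable.aestronglyMeasurable ?_
    unfold levyIntegrand
    fun_prop
  · filter_upwards [ae_fst (ae_abs_le_norm a)] with z hz
    exact norm_levyIntegrand_le hz

theorem integral_levyExponent (hPi : IsLevyMeasure Pi) (c : ℝ) (a : Lp ℝ ∞ ν) :
    ∫ x, levyExponent Pi c (a x) ∂ν =
      Complex.I * ((c * ∫ x, a x ∂ν : ℝ) : ℂ) +
        ∫ z : X × ℝ, levyIntegrand (a z.1) z.2 ∂(ν.prod Pi) := by
  have := hPi.sigmaFinite
  have ha : Integrable a ν := (Lp.memLp a).integrable le_top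
  have h1 := (integrable_levyIntegrand hPi a).integral_prod_left
  rw [integral_prod _ (integrable_levyIntegrand hPi a)]
  have h2 : Integrable (fun x => Complex.I * c * (a x : ℂ)) ν := ha.ofReal.const_mul _
  refine (integral_add h2 h1).trans ?_
  rw [integral_const_mul, integral_complex_ofReal, mul_assoc, ← Complex.ofReal_mul]

/-- The exponential of a process given by jumps is proportional to an exponential vector of the
configuration of jumps. -/
theorem IsJumpConfiguration.exp_eq [SigmaFinite (ν.prod Pi)] (hPi : IsLevyMeasure Pi)
    (hN : IsJumpConfiguration Pi c η N) (a : Lp ℝ ∞ ν) :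
    ∀ᵐ ω ∂P, poissonExp hN.poisson (levyVecL hPi a) ω =
      Complex.exp (-∫ x, levyExponent Pi c (a x) ∂ν) * Complex.exp (Complex.I * (η a ω : ℂ)) := by
  set B : ℕ → Set (X × ℝ) := fun n => Prod.snd ⁻¹' bigJumps n with hB
  have hBm : ∀ n, MeasurableSet (B n) := fun n => measurable_snd (measurableSet_bigJumps n)
  set u : ℕ → X × ℝ → ℝ := fun n z => if 1 / ((n : ℝ) + 1) < |z.2| then a z.1 * z.2 else 0 with hu
  set q : ℕ → ℝ := fun n => c * ∫ x, a x ∂ν -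
    ∫ z : X × ℝ, (if 1 / ((n : ℝ) + 1) < |z.2| then a z.1 * (z.2 / (1 + z.2 ^ 2)) else 0)
      ∂(ν.prod Pi) with hq
  set A : ℕ → Ω → ℝ := fun n ω => c * ∫ x, a x ∂ν +
    ((∑' z : X × ℝ, ((N ω).mult z : ℝ) * u n z) -
      ∫ z : X × ℝ, (if 1 / ((n : ℝ) + 1) < |z.2| then a z.1 * (z.2 / (1 + z.2 ^ 2)) else 0)
        ∂(ν.prod Pi)) with hA
  have hAq : ∀ n ω, A n ω = q n + ∑' z : X × ℝ, ((N ω).mult z : ℝ) * u n z := fun n ω => by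
    simp only [hA, hq]
    ring
  set h : ℕ → Lp ℂ 2 (ν.prod Pi) := fun n => cut (B n) (hBm n) (levyVecL hPi a) with hh
  -- Jumps larger than `1 / (n + 1)` are almost surely finite in number, so the truncated
  -- exponential vector equals `k n · exp (i A n)` exactly. In the limit, `k n` tends to the
  -- Lévy–Khintchin constant, the vectors converge in `L²`, and `A n` converges to `⟨a, η⟩` in
  -- probability.
  set k : ℕ → ℂ := fun n =>
    Complex.exp (-∫ z, h n z ∂(ν.prod Pi)) * Complex.exp (-(Complex.I * q n)) with hk
  have hkA : ∀ n, ∀ᵐ ω ∂P, poissonExp hN.poisson (h n) ω =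
      k n * Complex.exp (Complex.I * (A n ω : ℂ)) := by
    intro n
    have h1 : h n =ᵐ[ν.prod Pi] fun z => Complex.exp (Complex.I * (u n z : ℂ)) - 1 := by
      filter_upwards [coeFn_cut (B n) (hBm n) (levyVecL hPi a), coeFn_levyVecL hPi a] with z k1 k2
      rw [hh]
      refine k1.trans ?_
      by_cases hz : z ∈ B n
      · have hz' : 1 / ((n : ℝ) + 1) < |z.2| := hz
        rw [Set.indicator_of_mem hz, k2, levyVec, hu]
        simp only [hz', if_true]
      · have hz' : ¬ 1 / ((n : ℝ) + 1) < |z.2| := hz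
        rw [Set.indicator_of_notMem hz, hu]
        simp only [hz', if_false]
        simp
    filter_upwards [coeFn_poissonExp hN.poisson (integrable_cut_bigJumps hPi n (levyVecL hPi a)),
      hN.poisson.ae_expProd_congr h1,
      hN.poisson.ae_count_ne_top (hBm n) (measure_snd_bigJumps_ne_top ν hPi n)] with ω k1 k2 k3
    have k4 := Configuration.expProd_exp k3 (u := u n) fun z hz => by
      have hz' : ¬ 1 / ((n : ℝ) + 1) < |z.2| := hz
      simp only [hu, hz', if_false]
    refine k1.trans ?_
    rw [poissonExpFun]
    refine (congrArg (· * _) (k2.trans k4)).trans ?_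
    rw [hAq, hk, mul_assoc, ← Complex.exp_add, mul_comm, ← Complex.exp_add, ← Complex.exp_add]
    congr 1
    push_cast
    ring
  have hlim : Tendsto (fun n => poissonExp hN.poisson (h n)) atTop
      (𝓝 (poissonExp hN.poisson (levyVecL hPi a))) :=
    ((continuous_poissonExp hN.poisson).tendsto _).comp (tendsto_cut_bigJumps hPi _)
  have hklim : Tendsto k atTop (𝓝 (Complex.exp (-∫ x, levyExponent Pi c (a x) ∂ν))) := by
    have hint : Tendsto (fun n => ∫ z, (B n).indicator (fun z => levyIntegrand (a z.1) z.2) z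
        ∂(ν.prod Pi)) atTop (𝓝 (∫ z, levyIntegrand (a z.1) z.2 ∂(ν.prod Pi))) := by
      refine tendsto_integral_of_dominated_convergence (fun z => ‖levyIntegrand (a z.1) z.2‖)
        (fun n => (integrable_levyIntegrand hPi a).1.indicator (hBm n))
        (integrable_levyIntegrand hPi a).norm
        (fun n => ae_of_all _ fun z => norm_indicator_le_norm_self _ z) ?_
      have := hPi.sigmaFinite
      filter_upwards [ae_snd hPi.ae_ne_zero] with z hz
      refine tendsto_const_nhds.congr' ?_
      filter_upwards [eventually_mem_bigJumps hz] with n hn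
      exact (Set.indicator_of_mem (show z ∈ B n from hn)
        fun z : X × ℝ => levyIntegrand (a z.1) z.2).symm
    have hk' : ∀ n, k n = Complex.exp (-(Complex.I * ((c * ∫ x, a x ∂ν : ℝ) : ℂ) +
        ∫ z, (B n).indicator (fun z => levyIntegrand (a z.1) z.2) z ∂(ν.prod Pi))) := by
      intro n
      have hi1 : Integrable (h n) (ν.prod Pi) := integrable_cut_bigJumps hPi n _
      have hi2 : Integrable (fun z : X × ℝ => (if 1 / ((n : ℝ) + 1) < |z.2| then
          a z.1 * (z.2 / (1 + z.2 ^ 2)) else 0)) (ν.prod Pi) := by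
        have hfun : (fun z : X × ℝ => (if 1 / ((n : ℝ) + 1) < |z.2| then
            a z.1 * (z.2 / (1 + z.2 ^ 2)) else 0)) =
            (B n).indicator fun z => a z.1 * (z.2 / (1 + z.2 ^ 2)) := by
          ext z
          rw [Set.indicator]
          rfl
        rw [hfun, integrable_indicator_iff (hBm n)]
        have ha : Measurable a := (Lp.stronglyMeasurable a).measurable
        refine Measure.integrableOn_of_bounded (M := ‖a‖) (measure_snd_bigJumps_ne_top ν hPi n)
          (Measurable.aestronglyMeasurable (by fun_prop)) (ae_restrict_of_ae ?_)
        filter_upwards [ae_fst (ae_abs_le_norm a)] with z hz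
        have h1 : |z.2 / (1 + z.2 ^ 2)| ≤ 1 := by
          rw [abs_div, abs_of_pos (by positivity : 0 < 1 + z.2 ^ 2),
            div_le_one (by positivity), ← sq_abs]
          nlinarith [sq_nonneg (|z.2| - 1), abs_nonneg z.2]
        rw [Real.norm_eq_abs, abs_mul]
        calc |a z.1| * |z.2 / (1 + z.2 ^ 2)| ≤ ‖a‖ * 1 := by gcongr
          _ = ‖a‖ := mul_one _
      have h1 : ∫ z, (B n).indicator (fun z => levyIntegrand (a z.1) z.2) z ∂(ν.prod Pi) =
          ∫ z, h n z ∂(ν.prod Pi) - Complex.I * ((∫ z : X × ℝ, (if 1 / ((n : ℝ) + 1) < |z.2| then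
          a z.1 * (z.2 / (1 + z.2 ^ 2)) else 0) ∂(ν.prod Pi) : ℝ) : ℂ) := by
        have hi3 : Integrable (fun z : X × ℝ => Complex.I * (((if 1 / ((n : ℝ) + 1) < |z.2| then
          a z.1 * (z.2 / (1 + z.2 ^ 2)) else 0) : ℝ) : ℂ)) (ν.prod Pi) := hi2.ofReal.const_mul _
        rw [← integral_complex_ofReal, ← integral_const_mul, ← integral_sub hi1 hi3]
        refine integral_congr_ae ?_
        filter_upwards [coeFn_cut (B n) (hBm n) (levyVecL hPi a), coeFn_levyVecL hPi a]
          with z k1 k2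
        rw [show h n z = _ from k1]
        by_cases hz : z ∈ B n
        · have hz' : 1 / ((n : ℝ) + 1) < |z.2| := hz
          rw [Set.indicator_of_mem hz, Set.indicator_of_mem hz, k2, levyVec, levyIntegrand,
            if_pos hz']
          push_cast
          ring_nf
        · have hz' : ¬ 1 / ((n : ℝ) + 1) < |z.2| := hz
          rw [Set.indicator_of_notMem hz, Set.indicator_of_notMem hz, if_neg hz']
          simp
      rw [h1]
      simp only [hk, hq]
      rw [← Complex.exp_add]
      congr 1
      push_cast
      ring
    rw [integral_levyExponent hPi]
    simp only [funext hk']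
    exact ((Complex.continuous_exp.comp continuous_neg).tendsto _).comp (hint.const_add _)
  obtain ⟨n₁, hn₁, h1⟩ := (hN.jumps a).exists_seq_tendsto_ae
  obtain ⟨n₂, hn₂, h2⟩ := (tendstoInMeasure_of_tendsto_Lp
    (hlim.comp hn₁.tendsto_atTop)).exists_seq_tendsto_ae
  -- Solving for `k` and passing to the limit along a common subsequence yields a second expression
  -- for the limit of the constants.
  have h3 : ∀ᵐ ω ∂P, Tendsto (fun j => k (n₁ (n₂ j))) atTop
      (𝓝 (poissonExp hN.poisson (levyVecL hPi a) ω * Complex.exp (-(Complex.I * (η a ω : ℂ))))) := by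
    filter_upwards [h1, h2, ae_all_iff.2 hkA] with ω l1 l2 l3
    have l4 : Tendsto (fun j => Complex.exp (-(Complex.I * (A (n₁ (n₂ j)) ω : ℂ)))) atTop
        (𝓝 (Complex.exp (-(Complex.I * (η a ω : ℂ))))) := by
      have hc : Continuous fun y : ℝ => Complex.exp (-(Complex.I * (y : ℂ))) := by fun_prop
      exact (hc.tendsto _).comp (l1.comp hn₂.tendsto_atTop)
    refine (l2.mul l4).congr fun j => ?_
    simp only [Function.comp_apply]
    rw [l3, mul_assoc, ← Complex.exp_add, add_neg_cancel, Complex.exp_zero, mul_one]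
  filter_upwards [h3] with ω hω
  rw [tendsto_nhds_unique (hklim.comp (hn₁.comp hn₂).tendsto_atTop) hω, mul_assoc,
    ← Complex.exp_add, neg_add_cancel, Complex.exp_zero, mul_one]

/-- A process given by its jumps is a Lévy process. -/
theorem IsJumpConfiguration.isLevyProcess (hPi : IsLevyMeasure Pi)
    (hN : IsJumpConfiguration Pi c η N) : IsLevyProcess Pi c η := by
  intro a
  have := hPi.sigmaFinite
  have hE := isExpSystem_poissonExp hN.poisson
  -- Pairing with `E 0 = 1` says that an exponential vector has mean `1`, and this is the
  -- characteristic functional.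
  have h1 := hE.inner_eq 0 (levyVecL hPi a)
  rw [inner_zero_left, Complex.exp_zero, inner_eq_integral_conj_mul] at h1
  have h2 : ∫ ω, (starRingEnd ℂ) (poissonExp hN.poisson 0 ω) *
      poissonExp hN.poisson (levyVecL hPi a) ω ∂P =
      Complex.exp (-∫ x, levyExponent Pi c (a x) ∂ν) *
        ∫ ω, Complex.exp (Complex.I * (η a ω : ℂ)) ∂P := by
    rw [← integral_const_mul]
    refine integral_congr_ae ?_
    filter_upwards [hE.zero, hN.exp_eq hPi a] with ω k1 k2
    rw [k1, k2, map_one, one_mul]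
  rw [h2, Complex.exp_neg] at h1
  exact (inv_mul_eq_one₀ (Complex.exp_ne_zero _)).1 h1 |>.symm

end LevyVec


/-! ### Totality of the functions `1_A(x) (exp(i s t) - 1)` -/

section Totality

theorem ae_eq_zero_of_setIntegral_prod {X Y : Type*} [MeasurableSpace X] [MeasurableSpace Y]
    {μ : Measure (X × Y)} {g : X × Y → ℂ} (hg : Integrable g μ)
    (h : ∀ A T, MeasurableSet A → MeasurableSet T → ∫ z in A ×ˢ T, g z ∂μ = 0) : g =ᵐ[μ] 0 := by
  refine hg.ae_eq_zero_of_forall_setIntegral_eq_zero fun s hs hfin => ?_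
  clear hfin
  induction s, hs using MeasurableSpace.induction_on_inter generateFrom_prod.symm
    isPiSystem_prod with
  | empty => simp
  | basic s hs =>
    obtain ⟨A, hA, T, hT, rfl⟩ := hs
    exact h A T hA hT
  | compl s hs ih =>
    have h1 := integral_add_compl hs hg
    have h2 := h Set.univ Set.univ MeasurableSet.univ MeasurableSet.univ
    rw [Set.univ_prod_univ, Measure.restrict_univ] at h2
    rwa [ih, h2, zero_add] at h1
  | iUnion f hd hf ih =>
    rw [integral_iUnion hf hd hg.integrableOn]
    simp [ih]

/-- Otherwise both `t` and `√2 t` would be nonzero multiples of `2π` and `√2` rational. So `exp (i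
t) - 1` and `exp (i √2 t) - 1` have only `0` as common zero. -/
theorem eq_zero_of_exp_eq_one {t : ℝ} (h1 : Complex.exp (Complex.I * (t : ℂ)) = 1)
    (h2 : Complex.exp (Complex.I * ((Real.sqrt 2 * t : ℝ) : ℂ)) = 1) : t = 0 := by
  rw [Complex.exp_eq_one_iff] at h1 h2
  obtain ⟨m, hm⟩ := h1
  obtain ⟨n, hn⟩ := h2
  have hm' : t = m * (2 * Real.pi) := by
    have := congrArg Complex.im hm
    simpa using this
  have hn' : Real.sqrt 2 * t = n * (2 * Real.pi) := by
    have := congrArg Complex.im hn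
    simpa using this
  by_contra ht
  have hm0 : (m : ℝ) ≠ 0 := fun h0 => ht (by rw [hm', h0, zero_mul])
  have h3 : Real.sqrt 2 = ((n / m : ℚ) : ℝ) := by
    push_cast
    rw [eq_div_iff hm0]
    have h4 : (2 * Real.pi) ≠ 0 := by positivity
    refine mul_right_cancel₀ h4 ?_
    rw [mul_assoc, ← hm', hn']
  exact irrational_sqrt_two ⟨_, h3.symm⟩

variable {X : Type*} [MeasurableSpace X] {ν : Measure X} [IsFiniteMeasure ν] {Pi : Measure ℝ}

/-- The function `s 1_D`. -/
def stepL (ν : Measure X) [IsFiniteMeasure ν] (D : Set X) (hD : MeasurableSet D) (s : ℝ) :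
    Lp ℝ ∞ ν := indicatorConstLp ∞ hD (measure_ne_top ν D) s

theorem coeFn_levyVecL_stepL (hPi : IsLevyMeasure Pi) {D : Set X} (hD : MeasurableSet D) (s : ℝ) :
    ∀ᵐ z ∂ν.prod Pi, levyVecL hPi (stepL ν D hD s) z =
      (Prod.fst ⁻¹' D).indicator
        (fun z : X × ℝ => Complex.exp (Complex.I * ((s * z.2 : ℝ) : ℂ)) - 1) z := by
  have h1 : stepL ν D hD s =ᵐ[ν] D.indicator fun _ => s := indicatorConstLp_coeFn
  filter_upwards [coeFn_levyVecL hPi (stepL ν D hD s), ae_fst h1] with z k1 k2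
  rw [k1, levyVec, k2]
  by_cases hz : z.1 ∈ D
  · rw [Set.indicator_of_mem hz, Set.indicator_of_mem (by exact hz)]
  · rw [Set.indicator_of_notMem hz, Set.indicator_of_notMem (by exact hz)]
    simp

/-- Differences of the test functions have the form `1_D(x) exp (i q t) (exp (i r t) - 1)`. Hence
for each `r` all Fourier coefficients in `t` of `conj g · (exp (i r t) - 1)` vanish over every `D`,
and this function is zero. Two values of `r` with no common zero besides `t = 0` give `g = 0`. -/
theorem eq_zero_of_inner_levyVecL (hPi : IsLevyMeasure Pi) {A : Set X}
    (hA : MeasurableSet A) {g : Lp ℂ 2 (ν.prod Pi)} (hg : SupportedIn g (Prod.fst ⁻¹' A))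
    (h : ∀ D (hD : MeasurableSet D), D ⊆ A → ∀ s, ⟪g, levyVecL hPi (stepL ν D hD s)⟫_ℂ = 0) :
    g = 0 := by
  have := hPi.sigmaFinite
  have hD : ∀ D (hD : MeasurableSet D) s, ⟪g, levyVecL hPi (stepL ν D hD s)⟫_ℂ = 0 := by
    intro D hD s
    rw [← h (D ∩ A) (hD.inter hA) Set.inter_subset_right s, inner_eq_integral_conj_mul,
      inner_eq_integral_conj_mul]
    refine integral_congr_ae ?_
    filter_upwards [coeFn_levyVecL_stepL hPi hD s, coeFn_levyVecL_stepL hPi (hD.inter hA) s, hg]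
      with z k1 k2 k3
    rw [k1, k2]
    by_cases hz : z.1 ∈ A
    · congr 1
      by_cases hz' : z.1 ∈ D
      · rw [Set.indicator_of_mem (by exact hz'), Set.indicator_of_mem (by exact ⟨hz', hz⟩)]
      · rw [Set.indicator_of_notMem (by exact hz'),
          Set.indicator_of_notMem (by exact fun h => hz' h.1)]
    · rw [k3 hz, map_zero, zero_mul, zero_mul]
  -- The extra factor makes the function integrable over the possibly infinite measure, which the
  -- uniqueness theorem for Fourier transforms requires.
  have key : ∀ r : ℝ, ∀ᵐ z ∂ν.prod Pi, (starRingEnd ℂ) (g z) *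
      (Complex.exp (Complex.I * ((r * z.2 : ℝ) : ℂ)) - 1) = 0 := by
    intro r
    have hint : Integrable (fun z => (starRingEnd ℂ) (g z) *
        (Complex.exp (Complex.I * ((r * z.2 : ℝ) : ℂ)) - 1)) (ν.prod Pi) := by
      refine (integrable_conj_mul g (levyVecL hPi (stepL ν Set.univ MeasurableSet.univ r))).congr ?_
      filter_upwards [coeFn_levyVecL_stepL (ν := ν) hPi MeasurableSet.univ r] with z hz
      rw [hz]
      simp
    refine ae_eq_zero_of_setIntegral_prod hint fun D T hDm hT => ?_
    have hDm' : MeasurableSet (Prod.fst ⁻¹' D : Set (X × ℝ)) := measurable_fst hDm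
    have h1 := setIntegral_eq_zero_of_charFunctional (ι := Unit) (P := ν.prod Pi)
      (Y := fun _ z => z.2) (fun _ => measurable_snd) (hint.indicator hDm') (fun s c => ?_)
      (S := Prod.snd ⁻¹' T) (by
        rw [iSup_const]
        exact ⟨T, hT, rfl⟩)
    · rw [setIntegral_indicator hDm', Set.inter_comm] at h1
      exact h1
    · set q := ∑ i ∈ s, c i with hq
      have hi1 := integrable_conj_mul g (levyVecL hPi (stepL ν D hDm (q + r)))
      have hi2 := integrable_conj_mul g (levyVecL hPi (stepL ν D hDm q))
      have h2 : ∫ z, Complex.exp (Complex.I * ((∑ i ∈ s, c i * z.2 : ℝ) : ℂ)) *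
          (Prod.fst ⁻¹' D).indicator (fun z => (starRingEnd ℂ) (g z) *
            (Complex.exp (Complex.I * ((r * z.2 : ℝ) : ℂ)) - 1)) z ∂ν.prod Pi =
          ∫ z, ((starRingEnd ℂ) (g z) * levyVecL hPi (stepL ν D hDm (q + r)) z -
            (starRingEnd ℂ) (g z) * levyVecL hPi (stepL ν D hDm q) z) ∂ν.prod Pi := by
        refine integral_congr_ae ?_
        filter_upwards [coeFn_levyVecL_stepL hPi hDm (q + r), coeFn_levyVecL_stepL hPi hDm q]
          with z k1 k2
        rw [k1, k2, ← Finset.sum_mul, ← hq]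
        by_cases hz : z ∈ (Prod.fst ⁻¹' D : Set (X × ℝ))
        · simp only [Set.indicator_of_mem hz]
          rw [add_mul, Complex.ofReal_add, mul_add, Complex.exp_add]
          ring
        · simp only [Set.indicator_of_notMem hz]
          ring
      rw [h2, integral_sub hi1 hi2, ← inner_eq_integral_conj_mul, ← inner_eq_integral_conj_mul,
        hD D hDm, hD D hDm, sub_zero]
  refine Lp.ext ?_
  filter_upwards [key 1, key (Real.sqrt 2), ae_snd hPi.ae_ne_zero,
    Lp.coeFn_zero ℂ 2 (ν.prod Pi)] with z k1 k2 k3 k4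
  rw [k4]
  by_contra h0
  have hg0 : (starRingEnd ℂ) (g z) ≠ 0 := fun h => h0 (by simpa using h)
  refine k3 (eq_zero_of_exp_eq_one ?_ ?_)
  · have := (mul_eq_zero.1 k1).resolve_left hg0
    rw [one_mul] at this
    exact sub_eq_zero.1 this
  · exact sub_eq_zero.1 ((mul_eq_zero.1 k2).resolve_left hg0)

end Totality

/-! ### The σ-fields of a Lévy process -/

section LevySigma

theorem aestronglyMeasurable_prod {ι Ω : Type*} {m : MeasurableSpace Ω} [MeasurableSpace Ω]
    {P : Measure Ω} {f : ι → Ω → ℂ} (s : Finset ι) (hf : ∀ i, AEStronglyMeasurable[m] (f i) P) :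
    AEStronglyMeasurable[m] (fun ω => ∏ i ∈ s, f i ω) P := by
  classical
  induction s using Finset.induction_on with
  | empty => simpa using aestronglyMeasurable_const
  | insert i s hi ih =>
    simp only [Finset.prod_insert hi]
    exact (hf i).mul ih

variable {X Ω : Type*} [MeasurableSpace X] [MeasurableSpace Ω] {ν : Measure X} {Pi : Measure ℝ}
  [IsFiniteMeasure ν] {P : Measure Ω} [IsProbabilityMeasure P]
  {η : GenProcess ∞ ν P} {N : Ω → Configuration (X × ℝ)} {c : ℝ}

theorem prod_fst_singleton_eq_zero [NullSingletonClass ν] [SFinite Pi] (x : X) :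
    ν.prod Pi (Prod.fst ⁻¹' {x}) = 0 := by
  have : (Prod.fst ⁻¹' {x} : Set (X × ℝ)) = {x} ×ˢ Set.univ := by ext; simp
  rw [this, Measure.prod_prod, measure_singleton, zero_mul]

/-- Sums of jumps determine the jumps: exponentials of `i η` yield the exponential vectors of `exp
(i a(x) t) - 1`, fine partitions turn these into first chaos elements, totality gives the whole
first chaos over `A`, and products over partitions give all exponential vectors over `A`.
Conversely, a functional of `η` over `A` orthogonal to them is orthogonal to the exponentials of `i
η`. -/
theorem IsJumpConfiguration.represents_sigma [MeasurableSpace.CountablyGenerated X]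
    [MeasurableSpace.SeparatesPoints X] [NullSingletonClass ν] [SigmaFinite (ν.prod Pi)]
    (hPi : IsLevyMeasure Pi) (hN : IsJumpConfiguration Pi c η N) {A : Set X}
    (hA : MeasurableSet A) :
    Represents (η.sigma A) (poissonExp hN.poisson) (Prod.fst ⁻¹' A) := by
  have := hPi.sigmaFinite
  set E := poissonExp hN.poisson with hE'
  have hE : IsExpSystem E := isExpSystem_poissonExp hN.poisson
  have hm := η.sigma_le A
  have hμ : ∀ x : X, ν.prod Pi (Prod.fst ⁻¹' {x}) = 0 := prod_fst_singleton_eq_zero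
  set L := lpMeas ℂ ℂ (η.sigma A) 2 P with hL
  have hLc : IsClosed (L : Set (Lp ℂ 2 P)) := isClosed_lpMeas hm
  have hexp : ∀ a : Lp ℝ ∞ ν, (∀ᵐ x ∂ν, x ∉ A → a x = 0) → E (levyVecL hPi a) ∈ L := by
    intro a ha
    have hk := hN.exp_eq hPi a
    set k := Complex.exp (-∫ x, levyExponent Pi c (a x) ∂ν)
    rw [hL, mem_lpMeas_iff_aestronglyMeasurable]
    refine AEStronglyMeasurable.congr ?_ (EventuallyEq.symm hk)
    have h1 : Measurable[η.sigma A] fun ω => k * Complex.exp (Complex.I * (η a ω : ℂ)) :=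
      (Complex.measurable_exp.comp ((Complex.measurable_ofReal.comp
        (η.measurable_sigma ha)).const_mul Complex.I)).const_mul k
    exact h1.stronglyMeasurable.aestronglyMeasurable
  have hE0 : E 0 ∈ L := by
    rw [hL, mem_lpMeas_iff_aestronglyMeasurable]
    exact AEStronglyMeasurable.congr aestronglyMeasurable_const hE.zero.symm
  -- Restricting `exp (i a(x) t) - 1` to a cell amounts to restricting `a`, so each term of the
  -- approximating sums is again a functional of `η` over `A`.
  have hch : ∀ a : Lp ℝ ∞ ν, (∀ᵐ x ∂ν, x ∉ A → a x = 0) → hE.firstChaos (levyVecL hPi a) ∈ L := by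
    intro a ha
    refine hLc.mem_of_tendsto (hE.tendsto_sum_exp_cellCut hμ (levyVecL hPi a))
      (Eventually.of_forall fun n => Submodule.sum_mem _ fun b _ => Submodule.sub_mem _ ?_ hE0)
    have hD : MeasurableSet (cellIndex X n ⁻¹' {b}) :=
      measurable_cellIndex n (measurableSet_singleton b)
    have h1 : cellCut n {b} (levyVecL hPi a) = levyVecL hPi (indL _ hD a) := cut_levyVecL hPi hD a
    rw [h1]
    refine hexp _ ?_
    have h2 : indL _ hD a =ᵐ[ν] (cellIndex X n ⁻¹' {b}).indicator a := MemLp.coeFn_toLp _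
    filter_upwards [h2, ha] with x k1 k2 hx
    rw [k1, Set.indicator_apply_eq_zero]
    exact fun _ => k2 hx
  have hall : ∀ f : Lp ℂ 2 (ν.prod Pi), SupportedIn f (Prod.fst ⁻¹' A) → hE.firstChaos f ∈ L := by
    intro f hf
    set K : Submodule ℂ (Lp ℂ 2 (ν.prod Pi)) :=
      (Submodule.span ℂ {v | ∃ D, ∃ hD : MeasurableSet D, D ⊆ A ∧ ∃ s,
        v = levyVecL hPi (stepL ν D hD s)}).topologicalClosure with hK
    have hKL : ∀ v ∈ K, hE.firstChaos v ∈ L := by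
      have : K ≤ L.comap hE.firstChaos.toLinearMap := by
        refine Submodule.topologicalClosure_minimal _ (Submodule.span_le.2 ?_)
          (hLc.preimage hE.firstChaos.continuous)
        rintro _ ⟨D, hD, hDA, s, rfl⟩
        refine hch _ ?_
        have h1 : stepL ν D hD s =ᵐ[ν] D.indicator fun _ => s := indicatorConstLp_coeFn
        filter_upwards [h1] with x hx hxA
        rw [hx, Set.indicator_of_notMem fun h => hxA (hDA h)]
      exact fun v hv => this hv
    have : CompleteSpace K := (Submodule.isClosed_topologicalClosure _).completeSpace_coe
    have hpm : K.starProjection f ∈ K := Submodule.starProjection_apply_mem _ _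
    set w := f - K.starProjection f with hw
    have hwK : ∀ v ∈ K, ⟪w, v⟫_ℂ = 0 := fun v hv =>
      (Submodule.mem_orthogonal' _ _).1 (Submodule.sub_starProjection_mem_orthogonal (K := K) f) v hv
    -- The remainder `w` is orthogonal to the test functions over `A`, so its restriction to `A × ℝ`
    -- vanishes by totality; as `f` is supported there, `w` is orthogonal to `f` as well.
    have hcut : ∀ v, SupportedIn v (Prod.fst ⁻¹' A) →
        ⟪cut (Prod.fst ⁻¹' A) (measurable_fst hA) w, v⟫_ℂ = ⟪w, v⟫_ℂ := by
      intro v hv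
      conv_rhs => rw [← cut_add_cut_compl (Prod.fst ⁻¹' A) (measurable_fst hA) w]
      rw [inner_add_left, inner_eq_zero_of_disjoint ((supportedIn_cut (Prod.fst ⁻¹' A)ᶜ
        (measurable_fst hA).compl w).disjoint hv disjoint_compl_left), add_zero]
    have hcw : cut (Prod.fst ⁻¹' A) (measurable_fst hA) w = 0 := by
      refine eq_zero_of_inner_levyVecL hPi hA (supportedIn_cut _ _ _) fun D hD hDA s => ?_
      rw [hcut]
      · refine hwK _ (Submodule.le_topologicalClosure _ (Submodule.subset_span ?_))
        exact ⟨D, hD, hDA, s, rfl⟩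
      · filter_upwards [coeFn_levyVecL_stepL hPi hD s] with z hz hzA
        rw [hz, Set.indicator_of_notMem (by exact fun h => hzA (hDA h))]
    have hw0 : ⟪w, w⟫_ℂ = 0 := by
      have h1 : ⟪w, f⟫_ℂ = 0 := by rw [← hcut f hf, hcw, inner_zero_left]
      conv_lhs => rw [hw, inner_sub_right, ← hw, h1, hwK _ hpm, sub_zero]
    rw [sub_eq_zero.1 (inner_self_eq_zero.1 hw0)]
    exact hKL _ hpm
  refine Represents.of_orthogonal hm (fun h hh => ?_) fun f hf hf0 => ?_
  -- Independence over the cells comes from the σ-fields of the configuration, already known to be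
  -- represented; those of `η` are still under investigation.
  · obtain ⟨F, hF, hF'⟩ := hE.exists_tendsto_prod (M := fun A => configSigma N (Prod.fst ⁻¹' A)) hμ
      (fun A hA => represents_configSigma hN.poisson (measurable_fst hA)) h
    refine hLc.mem_of_tendsto hF (Eventually.of_forall fun n => ?_)
    rw [SetLike.mem_coe, hL, mem_lpMeas_iff_aestronglyMeasurable]
    refine AEStronglyMeasurable.congr ?_ (hF' n).2.symm
    refine aestronglyMeasurable_prod _ fun b => ?_
    refine mem_lpMeas_iff_aestronglyMeasurable (𝕜 := ℂ).1 (Submodule.add_mem L hE0 (hall _ ?_))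
    filter_upwards [coeFn_cut _ (measurableSet_cells n {b}) h, hh] with z k1 k2 hz
    refine k1.trans ?_
    rw [Set.indicator_apply_eq_zero]
    exact fun _ => k2 hz
  · refine eq_zero_of_inner_exp_eq_zero
      (Y := fun (a : {a : Lp ℝ ∞ ν // ∀ᵐ x ∂ν, x ∉ A → a x = 0}) ω => η a.1 ω)
      (fun a => η.measurable a.1) ?_ fun s c => ?_
    · rw [← η.sigma_eq_iSup]
      exact mem_lpMeas_iff_aestronglyMeasurable (𝕜 := ℂ).1 hf
    · set a : Lp ℝ ∞ ν := ∑ i ∈ s, (-c i) • i.1 with ha'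
      have ha : ∀ᵐ x ∂ν, x ∉ A → a x = 0 := by
        have : a ∈ {a : Lp ℝ ∞ ν | ∀ᵐ x ∂ν, x ∉ A → a x = 0} := by
          refine Finset.sum_induction _ (fun a => a ∈ {a : Lp ℝ ∞ ν | ∀ᵐ x ∂ν, x ∉ A → a x = 0})
            ?_ ?_ ?_
          · intro a b ha hb
            filter_upwards [ha, hb, Lp.coeFn_add a b] with x h1 h2 h3 hx
            rw [h3]
            exact (congrArg₂ (· + ·) (h1 hx) (h2 hx)).trans (add_zero 0)
          · filter_upwards [Lp.coeFn_zero ℝ ∞ ν] with x h1 _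
            exact h1
          · intro i _
            filter_upwards [i.2, Lp.coeFn_smul (-c i) i.1] with x h1 h2 hx
            rw [h2]
            exact (congrArg ((-c i) • ·) (h1 hx)).trans (smul_zero _)
        exact this
      obtain ⟨k, hk0, hk⟩ : ∃ k : ℂ, k ≠ 0 ∧ ∀ᵐ ω ∂P, E (levyVecL hPi a) ω =
          k * Complex.exp (Complex.I * (η a ω : ℂ)) :=
        ⟨_, Complex.exp_ne_zero _, hN.exp_eq hPi a⟩
      have hsup : SupportedIn (levyVecL hPi a) (Prod.fst ⁻¹' A) := by
        filter_upwards [coeFn_levyVecL hPi a, ae_fst ha] with z k1 k2 hz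
        rw [k1, levyVec, k2 hz]
        simp
      have h1 := hf0 _ hsup
      rw [inner_eq_integral_conj_mul] at h1
      have h2 : ∫ ω, (starRingEnd ℂ) (E (levyVecL hPi a) ω) * f ω ∂P =
          ∫ ω, (starRingEnd ℂ) k *
            (Complex.exp (Complex.I * ((∑ i ∈ s, c i * η i.1 ω : ℝ) : ℂ)) * f ω) ∂P := by
        refine integral_congr_ae ?_
        filter_upwards [hk, η.coeFn_sum s (fun i => -c i) fun i => i.1] with ω k1 k2
        rw [k1, ha', k2, map_mul, ← Complex.exp_conj, map_mul, Complex.conj_I, Complex.conj_ofReal]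
        simp only [neg_mul, Finset.sum_neg_distrib, Complex.ofReal_neg, mul_neg, neg_neg]
        ring
      rw [h2, integral_const_mul] at h1
      refine (mul_eq_zero.1 h1).resolve_left ?_
      simpa using hk0

end LevySigma


/-! ### The isomorphism of `L²(α)` and `L²(η)` -/

section ConstantVectors

variable {X : Type*} [MeasurableSpace X] {ν : Measure X} [IsFiniteMeasure ν] {Pi : Measure ℝ}

/-- The constant `L²(ℝ, Pi)`-valued function `v`. -/
def constVec (ν : Measure X) [IsFiniteMeasure ν] [SFinite Pi] (v : Lp ℂ 2 Pi) :
    Lp ℂ 2 (ν.prod Pi) := ((Lp.memLp v).comp_snd ν).toLp _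

theorem coeFn_constVec [SFinite Pi] (v : Lp ℂ 2 Pi) :
    ∀ᵐ z ∂ν.prod Pi, constVec ν v z = v z.2 := MemLp.coeFn_toLp _

/-- Singletons are the only sets of values that uniqueness needs: each leaves a single function, so
an isomorphism acting identically on values must fix it. -/
theorem mem_functionsWithValuesIn_singleton [SFinite Pi] {v : Lp ℂ 2 Pi} {f : Lp ℂ 2 (ν.prod Pi)} :
    f ∈ functionsWithValuesIn ν Pi {v} ↔ f = constVec ν v := by
  have h0 : f ∈ functionsWithValuesIn ν Pi {v} ↔ ∀ᵐ x ∂ν, ∀ᵐ t ∂Pi, f (x, t) = v t := by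
    simp [functionsWithValuesIn]
  have h2 : Measurable fun z : X × ℝ => v z.2 :=
    (Lp.stronglyMeasurable v).measurable.comp measurable_snd
  have h3 : MeasurableSet {z : X × ℝ | f z = v z.2} :=
    measurableSet_eq_fun (Lp.stronglyMeasurable f).measurable h2
  rw [h0, ← Measure.ae_prod_iff_ae_ae (μ := ν) (ν := Pi) (p := fun z => f z = v z.2) h3]
  constructor
  · intro h
    refine Lp.ext ?_
    filter_upwards [h, coeFn_constVec (ν := ν) v] with z h1 h2
    rw [h1, h2]
  · rintro rfl
    exact coeFn_constVec v

/-- Taking for `v` the indicators of `T ∩ bigJumps n` gives the rectangles of finite measure, and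
the sets `bigJumps n` exhaust almost all of the line. -/
theorem eq_zero_of_inner_cut_constVec [SFinite Pi] (hPi : IsLevyMeasure Pi)
    {g : Lp ℂ 2 (ν.prod Pi)}
    (h : ∀ A (hA : MeasurableSet A) (v : Lp ℂ 2 Pi),
      ⟪g, cut (Prod.fst ⁻¹' A) (measurable_fst hA) (constVec ν v)⟫_ℂ = 0) : g = 0 := by
  let v : ∀ (n : ℕ) (T : Set ℝ), MeasurableSet T → Lp ℂ 2 Pi := fun n T hT =>
    indicatorConstLp 2 (hT.inter (measurableSet_bigJumps n))
      (measure_ne_top_of_subset Set.inter_subset_right (hPi.measure_bigJumps n).ne) (1 : ℂ)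
  have hv : ∀ n T (hT : MeasurableSet T), ∀ᵐ z ∂ν.prod Pi, constVec ν (v n T hT) z =
      (T ∩ bigJumps n).indicator (fun _ => (1 : ℂ)) z.2 := fun n T hT => by
    have h1 : v n T hT =ᵐ[Pi] (T ∩ bigJumps n).indicator fun _ => (1 : ℂ) :=
      indicatorConstLp_coeFn
    filter_upwards [coeFn_constVec (ν := ν) (v n T hT), ae_snd h1] with z k1 k2
    rw [k1, k2]
  have key : ∀ n, ∀ᵐ z ∂ν.prod Pi, (starRingEnd ℂ) (g z) *
      (bigJumps n).indicator (fun _ => (1 : ℂ)) z.2 = 0 := by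
    intro n
    refine ae_eq_zero_of_setIntegral_prod ?_ fun A T hA hT => ?_
    · refine (integrable_conj_mul g (constVec ν (v n Set.univ MeasurableSet.univ))).congr ?_
      filter_upwards [hv n Set.univ MeasurableSet.univ] with z hz
      rw [hz, Set.univ_inter]
    · rw [← integral_indicator (hA.prod hT), ← h A hA (v n T hT), inner_eq_integral_conj_mul]
      refine integral_congr_ae ?_
      filter_upwards [hv n T hT, coeFn_cut (Prod.fst ⁻¹' A) (measurable_fst hA)
        (constVec ν (v n T hT))] with z k1 k2
      rw [k2]
      simp only [Set.indicator, k1]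
      by_cases h1 : z.1 ∈ A <;> by_cases h2 : z.2 ∈ T <;> by_cases h3 : z.2 ∈ bigJumps n <;>
        simp [h1, h2, h3]
  refine Lp.ext ?_
  filter_upwards [ae_all_iff.2 key, ae_snd hPi.ae_ne_zero, Lp.coeFn_zero ℂ 2 (ν.prod Pi)]
    with z k1 k2 k3
  obtain ⟨n, hn⟩ := (eventually_mem_bigJumps k2).exists
  have := k1 n
  rw [Set.indicator_of_mem hn, mul_one] at this
  rw [k3]
  simpa using this

end ConstantVectors

/-! ### From constant functions to the whole first chaos -/

section Uniqueness

variable {X Ω₁ Ω₂ : Type*} {m₁ : MeasurableSpace Ω₁} {m₂ : MeasurableSpace Ω₂}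
  {M₁ : Set X → MeasurableSpace Ω₁} {M₂ : Set X → MeasurableSpace Ω₂}
  [MeasurableSpace X] [MeasurableSpace Ω₁] [MeasurableSpace Ω₂]
  {ν : Measure X} [IsFiniteMeasure ν] {Pi : Measure ℝ} [SFinite Pi]
  {P₁ : Measure Ω₁} {P₂ : Measure Ω₂}
  {E₁ : Lp ℂ 2 (ν.prod Pi) → Lp ℂ 2 P₁} {E₂ : Lp ℂ 2 (ν.prod Pi) → Lp ℂ 2 P₂}

/-- A unity-preserving special isomorphism that respects the constants of the first chaos respects
the whole first chaos. -/
theorem map_firstChaos_of_constVec [IsProbabilityMeasure P₁]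
    (hPi : IsLevyMeasure Pi) (hE₁ : IsExpSystem E₁) (hE₂ : IsExpSystem E₂)
    (r₁ : Represents m₁ E₁ Set.univ) (r₂ : Represents m₂ E₂ Set.univ)
    (hM₁ : ∀ A, MeasurableSet A → Represents (M₁ A) E₁ (Prod.fst ⁻¹' A))
    (hM₂ : ∀ A, MeasurableSet A → Represents (M₂ A) E₂ (Prod.fst ⁻¹' A))
    {Ψ : L2 m₁ P₁ ≃ₗᵢ[ℂ] L2 m₂ P₂} (hu : IsUnityPreserving Ψ)
    (hΨ : ∀ A, MeasurableSet A → ConjMapsTo Ψ (tensorFactor m₁ (M₁ A) (M₁ Aᶜ) P₁)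
      (tensorFactor m₂ (M₂ A) (M₂ Aᶜ) P₂))
    (hc : ∀ (v : Lp ℂ 2 Pi) (u : L2 m₁ P₁), u.1 = hE₁.firstChaos (constVec ν v) →
      (Ψ u).1 = hE₂.firstChaos (constVec ν v))
    (f : Lp ℂ 2 (ν.prod Pi)) (u : L2 m₁ P₁) (hf : u.1 = hE₁.firstChaos f) :
    (Ψ u).1 = hE₂.firstChaos f := by
  -- The defect of the claim as a bounded operator. It respects supports over `X`, its values have
  -- mean zero, and it vanishes on constants.
  let D : Lp ℂ 2 (ν.prod Pi) →L[ℂ] Lp ℂ 2 P₂ :=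
    extendByZero r₁.le Ψ ∘L hE₁.firstChaos.toContinuousLinearMap -
      hE₂.firstChaos.toContinuousLinearMap
  have hD : ∀ f (u : L2 m₁ P₁), u.1 = hE₁.firstChaos f →
      D f = (Ψ u).1 - hE₂.firstChaos f := by
    intro f u hu
    change extendByZero r₁.le Ψ (hE₁.firstChaos f) - hE₂.firstChaos f = _
    rw [← hu, extendByZero_apply]
  have hmem : ∀ f, hE₁.firstChaos f ∈ lpMeas ℂ ℂ m₁ 2 P₁ := fun f =>
    r₁.mem_iff.2 (hE₁.firstChaos_mem (supportedIn_univ f))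
  have hDmem : ∀ A, MeasurableSet A → ∀ f, SupportedIn f (Prod.fst ⁻¹' A) →
      D f ∈ expSpace E₂ (Prod.fst ⁻¹' A) := by
    intro A hA f hfA
    rw [hD f ⟨_, hmem f⟩ rfl]
    refine Submodule.sub_mem _ ?_ (hE₂.firstChaos_mem hfA)
    exact (special_map_mul hE₁ hE₂ r₁ r₂ (hM₁ A hA) (hM₁ _ hA.compl) (hM₂ A hA)
      (hM₂ _ hA.compl) hu (hΨ A hA) (f := ⟨_, hmem f⟩) (hE₁.firstChaos_mem hfA)).1
  have hD0 : ∀ f, ⟪E₂ 0, D f⟫_ℂ = 0 := by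
    intro f
    let e : L2 m₁ P₁ := ⟨E₁ 0, r₁.mem_iff.2 (mem_expSpace E₁ (supportedIn_univ 0))⟩
    have h1 : (Ψ e).1 = E₂ 0 := by
      have h2 : (Ψ e).1 =ᵐ[P₂] fun _ => 1 := hu e hE₁.zero
      exact Lp.ext (h2.trans hE₂.zero.symm)
    rw [hD f ⟨_, hmem f⟩ rfl, inner_sub_right, hE₂.inner_zero_firstChaos, ← h1, inner_map_coe,
      hE₁.inner_zero_firstChaos, sub_zero]
  have hcut : ∀ A (hA : MeasurableSet A) (v : Lp ℂ 2 Pi),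
      D (cut (Prod.fst ⁻¹' A) (measurable_fst hA) (constVec ν v)) = 0 := by
    intro A hA v
    set B : Set (X × ℝ) := Prod.fst ⁻¹' A with hB
    have hBm : MeasurableSet B := measurable_fst hA
    have h1 := hDmem A hA _ (supportedIn_cut B hBm (constVec ν v))
    have h2 := hDmem Aᶜ hA.compl _ (supportedIn_cut Bᶜ hBm.compl (constVec ν v))
    -- The two parts of the defect cancel. Lying over complementary sets and having mean zero, they
    -- are also orthogonal, so each of them vanishes.
    have h3 : D (cut B hBm (constVec ν v)) + D (cut Bᶜ hBm.compl (constVec ν v)) = 0 := by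
      rw [← map_add, cut_add_cut_compl, hD _ ⟨_, hmem _⟩ rfl, hc v ⟨_, hmem _⟩ rfl, sub_self]
    have h4 := hE₂.inner_eq_mul_of_disjoint
      (Set.disjoint_compl_right_iff_subset.2 subset_rfl : Disjoint B Bᶜ) h1 h2
    rw [hD0, mul_zero, eq_neg_of_add_eq_zero_right h3, inner_neg_right, neg_eq_zero,
      inner_self_eq_zero] at h4
    exact h4
  have hK : IsClosed (LinearMap.ker D.toLinearMap : Set (Lp ℂ 2 (ν.prod Pi))) := D.isClosed_ker
  have : CompleteSpace (LinearMap.ker D.toLinearMap) := hK.completeSpace_coe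
  have htop : LinearMap.ker D.toLinearMap = ⊤ := by
    rw [← Submodule.orthogonal_eq_bot_iff, eq_bot_iff]
    intro g hg
    refine eq_zero_of_inner_cut_constVec hPi fun A hA v => ?_
    exact (Submodule.mem_orthogonal' _ _).1 hg _ (hcut A hA v)
  have h5 : D f = 0 := (htop ▸ Submodule.mem_top : f ∈ LinearMap.ker D.toLinearMap)
  rw [hD f u hf] at h5
  exact sub_eq_zero.1 h5

end Uniqueness

theorem Intertwines.eq {Z Ω₁ Ω₂ : Type*} {m₁ : MeasurableSpace Ω₁} {m₂ : MeasurableSpace Ω₂}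
    [MeasurableSpace Z] [MeasurableSpace Ω₁] [MeasurableSpace Ω₂] {μ : Measure Z}
    {P₁ : Measure Ω₁} {P₂ : Measure Ω₂} {E₁ : Lp ℂ 2 μ → Lp ℂ 2 P₁} {E₂ : Lp ℂ 2 μ → Lp ℂ 2 P₂}
    {Φ Ψ : L2 m₁ P₁ ≃ₗᵢ[ℂ] L2 m₂ P₂} (hΦ : Intertwines E₁ E₂ Φ) (hΨ : Intertwines E₁ E₂ Ψ)
    (r₁ : Represents m₁ E₁ Set.univ) : Ψ = Φ := by
  ext u : 1
  refine Subtype.ext ?_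
  rw [← extendByZero_apply r₁.le, ← extendByZero_apply r₁.le]
  refine eqOn_expSpace (E := E₁) (fun h _ => ?_) (r₁.mem_iff.1 u.2)
  have hm : E₁ h ∈ lpMeas ℂ ℂ m₁ 2 P₁ := r₁.mem_iff.2 (mem_expSpace E₁ (supportedIn_univ h))
  have h1 := extendByZero_apply r₁.le Ψ ⟨E₁ h, hm⟩
  have h2 := extendByZero_apply r₁.le Φ ⟨E₁ h, hm⟩
  rw [hΨ h _ rfl] at h1
  rw [hΦ h _ rfl] at h2
  exact h1.trans h2.symm

/-! ### Assembly of the isomorphism and of its properties -/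

section Isomorphism

theorem isGaussianIntegral_iff {Z Ω : Type*} {m : MeasurableSpace Ω} [MeasurableSpace Z]
    [MeasurableSpace Ω] {μ : Measure Z} {P : Measure Ω} [IsProbabilityMeasure P]
    {W : GenProcess 2 μ P} (hW : IsWhiteNoise W) (f : Lp ℂ 2 μ) (F : L2 m P) :
    IsGaussianIntegral W f F ↔ F.1 = (isExpSystem_gaussExp hW).firstChaos f := by
  have h1 := firstChaos_gaussExp hW f
  constructor
  · intro h
    refine Lp.ext (EventuallyEq.trans ?_ h1.symm)
    exact h
  · intro h
    rw [IsGaussianIntegral, h]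
    exact h1

variable {X Ω₁ Ω₂ : Type*} [MeasurableSpace X] [StandardBorelSpace X]
    [MeasurableSpace Ω₁] [MeasurableSpace Ω₂]
    {ν : Measure X} [IsFiniteMeasure ν] [NullSingletonClass ν]
    {Pi : Measure ℝ} {c : ℝ}
    {P₁ : Measure Ω₁} [IsProbabilityMeasure P₁] {P₂ : Measure Ω₂} [IsProbabilityMeasure P₂]
    {W : GenProcess 2 (ν.prod Pi) P₁} {η : GenProcess ∞ ν P₂} {N : Ω₂ → Configuration (X × ℝ)}

/-- `Φ` matches the exponential vectors of the noise with those of the jumps. Over `X` the factors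
on the side of `η` come from the σ-fields of `η`, over `X × ℝ` from those of the configuration; both
are represented by the same exponential vectors, so one intertwiner serves both factorizations. -/
theorem IsJumpConfiguration.exists_isomorphism (hPi : IsLevyMeasure Pi) (hW : IsWhiteNoise W)
    (hN : IsJumpConfiguration Pi c η N) :
    ∃ Φ : L2 (W.sigma Set.univ) P₁ ≃ₗᵢ[ℂ] L2 (η.sigma Set.univ) P₂,
      IsUnityPreserving Φ ∧ IsReal Φ ∧
      IsSpecialIsomorphism (baseFactorization W) (processFactorization η) Φ ∧
      IsSpecialIsomorphism (processFactorization W) (jumpFactorization η N) Φ ∧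
      ActsIdenticallyOnValues W N Φ ∧ HasExponentialFormula W N Φ ∧
      ∀ Ψ : L2 (W.sigma Set.univ) P₁ ≃ₗᵢ[ℂ] L2 (η.sigma Set.univ) P₂,
        IsUnityPreserving Ψ → IsReal Ψ →
        IsSpecialIsomorphism (baseFactorization W) (processFactorization η) Ψ →
        ActsIdenticallyOnValues W N Ψ → Ψ = Φ := by
  have := hPi.sigmaFinite
  have hE₁ := isExpSystem_gaussExp hW
  have hE₂ := isExpSystem_poissonExp hN.poisson
  have r₁ := represents_gaussExp hW Set.univ
  have r₂ : Represents (η.sigma Set.univ) (poissonExp hN.poisson) Set.univ :=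
    hN.represents_sigma hPi MeasurableSet.univ
  have hM₂ : ∀ A, MeasurableSet A →
      Represents (η.sigma A) (poissonExp hN.poisson) (Prod.fst ⁻¹' A) :=
    fun A hA => hN.represents_sigma hPi hA
  have hcomp : ∀ (f : Lp ℂ 2 (ν.prod Pi)) (G : L2 (η.sigma Set.univ) P₂),
      IsCompensatedIntegral (ν.prod Pi) N f G ↔ G.1 = hE₂.firstChaos f :=
    isCompensatedIntegral_iff hN.poisson fun f =>
      r₂.mem_iff.2 (hE₂.firstChaos_mem (supportedIn_univ f))
  have hgauss : ∀ (f : Lp ℂ 2 (ν.prod Pi)) (F : L2 (W.sigma Set.univ) P₁),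
      IsGaussianIntegral W f F ↔ F.1 = hE₁.firstChaos f := isGaussianIntegral_iff hW
  obtain ⟨Φ, hΦ⟩ := exists_intertwines hE₁ hE₂ r₁ r₂
  refine ⟨Φ, hΦ.isUnityPreserving hE₁ hE₂, hΦ.isReal hE₁ hE₂ r₁ r₂, fun A hA => ?_,
    fun B hB => ?_, fun V => ?_, fun h h2 h1 => ?_, fun Ψ hu _ hs hv => ?_⟩
  · exact hΦ.image_tensorFactor hE₁ hE₂ r₁ r₂ (measurable_fst hA) (represents_gaussExp hW _)
      (represents_gaussExp hW _) (hM₂ A hA) (hM₂ _ hA.compl)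
  · exact hΦ.image_tensorFactor hE₁ hE₂ r₁ r₂ hB (represents_gaussExp hW _)
      (represents_gaussExp hW _) (represents_configSigma hN.poisson hB)
      (represents_configSigma hN.poisson hB.compl)
  · ext G
    constructor
    · rintro ⟨F, ⟨f, hf, hF⟩, rfl⟩
      exact ⟨f, hf, (hcomp _ _).2 (hΦ.map_firstChaos hE₁ hE₂ r₁ ((hgauss _ _).1 hF))⟩
    · rintro ⟨f, hf, hG⟩
      let F : L2 (W.sigma Set.univ) P₁ :=
        ⟨hE₁.firstChaos f, r₁.mem_iff.2 (hE₁.firstChaos_mem (supportedIn_univ f))⟩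
      refine ⟨F, ⟨f, hf, (hgauss _ _).2 rfl⟩, Subtype.ext ?_⟩
      rw [hΦ.map_firstChaos hE₁ hE₂ r₁ (rfl : F.1 = hE₁.firstChaos f), (hcomp _ _).1 hG]
  · have hi : Integrable (fun z => (h z : ℂ)) (ν.prod Pi) := h1.ofReal
    have hs := hN.poisson.ae_summableOn hi
    refine ⟨?_, ⟨gaussExp hW (ofRealL (h2.toLp h)),
      r₁.mem_iff.2 (mem_expSpace _ (supportedIn_univ _))⟩, gaussExp_ofRealL hW _, ?_⟩
    · filter_upwards [hs] with ω hω
      exact (Configuration.expProd_ofReal hω).2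
    · have hae : ofRealL (h2.toLp h) =ᵐ[ν.prod Pi] fun z => (h z : ℂ) := by
        filter_upwards [coeFn_ofRealL (h2.toLp h), h2.coeFn_toLp] with z k1 k2
        rw [k1, k2]
      rw [hΦ (ofRealL (h2.toLp h)) _ rfl]
      filter_upwards [hs, coeFn_poissonExp hN.poisson (hi.congr hae.symm),
        poissonExpFun_congr hN.poisson hae] with ω k1 k2 k3
      rw [k2, k3, poissonExpFun, (Configuration.expProd_ofReal k1).1, integral_complex_ofReal]
      push_cast
      rfl
  · have hconj : ∀ A, MeasurableSet A → ConjMapsTo Ψ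
        (tensorFactor (W.sigma Set.univ) (W.sigma (Prod.fst ⁻¹' A)) (W.sigma (Prod.fst ⁻¹' Aᶜ)) P₁)
        (tensorFactor (η.sigma Set.univ) (η.sigma A) (η.sigma Aᶜ) P₂) := by
      intro A hA T hT
      have := hs A hA
      rw [processFactorization] at this
      rw [← this]
      exact ⟨T, hT, rfl⟩
    refine hΦ.eq ?_ r₁
    refine intertwines_of_firstChaos prod_fst_singleton_eq_zero hE₁ hE₂ r₁ r₂
      (M₁ := fun A => W.sigma (Prod.fst ⁻¹' A)) (M₂ := fun A => η.sigma A)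
      (fun A hA => represents_gaussExp hW _) hM₂ hu hconj ?_
    refine map_firstChaos_of_constVec hPi hE₁ hE₂ r₁ r₂
      (M₁ := fun A => W.sigma (Prod.fst ⁻¹' A)) (M₂ := fun A => η.sigma A)
      (fun A hA => represents_gaussExp hW _) hM₂ hu hconj fun v u hv' => ?_
    -- The choice `V = {v}` forces `Ψ` to send the constant `v` in one first chaos to the constant
    -- `v` in the other.
    have h3 : Ψ u ∈ Ψ '' {F | ∃ f ∈ functionsWithValuesIn ν Pi {v}, IsGaussianIntegral W f F} :=
      ⟨u, ⟨constVec ν v, mem_functionsWithValuesIn_singleton.2 rfl, (hgauss _ _).2 hv'⟩, rfl⟩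
    rw [hv {v}] at h3
    obtain ⟨f, hf, hG⟩ := h3
    rw [mem_functionsWithValuesIn_singleton.1 hf] at hG
    exact (hcomp _ _).1 hG

end Isomorphism


/-! ### The Lévy process with a given Poisson process of jumps -/

section JumpProcess

variable {X Ω : Type*} [MeasurableSpace X] [MeasurableSpace Ω] {ν : Measure X} {Pi : Measure ℝ}

/-- The contribution `a(x) t` of the small jumps. -/
def smallJump (a : X → ℝ) (z : X × ℝ) : ℂ :=
  (Prod.snd ⁻¹' (bigJumps 0)ᶜ).indicator (fun z : X × ℝ => ((a z.1 * z.2 : ℝ) : ℂ)) z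

/-- The contribution `a(x) t` of the large jumps. -/
def largeJump (a : X → ℝ) (z : X × ℝ) : ℝ :=
  (Prod.snd ⁻¹' bigJumps 0).indicator (fun z : X × ℝ => a z.1 * z.2) z

/-- The compensating kernel. -/
def jumpKernel (t : ℝ) : ℝ := (bigJumps 0)ᶜ.indicator id t - t / (1 + t ^ 2)

theorem mem_bigJumps_zero {t : ℝ} : t ∈ bigJumps 0 ↔ 1 < |t| := by
  simp [bigJumps]

theorem bigJumps_zero_subset (n : ℕ) : bigJumps 0 ⊆ bigJumps n := fun t ht => by
  rw [mem_bigJumps_zero] at ht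
  refine lt_of_le_of_lt ?_ ht
  rw [div_le_one (by positivity)]
  have : (0 : ℝ) ≤ n := Nat.cast_nonneg n
  linarith

theorem measurable_jumpKernel : Measurable jumpKernel :=
  (measurable_id.indicator (measurableSet_bigJumps 0).compl).sub (by fun_prop)

/-- Small jumps are compensated in the first chaos by `a(x) t` on `|t| ≤ 1`, while the process is
compensated by `a(x) t / (1 + t²)`. The bound makes the discrepancy absolutely integrable. -/
theorem abs_jumpKernel_le (t : ℝ) : |jumpKernel t| ≤ t ^ 2 / (1 + t ^ 2) := by
  have ht : 0 < 1 + t ^ 2 := by positivity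
  by_cases h : t ∈ bigJumps 0
  · have h1 := mem_bigJumps_zero.1 h
    rw [jumpKernel, Set.indicator_of_notMem (by simpa using h), zero_sub, abs_neg, abs_div,
      abs_of_pos ht, ← sq_abs t]
    gcongr
    nlinarith
  · have h1 : |t| ≤ 1 := not_lt.1 fun h' => h (mem_bigJumps_zero.2 h')
    have h2 : t - t / (1 + t ^ 2) = t * (t ^ 2 / (1 + t ^ 2)) := by
      field_simp
      ring
    rw [jumpKernel, Set.indicator_of_mem (by exact h), id, h2, abs_mul,
      abs_of_nonneg (by positivity : 0 ≤ t ^ 2 / (1 + t ^ 2))]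
    exact mul_le_of_le_one_left (by positivity) h1

theorem measurable_smallJump {a : X → ℝ} (ha : Measurable a) : Measurable (smallJump a) :=
  Measurable.indicator (by fun_prop) (measurable_snd (measurableSet_bigJumps 0).compl)

theorem measurable_largeJump {a : X → ℝ} (ha : Measurable a) : Measurable (largeJump a) :=
  Measurable.indicator (by fun_prop) (measurable_snd (measurableSet_bigJumps 0))

variable [IsFiniteMeasure ν]

theorem memLp_smallJump (hPi : IsLevyMeasure Pi) (a : Lp ℝ ∞ ν) :
    MemLp (smallJump a) 2 (ν.prod Pi) := by
  have hm := (measurable_smallJump (Lp.stronglyMeasurable a).measurable).aestronglyMeasurable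
    (μ := ν.prod Pi)
  rw [memLp_two_iff_integrable_sq_norm hm]
  refine (integrable_sq_levy ν hPi (2 * ‖a‖ ^ 2)).mono' (hm.norm.pow 2) ?_
  filter_upwards [ae_fst (ae_abs_le_norm a)] with z hz
  rw [Real.norm_of_nonneg (by positivity), smallJump]
  by_cases h : z.2 ∈ bigJumps 0
  · rw [Set.indicator_of_notMem (by simpa using h), norm_zero, zero_pow two_ne_zero]
    positivity
  · have h1 : |z.2| ≤ 1 := not_lt.1 fun h' => h (mem_bigJumps_zero.2 h')
    have h2 : z.2 ^ 2 ≤ 1 := by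
      rw [← sq_abs]
      nlinarith [abs_nonneg z.2]
    have hst : z.2 ^ 2 ≤ 2 * (z.2 ^ 2 / (1 + z.2 ^ 2)) := by
      rw [mul_div_assoc', le_div_iff₀ (by positivity)]
      nlinarith [sq_nonneg z.2]
    rw [Set.indicator_of_mem (by exact h), Complex.norm_real, Real.norm_eq_abs, abs_mul, mul_pow,
      sq_abs z.2, mul_comm 2, mul_assoc]
    gcongr

/-- The contribution of the small jumps as an element of `L²`. -/
def smallJumpL (hPi : IsLevyMeasure Pi) (a : Lp ℝ ∞ ν) : Lp ℂ 2 (ν.prod Pi) :=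
  (memLp_smallJump hPi a).toLp _

theorem coeFn_smallJumpL (hPi : IsLevyMeasure Pi) (a : Lp ℝ ∞ ν) :
    smallJumpL hPi a =ᵐ[ν.prod Pi] smallJump a := MemLp.coeFn_toLp _

theorem integrable_jumpKernel (hPi : IsLevyMeasure Pi) (a : Lp ℝ ∞ ν) :
    Integrable (fun z : X × ℝ => a z.1 * jumpKernel z.2) (ν.prod Pi) := by
  have ha : Measurable a := (Lp.stronglyMeasurable a).measurable
  have hk := measurable_jumpKernel
  refine (integrable_sq_levy ν hPi ‖a‖).mono' (Measurable.aestronglyMeasurable (by fun_prop)) ?_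
  filter_upwards [ae_fst (ae_abs_le_norm a)] with z hz
  rw [Real.norm_eq_abs, abs_mul]
  exact mul_le_mul hz (abs_jumpKernel_le _) (abs_nonneg _) (norm_nonneg _)

theorem smallJumpL_add (hPi : IsLevyMeasure Pi) (a b : Lp ℝ ∞ ν) :
    smallJumpL hPi (a + b) = smallJumpL hPi a + smallJumpL hPi b := by
  refine Lp.ext ?_
  filter_upwards [coeFn_smallJumpL hPi (a + b), coeFn_smallJumpL hPi a, coeFn_smallJumpL hPi b,
    Lp.coeFn_add (smallJumpL hPi a) (smallJumpL hPi b), ae_fst (Lp.coeFn_add a b)]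
    with z h1 h2 h3 h4 h5
  have h5' : (a + b : Lp ℝ ∞ ν) z.1 = a z.1 + b z.1 := h5
  refine h1.trans (Eq.trans ?_ h4.symm)
  refine Eq.trans ?_ (congrArg₂ (· + ·) h2 h3).symm
  by_cases h : z ∈ (Prod.snd ⁻¹' (bigJumps 0)ᶜ : Set (X × ℝ))
  · simp only [smallJump, Set.indicator_of_mem h, h5']
    push_cast
    ring
  · simp only [smallJump, Set.indicator_of_notMem h, add_zero]

theorem smallJumpL_smul (hPi : IsLevyMeasure Pi) (r : ℝ) (a : Lp ℝ ∞ ν) :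
    smallJumpL hPi (r • a) = (r : ℂ) • smallJumpL hPi a := by
  refine Lp.ext ?_
  filter_upwards [coeFn_smallJumpL hPi (r • a), coeFn_smallJumpL hPi a,
    Lp.coeFn_smul (r : ℂ) (smallJumpL hPi a), ae_fst (Lp.coeFn_smul r a)]
    with z h1 h2 h4 h5
  have h5' : (r • a : Lp ℝ ∞ ν) z.1 = r * a z.1 := h5
  refine h1.trans (Eq.trans ?_ h4.symm)
  refine Eq.trans ?_ (congrArg ((r : ℂ) • ·) h2).symm
  by_cases h : z ∈ (Prod.snd ⁻¹' (bigJumps 0)ᶜ : Set (X × ℝ))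
  · simp only [smallJump, Set.indicator_of_mem h, h5', smul_eq_mul]
    push_cast
    ring
  · simp only [smallJump, Set.indicator_of_notMem h, smul_zero]

variable {P : Measure Ω} [IsProbabilityMeasure P] {N : Ω → Configuration (X × ℝ)}

theorem Configuration.summable_of_count_ne_top {Z : Type*} {κ : Configuration Z} {B : Set Z}
    (hB : κ.count B ≠ ∞) {u : Z → ℝ} (hu : ∀ z, z ∉ B → u z = 0) :
    Summable fun z => (κ.mult z : ℝ) * u z := by
  refine summable_of_hasFiniteSupport ((κ.finite_support_of_count_ne_top hB).subset fun z hz => ?_)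
  refine ⟨?_, ?_⟩
  · by_contra h0
    simp [hu z h0] at hz
  · intro h0
    simp [h0] at hz

variable [SigmaFinite (ν.prod Pi)]

/-- The value at `a` of the process with jumps `N`. -/
def jumpValue (hPi : IsLevyMeasure Pi) (c : ℝ) (hN : IsPoissonProcess (ν.prod Pi) P N)
    (a : Lp ℝ ∞ ν) (ω : Ω) : ℝ :=
  c * ∫ x, a x ∂ν + ∑' z, ((N ω).mult z : ℝ) * largeJump a z +
    ((isExpSystem_poissonExp hN).firstChaos (smallJumpL hPi a) ω).re +
    ∫ z : X × ℝ, a z.1 * jumpKernel z.2 ∂(ν.prod Pi)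

theorem aestronglyMeasurable_jumpValue (hPi : IsLevyMeasure Pi) (c : ℝ)
    (hN : IsPoissonProcess (ν.prod Pi) P N) (a : Lp ℝ ∞ ν) :
    AEStronglyMeasurable (jumpValue hPi c hN a) P := by
  have h1 := Configuration.measurable_tsum_real hN.measurable
    (measurable_largeJump (Lp.stronglyMeasurable a).measurable)
  have h2 : Measurable fun ω => ((isExpSystem_poissonExp hN).firstChaos (smallJumpL hPi a) ω).re :=
    Complex.measurable_re.comp (Lp.stronglyMeasurable _).measurable
  exact (((h1.const_add _).add h2).add_const _).aestronglyMeasurable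

theorem ae_count_bigJumps_ne_top (hPi : IsLevyMeasure Pi)
    (hN : IsPoissonProcess (ν.prod Pi) P N) (n : ℕ) :
    ∀ᵐ ω ∂P, (N ω).count (Prod.snd ⁻¹' bigJumps n) ≠ ∞ :=
  hN.ae_count_ne_top (measurable_snd (measurableSet_bigJumps n))
    (measure_snd_bigJumps_ne_top ν hPi n)

theorem jumpValue_add (hPi : IsLevyMeasure Pi) (c : ℝ) (hN : IsPoissonProcess (ν.prod Pi) P N)
    (a b : Lp ℝ ∞ ν) :
    ∀ᵐ ω ∂P, jumpValue hPi c hN (a + b) ω = jumpValue hPi c hN a ω + jumpValue hPi c hN b ω := by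
  have hab := Lp.coeFn_add a b
  have e1 : ∫ x, (a + b : Lp ℝ ∞ ν) x ∂ν = ∫ x, a x ∂ν + ∫ x, b x ∂ν := by
    rw [← integral_add ((Lp.memLp a).integrable le_top) ((Lp.memLp b).integrable le_top)]
    exact integral_congr_ae hab
  have e2 : ∫ z : X × ℝ, (a + b : Lp ℝ ∞ ν) z.1 * jumpKernel z.2 ∂(ν.prod Pi) =
      ∫ z : X × ℝ, a z.1 * jumpKernel z.2 ∂(ν.prod Pi) +
        ∫ z : X × ℝ, b z.1 * jumpKernel z.2 ∂(ν.prod Pi) := by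
    rw [← integral_add (integrable_jumpKernel hPi a) (integrable_jumpKernel hPi b)]
    refine integral_congr_ae ?_
    filter_upwards [ae_fst hab] with z hz
    rw [show (a + b : Lp ℝ ∞ ν) z.1 = a z.1 + b z.1 from hz, add_mul]
  filter_upwards [hN.ae_forall (ae_fst hab), ae_count_bigJumps_ne_top hPi hN 0,
    Lp.coeFn_add ((isExpSystem_poissonExp hN).firstChaos (smallJumpL hPi a))
      ((isExpSystem_poissonExp hN).firstChaos (smallJumpL hPi b))] with ω h1 h2 h3
  have e3 : ∑' z, ((N ω).mult z : ℝ) * largeJump (a + b : Lp ℝ ∞ ν) z =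
      ∑' z, ((N ω).mult z : ℝ) * largeJump a z + ∑' z, ((N ω).mult z : ℝ) * largeJump b z := by
    have hs : ∀ b : X → ℝ, Summable fun z => ((N ω).mult z : ℝ) * largeJump b z := fun b =>
      Configuration.summable_of_count_ne_top h2 fun z hz => Set.indicator_of_notMem hz _
    rw [← (hs a).tsum_add (hs b)]
    refine tsum_congr fun z => ?_
    by_cases hz : (N ω).mult z = 0
    · simp [hz]
    · have h4 : (a + b : Lp ℝ ∞ ν) z.1 = a z.1 + b z.1 := h1 z hz
      by_cases h : z ∈ (Prod.snd ⁻¹' bigJumps 0 : Set (X × ℝ))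
      · simp only [largeJump, Set.indicator_of_mem h, h4]
        ring
      · simp only [largeJump, Set.indicator_of_notMem h, mul_zero, add_zero]
  have e4 : ((isExpSystem_poissonExp hN).firstChaos (smallJumpL hPi (a + b)) ω).re =
      ((isExpSystem_poissonExp hN).firstChaos (smallJumpL hPi a) ω).re +
        ((isExpSystem_poissonExp hN).firstChaos (smallJumpL hPi b) ω).re := by
    rw [smallJumpL_add, map_add, h3]
    exact Complex.add_re _ _
  rw [jumpValue, e1, e2, e3, e4, jumpValue, jumpValue]
  ring

theorem jumpValue_smul (hPi : IsLevyMeasure Pi) (c : ℝ) (hN : IsPoissonProcess (ν.prod Pi) P N)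
    (r : ℝ) (a : Lp ℝ ∞ ν) :
    ∀ᵐ ω ∂P, jumpValue hPi c hN (r • a) ω = r * jumpValue hPi c hN a ω := by
  have hab := Lp.coeFn_smul r a
  have e1 : ∫ x, (r • a : Lp ℝ ∞ ν) x ∂ν = r * ∫ x, a x ∂ν := by
    rw [← integral_const_mul]
    exact integral_congr_ae hab
  have e2 : ∫ z : X × ℝ, (r • a : Lp ℝ ∞ ν) z.1 * jumpKernel z.2 ∂(ν.prod Pi) =
      r * ∫ z : X × ℝ, a z.1 * jumpKernel z.2 ∂(ν.prod Pi) := by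
    rw [← integral_const_mul]
    refine integral_congr_ae ?_
    filter_upwards [ae_fst hab] with z hz
    rw [show (r • a : Lp ℝ ∞ ν) z.1 = r * a z.1 from hz, mul_assoc]
  filter_upwards [hN.ae_forall (ae_fst hab),
    Lp.coeFn_smul (r : ℂ) ((isExpSystem_poissonExp hN).firstChaos (smallJumpL hPi a))]
    with ω h1 h3
  have e3 : ∑' z, ((N ω).mult z : ℝ) * largeJump (r • a : Lp ℝ ∞ ν) z =
      r * ∑' z, ((N ω).mult z : ℝ) * largeJump a z := by
    rw [← tsum_mul_left]
    refine tsum_congr fun z => ?_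
    by_cases hz : (N ω).mult z = 0
    · simp [hz]
    · have h4 : (r • a : Lp ℝ ∞ ν) z.1 = r * a z.1 := h1 z hz
      by_cases h : z ∈ (Prod.snd ⁻¹' bigJumps 0 : Set (X × ℝ))
      · simp only [largeJump, Set.indicator_of_mem h, h4]
        ring
      · simp only [largeJump, Set.indicator_of_notMem h, mul_zero]
  have e4 : ((isExpSystem_poissonExp hN).firstChaos (smallJumpL hPi (r • a)) ω).re =
      r * ((isExpSystem_poissonExp hN).firstChaos (smallJumpL hPi a) ω).re := by
    rw [smallJumpL_smul, map_smul, h3]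
    exact Complex.re_ofReal_mul _ _
  rw [jumpValue, e1, e2, e3, e4, jumpValue]
  ring

/-- The process with jumps `N` and drift `c`. -/
def jumpProcess (hPi : IsLevyMeasure Pi) (c : ℝ) (hN : IsPoissonProcess (ν.prod Pi) P N) :
    GenProcess ∞ ν P where
  toFun a := AEEqFun.mk (jumpValue hPi c hN a) (aestronglyMeasurable_jumpValue hPi c hN a)
  map_add' a b := by
    rw [AEEqFun.mk_add_mk, AEEqFun.mk_eq_mk]
    exact jumpValue_add hPi c hN a b
  map_smul' r a := by
    rw [RingHom.id_apply, AEEqFun.smul_mk, AEEqFun.mk_eq_mk]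
    exact jumpValue_smul hPi c hN r a

/-- The truncated sum splits into the large jumps, which do not depend on the truncation, and the
real part of an element of `L²`. The latter converges in `L²`, hence in probability. -/
theorem isJumpConfiguration_jumpProcess (hPi : IsLevyMeasure Pi) (c : ℝ)
    (hN : IsPoissonProcess (ν.prod Pi) P N) :
    IsJumpConfiguration Pi c (jumpProcess hPi c hN) N where
  poisson := hN
  jumps a := by
    have := hPi.sigmaFinite
    have hE := isExpSystem_poissonExp hN
    set B : ℕ → Set (X × ℝ) := fun n => Prod.snd ⁻¹' bigJumps n with hB
    have hBm : ∀ n, MeasurableSet (B n) := fun n => measurable_snd (measurableSet_bigJumps n)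
    have ha : Measurable a := (Lp.stronglyMeasurable a).measurable
    set f : ℕ → Lp ℂ 2 (ν.prod Pi) := fun n => cut (B n) (hBm n) (smallJumpL hPi a) with hf
    have hfi : ∀ n, Integrable (f n) (ν.prod Pi) := fun n =>
      integrable_cut_bigJumps hPi n (smallJumpL hPi a)
    set d : ℕ → ℝ := fun n => ∫ z, (B n).indicator (fun z => a z.1 * jumpKernel z.2) z ∂(ν.prod Pi)
      with hd
    have hdlim : Tendsto d atTop (𝓝 (∫ z : X × ℝ, a z.1 * jumpKernel z.2 ∂(ν.prod Pi))) := by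
      refine tendsto_integral_of_dominated_convergence (fun z => ‖a z.1 * jumpKernel z.2‖)
        (fun n => (integrable_jumpKernel hPi a).1.indicator (hBm n))
        (integrable_jumpKernel hPi a).norm
        (fun n => ae_of_all _ fun z => norm_indicator_le_norm_self _ z) ?_
      filter_upwards [ae_snd hPi.ae_ne_zero] with z hz
      refine tendsto_const_nhds.congr' ?_
      filter_upwards [eventually_mem_bigJumps hz] with n hn
      exact (Set.indicator_of_mem (show z ∈ B n from hn)
        fun z : X × ℝ => a z.1 * jumpKernel z.2).symm
    -- The deterministic correction `d n` enters as a multiple of `E 0 = 1`, so that both converging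
    -- terms live in `L²`.
    set V : ℕ → Lp ℂ 2 P := fun n => hE.firstChaos (f n) + (d n : ℂ) • poissonExp hN 0 with hV
    have hVlim : Tendsto V atTop (𝓝 (hE.firstChaos (smallJumpL hPi a) +
        ((∫ z : X × ℝ, a z.1 * jumpKernel z.2 ∂(ν.prod Pi) : ℝ) : ℂ) • poissonExp hN 0)) := by
      refine ((hE.firstChaos.continuous.tendsto _).comp (tendsto_cut_bigJumps hPi _)).add ?_
      exact ((Complex.continuous_ofReal.tendsto _).comp hdlim).smul_const _
    have hVm := tendstoInMeasure_of_tendsto_Lp hVlim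
    have hVre : ∀ (g : Lp ℂ 2 P) (r : ℝ), ∀ᵐ ω ∂P, ((g + (r : ℂ) • poissonExp hN 0 : Lp ℂ 2 P) ω).re =
        (g ω).re + r := by
      intro g r
      filter_upwards [Lp.coeFn_add g ((r : ℂ) • poissonExp hN 0),
        Lp.coeFn_smul (r : ℂ) (poissonExp hN 0), hE.zero] with ω k1 k2 k3
      have k2' : ((r : ℂ) • poissonExp hN 0 : Lp ℂ 2 P) ω = (r : ℂ) * poissonExp hN 0 ω := k2
      have k1' : (g + (r : ℂ) • poissonExp hN 0 : Lp ℂ 2 P) ω =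
        g ω + ((r : ℂ) • poissonExp hN 0 : Lp ℂ 2 P) ω := k1
      rw [k1', k2', k3]
      simp
    have hA : ∀ n : ℕ, ∀ᵐ ω ∂P, c * ∫ x, a x ∂ν +
          ((∑' z : X × ℝ, ((N ω).mult z : ℝ) *
              (if 1 / ((n : ℝ) + 1) < |z.2| then a z.1 * z.2 else 0)) -
            ∫ z : X × ℝ, (if 1 / ((n : ℝ) + 1) < |z.2| then a z.1 * (z.2 / (1 + z.2 ^ 2)) else 0)
              ∂(ν.prod Pi)) =
        c * ∫ x, a x ∂ν + ∑' z, ((N ω).mult z : ℝ) * largeJump a z + (V n ω).re := by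
      intro n
      have hfre : ∀ᵐ z ∂ν.prod Pi, f n z = (((B n).indicator (fun z => (smallJump a z).re) z : ℝ) : ℂ) := by
        filter_upwards [coeFn_cut (B n) (hBm n) (smallJumpL hPi a), coeFn_smallJumpL hPi a]
          with z k1 k2
        rw [show f n z = _ from k1]
        by_cases hz : z ∈ B n
        · rw [Set.indicator_of_mem hz, Set.indicator_of_mem hz, k2]
          by_cases hz' : z ∈ (Prod.snd ⁻¹' (bigJumps 0)ᶜ : Set (X × ℝ))
          · simp only [smallJump, Set.indicator_of_mem hz', Complex.ofReal_re]
          · simp only [smallJump, Set.indicator_of_notMem hz', Complex.zero_re, Complex.ofReal_zero]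
        · rw [Set.indicator_of_notMem hz, Set.indicator_of_notMem hz, Complex.ofReal_zero]
      have hgi : Integrable ((B n).indicator fun z => (smallJump a z).re) (ν.prod Pi) := by
        have := (hfi n).re
        refine this.congr ?_
        filter_upwards [hfre] with z hz
        rw [hz]
        rfl
      have hki : Integrable ((B n).indicator fun z => a z.1 * jumpKernel z.2) (ν.prod Pi) :=
        (integrable_jumpKernel hPi a).indicator (hBm n)
      have hv : ∫ z : X × ℝ, (if 1 / ((n : ℝ) + 1) < |z.2| then a z.1 * (z.2 / (1 + z.2 ^ 2)) else 0)
              ∂(ν.prod Pi) = ∫ z, (B n).indicator (fun z => (smallJump a z).re) z ∂(ν.prod Pi) - d n := by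
        rw [hd, ← integral_sub hgi hki]
        refine integral_congr_ae (ae_of_all _ fun z => ?_)
        by_cases hz : z ∈ B n
        · have hz' : 1 / ((n : ℝ) + 1) < |z.2| := hz
          simp only [hz', if_true, Set.indicator_of_mem hz, jumpKernel]
          by_cases h0 : z.2 ∈ (bigJumps 0)ᶜ
          · rw [smallJump, Set.indicator_of_mem (by exact h0), Set.indicator_of_mem h0,
              Complex.ofReal_re, id]
            ring
          · rw [smallJump, Set.indicator_of_notMem (by exact h0), Set.indicator_of_notMem h0,
              Complex.zero_re]
            ring
        · have hz' : ¬ 1 / ((n : ℝ) + 1) < |z.2| := hz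
          simp only [hz', if_false, Set.indicator_of_notMem hz, sub_zero]
      have hint : ∫ z, f n z ∂(ν.prod Pi) =
          ((∫ z, (B n).indicator (fun z => (smallJump a z).re) z ∂(ν.prod Pi) : ℝ) : ℂ) := by
        rw [← integral_complex_ofReal]
        exact integral_congr_ae hfre
      filter_upwards [hVre (hE.firstChaos (f n)) (d n), firstChaos_poissonExp hN (hfi n),
        hN.ae_forall hfre, ae_count_bigJumps_ne_top hPi hN 0, ae_count_bigJumps_ne_top hPi hN n]
        with ω k1 k2 k3 k4 k5
      have e1 : ∑' z, ((N ω).mult z : ℂ) * f n z =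
          ((∑' z, ((N ω).mult z : ℝ) * (B n).indicator (fun z => (smallJump a z).re) z : ℝ) : ℂ) := by
        rw [Complex.ofReal_tsum]
        refine tsum_congr fun z => ?_
        by_cases hz : (N ω).mult z = 0
        · simp [hz]
        · rw [k3 z hz]
          push_cast
          rfl
      have e2 : ∑' z : X × ℝ, ((N ω).mult z : ℝ) *
              (if 1 / ((n : ℝ) + 1) < |z.2| then a z.1 * z.2 else 0) =
          ∑' z, ((N ω).mult z : ℝ) * largeJump a z +
            ∑' z, ((N ω).mult z : ℝ) * (B n).indicator (fun z => (smallJump a z).re) z := by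
        have hs₀ : Summable fun z => ((N ω).mult z : ℝ) * largeJump a z :=
          Configuration.summable_of_count_ne_top k4 fun z hz => Set.indicator_of_notMem hz _
        have hs : Summable fun z => ((N ω).mult z : ℝ) *
            (B n).indicator (fun z => (smallJump a z).re) z :=
          Configuration.summable_of_count_ne_top k5 fun z hz => Set.indicator_of_notMem hz _
        rw [← hs₀.tsum_add hs]
        refine tsum_congr fun z => ?_
        rw [← mul_add]
        congr 1
        by_cases h0 : z.2 ∈ bigJumps 0
        · have hz : z ∈ B n := bigJumps_zero_subset n h0
          have hz' : 1 / ((n : ℝ) + 1) < |z.2| := hz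
          rw [if_pos hz', Set.indicator_of_mem hz, largeJump, Set.indicator_of_mem (by exact h0),
            smallJump, Set.indicator_of_notMem (by simpa using h0), Complex.zero_re, add_zero]
        · rw [largeJump, Set.indicator_of_notMem (by exact h0), zero_add]
          by_cases hz : z ∈ B n
          · have hz' : 1 / ((n : ℝ) + 1) < |z.2| := hz
            rw [if_pos hz', Set.indicator_of_mem hz, smallJump, Set.indicator_of_mem (by exact h0),
              Complex.ofReal_re]
          · have hz' : ¬ 1 / ((n : ℝ) + 1) < |z.2| := hz
            rw [if_neg hz', Set.indicator_of_notMem hz]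
      rw [show (V n ω).re = _ from k1, k2, e1, hint, hv, e2, ← Complex.ofReal_sub,
        Complex.ofReal_re]
      ring
    have hlim : ∀ᵐ ω ∂P, jumpProcess hPi c hN a ω =
        c * ∫ x, a x ∂ν + ∑' z, ((N ω).mult z : ℝ) * largeJump a z +
          ((hE.firstChaos (smallJumpL hPi a) +
        ((∫ z : X × ℝ, a z.1 * jumpKernel z.2 ∂(ν.prod Pi) : ℝ) : ℂ) • poissonExp hN 0 :
          Lp ℂ 2 P) ω).re := by
      filter_upwards [AEEqFun.coeFn_mk (jumpValue hPi c hN a)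
        (aestronglyMeasurable_jumpValue hPi c hN a), hVre (hE.firstChaos (smallJumpL hPi a))
        (∫ z : X × ℝ, a z.1 * jumpKernel z.2 ∂(ν.prod Pi))] with ω k1 k2
      rw [k2]
      refine Eq.trans k1 ?_
      rw [jumpValue, add_assoc]
    refine TendstoInMeasure.congr' (Eventually.of_forall fun n => EventuallyEq.symm (hA n))
      (EventuallyEq.symm hlim) ?_
    intro ε hε
    refine tendsto_of_tendsto_of_tendsto_of_le_of_le tendsto_const_nhds (hVm ε hε)
      (fun n => zero_le) fun n => measure_mono fun ω hω => ?_
    refine le_trans (show ε ≤ _ from hω) ?_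
    -- Adding the common large-jump term preserves distances, and taking real parts does not
    -- increase them.
    rw [edist_add_left, edist_dist, edist_dist, Real.dist_eq, Complex.dist_eq, ← Complex.sub_re]
    exact ENNReal.ofReal_le_ofReal (Complex.abs_re_le_norm _)

end JumpProcess


/-! ### Construction of Poisson processes -/

section FinitePoisson

theorem integral_prod_infinitePi {ι : Type*} {Y : ι → Type*} [∀ i, MeasurableSpace (Y i)]
    (p : ∀ i, Measure (Y i)) [∀ i, IsProbabilityMeasure (p i)] (s : Finset ι) {g : ∀ i, Y i → ℂ}
    (hg : ∀ i, Measurable (g i)) :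
    ∫ x, ∏ i ∈ s, g i (x i) ∂Measure.infinitePi p = ∏ i ∈ s, ∫ y, g i y ∂p i := by
  have h1 : iIndepFun (fun i (x : ∀ i, Y i) => g i (x i)) (Measure.infinitePi p) :=
    iIndepFun_infinitePi hg
  have h2 := (h1.precomp (g := (Subtype.val : s → ι)) Subtype.val_injective)
  have h3 := h2.integral_fun_prod_eq_prod_integral fun i =>
    ((hg i.1).comp (measurable_pi_apply i.1)).aestronglyMeasurable
  rw [Finset.prod_coe_sort s fun i => ∫ x, g i (x i) ∂Measure.infinitePi p] at h3
  simp only [fun x : ∀ i, Y i => Finset.prod_coe_sort s fun i => g i (x i)] at h3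
  rw [h3]
  refine Finset.prod_congr rfl fun i _ => ?_
  rw [← Measure.infinitePi_map_eval p i, integral_map (measurable_pi_apply i).aemeasurable
    (hg i).aestronglyMeasurable]

/-- A finite sequence of points of the line, padded to an infinite one. -/
abbrev Block : Type := ℕ × (ℕ → ℝ)

open Classical in
/-- The number of points in `C`. -/
def Block.num (b : Block) (C : Set ℝ) : ℕ := ∑ i ∈ Finset.range b.1, if b.2 i ∈ C then 1 else 0

theorem Block.measurable_num {C : Set ℝ} (hC : MeasurableSet C) :
    Measurable fun b : Block => b.num C := by
  refine measurable_from_prod_countable_right fun n => ?_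
  classical
  change Measurable fun r : ℕ → ℝ => Block.num (n, r) C
  simp only [Block.num]
  refine Finset.measurable_fun_sum _ fun i _ => ?_
  exact Measurable.ite (measurable_pi_apply i hC) measurable_const measurable_const

/-- The law of a Poisson number of independent points with mean measure `q`. -/
def blockMeasure (q : FiniteMeasure ℝ) : Measure Block :=
  (poissonMeasure q.mass).prod (Measure.infinitePi fun _ : ℕ => (q.normalize : Measure ℝ))

instance (q : FiniteMeasure ℝ) : IsProbabilityMeasure (blockMeasure q) := by
  unfold blockMeasure
  infer_instance

/-- It also covers the zero measure, where the normalization is an arbitrary default and the mass is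
`0`. -/
theorem mass_smul_normalize (q : FiniteMeasure ℝ) :
    (q.mass : ℝ≥0∞) • (q.normalize : Measure ℝ) = (q : Measure ℝ) := by
  conv_rhs => rw [q.self_eq_mass_smul_normalize]
  rfl

theorem lintegral_num_blockMeasure (q : FiniteMeasure ℝ) {C : Set ℝ} (hC : MeasurableSet C) :
    ∫⁻ b, (b.num C : ℝ≥0∞) ∂blockMeasure q = (q : Measure ℝ) C := by
  classical
  have hm : Measurable fun b : Block => (b.num C : ℝ≥0∞) :=
    (measurable_of_countable _).comp (Block.measurable_num hC)
  rw [blockMeasure, lintegral_prod _ hm.aemeasurable]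
  have h1 : ∀ n : ℕ, ∫⁻ r, (Block.num (n, r) C : ℝ≥0∞)
      ∂(Measure.infinitePi fun _ : ℕ => (q.normalize : Measure ℝ)) =
      n * (q.normalize : Measure ℝ) C := by
    intro n
    simp only [Block.num, Nat.cast_sum, Nat.cast_ite, Nat.cast_one, Nat.cast_zero]
    rw [lintegral_finsetSum]
    · have h2 : ∀ i : ℕ, ∫⁻ r : ℕ → ℝ, (if r i ∈ C then 1 else 0 : ℝ≥0∞)
          ∂(Measure.infinitePi fun _ : ℕ => (q.normalize : Measure ℝ)) =
          (q.normalize : Measure ℝ) C := by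
        intro i
        have h3 : ∀ r : ℕ → ℝ, (if r i ∈ C then 1 else 0 : ℝ≥0∞) =
            ((fun r : ℕ → ℝ => r i) ⁻¹' C).indicator 1 r := fun r => by
          simp [Set.indicator_apply]
        simp only [h3]
        rw [lintegral_indicator_one (measurable_pi_apply i hC),
          ← Measure.map_apply (measurable_pi_apply i) hC]
        exact congrArg (fun m : Measure ℝ => m C) (Measure.infinitePi_map_eval _ i)
      simp [h2]
    · intro i _
      exact Measurable.ite (measurable_pi_apply i hC) measurable_const measurable_const
  simp only [h1]
  rw [lintegral_mul_const _ (measurable_of_countable _), lintegral_cast_poissonMeasure,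
    ← mass_smul_normalize q, Measure.smul_apply, smul_eq_mul]

/-- Given the number `n` of points, the factors are independent and the mean is the `n`-th power of
the mean of `g`; the Poisson generating function then sums over `n`. -/
theorem integral_prod_blockMeasure (q : FiniteMeasure ℝ) {g : ℝ → ℂ} (hg : Measurable g)
    (hg1 : ∀ y, ‖g y‖ ≤ 1) :
    ∫ b, ∏ i ∈ Finset.range b.1, g (b.2 i) ∂blockMeasure q =
      Complex.exp (∫ y, (g y - 1) ∂(q : Measure ℝ)) := by
  have hm : Measurable fun b : Block => ∏ i ∈ Finset.range b.1, g (b.2 i) := by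
    refine measurable_from_prod_countable_right fun n => ?_
    change Measurable fun r : ℕ → ℝ => ∏ i ∈ Finset.range n, g (r i)
    exact Finset.measurable_fun_prod _ fun i _ => hg.comp (measurable_pi_apply i)
  have hint : Integrable (fun b : Block => ∏ i ∈ Finset.range b.1, g (b.2 i)) (blockMeasure q) := by
    refine Integrable.of_bound hm.aestronglyMeasurable 1 (ae_of_all _ fun b => ?_)
    rw [norm_prod]
    exact Finset.prod_le_one (fun _ _ => norm_nonneg _) fun i _ => hg1 _
  have hgi : ∀ m : Measure ℝ, IsFiniteMeasure m → Integrable g m := fun m _ =>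
    Integrable.of_bound hg.aestronglyMeasurable 1 (ae_of_all _ hg1)
  rw [blockMeasure] at hint ⊢
  rw [integral_prod _ hint]
  simp only [integral_prod_infinitePi (fun _ : ℕ => (q.normalize : Measure ℝ)) _ fun _ => hg,
    Finset.prod_const, Finset.card_range]
  have h1 := integral_pow_poissonMeasure q.mass (∫ y, g y ∂(q.normalize : Measure ℝ) - 1)
  rw [add_sub_cancel] at h1
  rw [h1, integral_sub (hgi _ inferInstance) (integrable_const _), ← mass_smul_normalize q,
    integral_smul_measure, integral_smul_measure]
  simp only [integral_const, probReal_univ, ENNReal.coe_toReal, one_smul, Complex.real_smul]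
  congr 1
  ring

end FinitePoisson


/-! ### A Poisson process on a standard Borel space -/

section Canonical

theorem Block.coe_num (b : Block) (C : Set ℝ) [∀ i, Decidable (i < b.1 ∧ b.2 i ∈ C)] :
    (b.num C : ℝ≥0∞) = ∑' i, if i < b.1 ∧ b.2 i ∈ C then 1 else 0 := by
  classical
  rw [tsum_eq_sum (s := Finset.range b.1)]
  · rw [Block.num, Nat.cast_sum]
    refine Finset.sum_congr rfl fun i hi => ?_
    simp only [Finset.mem_range.1 hi, true_and]
    split_ifs <;> simp
  · intro i hi
    rw [if_neg fun h => hi (Finset.mem_range.2 h.1)]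

variable {Z : Type*} [MeasurableSpace Z] [StandardBorelSpace Z] (μ : Measure Z) [SigmaFinite μ]

/-- The cells of a partition of the space into sets of finite measure. -/
def cell (k : ℕ) : Set Z := spanningSetsIndex μ ⁻¹' {k}

theorem measurableSet_cell (k : ℕ) : MeasurableSet (cell μ k) :=
  measurableSet_spanningSetsIndex μ (measurableSet_singleton k)

theorem disjoint_cell : Pairwise (Function.onFun Disjoint (cell μ)) := fun i j hij =>
  Set.disjoint_left.2 fun _ hi hj => hij (hi.symm.trans hj)

theorem iUnion_cell : ⋃ k, cell μ k = Set.univ :=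
  Set.eq_univ_of_forall fun z => Set.mem_iUnion.2 ⟨spanningSetsIndex μ z, rfl⟩

theorem measure_cell_lt_top (k : ℕ) : μ (cell μ k) < ∞ := by
  rw [cell, preimage_spanningSetsIndex_singleton]
  exact (measure_mono (disjointed_subset _ k)).trans_lt (measure_spanningSets_lt_top μ k)

/-- The part of `B` in a cell, embedded into the line. -/
def cellImage (k : ℕ) (B : Set Z) : Set ℝ := embeddingReal Z '' (B ∩ cell μ k)

theorem measurableSet_cellImage (k : ℕ) {B : Set Z} (hB : MeasurableSet B) :
    MeasurableSet (cellImage μ k B) :=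
  (measurableEmbedding_embeddingReal Z).measurableSet_image.2 (hB.inter (measurableSet_cell μ k))

/-- The configuration given by finite sequences of points of the cells. -/
def ofBlocks (d : ℕ → Block) : Configuration Z where
  -- Only the block of the cell of `z` is consulted: entries of a block outside the image of its own
  -- cell are ignored.
  mult z := (d (spanningSetsIndex μ z)).num {embeddingReal Z z}
  countable_support := by
    classical
    refine Set.Countable.mono (s₂ := ⋃ (k : ℕ) (i : ℕ), {z | embeddingReal Z z = (d k).2 i})
      (fun z hz => ?_) ?_
    · obtain ⟨i, _, hi⟩ := Finset.exists_ne_zero_of_sum_ne_zero hz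
      refine Set.mem_iUnion₂.2 ⟨spanningSetsIndex μ z, i, ?_⟩
      by_contra h
      exact hi (if_neg fun h' => h (Set.mem_singleton_iff.1 h').symm)
    · refine Set.countable_iUnion fun k => Set.countable_iUnion fun i => Set.Subsingleton.countable ?_
      intro x hx y hy
      exact (measurableEmbedding_embeddingReal Z).injective (hx.trans hy.symm)

/-- Interchange of summations: an entry of a block represents at most one point of `Z`, by
injectivity of the embedding. -/
theorem count_ofBlocks (d : ℕ → Block) (B : Set Z) :
    (ofBlocks μ d).count B = ∑' k, ((d k).num (cellImage μ k B) : ℝ≥0∞) := by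
  classical
  let T : ℕ → ℕ → Z → ℝ≥0∞ := fun k i z =>
    if (z ∈ B ∧ spanningSetsIndex μ z = k) ∧ i < (d k).1 ∧ (d k).2 i = embeddingReal Z z
    then 1 else 0
  have h1 : ∀ z, B.indicator (fun z => ((ofBlocks μ d).mult z : ℝ≥0∞)) z =
      ∑' k, ∑' i, T k i z := by
    intro z
    by_cases hz : z ∈ B
    · rw [Set.indicator_of_mem hz, tsum_eq_single (spanningSetsIndex μ z)]
      · change (((d (spanningSetsIndex μ z)).num {embeddingReal Z z} : ℕ) : ℝ≥0∞) = _
        rw [Block.coe_num]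
        refine tsum_congr fun i => ?_
        simp [T, hz]
      · intro k hk
        rw [ENNReal.tsum_eq_zero]
        exact fun i => if_neg fun h => hk h.1.2.symm
    · rw [Set.indicator_of_notMem hz]
      symm
      rw [ENNReal.tsum_eq_zero]
      intro k
      rw [ENNReal.tsum_eq_zero]
      exact fun i => if_neg fun h => hz h.1.1
  have h2 : ∀ k i, ∑' z, T k i z =
      if i < (d k).1 ∧ (d k).2 i ∈ cellImage μ k B then 1 else 0 := by
    intro k i
    split_ifs with h
    · obtain ⟨hi, z, ⟨hzB, hzk⟩, hz⟩ := h
      rw [tsum_eq_single z]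
      · exact if_pos ⟨⟨hzB, hzk⟩, hi, hz.symm⟩
      · intro y hy
        refine if_neg fun h' => hy ((measurableEmbedding_embeddingReal Z).injective ?_)
        rw [← h'.2.2, hz]
    · rw [ENNReal.tsum_eq_zero]
      exact fun z => if_neg fun h' => h ⟨h'.2.1, z, h'.1, h'.2.2.symm⟩
  rw [Configuration.count, tsum_subtype B fun z => ((ofBlocks μ d).mult z : ℝ≥0∞)]
  simp only [h1]
  rw [ENNReal.tsum_comm]
  refine tsum_congr fun k => ?_
  rw [ENNReal.tsum_comm, Block.coe_num]
  exact tsum_congr fun i => h2 k i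

theorem measurable_count_ofBlocks {B : Set Z} (hB : MeasurableSet B) :
    Measurable fun d => (ofBlocks μ d).count B := by
  simp only [count_ofBlocks]
  refine Measurable.tsum fun k => ?_
  exact (measurable_of_countable (fun n : ℕ => (n : ℝ≥0∞))).comp
    ((Block.measurable_num (measurableSet_cellImage μ k hB)).comp (measurable_pi_apply k))

/-- The restriction of `μ` to a cell, transported to the line. -/
def cellMeasure (k : ℕ) : FiniteMeasure ℝ :=
  ⟨(μ.restrict (cell μ k)).map (embeddingReal Z), by
    have : IsFiniteMeasure (μ.restrict (cell μ k)) :=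
      ⟨by rw [Measure.restrict_apply_univ]; exact measure_cell_lt_top μ k⟩
    infer_instance⟩

theorem coe_cellMeasure (k : ℕ) :
    (cellMeasure μ k : Measure ℝ) = (μ.restrict (cell μ k)).map (embeddingReal Z) := rfl

theorem cellMeasure_cellImage (k : ℕ) (B : Set Z) :
    (cellMeasure μ k : Measure ℝ) (cellImage μ k B) = μ (B ∩ cell μ k) := by
  rw [coe_cellMeasure, (measurableEmbedding_embeddingReal Z).map_apply, cellImage,
    Set.preimage_image_eq _ (measurableEmbedding_embeddingReal Z).injective,
    Measure.restrict_apply' (measurableSet_cell μ k), Set.inter_assoc, Set.inter_self]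

/-- The law of the points of a Poisson process with mean measure `μ`. -/
def poissonLaw : Measure (ℕ → Block) := Measure.infinitePi fun k => blockMeasure (cellMeasure μ k)

instance : IsProbabilityMeasure (poissonLaw μ) := by
  unfold poissonLaw
  infer_instance

theorem lintegral_count_poissonLaw {B : Set Z} (hB : MeasurableSet B) :
    ∫⁻ d, (ofBlocks μ d).count B ∂poissonLaw μ = μ B := by
  have hm : ∀ k, Measurable fun b : Block => (b.num (cellImage μ k B) : ℝ≥0∞) := fun k =>
    (measurable_of_countable (fun n : ℕ => (n : ℝ≥0∞))).comp
      (Block.measurable_num (measurableSet_cellImage μ k hB))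
  simp only [count_ofBlocks]
  have hm' : ∀ k, Measurable fun d : ℕ → Block => ((d k).num (cellImage μ k B) : ℝ≥0∞) := fun k =>
    (hm k).comp (measurable_pi_apply k)
  rw [lintegral_tsum fun k => (hm' k).aemeasurable]
  have h1 : ∀ k, ∫⁻ d, ((d k).num (cellImage μ k B) : ℝ≥0∞) ∂poissonLaw μ = μ (B ∩ cell μ k) := by
    intro k
    rw [← cellMeasure_cellImage, ← lintegral_num_blockMeasure _ (measurableSet_cellImage μ k hB),
      ← Measure.infinitePi_map_eval (fun k => blockMeasure (cellMeasure μ k)) k,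
      lintegral_map (hm k) (measurable_pi_apply k)]
    rfl
  simp only [h1]
  rw [← measure_iUnion, ← Set.inter_iUnion, iUnion_cell, Set.inter_univ]
  · exact fun i j hij => (disjoint_cell μ hij).mono Set.inter_subset_right Set.inter_subset_right
  · exact fun k => hB.inter (measurableSet_cell μ k)

theorem ae_count_ne_top_poissonLaw {B : Set Z} (hB : MeasurableSet B) (hμ : μ B ≠ ∞) :
    ∀ᵐ d ∂poissonLaw μ, (ofBlocks μ d).count B ≠ ∞ := by
  have h := ae_lt_top (measurable_count_ofBlocks μ hB)
    (by rwa [lintegral_count_poissonLaw μ hB] : ∫⁻ d, (ofBlocks μ d).count B ∂poissonLaw μ ≠ ∞)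
  filter_upwards [h] with d hd
  exact hd.ne

variable {ι : Type*} [Fintype ι]

/-- The blocks are independent, and the block of a cell contributes the exponential of the integral
over that cell. Finitely many cells give a finite product; dominated convergence, with integrands of
modulus one, adds the rest. -/
theorem integral_exp_count_poissonLaw {B : ι → Set Z} (hB : ∀ j, MeasurableSet (B j))
    (hμ : ∀ j, μ (B j) ≠ ∞) (t : ι → ℝ) :
    ∫ d, Complex.exp (Complex.I *
        ((∑ j, t j * ((ofBlocks μ d).count (B j)).toReal : ℝ) : ℂ)) ∂poissonLaw μ =
      Complex.exp (∫ z, (Complex.exp (Complex.I *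
        ((∑ j, t j * (B j).indicator 1 z : ℝ) : ℂ)) - 1) ∂μ) := by
  classical
  have hemb := measurableEmbedding_embeddingReal Z
  set C : ℕ → ι → Set ℝ := fun k j => cellImage μ k (B j) with hC
  have hCm : ∀ k j, MeasurableSet (C k j) := fun k j => measurableSet_cellImage μ k (hB j)
  set u : Z → ℝ := fun z => ∑ j, t j * (B j).indicator 1 z with hu
  have hum : Measurable u := by
    refine Finset.measurable_fun_sum _ fun j _ => Measurable.const_mul ?_ _
    exact measurable_one.indicator (hB j)
  set v : ℕ → ℝ → ℝ := fun k y => ∑ j, t j * (C k j).indicator 1 y with hv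
  have hvm : ∀ k, Measurable (v k) := fun k => by
    refine Finset.measurable_fun_sum _ fun j _ => Measurable.const_mul ?_ _
    exact measurable_one.indicator (hCm k j)
  have huv : ∀ k, ∀ z ∈ cell μ k, v k (embeddingReal Z z) = u z := by
    intro k z hz
    refine Finset.sum_congr rfl fun j _ => ?_
    congr 1
    have : embeddingReal Z z ∈ C k j ↔ z ∈ B j := by
      refine ⟨fun ⟨y, hy, hyz⟩ => ?_, fun h => ⟨z, ⟨h, hz⟩, rfl⟩⟩
      rw [← hemb.injective hyz]
      exact hy.1
    by_cases h : z ∈ B j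
    · rw [Set.indicator_of_mem h, Set.indicator_of_mem (this.2 h)]
      rfl
    · rw [Set.indicator_of_notMem h, Set.indicator_of_notMem fun h' => h (this.1 h')]
  set h : Z → ℂ := fun z => Complex.exp (Complex.I * (u z : ℂ)) - 1 with hh
  have hhi : Integrable h μ := by
    have hD : μ (⋃ j, B j) ≠ ∞ := by
      refine ne_top_of_le_ne_top ?_ (measure_iUnion_fintype_le μ B)
      exact ENNReal.sum_ne_top.2 fun j _ => hμ j
    have hDm : MeasurableSet (⋃ j, B j) := MeasurableSet.iUnion hB
    have h0 : h = (⋃ j, B j).indicator h := by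
      ext z
      by_cases hz : z ∈ ⋃ j, B j
      · rw [Set.indicator_of_mem hz]
      · rw [Set.indicator_of_notMem hz]
        have : u z = 0 := Finset.sum_eq_zero fun j _ => by
          rw [Set.indicator_of_notMem fun h => hz (Set.mem_iUnion.2 ⟨j, h⟩), mul_zero]
        simp [hh, this]
    rw [h0, integrable_indicator_iff hDm]
    refine Measure.integrableOn_of_bounded (M := 2) hD ?_ (ae_of_all _ fun z => ?_)
    · exact Measurable.aestronglyMeasurable (by fun_prop)
    · refine (norm_sub_le _ _).trans ?_
      rw [norm_exp_I_mul, norm_one]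
      norm_num
  have hblock : ∀ k (b : Block), ∏ i ∈ Finset.range b.1, Complex.exp (Complex.I * (v k (b.2 i) : ℂ)) =
      Complex.exp (Complex.I * ((∑ j, t j * (b.num (C k j) : ℝ) : ℝ) : ℂ)) := by
    intro k b
    rw [← Complex.exp_sum, ← Finset.mul_sum, ← Complex.ofReal_sum, Finset.sum_comm]
    congr 3
    refine Finset.sum_congr rfl fun j _ => ?_
    rw [← Finset.mul_sum, Block.num]
    push_cast
    congr 1
  have hpart : ∀ K : ℕ, ∫ d, Complex.exp (Complex.I * ((∑ j, t j *
      ∑ k ∈ Finset.range K, ((d k).num (C k j) : ℝ) : ℝ) : ℂ)) ∂poissonLaw μ =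
      Complex.exp (∑ k ∈ Finset.range K, ∫ z in cell μ k, h z ∂μ) := by
    intro K
    have h1 : ∀ d : ℕ → Block, Complex.exp (Complex.I * ((∑ j, t j *
        ∑ k ∈ Finset.range K, ((d k).num (C k j) : ℝ) : ℝ) : ℂ)) =
        ∏ k ∈ Finset.range K,
          Complex.exp (Complex.I * ((∑ j, t j * ((d k).num (C k j) : ℝ) : ℝ) : ℂ)) := by
      intro d
      rw [← Complex.exp_sum, ← Finset.mul_sum, ← Complex.ofReal_sum, Finset.sum_comm]
      simp only [Finset.mul_sum]
    simp only [h1]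
    rw [poissonLaw, integral_prod_infinitePi (fun k => blockMeasure (cellMeasure μ k))
      (Finset.range K) (g := fun k (b : Block) =>
        Complex.exp (Complex.I * ((∑ j, t j * (b.num (C k j) : ℝ) : ℝ) : ℂ))), Complex.exp_sum]
    · refine Finset.prod_congr rfl fun k _ => ?_
      simp only [← hblock]
      rw [integral_prod_blockMeasure _ (g := fun y => Complex.exp (Complex.I * (v k y : ℂ)))
        (by have := hvm k; fun_prop) fun y => (norm_exp_I_mul _).le, coe_cellMeasure, hemb.integral_map]
      congr 1
      refine setIntegral_congr_fun (measurableSet_cell μ k) fun z hz => ?_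
      simp only [huv k z hz, hh]
    · intro k
      have : ∀ j, Measurable fun b : Block => (b.num (C k j) : ℝ) := fun j =>
        (measurable_of_countable (fun n : ℕ => (n : ℝ))).comp (Block.measurable_num (hCm k j))
      fun_prop
  have hl1 : Tendsto (fun K : ℕ => Complex.exp (∑ k ∈ Finset.range K, ∫ z in cell μ k, h z ∂μ))
      atTop (𝓝 (Complex.exp (∫ z, h z ∂μ))) := by
    have h1 := hasSum_integral_iUnion (fun k => measurableSet_cell μ k) (disjoint_cell μ)
      (hhi.integrableOn (s := ⋃ k, cell μ k))
    rw [iUnion_cell, setIntegral_univ] at h1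
    exact (Complex.continuous_exp.tendsto _).comp h1.tendsto_sum_nat
  refine tendsto_nhds_unique ?_ hl1
  simp only [← hpart]
  refine tendsto_integral_of_dominated_convergence (fun _ => 1) (fun K => ?_)
    (integrable_const _) (fun K => ae_of_all _ fun d => (norm_exp_I_mul _).le) ?_
  · have : ∀ k j, Measurable fun d : ℕ → Block => ((d k).num (C k j) : ℝ) := fun k j =>
      (measurable_of_countable (fun n : ℕ => (n : ℝ))).comp
        ((Block.measurable_num (hCm k j)).comp (measurable_pi_apply k))
    exact Measurable.aestronglyMeasurable (by fun_prop)
  · filter_upwards [ae_all_iff.2 fun j => ae_count_ne_top_poissonLaw μ (hB j) (hμ j)] with d hd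
    have hc : Continuous fun y : ℝ => Complex.exp (Complex.I * (y : ℂ)) := by fun_prop
    refine (hc.tendsto _).comp (tendsto_finsetSum _ fun j _ => Tendsto.const_mul _ ?_)
    have h1 := hd j
    rw [count_ofBlocks] at h1 ⊢
    have h2 := ENNReal.summable_toReal h1
    have h3 := h2.hasSum.tendsto_sum_nat
    rw [← ENNReal.tsum_toReal_eq fun k => ENNReal.natCast_ne_top _] at h3
    simpa using h3

theorem integral_exp_count_of_disjoint {B : ι → Set Z} (hB : ∀ j, MeasurableSet (B j))
    (hμ : ∀ j, μ (B j) ≠ ∞) (hd : Pairwise fun i j => Disjoint (B i) (B j)) (t : ι → ℝ) :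
    ∫ d, Complex.exp (Complex.I *
        ((∑ j, t j * ((ofBlocks μ d).count (B j)).toReal : ℝ) : ℂ)) ∂poissonLaw μ =
      ∏ j, Complex.exp ((μ (B j)).toReal * (Complex.exp (Complex.I * (t j : ℂ)) - 1)) := by
  classical
  rw [integral_exp_count_poissonLaw μ hB hμ, ← Complex.exp_sum]
  congr 1
  have h1 : ∀ z, Complex.exp (Complex.I * ((∑ j, t j * (B j).indicator 1 z : ℝ) : ℂ)) - 1 =
      ∑ j, (B j).indicator (fun _ => Complex.exp (Complex.I * (t j : ℂ)) - 1) z := by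
    intro z
    by_cases hz : ∃ j, z ∈ B j
    · obtain ⟨j, hj⟩ := hz
      have h2 : ∀ i, i ≠ j → z ∉ B i := fun i hij hi => Set.disjoint_left.1 (hd hij) hi hj
      rw [Finset.sum_eq_single j, Finset.sum_eq_single j, Set.indicator_of_mem hj,
        Set.indicator_of_mem hj, Pi.one_apply, mul_one]
      · exact fun i _ hi => Set.indicator_of_notMem (h2 i hi) _
      · simp
      · intro i _ hi
        rw [Set.indicator_of_notMem (h2 i hi), mul_zero]
      · simp
    · push Not at hz
      rw [Finset.sum_eq_zero, Finset.sum_eq_zero]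
      · simp
      · exact fun i _ => Set.indicator_of_notMem (hz i) _
      · intro i _
        rw [Set.indicator_of_notMem (hz i), mul_zero]
  simp only [h1]
  rw [integral_finsetSum]
  · refine Finset.sum_congr rfl fun j _ => ?_
    rw [integral_indicator_const _ (hB j), Complex.real_smul]
    rfl
  · exact fun j _ => (integrable_indicator_iff (hB j)).2 (integrableOn_const (hμ j))

end Canonical


/-! ### Law and independence of the counts -/

section CanonicalPoisson

variable {Z : Type*} [MeasurableSpace Z] [StandardBorelSpace Z] (μ : Measure Z) [SigmaFinite μ]

theorem charFun_count_poissonLaw {B : Set Z} (hB : MeasurableSet B) (hμ : μ B ≠ ∞) (t : ℝ) :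
    charFun ((poissonLaw μ).map fun d => ((ofBlocks μ d).count B).toReal) t =
      Complex.exp ((μ B).toReal * (Complex.exp (Complex.I * (t : ℂ)) - 1)) := by
  have hm : Measurable fun d => ((ofBlocks μ d).count B).toReal :=
    (measurable_count_ofBlocks μ hB).ennreal_toReal
  rw [charFun_apply_real, integral_map hm.aemeasurable
    (Measurable.aestronglyMeasurable (by fun_prop))]
  have h1 := integral_exp_count_of_disjoint μ (ι := Unit) (B := fun _ => B) (fun _ => hB)
    (fun _ => hμ) (fun i j hij => (hij (Subsingleton.elim i j)).elim) fun _ => t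
  simp only [Finset.univ_unique, Finset.sum_singleton, Finset.prod_singleton] at h1
  rw [← h1]
  refine integral_congr_ae (ae_of_all _ fun d => ?_)
  change Complex.exp _ = Complex.exp _
  congr 1
  push_cast
  ring

theorem law_poissonLaw {B : Set Z} (hB : MeasurableSet B) (hμ : μ B ≠ ∞) (n : ℕ) :
    poissonLaw μ {d | (ofBlocks μ d).count B = n} =
      ENNReal.ofReal (Real.exp (-(μ B).toReal) * (μ B).toReal ^ n / (n.factorial : ℝ)) := by
  have hm : Measurable fun d => ((ofBlocks μ d).count B).toReal :=
    (measurable_count_ofBlocks μ hB).ennreal_toReal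
  have hcast : Measurable (Nat.cast : ℕ → ℝ) := measurable_of_countable _
  have h1 : (poissonLaw μ).map (fun d => ((ofBlocks μ d).count B).toReal) =
      (poissonMeasure (μ B).toNNReal).map (Nat.cast : ℕ → ℝ) := by
    have := Measure.isProbabilityMeasure_map (μ := poissonLaw μ) hm.aemeasurable
    have := Measure.isProbabilityMeasure_map (μ := poissonMeasure (μ B).toNNReal) hcast.aemeasurable
    refine Measure.ext_of_charFun (funext fun t => ?_)
    rw [charFun_count_poissonLaw μ hB hμ, charFun_map_cast_poissonMeasure, mul_comm Complex.I]
    rfl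
  have h2 : poissonLaw μ {d | (ofBlocks μ d).count B = n} =
      (poissonLaw μ).map (fun d => ((ofBlocks μ d).count B).toReal) {(n : ℝ)} := by
    rw [Measure.map_apply hm (measurableSet_singleton _)]
    refine measure_congr ?_
    filter_upwards [ae_count_ne_top_poissonLaw μ hB hμ] with d hd
    refine propext ⟨fun h => ?_, fun h => ?_⟩
    · change ((ofBlocks μ d).count B).toReal = n
      rw [show (ofBlocks μ d).count B = n from h, ENNReal.toReal_natCast]
    · have h' : ((ofBlocks μ d).count B).toReal = n := h
      change (ofBlocks μ d).count B = n
      rw [← ENNReal.ofReal_toReal hd, h', ENNReal.ofReal_natCast]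
  have h3 : (Nat.cast : ℕ → ℝ) ⁻¹' {(n : ℝ)} = {n} := by
    ext m
    simp
  rw [h2, h1, Measure.map_apply hcast (measurableSet_singleton _), h3, poissonMeasure_singleton]
  rfl

/-- Exhausting `B` by sets of finite measure gives Poisson counts with means tending to infinity, so
every fixed bound has probability zero. Independence is required for sets of infinite measure too,
where the count must therefore be constant. -/
theorem ae_count_eq_top_poissonLaw {B : Set Z} (hB : MeasurableSet B) (hμ : μ B = ∞) :
    ∀ᵐ d ∂poissonLaw μ, (ofBlocks μ d).count B = ∞ := by
  set D : ℕ → Set Z := fun K => B ∩ spanningSets μ K with hD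
  have hDm : ∀ K, MeasurableSet (D K) := fun K => hB.inter (measurableSet_spanningSets μ K)
  have hDμ : ∀ K, μ (D K) ≠ ∞ := fun K =>
    ne_top_of_le_ne_top (measure_spanningSets_lt_top μ K).ne (measure_mono Set.inter_subset_right)
  have hr : Tendsto (fun K => (μ (D K)).toReal) atTop atTop := by
    rw [← ENNReal.tendsto_ofReal_nhds_top]
    have h1 := tendsto_measure_iUnion_atTop (μ := μ) (s := D)
      fun i j hij => Set.inter_subset_inter_right _ (monotone_spanningSets μ hij)
    rw [hD, ← Set.inter_iUnion, iUnion_spanningSets, Set.inter_univ, hμ] at h1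
    refine h1.congr fun K => ?_
    exact (ENNReal.ofReal_toReal (hDμ K)).symm
  have hmono : ∀ (κ : Configuration Z) {s t : Set Z}, s ⊆ t → κ.count s ≤ κ.count t := by
    intro κ s t hst
    rw [Configuration.count, Configuration.count,
      tsum_subtype s fun z => (κ.mult z : ℝ≥0∞), tsum_subtype t fun z => (κ.mult z : ℝ≥0∞)]
    exact ENNReal.tsum_le_tsum fun z => Set.indicator_le_indicator_of_subset hst
      (fun _ => zero_le) z
  have hzero : ∀ m : ℕ, poissonLaw μ {d | (ofBlocks μ d).count B = m} = 0 := by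
    intro m
    have hle : ∀ K, poissonLaw μ {d | (ofBlocks μ d).count B = m} ≤
        ∑ i ∈ Finset.range (m + 1), poissonLaw μ {d | (ofBlocks μ d).count (D K) = i} := by
      intro K
      refine (measure_mono fun d hd => ?_).trans (measure_biUnion_finset_le _ _)
      have h1 : (ofBlocks μ d).count (D K) ≤ m :=
        (hmono _ Set.inter_subset_left).trans (le_of_eq hd)
      have h2 : (ofBlocks μ d).count (D K) ≠ ∞ := ne_top_of_le_ne_top (ENNReal.natCast_ne_top m) h1
      rw [← Configuration.coe_num _ h2] at h1
      refine Set.mem_biUnion (x := (ofBlocks μ d).num (D K)) ?_ (Configuration.coe_num _ h2).symm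
      exact Finset.mem_coe.2 (Finset.mem_range.2 (Nat.lt_succ_of_le (by exact_mod_cast h1)))
    refine le_antisymm (ge_of_tendsto' (x := atTop) ?_ hle) zero_le
    rw [← Finset.sum_const_zero (s := Finset.range (m + 1))]
    refine tendsto_finsetSum _ fun i _ => ?_
    simp only [law_poissonLaw μ (hDm _) (hDμ _)]
    rw [← ENNReal.ofReal_zero]
    refine (ENNReal.continuous_ofReal.tendsto _).comp ?_
    have h1 := ((Real.tendsto_pow_mul_exp_neg_atTop_nhds_zero i).comp hr).div_const
      (i.factorial : ℝ)
    rw [zero_div] at h1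
    refine h1.congr fun K => ?_
    simp only [Function.comp_apply]
    rw [mul_comm]
  have hall : ∀ᵐ d ∂poissonLaw μ, ∀ m : ℕ, (ofBlocks μ d).count B ≠ m := by
    rw [ae_all_iff]
    intro m
    rw [ae_iff]
    simpa using hzero m
  filter_upwards [hall] with d hd
  by_contra h
  exact hd _ (Configuration.coe_num _ h).symm

theorem iIndepFun_toReal_count_poissonLaw {n : ℕ} {B : Fin n → Set Z}
    (hB : ∀ j, MeasurableSet (B j)) (hμ : ∀ j, μ (B j) ≠ ∞)
    (hd : Pairwise fun i j => Disjoint (B i) (B j)) :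
    iIndepFun (fun j d => ((ofBlocks μ d).count (B j)).toReal) (poissonLaw μ) := by
  have hm : ∀ j, Measurable fun d => ((ofBlocks μ d).count (B j)).toReal := fun j =>
    (measurable_count_ofBlocks μ (hB j)).ennreal_toReal
  rw [iIndepFun_iff_charFun_pi fun j => (hm j).aemeasurable]
  intro t
  rw [charFun_apply, integral_map (Measurable.aemeasurable (by fun_prop))
    (Measurable.aestronglyMeasurable (by fun_prop))]
  simp only [charFun_count_poissonLaw μ (hB _) (hμ _)]
  rw [← integral_exp_count_of_disjoint μ hB hμ hd]
  refine integral_congr_ae (ae_of_all _ fun d => ?_)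
  simp only [PiLp.inner_apply, RCLike.inner_apply, conj_trivial]
  rw [mul_comm]

theorem isPoissonProcess_ofBlocks : IsPoissonProcess μ (poissonLaw μ) (ofBlocks μ) where
  measurable B hB := measurable_count_ofBlocks μ hB
  law B hB hμ n := law_poissonLaw μ hB hμ n
  indep n B hB hd := by
    classical
    -- Sets of infinite measure are replaced by `∅`; afterwards their counts are restored as the
    -- constant `∞`, which does not affect independence.
    have h1 := iIndepFun_toReal_count_poissonLaw μ (B := fun j => if μ (B j) = ∞ then ∅ else B j)
      (fun j => by split_ifs; exacts [MeasurableSet.empty, hB j])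
      (fun j => by
        split_ifs with h
        · simp
        · exact h)
      (fun i j hij => (hd hij).mono (by split_ifs <;> simp) (by split_ifs <;> simp))
    have h2 := h1.comp (fun j x => if μ (B j) = ∞ then (∞ : ℝ≥0∞) else ENNReal.ofReal x)
      (fun j => by
        split_ifs
        · exact measurable_const
        · exact ENNReal.measurable_ofReal)
    refine h2.congr fun j => ?_
    by_cases hj : μ (B j) = ∞
    · filter_upwards [ae_count_eq_top_poissonLaw μ (hB j) hj] with d hd
      simp [hj, hd]
    · filter_upwards [ae_count_ne_top_poissonLaw μ (hB j) hj] with d hd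
      simp [hj, hd]

end CanonicalPoisson


/-! ### Recovering the points of a configuration from the counts -/

section Sorting

/-- Order statistics are functions of counts in half-lines, which is how the points become
measurable functions of the counts. -/
theorem getElem_le_iff_lt_countP {l : List ℝ} (hl : l.Pairwise (· ≤ ·)) (x : ℝ) :
    ∀ (i : ℕ) (hi : i < l.length), l[i] ≤ x ↔ i < l.countP (fun y => decide (y ≤ x)) := by
  induction l with
  | nil => intro i hi; simp at hi
  | cons a l ih =>
    rw [List.pairwise_cons] at hl
    intro i hi
    by_cases hax : a ≤ x
    · cases i with
      | zero => simp [hax]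
      | succ i =>
        simp only [List.getElem_cons_succ, hax, decide_true, List.countP_cons_of_pos]
        rw [ih hl.2 i (by simpa using hi)]
        omega
    · have h0 : ∀ y ∈ a :: l, ¬ y ≤ x := by
        intro y hy hyx
        rcases List.mem_cons.1 hy with rfl | hy
        · exact hax hyx
        · exact hax ((hl.1 y hy).trans hyx)
      have h1 : (a :: l).countP (fun y => decide (y ≤ x)) = 0 := by
        rw [List.countP_eq_zero]
        intro y hy
        simpa using h0 y hy
      rw [h1]
      simp only [Nat.not_lt_zero, iff_false]
      exact h0 _ (List.getElem_mem hi)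

open Classical in
theorem Block.num_eq_countP (b : Block) (C : Set ℝ) :
    b.num C = ((List.range b.1).map b.2).countP fun y => decide (y ∈ C) := by
  obtain ⟨n, r⟩ := b
  simp only [Block.num]
  induction n with
  | zero => simp
  | succ n ih =>
    rw [Finset.sum_range_succ, ih, List.range_succ, List.map_append, List.countP_append]
    simp [List.countP_cons]

/-- A list of points as a padded sequence. -/
def Block.ofList (l : List ℝ) : Block := (l.length, fun i => l.getD i 0)

open Classical in
theorem Block.num_ofList (l : List ℝ) (C : Set ℝ) :
    (Block.ofList l).num C = l.countP fun y => decide (y ∈ C) := by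
  rw [Block.num_eq_countP]
  congr 1
  refine List.ext_getElem (by simp [Block.ofList]) fun i h1 h2 => ?_
  simp [Block.ofList, h2]

open Classical in
/-- The points of the block in `D`, in increasing order. -/
def Block.sorted (b : Block) (D : Set ℝ) : List ℝ :=
  (((List.range b.1).map b.2).filter fun y => decide (y ∈ D)).insertionSort (· ≤ ·)

open Classical in
theorem Block.countP_sorted (b : Block) (D C : Set ℝ) :
    (b.sorted D).countP (fun y => decide (y ∈ C)) = b.num (C ∩ D) := by
  rw [Block.sorted, (List.perm_insertionSort _ _).countP_eq, List.countP_filter,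
    Block.num_eq_countP]
  congr 1
  ext y
  simp

theorem Block.num_ofList_sorted (b : Block) (D C : Set ℝ) :
    (Block.ofList (b.sorted D)).num C = b.num (C ∩ D) := by
  rw [Block.num_ofList, Block.countP_sorted]

theorem Block.length_sorted (b : Block) (D : Set ℝ) : (b.sorted D).length = b.num D := by
  classical
  have := b.countP_sorted D Set.univ
  rw [Set.univ_inter] at this
  rw [← this, eq_comm, List.countP_eq_length]
  simp

/-- The second alternative comes from the padding value `0` past the end of the list. -/
theorem Block.getD_sorted_le_iff (b : Block) (D : Set ℝ) (i : ℕ) (x : ℝ) :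
    (b.sorted D).getD i 0 ≤ x ↔
      (i < b.num D ∧ i < b.num (Set.Iic x ∩ D)) ∨ (¬ i < b.num D ∧ 0 ≤ x) := by
  classical
  rw [← b.length_sorted D]
  by_cases hi : i < (b.sorted D).length
  · have h1 := getElem_le_iff_lt_countP (l := b.sorted D) (List.pairwise_insertionSort _ _) x i hi
    have h2 := b.countP_sorted D (Set.Iic x)
    simp only [Set.mem_Iic] at h2
    rw [h2] at h1
    simp [hi, h1]
  · simp [hi, not_lt.1 hi]

variable {Z : Type*} [MeasurableSpace Z] [StandardBorelSpace Z] (μ : Measure Z) [SigmaFinite μ]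

/-- The points of the cells in increasing order. -/
def sortBlocks (d : ℕ → Block) (k : ℕ) : Block :=
  Block.ofList ((d k).sorted (cellImage μ k Set.univ))

/-- The multiplicities ignore both the order in a block and the entries outside its cell. The sorted
blocks are thus a standard form of the points, from which the configuration is recovered. -/
theorem ofBlocks_sortBlocks (d : ℕ → Block) : ofBlocks μ (sortBlocks μ d) = ofBlocks μ d := by
  have h : (ofBlocks μ (sortBlocks μ d)).mult = (ofBlocks μ d).mult := by
    ext z
    change (sortBlocks μ d (spanningSetsIndex μ z)).num _ = (d (spanningSetsIndex μ z)).num _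
    rw [sortBlocks, Block.num_ofList_sorted, Set.inter_eq_left.2]
    rw [Set.singleton_subset_iff]
    exact ⟨z, ⟨trivial, rfl⟩, rfl⟩
  cases h1 : ofBlocks μ (sortBlocks μ d)
  cases h2 : ofBlocks μ d
  simp only [h1, h2] at h
  subst h
  rfl

theorem coe_num_eq_count (d : ℕ → Block) (k : ℕ) (C : Set ℝ) :
    ((d k).num (C ∩ cellImage μ k Set.univ) : ℝ≥0∞) =
      (ofBlocks μ d).count (embeddingReal Z ⁻¹' C ∩ cell μ k) := by
  rw [count_ofBlocks, tsum_eq_single k]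
  · congr 2
    ext y
    constructor
    · rintro ⟨hy, z, ⟨-, hz⟩, rfl⟩
      exact ⟨z, ⟨⟨hy, hz⟩, hz⟩, rfl⟩
    · rintro ⟨z, ⟨⟨hy, hz⟩, -⟩, rfl⟩
      exact ⟨hy, z, ⟨trivial, hz⟩, rfl⟩
  · intro j hj
    have : cellImage μ j (embeddingReal Z ⁻¹' C ∩ cell μ k) = ∅ := by
      rw [cellImage, Set.image_eq_empty]
      refine Set.eq_empty_of_forall_notMem fun z hz => hj ?_
      exact hz.2.symm.trans hz.1.2
    rw [this]
    simp [Block.num]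

theorem measurable_num_configSigma (k : ℕ) {C : Set ℝ} (hC : MeasurableSet C) :
    Measurable[configSigma (ofBlocks μ) Set.univ]
      fun d : ℕ → Block => (d k).num (C ∩ cellImage μ k Set.univ) := by
  have h1 := measurable_configSigma_count (ofBlocks μ)
    ((measurable_embeddingReal Z hC).inter (measurableSet_cell μ k)) (Set.subset_univ _)
  refine @measurable_to_countable' _ _ _ _ (configSigma (ofBlocks μ) Set.univ) _ fun n => ?_
  have h2 := h1 (measurableSet_singleton (n : ℝ≥0∞))
  refine (congrArg (MeasurableSet[configSigma (ofBlocks μ) Set.univ]) ?_).mpr h2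
  ext d
  simp only [Set.mem_preimage, Set.mem_singleton_iff, ← coe_num_eq_count]
  exact Nat.cast_inj.symm

/-- It encodes a configuration by an element of a standard Borel space that depends measurably on
the counts alone. -/
theorem measurable_sortBlocks :
    Measurable[configSigma (ofBlocks μ) Set.univ] (sortBlocks μ) := by
  set m := configSigma (ofBlocks μ) Set.univ with hm
  have hD : ∀ k (C : Set ℝ), MeasurableSet C → ∀ i : ℕ,
      MeasurableSet[m] {d : ℕ → Block | i < (d k).num (C ∩ cellImage μ k Set.univ)} := by
    intro k C hC i
    exact measurable_num_configSigma μ k hC (measurableSet_Ioi (a := i))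
  have hD1 : ∀ k (i : ℕ), MeasurableSet[m] {d : ℕ → Block | i < (d k).num (cellImage μ k Set.univ)} := by
    intro k i
    have := hD k Set.univ MeasurableSet.univ i
    simpa only [Set.univ_inter] using this
  refine @measurable_pi_lambda _ _ _ m _ _ fun k => ?_
  have hl : Measurable[m] fun d : ℕ → Block =>
      ((d k).sorted (cellImage μ k Set.univ)).length := by
    have h1 := measurable_num_configSigma μ k MeasurableSet.univ
    simp only [Set.univ_inter, ← Block.length_sorted] at h1
    exact h1
  have hr : Measurable[m] fun (d : ℕ → Block) (i : ℕ) =>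
      ((d k).sorted (cellImage μ k Set.univ)).getD i 0 := by
    refine @measurable_pi_lambda _ _ _ m _ _ fun i => ?_
    refine @measurable_of_Iic _ _ _ _ _ m _ _ _ _ fun x => ?_
    have h1 : (fun d : ℕ → Block => ((d k).sorted (cellImage μ k Set.univ)).getD i 0) ⁻¹' Set.Iic x =
        ({d : ℕ → Block | i < (d k).num (cellImage μ k Set.univ)} ∩
          {d : ℕ → Block | i < (d k).num (Set.Iic x ∩ cellImage μ k Set.univ)}) ∪
        ({d : ℕ → Block | i < (d k).num (cellImage μ k Set.univ)}ᶜ ∩ {_d | 0 ≤ x}) := by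
      ext d
      exact Block.getD_sorted_le_iff _ _ _ _
    refine (congrArg (MeasurableSet[m]) h1).mpr ?_
    refine @MeasurableSet.union _ m _ _ (@MeasurableSet.inter _ m _ _ (hD1 k i)
      (hD k _ measurableSet_Iic i)) (@MeasurableSet.inter _ m _ _ (@MeasurableSet.compl _ _ m (hD1 k i)) ?_)
    exact @MeasurableSet.const _ m _
  exact hl.prodMk hr

end Sorting


/-! ### Existence of the configuration of jumps -/

section Transfer

/-- The map is encoded by a bounded real function through an embedding and `arctan`. The code lies
in `L²`, so the inclusion gives an `m₂`-measurable version of it, and this is decoded by a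
measurable left inverse. -/
theorem exists_measurable_ae_eq_of_lpMeas_le {Ω D : Type*} {m₁ m₂ : MeasurableSpace Ω}
    [mΩ : MeasurableSpace Ω] {P : Measure Ω} [IsFiniteMeasure P] [MeasurableSpace D]
    [StandardBorelSpace D] [Nonempty D] (h₁ : m₁ ≤ mΩ)
    (hle : lpMeas ℂ ℂ m₁ 2 P ≤ lpMeas ℂ ℂ m₂ 2 P) {s : Ω → D} (hs : Measurable[m₁] s) :
    ∃ s' : Ω → D, Measurable[m₂] s' ∧ s =ᵐ[P] s' := by
  let φ : D → ℝ := fun x => Real.arctan (embeddingReal D x)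
  have hφm : Measurable φ := Real.measurable_arctan.comp (measurable_embeddingReal D)
  have hφ : MeasurableEmbedding φ := hφm.measurableEmbedding fun x y hxy =>
    (measurableEmbedding_embeddingReal D).injective (Real.arctan_injective hxy)
  have hfm : Measurable[m₁] fun ω => (φ (s ω) : ℂ) :=
    Complex.measurable_ofReal.comp (hφm.comp hs)
  have hf : MemLp (fun ω => (φ (s ω) : ℂ)) 2 P := by
    refine MemLp.of_bound (hfm.mono h₁ le_rfl).aestronglyMeasurable (Real.pi / 2)
      (ae_of_all _ fun ω => ?_)
    rw [Complex.norm_real, Real.norm_eq_abs, abs_le]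
    exact ⟨(Real.neg_pi_div_two_lt_arctan _).le, (Real.arctan_lt_pi_div_two _).le⟩
  have h2 : hf.toLp _ ∈ lpMeas ℂ ℂ m₁ 2 P := by
    rw [mem_lpMeas_iff_aestronglyMeasurable]
    exact hfm.stronglyMeasurable.aestronglyMeasurable.congr hf.coeFn_toLp.symm
  have h3 := hle h2
  rw [mem_lpMeas_iff_aestronglyMeasurable] at h3
  obtain ⟨g, hg, hgae⟩ := h3
  refine ⟨fun ω => hφ.invFun (g ω).re,
    hφ.measurable_invFun.comp (Complex.measurable_re.comp hg.measurable), ?_⟩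
  filter_upwards [hgae, hf.coeFn_toLp] with ω k1 k2
  rw [← k1, k2, Complex.ofReal_re]
  exact (hφ.leftInverse_invFun (s ω)).symm

theorem GenProcess.sigma_univ_eq_comap {Z Ω : Type*} [MeasurableSpace Z] [MeasurableSpace Ω]
    {p : ℝ≥0∞} {μ : Measure Z} {P : Measure Ω} (Y : GenProcess p μ P) :
    Y.sigma Set.univ =
      MeasurableSpace.comap (fun ω (a : Lp ℝ p μ) => Y a ω) MeasurableSpace.pi := by
  rw [MeasurableSpace.pi, MeasurableSpace.comap_iSup, GenProcess.sigma]
  refine iSup_congr fun a => ?_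
  rw [MeasurableSpace.comap_comp, iSup_pos (by simp)]
  rfl

theorem IsLevyProcess.integral_exp_sum {X Ω : Type*} [MeasurableSpace X] [MeasurableSpace Ω]
    {ν : Measure X} {P : Measure Ω} {Pi : Measure ℝ} {c : ℝ} {η : GenProcess ∞ ν P}
    (hη : IsLevyProcess Pi c η) (s : Finset (Lp ℝ ∞ ν)) (q : Lp ℝ ∞ ν → ℝ) :
    ∫ ω, Complex.exp (Complex.I * ((∑ a ∈ s, q a * η a ω : ℝ) : ℂ)) ∂P =
      Complex.exp (∫ x, levyExponent Pi c ((∑ a ∈ s, q a • a : Lp ℝ ∞ ν) x) ∂ν) := by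
  rw [← hη]
  refine integral_congr_ae ?_
  filter_upwards [η.coeFn_sum s q fun a => a] with ω hω
  rw [hω]

theorem IsLevyProcess.map_eq {X Ω Ω' : Type*} [MeasurableSpace X] [MeasurableSpace Ω]
    [MeasurableSpace Ω'] {ν : Measure X} {P : Measure Ω} {P' : Measure Ω'} [IsFiniteMeasure P]
    [IsFiniteMeasure P'] {Pi : Measure ℝ} {c : ℝ} {η : GenProcess ∞ ν P} {η' : GenProcess ∞ ν P'}
    (hη : IsLevyProcess Pi c η) (hη' : IsLevyProcess Pi c η') :
    P.map (fun ω (a : Lp ℝ ∞ ν) => η a ω) = P'.map (fun ω (a : Lp ℝ ∞ ν) => η' a ω) :=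
  map_eq_of_charFunctional_eq (fun a => η.measurable a) (fun a => η'.measurable a) fun s q => by
    rw [hη.integral_exp_sum, hη'.integral_exp_sum]

variable {X Ω : Type*} [MeasurableSpace X] [StandardBorelSpace X] [MeasurableSpace Ω]
  {ν : Measure X} [IsFiniteMeasure ν] [NullSingletonClass ν] {Pi : Measure ℝ} {c : ℝ}
  {P : Measure Ω} [IsProbabilityMeasure P] {η : GenProcess ∞ ν P}

/-- On the canonical space the jumps are mod 0 a function of the process with these jumps. The same
function of the given process has the right joint law, and being a configuration of jumps is a
property of this joint law. -/
theorem IsLevyProcess.exists_isJumpConfiguration (hPi : IsLevyMeasure Pi)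
    (hη : IsLevyProcess Pi c η) :
    ∃ N : Ω → Configuration (X × ℝ), IsJumpConfiguration Pi c η N := by
  have := hPi.sigmaFinite
  set μ := ν.prod Pi with hμ
  set P' := poissonLaw μ with hP'
  have hN' : IsPoissonProcess μ P' (ofBlocks μ) := isPoissonProcess_ofBlocks μ
  set η' : GenProcess ∞ ν P' := jumpProcess hPi c hN' with hη'def
  have hJ : IsJumpConfiguration Pi c η' (ofBlocks μ) := isJumpConfiguration_jumpProcess hPi c hN'
  have hrc : Represents (configSigma (ofBlocks μ) Set.univ) (poissonExp hN') Set.univ :=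
    represents_configSigma hN' MeasurableSet.univ
  have hrs : Represents (η'.sigma Set.univ) (poissonExp hN') Set.univ :=
    hJ.represents_sigma hPi MeasurableSet.univ
  -- The σ-fields of the configuration and of `η'` are represented by the same exponential vectors,
  -- hence coincide mod 0.
  obtain ⟨s', hs', hss'⟩ := exists_measurable_ae_eq_of_lpMeas_le hrc.le
    (hrc.eq.trans hrs.eq.symm).le (measurable_sortBlocks μ)
  set y : Ω → Lp ℝ ∞ ν → ℝ := fun ω a => η a ω with hy
  set y' : (ℕ → Block) → Lp ℝ ∞ ν → ℝ := fun d a => η' a d with hy'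
  have hym : Measurable y := measurable_pi_lambda _ fun a => η.measurable a
  have hym' : Measurable y' := measurable_pi_lambda _ fun a => η'.measurable a
  rw [η'.sigma_univ_eq_comap] at hs'
  -- A function measurable with respect to the process is a measurable function `G` of its path, and
  -- `G` can be applied to paths of `η`.
  obtain ⟨G, hG, hGs⟩ := hs'.exists_eq_measurable_comp
  have hmap : P.map y = P'.map y' := hη.map_eq (hJ.isLevyProcess hPi)
  have hset : ∀ S : Set (Lp ℝ ∞ ν → ℝ), MeasurableSet S → P (y ⁻¹' S) = P' (y' ⁻¹' S) := by
    intro S hS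
    rw [← Measure.map_apply hym hS, ← Measure.map_apply hym' hS, hmap]
  have hrec : ∀ᵐ d ∂P', ofBlocks μ (G (y' d)) = ofBlocks μ d := by
    filter_upwards [hss'] with d hd
    rw [← ofBlocks_sortBlocks μ d, hd, hGs]
    rfl
  let M : (Lp ℝ ∞ ν → ℝ) → Configuration (X × ℝ) := fun w => ofBlocks μ (G w)
  have hM : ∀ B, MeasurableSet B → Measurable fun w => (M w).count B := fun B hB =>
    (measurable_count_ofBlocks μ hB).comp hG
  refine ⟨fun ω => M (y ω), ⟨fun B hB => (hM B hB).comp hym, fun B hB hBμ n => ?_,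
    fun n B hB hd => ?_⟩, fun a => ?_⟩
  · rw [← hN'.law B hB hBμ n]
    refine (hset {w | (M w).count B = n} (hM B hB (measurableSet_singleton _))).trans ?_
    refine measure_congr ?_
    filter_upwards [hrec] with d hd
    change ((ofBlocks μ (G (y' d))).count B = n) = ((ofBlocks μ d).count B = n)
    rw [hd]
  · have h1 : iIndepFun (fun i d => (M (y' d)).count (B i)) P' := by
      refine (hN'.indep n B hB hd).congr fun i => ?_
      filter_upwards [hrec] with d hd
      change (ofBlocks μ d).count (B i) = (ofBlocks μ (G (y' d))).count (B i)
      rw [hd]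
    have hF : Measurable fun w (i : Fin n) => (M w).count (B i) :=
      measurable_pi_lambda _ fun i => hM _ (hB i)
    have hm' : ∀ i, AEMeasurable (fun d => (M (y' d)).count (B i)) P' := fun i =>
      ((hM _ (hB i)).comp hym').aemeasurable
    have hm : ∀ i, AEMeasurable (fun ω => (M (y ω)).count (B i)) P := fun i =>
      ((hM _ (hB i)).comp hym).aemeasurable
    rw [iIndepFun_iff_map_fun_eq_pi_map hm'] at h1
    rw [iIndepFun_iff_map_fun_eq_pi_map hm]
    have e1 : ∀ i, P.map (fun ω => (M (y ω)).count (B i)) =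
        P'.map (fun d => (M (y' d)).count (B i)) := fun i => by
      have h2 := Measure.map_map (μ := P) (hM _ (hB i)) hym
      have h3 := Measure.map_map (μ := P') (hM _ (hB i)) hym'
      rw [hmap, h3] at h2
      exact h2.symm
    have e2 : P.map (fun ω i => (M (y ω)).count (B i)) =
        P'.map (fun d i => (M (y' d)).count (B i)) := by
      have h2 := Measure.map_map (μ := P) hF hym
      have h3 := Measure.map_map (μ := P') hF hym'
      rw [hmap, h3] at h2
      exact h2.symm
    simp only [e1]
    exact e2.trans h1
  · have ha : Measurable a := (Lp.stronglyMeasurable a).measurable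
    have hT : ∀ n : ℕ, Measurable fun w => c * ∫ x, a x ∂ν +
          ((∑' z : X × ℝ, ((M w).mult z : ℝ) *
              (if 1 / ((n : ℝ) + 1) < |z.2| then a z.1 * z.2 else 0)) -
            ∫ z : X × ℝ, (if 1 / ((n : ℝ) + 1) < |z.2| then a z.1 * (z.2 / (1 + z.2 ^ 2)) else 0)
              ∂μ) := by
      intro n
      have hu : Measurable fun z : X × ℝ =>
          if 1 / ((n : ℝ) + 1) < |z.2| then a z.1 * z.2 else 0 :=
        Measurable.ite (measurable_snd (measurableSet_bigJumps n)) (by fun_prop) measurable_const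
      exact ((Configuration.measurable_tsum_real hM hu).sub_const _).const_add _
    -- The probability of a deviation by at least `ε` concerns a measurable set of paths, so it is
    -- the same for both processes.
    intro ε hε
    refine (hJ.jumps a ε hε).congr fun n => ?_
    refine Eq.trans ?_ (hset {w | ε ≤ edist _ (w a)} (measurableSet_le measurable_const
      ((hT n).edist (measurable_pi_apply a)))).symm
    refine measure_congr ?_
    filter_upwards [hrec] with d hd
    change (ε ≤ edist _ _) = (ε ≤ edist (c * ∫ x, a x ∂ν +
          ((∑' z : X × ℝ, ((ofBlocks μ (G (y' d))).mult z : ℝ) *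
              (if 1 / ((n : ℝ) + 1) < |z.2| then a z.1 * z.2 else 0)) -
            ∫ z : X × ℝ, (if 1 / ((n : ℝ) + 1) < |z.2| then a z.1 * (z.2 / (1 + z.2 ^ 2)) else 0)
              ∂μ)) (y' d a))
    rw [hd]

end Transfer

end LevyGauss

end

theorem theorem4p1 {X Ω₁ Ω₂ : Type*} [MeasurableSpace X] [StandardBorelSpace X]
    [MeasurableSpace Ω₁] [MeasurableSpace Ω₂]
    (ν : Measure X) [IsFiniteMeasure ν] [NullSingletonClass ν]
    (Pi : Measure ℝ) (hPi : LevyGauss.IsLevyMeasure Pi) (c : ℝ)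
    (P₁ : Measure Ω₁) [IsProbabilityMeasure P₁] (P₂ : Measure Ω₂) [IsProbabilityMeasure P₂]
    (W : LevyGauss.GenProcess 2 (ν.prod Pi) P₁) (hW : LevyGauss.IsWhiteNoise W)
    (η : LevyGauss.GenProcess ∞ ν P₂) (hη : LevyGauss.IsLevyProcess Pi c η) :
    (∃ N : Ω₂ → LevyGauss.Configuration (X × ℝ), LevyGauss.IsJumpConfiguration Pi c η N) ∧
    ∀ N : Ω₂ → LevyGauss.Configuration (X × ℝ), LevyGauss.IsJumpConfiguration Pi c η N →
      ∃ Φ : LevyGauss.L2 (W.sigma Set.univ) P₁ ≃ₗᵢ[ℂ] LevyGauss.L2 (η.sigma Set.univ) P₂,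
        LevyGauss.IsUnityPreserving Φ ∧
        LevyGauss.IsReal Φ ∧
        LevyGauss.IsSpecialIsomorphism
          (LevyGauss.baseFactorization W) (LevyGauss.processFactorization η) Φ ∧
        LevyGauss.IsSpecialIsomorphism
          (LevyGauss.processFactorization W) (LevyGauss.jumpFactorization η N) Φ ∧
        LevyGauss.ActsIdenticallyOnValues W N Φ ∧
        LevyGauss.HasExponentialFormula W N Φ ∧
        ∀ Ψ : LevyGauss.L2 (W.sigma Set.univ) P₁ ≃ₗᵢ[ℂ] LevyGauss.L2 (η.sigma Set.univ) P₂,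
          LevyGauss.IsUnityPreserving Ψ → LevyGauss.IsReal Ψ →
          LevyGauss.IsSpecialIsomorphism
            (LevyGauss.baseFactorization W) (LevyGauss.processFactorization η) Ψ →
          LevyGauss.ActsIdenticallyOnValues W N Ψ →
          Ψ = Φ := by
  exact ⟨hη.exists_isJumpConfiguration hPi, fun _ hN => hN.exists_isomorphism hPi hW⟩
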